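/- **Setting.** Let $k$ be a field and $q^{1/2}\in k^\times$ not a root of unity (for example $k=\mathbb C(q^{1/2})$), and let $G=\mathrm{GL}_2$ or $\mathrm{SL}_2$, so $\dim G=4$ or $3$. Let $$R=\begin{pmatrix}q&0&0&0\\0&1&0&0\\0&q-q^{-1}&1&0\\0&0&0&q\end{pmatrix}\ (\mathrm{GL}_2),\qquad q^{-1/2}\text{ times this matrix}\ (\mathrm{SL}_2),$$ $R_{21}$ its flip, and $X_1=X\otimes I$, $X_2=I\otimes X$ for a $2\times2$ matrix $X=(x^i_j)$ of generators. Every matrix of generators below is either of *reflection type*, $R_{21}X_1RX_2=X_2R_{21}X_1R$, with $\det_q X=x^1_1x^2_2-q^2x^1_2x^2_1$, or of *FRT type*, $R_{21}X_1X_2=X_2X_1R$, with $\det_qX=x^1_1x^2_2-q\,x^1_2x^2_1$. In all algebras below all $q$-determinants are inverted (and for $\mathrm{SL}_2$ set equal to $1$). $\mathcal O_q(G)$ (resp. $\mathcal O'_q(G)$) is generated by one matrix of reflection (resp. FRT) type. $\mathcal D_q(G)$ is generated by $A,D$ of reflection type with $R_{21}D_1RA_2=A_2R_{21}D_1R_{21}^{-1}$;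 $\mathcal D'_q(G)$ is generated by $A$ of reflection type and $F$ of FRT type with $F_2A_1=R_{21}A_1RF_2$. Algebras of this kind are multiplied by the braided tensor product $\tilde\otimes$, with a factor on the left (matrices $B$ of reflection, $F$ of FRT type) and a factor to its right (matrices $\tilde B,\tilde F$) subject to $$\tilde B_1RB_2R^{-1}=RB_2R^{-1}\tilde B_1,\quad \tilde F_1B_2=RB_2R^{-1}\tilde F_1,\quad \tilde B_1RF_2=RF_2\tilde B_1,\quad \tilde F_1F_2=RF_2\tilde F_1 .$$ For $g\ge0$, $r\ge1$ let $\mathcal A_{g,r}=\mathcal D_q(G)^{\tilde\otimes g}\,\tilde\otimes\,\mathcal D'_q(G)^{\tilde\otimes(r-1)}$, the internal skein algebra of the surface of genus $g$ with $r$ boundary components and one gate on each of them. For $g=g_1+g_2$, $r=r_1+r_2$ with $r_1,r_2\ge1$ we also use the presentation of the internal skein algebra of the same surface by the handle-and-comb decomposition adapted to a separating curve: it is generated by $\mathcal A_{g_1,r_1}$, one connecting factor $\mathcal D'_q(G)$ (matrices $A,F$) and $\mathcal A_{g_2,r_2}$, where $\mathcal A_{g_1,r_1}$ and $\mathcal D'_q(G)$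 form a braided tensor product in this order, $\mathcal A_{g_2,r_2}$ commutes with $\mathcal A_{g_1,r_1}$ and with $A$, and the matrices $\tilde B$, $\tilde F$ of $\mathcal A_{g_2,r_2}$ of reflection, resp. FRT type satisfy $\tilde B_1F_2R^{-1}=F_2R^{-1}\tilde B_1$, resp. $\tilde F_1F_2=F_2R^{-1}\tilde F_1$. Consider one of the following two cases. * *Non-separating:* $\mathcal A=\mathcal A_{g,r}$ with $g,r\ge1$; $A,D$ are the matrices of the first factor $\mathcal D_q(G)$; $\mathcal A'=\mathcal A_{g-1,r}$ is given by the other factors; $\mathcal O=\mathcal O_q(G)\to\mathcal A$, $L\mapsto D$. * *Separating:* $\mathcal A=\mathcal A_{g,r}$ in the adapted presentation; $A,F$ are the matrices of the connecting factor $\mathcal D'_q(G)$; $\mathcal A'=\mathcal A_{g_1,r_1}\otimes\mathcal A_{g_2,r_2}$; $\mathcal O=\mathcal O'_q(G)\to\mathcal A$, $F\mapsto F$. The Gelfand–Kirillov dimension of a module $M$ over an algebra $B$ is the infimum of all $d\ge0$ such that for all finite-dimensional $V\subseteq B$, $W\subseteq M$ there is $c$ with $\dim_k(V_{\le n}W)\le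 c\,n^d$ for all $n\ge1$, where $V_{\le n}$ is spanned by the products of at most $n$ elements of $V$. Let $N=(g+r-1)\dim G$ and $N'=N-\dim G$. A module over $\mathcal A$ (resp. $\mathcal A'$) is *holonomic* if it is finitely generated and has GK dimension at most $N$ (resp. $N'$). **Proposition.** Let $M$ be a holonomic left $\mathcal A$-module, and let $$M_0=\ker(\det\nolimits_q(A)-1)\cap\ker(a^1_2)\cap\ker(a^2_1)\cap\ker(a^2_2-1)\subseteq M .$$ 1. $M_0$ is an $\mathcal A'$-submodule of $M$, and it is holonomic as an $\mathcal A'$-module. 2. If every nonzero $\mathcal A$-submodule of $M$ has GK dimension exactly $N$, then every nonzero $\mathcal A'$-submodule of $M_0$ has GK dimension exactly $N'$; in particular $\operatorname{GKdim}(M_0)=N'$ unless $M_0=0$. 3. The map $\mathcal O\otimes_kM_0\to M$, $b\otimes m\mapsto bm$, is injective, and its image is the $\mathcal A$-submodule $\mathcal A M_0$ generated by $M_0$. If $M_0\neq0$, then $\operatorname{GKdim}(\mathcal A M_0)=\operatorname{GKdim}(M_0)+\dim G$. -/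

import Mathlib

open scoped Kronecker TensorProduct ENNReal NNReal

noncomputable section

namespace QSkein

/-! ### The group, the R-matrix, matrix equations -/

/-- The two gauge groups. -/
inductive Gauge
  | GL2
  | SL2

/-- The dimension of the group. -/
def Gauge.dim : Gauge → ℕ
  | .GL2 => 4
  | .SL2 => 3

/-- `4 × 4` matrices; rows and columns are indexed by `(1,1), (1,2), (2,1), (2,2)` (written with
`0, 1` in place of `1, 2`). -/
abbrev Mat4 (B : Type*) := Matrix (Fin 2 × Fin 2) (Fin 2 × Fin 2) B

/-- `2 × 2` matrices; the entry `X i j` is the generator with upper index `i`, lower index `j`. -/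
abbrev Mat2 (B : Type*) := Matrix (Fin 2) (Fin 2) B

section RMatrix

variable {k : Type*} [Field k]

/-- With `s = q^{1/2}`: the R-matrix of `GL₂` is not rescaled, that of `SL₂` by `q^{-1/2}`. -/
def rScale : Gauge → k → k
  | .GL2, _ => 1
  | .SL2, s => s⁻¹

/-- The R-matrix on the fundamental representation, `q = s ^ 2`. -/
def rMat (G : Gauge) (s : k) : Mat4 k :=
  rScale G s • Matrix.of fun p p' =>
    if p = p' then (if p.1 = p.2 then s ^ 2 else 1)
    else if p = (1, 0) ∧ p' = (0, 1) then s ^ 2 - (s ^ 2)⁻¹ else 0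

/-- The inverse of the R-matrix. -/
def rInv (G : Gauge) (s : k) : Mat4 k :=
  (rScale G s)⁻¹ • Matrix.of fun p p' =>
    if p = p' then (if p.1 = p.2 then (s ^ 2)⁻¹ else 1)
    else if p = (1, 0) ∧ p' = (0, 1) then (s ^ 2)⁻¹ - s ^ 2 else 0

/-- `R₂₁`: both tensor legs swapped. -/
def rMat21 (G : Gauge) (s : k) : Mat4 k := (rMat G s).submatrix Prod.swap Prod.swap

/-- The inverse of `R₂₁`. -/
def rInv21 (G : Gauge) (s : k) : Mat4 k := (rInv G s).submatrix Prod.swap Prod.swap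

theorem rScale_ne_zero (G : Gauge) {s : k} (hs : s ≠ 0) : rScale G s ≠ 0 := by
  cases G <;> simp [rScale, hs]

theorem rMat_mul_rInv (G : Gauge) {s : k} (hs : s ≠ 0) : rMat G s * rInv G s = 1 := by
  have h := rScale_ne_zero G hs
  rw [rMat, rInv, Matrix.smul_mul, Matrix.mul_smul, smul_smul, mul_inv_cancel₀ h, one_smul]
  ext ⟨a, b⟩ ⟨c, d⟩
  fin_cases a <;> fin_cases b <;> fin_cases c <;> fin_cases d <;>
    simp [Matrix.mul_apply, Fintype.sum_prod_type, hs]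

theorem rMat21_mul_rInv21 (G : Gauge) {s : k} (hs : s ≠ 0) :
    rMat21 G s * rInv21 G s = 1 := by
  have h := Matrix.submatrix_mul_equiv (rMat G s) (rInv G s) Prod.swap
    (Equiv.prodComm (Fin 2) (Fin 2)) Prod.swap
  rw [rMat_mul_rInv G hs] at h
  refine h.trans ?_
  ext ⟨a, b⟩ ⟨c, d⟩
  simp [Matrix.one_apply, and_comm]

end RMatrix

section Laws

variable {k : Type*} [Field k] {B C : Type*} [Ring B] [Algebra k B] [Ring C] [Algebra k C]

/-- `X₁ = X ⊗ I`. -/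
def leg1 (X : Mat2 B) : Mat4 B := X ⊗ₖ (1 : Mat2 B)

/-- `X₂ = I ⊗ X`. -/
def leg2 (X : Mat2 B) : Mat4 B := (1 : Mat2 B) ⊗ₖ X

/-- A scalar matrix, regarded as a matrix over the algebra. -/
def scal (B : Type*) [Ring B] [Algebra k B] (T : Mat4 k) : Mat4 B := T.map (algebraMap k B)

/-- The types of quadratic relations between two matrices of generators `Y` and `X`. -/
inductive Law
  /-- `R₂₁ Y₁ R X₂ = X₂ R₂₁ Y₁ R`, used with `Y = X`: the reflection equation -/
  | reflection
  /-- `R₂₁ Y₁ X₂ = X₂ Y₁ R`, used with `Y = X`: the FRT relation -/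
  | frt
  /-- `R₂₁ D₁ R A₂ = A₂ R₂₁ D₁ R₂₁⁻¹`: inside the algebra of `q`-difference operators `D_q` -/
  | smash
  /-- `F₂ A₁ = R₂₁ A₁ R F₂`: inside the algebra of `q`-difference operators `D'_q` -/
  | smashFrt
  /-- `Y₁ R X₂ R⁻¹ = R X₂ R⁻¹ Y₁`: braided tensor product, `Y` and `X` of reflection type -/
  | braidLoopLoop
  /-- `Y₁ X₂ = R X₂ R⁻¹ Y₁`: braided tensor product, `Y` of FRT and `X` of reflection type -/
  | braidFrtLoop
  /-- `Y₁ R X₂ = R X₂ Y₁`: braided tensor product, `Y` of reflection and `X` of FRT type -/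
  | braidLoopFrt
  /-- `Y₁ X₂ = R X₂ Y₁`: braided tensor product, `Y` and `X` of FRT type -/
  | braidFrtFrt
  /-- `Y₁ X₂ R⁻¹ = X₂ R⁻¹ Y₁`: `Y` is of reflection type and sits at the second gate of the
  FRT matrix `X` -/
  | endLoop
  /-- `Y₁ X₂ = X₂ R⁻¹ Y₁`: `Y` is of FRT type and starts at the second gate of the
  FRT matrix `X` -/
  | endFrt
  /-- `Y₁ X₂ = X₂ Y₁`: all entries commute -/
  | commute

/-- Left hand sides of the relations. -/
def Law.lhs (G : Gauge) (s : k) (Y X : Mat2 B) : Law → Mat4 B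
  | .reflection => scal B (rMat21 G s) * leg1 Y * scal B (rMat G s) * leg2 X
  | .frt => scal B (rMat21 G s) * leg1 Y * leg2 X
  | .smash => scal B (rMat21 G s) * leg1 Y * scal B (rMat G s) * leg2 X
  | .smashFrt => leg2 Y * leg1 X
  | .braidLoopLoop => leg1 Y * scal B (rMat G s) * leg2 X * scal B (rInv G s)
  | .braidFrtLoop => leg1 Y * leg2 X
  | .braidLoopFrt => leg1 Y * scal B (rMat G s) * leg2 X
  | .braidFrtFrt => leg1 Y * leg2 X
  | .endLoop => leg1 Y * leg2 X * scal B (rInv G s)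
  | .endFrt => leg1 Y * leg2 X
  | .commute => leg1 Y * leg2 X

/-- Right hand sides of the relations. -/
def Law.rhs (G : Gauge) (s : k) (Y X : Mat2 B) : Law → Mat4 B
  | .reflection => leg2 X * scal B (rMat21 G s) * leg1 Y * scal B (rMat G s)
  | .frt => leg2 X * leg1 Y * scal B (rMat G s)
  | .smash => leg2 X * scal B (rMat21 G s) * leg1 Y * scal B (rInv21 G s)
  | .smashFrt => scal B (rMat21 G s) * leg1 X * scal B (rMat G s) * leg2 Y
  | .braidLoopLoop => scal B (rMat G s) * leg2 X * scal B (rInv G s) * leg1 Y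
  | .braidFrtLoop => scal B (rMat G s) * leg2 X * scal B (rInv G s) * leg1 Y
  | .braidLoopFrt => scal B (rMat G s) * leg2 X * leg1 Y
  | .braidFrtFrt => scal B (rMat G s) * leg2 X * leg1 Y
  | .endLoop => leg2 X * scal B (rInv G s) * leg1 Y
  | .endFrt => leg2 X * scal B (rInv G s) * leg1 Y
  | .commute => leg2 X * leg1 Y

/-- The `q`-determinant `x¹₁ x²₂ - c x¹₂ x²₁`; here `c = q²` for matrices of reflection type and
`c = q` for matrices of FRT type. -/
def qdet (c : k) (X : Mat2 B) : B := X 0 0 * X 1 1 - c • (X 0 1 * X 1 0)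

theorem map_leg1 (f : B →ₐ[k] C) (X : Mat2 B) : (leg1 X).map f = leg1 (X.map f) := by
  ext ⟨a, b⟩ ⟨c, d⟩
  simp only [leg1, Matrix.map_apply, Matrix.kroneckerMap_apply, map_mul, Matrix.one_apply]
  split <;> simp

theorem map_leg2 (f : B →ₐ[k] C) (X : Mat2 B) : (leg2 X).map f = leg2 (X.map f) := by
  ext ⟨a, b⟩ ⟨c, d⟩
  simp only [leg2, Matrix.map_apply, Matrix.kroneckerMap_apply, map_mul, Matrix.one_apply]
  split <;> simp

theorem map_scal (f : B →ₐ[k] C) (T : Mat4 k) : (scal B T).map f = scal C T := by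
  ext p p'
  simp [scal]

theorem Law.map_lhs (f : B →ₐ[k] C) (G : Gauge) (s : k) (Y X : Mat2 B) (l : Law) :
    (l.lhs G s Y X).map f = l.lhs G s (Y.map f) (X.map f) := by
  cases l <;> simp only [Law.lhs, Matrix.map_mul, map_leg1, map_leg2, map_scal]

theorem Law.map_rhs (f : B →ₐ[k] C) (G : Gauge) (s : k) (Y X : Mat2 B) (l : Law) :
    (l.rhs G s Y X).map f = l.rhs G s (Y.map f) (X.map f) := by
  cases l <;> simp only [Law.rhs, Matrix.map_mul, map_leg1, map_leg2, map_scal]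

theorem map_qdet (f : B →ₐ[k] C) (c : k) (X : Mat2 B) : f (qdet c X) = qdet c (X.map f) := by
  simp [qdet]

end Laws

/-! ### Algebras presented by matrices of generators -/

/-- A family of `2 × 2` matrices of generators, some of reflection type (`loop`) and the others
of FRT type, together with the laws imposed on them. -/
structure Presentation where
  Idx : Type
  loop : Idx → Prop
  law : Law → Idx → Idx → Prop

/-- Generators: the matrix entries, and inverses of the `q`-determinants. -/
inductive Presentation.Gen (P : Presentation) : Type
  | entry (x : P.Idx) (i j : Fin 2) : Presentation.Gen P
  | detInv (x : P.Idx) : Presentation.Gen P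

namespace Presentation

open Classical in
/-- The constant in the `q`-determinant: `q²` for reflection type, `q` for FRT type. -/
def detConst {k : Type*} [Field k] (s : k) (P : Presentation) (x : P.Idx) : k :=
  if P.loop x then (s ^ 2) ^ 2 else s ^ 2

section

variable {k : Type*} [Field k] (G : Gauge) (s : k) (P : Presentation)

/-- The matrix of free generators. -/
def freeMat (k : Type*) [Field k] (P : Presentation) (x : P.Idx) : Mat2 (FreeAlgebra k P.Gen) :=
  Matrix.of fun i j => FreeAlgebra.ι k (Gen.entry x i j)

/-- The defining relations: the laws, entry by entry; every `q`-determinant is inverted; for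
`SL₂` every `q`-determinant is `1` (so that its inverse is `1` too). -/
inductive Rel : FreeAlgebra k P.Gen → FreeAlgebra k P.Gen → Prop
  | law (l : Law) (y x : P.Idx) (h : P.law l y x) (a b : Fin 2 × Fin 2) :
      Rel (l.lhs G s (freeMat k P y) (freeMat k P x) a b)
        (l.rhs G s (freeMat k P y) (freeMat k P x) a b)
  | det_mul_inv (x : P.Idx) :
      Rel (qdet (detConst s P x) (freeMat k P x) * FreeAlgebra.ι k (Gen.detInv x)) 1
  | inv_mul_det (x : P.Idx) :
      Rel (FreeAlgebra.ι k (Gen.detInv x) * qdet (detConst s P x) (freeMat k P x)) 1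
  | det_one (h : G = Gauge.SL2) (x : P.Idx) :
      Rel (qdet (detConst s P x) (freeMat k P x)) 1

/-- The algebra with these generators and relations. -/
def Alg : Type _ := RingQuot (Rel G s P)

instance : Ring (Alg G s P) := inferInstanceAs (Ring (RingQuot (Rel G s P)))

instance : Algebra k (Alg G s P) := inferInstanceAs (Algebra k (RingQuot (Rel G s P)))

/-- The quotient map. -/
def quot : FreeAlgebra k P.Gen →ₐ[k] Alg G s P := RingQuot.mkAlgHom k (Rel G s P)

/-- The matrix of generators with index `x`. -/
def mat (x : P.Idx) : Mat2 (Alg G s P) :=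
  Matrix.of fun i j => quot G s P (FreeAlgebra.ι k (Gen.entry x i j))

/-- The `q`-determinant of the matrix with index `x`. -/
def det (x : P.Idx) : Alg G s P := qdet (detConst s P x) (mat G s P x)

/-- The inverse of the `q`-determinant of the matrix with index `x`. -/
def detInv (x : P.Idx) : Alg G s P := quot G s P (FreeAlgebra.ι k (Gen.detInv x))

variable {G s P}

theorem freeMat_map (x : P.Idx) : (freeMat k P x).map (quot G s P) = mat G s P x := rfl

theorem law_eq {l : Law} {y x : P.Idx} (h : P.law l y x) :
    l.lhs G s (mat G s P y) (mat G s P x) = l.rhs G s (mat G s P y) (mat G s P x) := by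
  rw [← freeMat_map, ← freeMat_map, ← Law.map_lhs, ← Law.map_rhs]
  ext a b
  exact RingQuot.mkAlgHom_rel k (Rel.law l y x h a b)

theorem det_mul_detInv (x : P.Idx) : det G s P x * detInv G s P x = 1 := by
  have h := RingQuot.mkAlgHom_rel k (Rel.det_mul_inv (G := G) (s := s) x)
  rw [map_mul, map_one] at h
  rw [det, ← freeMat_map, ← map_qdet]
  exact h

theorem detInv_mul_det (x : P.Idx) : detInv G s P x * det G s P x = 1 := by
  have h := RingQuot.mkAlgHom_rel k (Rel.inv_mul_det (G := G) (s := s) x)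
  rw [map_mul, map_one] at h
  rw [det, ← freeMat_map, ← map_qdet]
  exact h

theorem det_eq_one (hG : G = Gauge.SL2) (x : P.Idx) : det G s P x = 1 := by
  have h := RingQuot.mkAlgHom_rel k (Rel.det_one (s := s) hG x)
  rw [map_one] at h
  rw [det, ← freeMat_map, ← map_qdet]
  exact h

variable (G s)

/-- A map of index sets that respects types and laws induces a homomorphism which sends the
matrix of generators with index `x` to the one with index `f x`. -/
def map {P Q : Presentation} (f : P.Idx → Q.Idx) (hloop : ∀ x, P.loop x ↔ Q.loop (f x))
    (hlaw : ∀ l y x, P.law l y x → Q.law l (f y) (f x)) : Alg G s P →ₐ[k] Alg G s Q :=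
  RingQuot.liftAlgHom k ⟨FreeAlgebra.lift k fun
      | .entry x i j => mat G s Q (f x) i j
      | .detInv x => detInv G s Q (f x), by
    set F : FreeAlgebra k P.Gen →ₐ[k] Alg G s Q := FreeAlgebra.lift k fun
      | .entry x i j => mat G s Q (f x) i j
      | .detInv x => detInv G s Q (f x) with hF
    have hmat : ∀ x, (freeMat k P x).map F = mat G s Q (f x) := by
      intro x
      ext i j
      simp [freeMat, hF]
    have hinv : ∀ x, F (FreeAlgebra.ι k (Gen.detInv x)) = detInv G s Q (f x) := by
      intro x
      simp [hF]
    have hc : ∀ x, detConst s P x = detConst s Q (f x) := by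
      intro x
      unfold detConst
      by_cases h : P.loop x
      · rw [if_pos h, if_pos ((hloop x).1 h)]
      · rw [if_neg h, if_neg (mt (hloop x).2 h)]
    have hdet : ∀ x, F (qdet (detConst s P x) (freeMat k P x)) = det G s Q (f x) := by
      intro x
      rw [map_qdet, hmat, hc, det]
    intro a b hab
    cases hab with
    | law l y x h a b =>
      have h1 := congrFun (congrFun (Law.map_lhs F G s (freeMat k P y) (freeMat k P x) l) a) b
      have h2 := congrFun (congrFun (Law.map_rhs F G s (freeMat k P y) (freeMat k P x) l) a) b
      rw [Matrix.map_apply] at h1 h2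
      rw [h1, h2, hmat, hmat, law_eq (hlaw l y x h)]
    | det_mul_inv x => rw [map_mul, map_one, hdet, hinv, det_mul_detInv]
    | inv_mul_det x => rw [map_mul, map_one, hdet, hinv, detInv_mul_det]
    | det_one h x => rw [map_one, hdet, det_eq_one h]⟩

theorem map_mat {P Q : Presentation} (f : P.Idx → Q.Idx) (hloop : ∀ x, P.loop x ↔ Q.loop (f x))
    (hlaw : ∀ l y x, P.law l y x → Q.law l (f y) (f x)) (x : P.Idx) (i j : Fin 2) :
    map G s f hloop hlaw (mat G s P x i j) = mat G s Q (f x) i j := by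
  simp only [map, mat, quot, Matrix.of_apply]
  erw [RingQuot.liftAlgHom_mkAlgHom_apply]
  simp

theorem map_detInv {P Q : Presentation} (f : P.Idx → Q.Idx)
    (hloop : ∀ x, P.loop x ↔ Q.loop (f x))
    (hlaw : ∀ l y x, P.law l y x → Q.law l (f y) (f x)) (x : P.Idx) :
    map G s f hloop hlaw (detInv G s P x) = detInv G s Q (f x) := by
  simp only [map, detInv, quot]
  erw [RingQuot.liftAlgHom_mkAlgHom_apply]
  simp

variable {G s}

/-- A subalgebra that contains the generators is everything. -/
theorem mem_of_generators (S : Subalgebra k (Alg G s P))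
    (h1 : ∀ x i j, mat G s P x i j ∈ S) (h2 : ∀ x, detInv G s P x ∈ S) (a : Alg G s P) :
    a ∈ S := by
  obtain ⟨w, rfl⟩ : ∃ w, quot G s P w = a := RingQuot.mkAlgHom_surjective k (Rel G s P) a
  induction w using FreeAlgebra.induction with
  | grade0 r => rw [AlgHom.commutes]; exact S.algebraMap_mem r
  | grade1 x =>
    cases x with
    | entry x i j => exact h1 x i j
    | detInv x => exact h2 x
  | mul a b ha hb => rw [map_mul]; exact S.mul_mem ha hb
  | add a b ha hb => rw [map_add]; exact S.add_mem ha hb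

theorem commute_detInv {b : Alg G s P} {x : P.Idx} (h : ∀ i j, Commute b (mat G s P x i j)) :
    Commute b (detInv G s P x) := by
  have hd : Commute b (det G s P x) :=
    ((h 0 0).mul_right (h 1 1)).sub_right (((h 0 1).mul_right (h 1 0)).smul_right _)
  have h' : b * det G s P x = det G s P x * b := hd
  change b * detInv G s P x = detInv G s P x * b
  calc b * detInv G s P x
      = detInv G s P x * det G s P x * b * detInv G s P x := by
        rw [detInv_mul_det, one_mul]
    _ = detInv G s P x * (b * det G s P x) * detInv G s P x := by
        rw [h', mul_assoc (detInv G s P x)]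
    _ = detInv G s P x * b := by
        rw [mul_assoc, mul_assoc, det_mul_detInv, mul_one]

end

end Presentation

/-! ### Internal skein algebras -/

/-- Reflection equation algebra: one matrix subject to the reflection equation. -/
def reflectionPres : Presentation where
  Idx := Unit
  loop _ := True
  law l _ _ := l = Law.reflection

/-- FRT algebra: one matrix subject to the FRT relation. -/
def frtPres : Presentation where
  Idx := Unit
  loop _ := False
  law l _ _ := l = Law.frt

/-- The quantum coordinate algebra `O_q(G)` (reflection equation algebra). -/
abbrev Oq {k : Type*} [Field k] (G : Gauge) (s : k) : Type _ :=
  Presentation.Alg G s reflectionPres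

/-- The quantum coordinate algebra `O'_q(G)` (FRT algebra). -/
abbrev OqFrt {k : Type*} [Field k] (G : Gauge) (s : k) : Type _ :=
  Presentation.Alg G s frtPres

/-- A handle-and-comb decomposition of a connected surface with one gate on every boundary
component. A block that is a handle contributes a tensor factor `D_q(G)` on one comb; any other
block contributes a factor `D'_q(G)`, which starts on one comb and ends on another one.
`before i j` means that `i` and `j` start on the same comb, with `i` to the left of `j`;
`feeds i j` means that the block `i`, of type `D'_q(G)`, ends on the comb on which `j` starts,
to the left of `j`. -/
structure GluingPattern where
  Block : Type
  handle : Block → Prop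
  before : Block → Block → Prop
  feeds : Block → Block → Prop

/-- The two matrices of generators of a block: the cycle `A`, and the complementary matrix,
which is `D` for a factor `D_q(G)` and `F` for a factor `D'_q(G)`. -/
inductive Cycle
  | A
  | compl

namespace GluingPattern

/-- A matrix of generators is of reflection type unless it is the matrix `F` of a factor
`D'_q(G)`. -/
def IsLoop (P : GluingPattern) (x : P.Block × Cycle) : Prop := x.2 = Cycle.A ∨ P.handle x.1

/-- The relations of the twisted tensor product given by the gluing pattern. -/
inductive Laws (P : GluingPattern) : Law → P.Block × Cycle → P.Block × Cycle → Prop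
  | reflection (x) (h : P.IsLoop x) : Laws P .reflection x x
  | frt (x) (h : ¬ P.IsLoop x) : Laws P .frt x x
  | smash (i) (h : P.handle i) : Laws P .smash (i, .compl) (i, .A)
  | smashFrt (i) (h : ¬ P.handle i) : Laws P .smashFrt (i, .compl) (i, .A)
  | braidLoopLoop (x y) (h : P.before x.1 y.1) (hy : P.IsLoop y) (hx : P.IsLoop x) :
      Laws P .braidLoopLoop y x
  | braidFrtLoop (x y) (h : P.before x.1 y.1) (hy : ¬ P.IsLoop y) (hx : P.IsLoop x) :
      Laws P .braidFrtLoop y x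
  | braidLoopFrt (x y) (h : P.before x.1 y.1) (hy : P.IsLoop y) (hx : ¬ P.IsLoop x) :
      Laws P .braidLoopFrt y x
  | braidFrtFrt (x y) (h : P.before x.1 y.1) (hy : ¬ P.IsLoop y) (hx : ¬ P.IsLoop x) :
      Laws P .braidFrtFrt y x
  | endLoop (x y) (h : P.feeds x.1 y.1) (hy : P.IsLoop y) (hx : ¬ P.IsLoop x) :
      Laws P .endLoop y x
  | endFrt (x y) (h : P.feeds x.1 y.1) (hy : ¬ P.IsLoop y) (hx : ¬ P.IsLoop x) :
      Laws P .endFrt y x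
  | commuteFeeds (x y) (h : P.feeds x.1 y.1) (hx : P.IsLoop x) : Laws P .commute y x
  | commuteFar (x y) (hne : x.1 ≠ y.1) (h1 : ¬ P.before x.1 y.1) (h2 : ¬ P.before y.1 x.1)
      (h3 : ¬ P.feeds x.1 y.1) (h4 : ¬ P.feeds y.1 x.1) : Laws P .commute y x

/-- The presentation of the internal skein algebra of a gluing pattern. -/
def pres (P : GluingPattern) : Presentation where
  Idx := P.Block × Cycle
  loop := P.IsLoop
  law := P.Laws

/-- An embedding of gluing patterns. -/
structure Emb (P Q : GluingPattern) where
  f : P.Block → Q.Block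
  inj : Function.Injective f
  handle : ∀ i, P.handle i ↔ Q.handle (f i)
  before : ∀ i j, P.before i j ↔ Q.before (f i) (f j)
  feeds : ∀ i j, P.feeds i j ↔ Q.feeds (f i) (f j)

theorem Emb.isLoop {P Q : GluingPattern} (e : Emb P Q) (x : P.Block × Cycle) :
    P.IsLoop x ↔ Q.IsLoop (e.f x.1, x.2) := by
  simp [IsLoop, e.handle]

theorem Emb.laws {P Q : GluingPattern} (e : Emb P Q) (l : Law) (y x : P.Block × Cycle)
    (h : P.Laws l y x) : Q.Laws l (e.f y.1, y.2) (e.f x.1, x.2) := by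
  cases h with
  | reflection _ h => exact .reflection _ ((e.isLoop _).1 h)
  | frt _ h => exact .frt _ (mt (e.isLoop _).2 h)
  | smash i h => exact .smash _ ((e.handle _).1 h)
  | smashFrt i h => exact .smashFrt _ (mt (e.handle _).2 h)
  | braidLoopLoop _ _ h hy hx =>
    exact .braidLoopLoop _ _ ((e.before _ _).1 h) ((e.isLoop _).1 hy) ((e.isLoop _).1 hx)
  | braidFrtLoop _ _ h hy hx =>
    exact .braidFrtLoop _ _ ((e.before _ _).1 h) (mt (e.isLoop _).2 hy) ((e.isLoop _).1 hx)
  | braidLoopFrt _ _ h hy hx =>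
    exact .braidLoopFrt _ _ ((e.before _ _).1 h) ((e.isLoop _).1 hy) (mt (e.isLoop _).2 hx)
  | braidFrtFrt _ _ h hy hx =>
    exact .braidFrtFrt _ _ ((e.before _ _).1 h) (mt (e.isLoop _).2 hy) (mt (e.isLoop _).2 hx)
  | endLoop _ _ h hy hx =>
    exact .endLoop _ _ ((e.feeds _ _).1 h) ((e.isLoop _).1 hy) (mt (e.isLoop _).2 hx)
  | endFrt _ _ h hy hx =>
    exact .endFrt _ _ ((e.feeds _ _).1 h) (mt (e.isLoop _).2 hy) (mt (e.isLoop _).2 hx)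
  | commuteFeeds _ _ h hx =>
    exact .commuteFeeds _ _ ((e.feeds _ _).1 h) ((e.isLoop _).1 hx)
  | commuteFar _ _ hne h1 h2 h3 h4 =>
    exact .commuteFar _ _ (fun h => hne (e.inj h)) (mt (e.before _ _).2 h1)
      (mt (e.before _ _).2 h2) (mt (e.feeds _ _).2 h3) (mt (e.feeds _ _).2 h4)

/-- The blocks of the standard decomposition of the surface of genus `g` with `r` boundary
components: `g` handles, followed by `r - 1` factors `D'_q(G)`. -/
abbrev StdBlock (g r : ℕ) : Type := Fin g ⊕ Fin (r - 1)

/-- The standard pattern: all blocks start on the first comb, from left to right, and every factor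
`D'_q(G)` ends on a comb of its own, on which nothing else sits. -/
def std (g r : ℕ) : GluingPattern where
  Block := StdBlock g r
  handle i := i.isLeft = true
  before i j := Sum.Lex (· < ·) (· < ·) i j
  feeds _ _ := False

/-- The pattern adapted to a separating curve: first the standard blocks for `(g₁, r₁)` on the
first comb, then (`Unit`) a factor `D'_q(G)` that starts on the first comb and ends on the second
comb, and to the right of that end the standard blocks for `(g₂, r₂)` on the second comb. Its
surface has genus `g₁ + g₂` and `r₁ + r₂` boundary components, and the `A`-cycle of the
connecting factor separates the two parts. -/
def sep (g₁ r₁ g₂ r₂ : ℕ) : GluingPattern where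
  Block := StdBlock g₁ r₁ ⊕ (Unit ⊕ StdBlock g₂ r₂)
  handle
    | .inl i => (std g₁ r₁).handle i
    | .inr (.inl _) => False
    | .inr (.inr i) => (std g₂ r₂).handle i
  before
    | .inl i, .inl j => (std g₁ r₁).before i j
    | .inl _, .inr (.inl _) => True
    | .inr (.inr i), .inr (.inr j) => (std g₂ r₂).before i j
    | _, _ => False
  feeds
    | .inr (.inl _), .inr (.inr _) => True
    | _, _ => False

/-- Dropping the first handle of the standard pattern. -/
def stdEmb (g r : ℕ) : Emb (std g r) (std (g + 1) r) where
  f := Sum.map Fin.succ id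
  inj := Function.Injective.sumMap (Fin.succ_injective g) Function.injective_id
  handle i := by cases i <;> rfl
  before i j := by cases i <;> cases j <;> simp [std]
  feeds _ _ := Iff.rfl

/-- The first part of the separated pattern. -/
def sepEmb₁ (g₁ r₁ g₂ r₂ : ℕ) : Emb (std g₁ r₁) (sep g₁ r₁ g₂ r₂) where
  f := Sum.inl
  inj := Sum.inl_injective
  handle _ := Iff.rfl
  before _ _ := Iff.rfl
  feeds _ _ := Iff.rfl

/-- The second part of the separated pattern. -/
def sepEmb₂ (g₁ r₁ g₂ r₂ : ℕ) : Emb (std g₂ r₂) (sep g₁ r₁ g₂ r₂) where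
  f := fun i => Sum.inr (Sum.inr i)
  inj := Sum.inr_injective.comp Sum.inr_injective
  handle _ := Iff.rfl
  before _ _ := Iff.rfl
  feeds _ _ := Iff.rfl

end GluingPattern

section Algebras

variable {k : Type*} [Field k] (G : Gauge) (s : k)

/-- The internal skein algebra of a gluing pattern. -/
abbrev PatternAlg (P : GluingPattern) : Type _ := Presentation.Alg G s P.pres

/-- `A_{g,r}`, the twisted tensor product of `g` factors `D_q(G)` and `r - 1` factors
`D'_q(G)`. -/
abbrev SkeinAlg (g r : ℕ) : Type _ := PatternAlg G s (GluingPattern.std g r)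

/-- `A_{g,r}` for `g = g₁ + g₂` and `r = r₁ + r₂`, in the presentation adapted to the separating
curve. -/
abbrev SepAlg (g₁ r₁ g₂ r₂ : ℕ) : Type _ := PatternAlg G s (GluingPattern.sep g₁ r₁ g₂ r₂)

/-- The homomorphism given by an embedding of patterns. -/
def embHom {P Q : GluingPattern} (e : GluingPattern.Emb P Q) :
    PatternAlg G s P →ₐ[k] PatternAlg G s Q :=
  Presentation.map G s (P := P.pres) (Q := Q.pres) (fun x => (e.f x.1, x.2)) e.isLoop e.laws

theorem embHom_mat {P Q : GluingPattern} (e : GluingPattern.Emb P Q) (x : P.Block × Cycle)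
    (i j : Fin 2) : embHom G s e (Presentation.mat G s P.pres x i j) =
      Presentation.mat G s Q.pres (e.f x.1, x.2) i j :=
  Presentation.map_mat G s (P := P.pres) (Q := Q.pres) (fun x => (e.f x.1, x.2)) e.isLoop
    e.laws x i j

theorem embHom_detInv {P Q : GluingPattern} (e : GluingPattern.Emb P Q)
    (x : P.Block × Cycle) : embHom G s e (Presentation.detInv G s P.pres x) =
      Presentation.detInv G s Q.pres (e.f x.1, x.2) :=
  Presentation.map_detInv G s (P := P.pres) (Q := Q.pres) (fun x => (e.f x.1, x.2)) e.isLoop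
    e.laws x

/-- The homomorphism from `O_q(G)` to the algebra of a gluing pattern given by one matrix of
reflection type. -/
def loopHom (P : GluingPattern) (x : P.Block × Cycle) (hx : P.IsLoop x) :
    Oq G s →ₐ[k] PatternAlg G s P :=
  Presentation.map G s (P := reflectionPres) (Q := P.pres) (fun _ => x)
    (fun _ => ⟨fun _ => hx, fun _ => trivial⟩)
    (fun l _ _ (h : l = Law.reflection) => h ▸ GluingPattern.Laws.reflection x hx)

/-- The homomorphism from `O'_q(G)` to the algebra of a gluing pattern given by one matrix of
FRT type. -/
def frtHom (P : GluingPattern) (x : P.Block × Cycle) (hx : ¬ P.IsLoop x) :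
    OqFrt G s →ₐ[k] PatternAlg G s P :=
  Presentation.map G s (P := frtPres) (Q := P.pres) (fun _ => x)
    (fun _ => ⟨fun h => h.elim, fun h => hx h⟩)
    (fun l _ _ (h : l = Law.frt) => h ▸ GluingPattern.Laws.frt x hx)

/-- Non-separating case: `A_{g,r} → A_{g+1,r}`, onto the factors other than the first `D_q(G)`. -/
def nonsepIncl (g r : ℕ) : SkeinAlg G s g r →ₐ[k] SkeinAlg G s (g + 1) r :=
  embHom G s (GluingPattern.stdEmb g r)

/-- Non-separating case: `O_q(G) → A_{g+1,r}`, `L ↦ D`, for the first factor `D_q(G)`. -/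
def nonsepCompl (g r : ℕ) : Oq G s →ₐ[k] SkeinAlg G s (g + 1) r :=
  loopHom G s (GluingPattern.std (g + 1) r) (Sum.inl 0, Cycle.compl) (Or.inr rfl)

/-- Separating case: `O'_q(G) → A_{g,r}`, `F ↦ F`, for the connecting factor `D'_q(G)`. -/
def sepCompl (g₁ r₁ g₂ r₂ : ℕ) : OqFrt G s →ₐ[k] SepAlg G s g₁ r₁ g₂ r₂ :=
  frtHom G s (GluingPattern.sep g₁ r₁ g₂ r₂) (Sum.inr (Sum.inl ()), Cycle.compl)
    (by simp [GluingPattern.IsLoop, GluingPattern.sep])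

theorem sep_commute (g₁ r₁ g₂ r₂ : ℕ) (a : SkeinAlg G s g₁ r₁) (b : SkeinAlg G s g₂ r₂) :
    Commute (embHom G s (GluingPattern.sepEmb₁ g₁ r₁ g₂ r₂) a)
      (embHom G s (GluingPattern.sepEmb₂ g₁ r₁ g₂ r₂) b) := by
  have hgen : ∀ (x : GluingPattern.StdBlock g₁ r₁ × Cycle)
      (y : GluingPattern.StdBlock g₂ r₂ × Cycle) (i j i' j' : Fin 2),
      Commute
        (Presentation.mat G s (GluingPattern.sep g₁ r₁ g₂ r₂).pres (Sum.inl x.1, x.2) i j)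
        (Presentation.mat G s (GluingPattern.sep g₁ r₁ g₂ r₂).pres
          (Sum.inr (Sum.inr y.1), y.2) i' j') := by
    intro x y i j i' j'
    have h := Presentation.law_eq (G := G) (s := s)
      (P := (GluingPattern.sep g₁ r₁ g₂ r₂).pres) (l := Law.commute)
      (GluingPattern.Laws.commuteFar (P := GluingPattern.sep g₁ r₁ g₂ r₂)
        (Sum.inl x.1, x.2) (Sum.inr (Sum.inr y.1), y.2) (fun h => nomatch h) (fun h => h)
        (fun h => h) (fun h => h) (fun h => h))
    have h' := congrFun (congrFun h (i', i)) (j', j)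
    simp only [Law.lhs, Law.rhs, leg1, leg2] at h'
    simp [Matrix.mul_apply, Fintype.sum_prod_type, Matrix.one_apply] at h'
    exact h'.symm
  have hb : ∀ (x : GluingPattern.StdBlock g₁ r₁ × Cycle) (i j : Fin 2),
      Commute (Presentation.mat G s (GluingPattern.sep g₁ r₁ g₂ r₂).pres (Sum.inl x.1, x.2) i j)
        (embHom G s (GluingPattern.sepEmb₂ g₁ r₁ g₂ r₂) b) := by
    intro x i j
    let S : Subalgebra k (SepAlg G s g₁ r₁ g₂ r₂) := Subalgebra.centralizer k
      {Presentation.mat G s (GluingPattern.sep g₁ r₁ g₂ r₂).pres (Sum.inl x.1, x.2) i j}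
    have : b ∈ S.comap (embHom G s (GluingPattern.sepEmb₂ g₁ r₁ g₂ r₂)) := by
      apply Presentation.mem_of_generators
      · intro y i' j'
        rw [Subalgebra.mem_comap]
        refine (congrArg (· ∈ S) (embHom_mat G s _ y i' j')).mpr ?_
        rw [Subalgebra.mem_centralizer_iff]
        rintro _ rfl
        exact hgen x y i j i' j'
      · intro y
        rw [Subalgebra.mem_comap]
        refine (congrArg (· ∈ S) (embHom_detInv G s _ y)).mpr ?_
        rw [Subalgebra.mem_centralizer_iff]
        rintro _ rfl
        exact Presentation.commute_detInv fun i' j' => hgen x y i j i' j'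
    rw [Subalgebra.mem_comap, Subalgebra.mem_centralizer_iff] at this
    exact this _ rfl
  let S : Subalgebra k (SepAlg G s g₁ r₁ g₂ r₂) := Subalgebra.centralizer k
    {embHom G s (GluingPattern.sepEmb₂ g₁ r₁ g₂ r₂) b}
  have : a ∈ S.comap (embHom G s (GluingPattern.sepEmb₁ g₁ r₁ g₂ r₂)) := by
    apply Presentation.mem_of_generators
    · intro x i j
      rw [Subalgebra.mem_comap]
      refine (congrArg (· ∈ S) (embHom_mat G s _ x i j)).mpr ?_
      rw [Subalgebra.mem_centralizer_iff]
      rintro _ rfl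
      exact (hb x i j).symm
    · intro x
      rw [Subalgebra.mem_comap]
      refine (congrArg (· ∈ S) (embHom_detInv G s _ x)).mpr ?_
      rw [Subalgebra.mem_centralizer_iff]
      rintro _ rfl
      exact Presentation.commute_detInv fun i j => (hb x i j).symm
  rw [Subalgebra.mem_comap, Subalgebra.mem_centralizer_iff] at this
  exact (this _ rfl).symm

/-- Separating case: `A_{g₁,r₁} ⊠ A_{g₂,r₂} → A_{g,r}`. -/
def sepIncl (g₁ r₁ g₂ r₂ : ℕ) :
    SkeinAlg G s g₁ r₁ ⊗[k] SkeinAlg G s g₂ r₂ →ₐ[k] SepAlg G s g₁ r₁ g₂ r₂ :=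
  Algebra.TensorProduct.lift (embHom G s (GluingPattern.sepEmb₁ g₁ r₁ g₂ r₂))
    (embHom G s (GluingPattern.sepEmb₂ g₁ r₁ g₂ r₂)) (sep_commute G s g₁ r₁ g₂ r₂)

end Algebras

/-! ### Modules: restriction, Gelfand-Kirillov dimension, holonomicity, the joint kernel -/

section Modules

variable {k : Type*} [Field k]

/-- The module `M`, regarded as a module over `A'` along `φ : A' → A`. -/
def Restrict {A' A : Type*} [Ring A'] [Algebra k A'] [Ring A] [Algebra k A] (_φ : A' →ₐ[k] A)
    (M : Type*) : Type _ := M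

section Restrict

variable {A' A : Type*} [Ring A'] [Algebra k A'] [Ring A] [Algebra k A] (φ : A' →ₐ[k] A)
  (M : Type*) [AddCommGroup M] [Module k M] [Module A M]

instance : AddCommGroup (Restrict φ M) := inferInstanceAs (AddCommGroup M)

instance : Module k (Restrict φ M) := inferInstanceAs (Module k M)

instance : Module A' (Restrict φ M) := Module.compHom M φ.toRingHom

instance [IsScalarTower k A M] : IsScalarTower k A' (Restrict φ M) where
  smul_assoc c a m := by
    change φ (c • a) • (show M from m) = c • (φ a • (show M from m))
    rw [map_smul, smul_assoc]

end Restrict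

/-- `dim_k (V_{≤ n} W)`, where `V_{≤ n}` is spanned by the products of at most `n` elements
of `V`. -/
def growth {A M : Type*} [Ring A] [Algebra k A] [AddCommGroup M] [Module k M] [Module A M]
    (V : Submodule k A) (W : Submodule k M) (n : ℕ) : ℕ :=
  Module.finrank k (Submodule.span k {x : M | ∃ a ∈ (1 ⊔ V) ^ n, ∃ w ∈ W, x = a • w})

/-- The Gelfand-Kirillov dimension of an `A`-module: the infimum of all `d` such that for all
finite dimensional `V ⊆ A` and `W ⊆ M` there is a constant `c` with
`dim (V_{≤ n} W) ≤ c n ^ d`. (If `A` and `M` are finitely generated, it suffices to consider one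
generating `V` and one generating `W`.) -/
def gkDim (k A M : Type*) [Field k] [Ring A] [Algebra k A] [AddCommGroup M] [Module k M]
    [Module A M] : ℝ≥0∞ :=
  ⨅ (d : ℝ≥0) (_ : ∀ (V : Submodule k A) (W : Submodule k M), V.FG → W.FG →
    ∃ c : ℝ, ∀ n : ℕ, 1 ≤ n → (growth V W n : ℝ) ≤ c * (n : ℝ) ^ (d : ℝ)), (d : ℝ≥0∞)

/-- Holonomic: finitely generated, of Gelfand-Kirillov dimension at most `n`. It is used with
`n` the number of tensor factors times `dim G`. -/
def IsHolonomic (k A M : Type*) [Field k] [Ring A] [Algebra k A] [AddCommGroup M] [Module k M]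
    [Module A M] (n : ℕ) : Prop :=
  Module.Finite A M ∧ gkDim k A M ≤ n

/-- Every nonzero submodule has Gelfand-Kirillov dimension exactly `n`. -/
def IsEquidimensional (k A M : Type*) [Field k] [Ring A] [Algebra k A] [AddCommGroup M]
    [Module k M] [Module A M] [IsScalarTower k A M] (n : ℕ) : Prop :=
  ∀ P : Submodule A M, P ≠ ⊥ → gkDim k A P = n

variable {A M : Type*} [Ring A] [Algebra k A] [AddCommGroup M] [Module k M] [Module A M]
  [IsScalarTower k A M]

/-- `ker (δ - 1) ∩ ker x¹₂ ∩ ker x²₁ ∩ ker (x²₂ - 1)`, for a matrix `X` and an element `δ`. -/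
def jointKernel (k : Type*) [Field k] {A : Type*} (M : Type*) [Ring A] [Algebra k A]
    [AddCommGroup M] [Module k M] [Module A M] [IsScalarTower k A M] (X : Mat2 A) (δ : A) :
    Submodule k M where
  carrier := {m | (δ - 1) • m = 0 ∧ X 0 1 • m = 0 ∧ X 1 0 • m = 0 ∧ (X 1 1 - 1) • m = 0}
  zero_mem' := by simp
  add_mem' := by
    rintro a b ⟨h1, h2, h3, h4⟩ ⟨h1', h2', h3', h4'⟩
    exact ⟨by rw [smul_add, h1, h1', add_zero], by rw [smul_add, h2, h2', add_zero],
      by rw [smul_add, h3, h3', add_zero], by rw [smul_add, h4, h4', add_zero]⟩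
  smul_mem' := by
    rintro c m ⟨h1, h2, h3, h4⟩
    have key : ∀ a : A, a • m = 0 → a • c • m = 0 := by
      intro a ha
      rw [← algebraMap_smul A c m, ← mul_smul, ← Algebra.commutes, mul_smul, ha, smul_zero]
    exact ⟨key _ h1, key _ h2, key _ h3, key _ h4⟩

/-- The multiplication map `O ⊗ V → M`, `b ⊗ m ↦ ψ(b) m`. -/
def actionMap {O : Type*} [Ring O] [Algebra k O] (ψ : O →ₐ[k] A) (V : Submodule k M) :
    O ⊗[k] V →ₗ[k] M :=
  TensorProduct.lift (LinearMap.mk₂ k (fun (b : O) (m : V) => ψ b • (m : M))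
    (fun b b' m => by rw [map_add, add_smul])
    (fun c b m => by rw [map_smul, smul_assoc])
    (fun b m m' => by rw [Submodule.coe_add, smul_add])
    (fun c b m => by
      rw [Submodule.coe_smul, ← algebraMap_smul A c (m : M), ← mul_smul, ← Algebra.commutes,
        mul_smul, algebraMap_smul]))

end Modules

section Kernels

variable {k : Type*} [Field k] (G : Gauge) (s : k)

/-- `M₀` in the non-separating case: the joint kernel of `det_q(A) - 1`, `a¹₂`, `a²₁`, `a²₂ - 1`,
where `A` belongs to the first factor `D_q(G)`. -/
def nonsepKernel (g r : ℕ) (M : Type*) [AddCommGroup M] [Module k M]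
    [Module (SkeinAlg G s (g + 1) r) M] [IsScalarTower k (SkeinAlg G s (g + 1) r) M] :
    Submodule k M :=
  jointKernel k M
    (Presentation.mat G s (GluingPattern.std (g + 1) r).pres (Sum.inl 0, Cycle.A))
    (Presentation.det G s (GluingPattern.std (g + 1) r).pres (Sum.inl 0, Cycle.A))

/-- `M₀` in the separating case: the joint kernel of `det_q(A) - 1`, `a¹₂`, `a²₁`, `a²₂ - 1`,
where `A` belongs to the connecting factor `D'_q(G)`. -/
def sepKernel (g₁ r₁ g₂ r₂ : ℕ) (M : Type*) [AddCommGroup M] [Module k M]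
    [Module (SepAlg G s g₁ r₁ g₂ r₂) M] [IsScalarTower k (SepAlg G s g₁ r₁ g₂ r₂) M] :
    Submodule k M :=
  jointKernel k M
    (Presentation.mat G s (GluingPattern.sep g₁ r₁ g₂ r₂).pres (Sum.inr (Sum.inl ()), Cycle.A))
    (Presentation.det G s (GluingPattern.sep g₁ r₁ g₂ r₂).pres (Sum.inr (Sum.inl ()), Cycle.A))

end Kernels

end QSkein

end

/-!
This is an analogue of Kashiwara's theorem. Let `A` be the matrix that is to act as the identity,
`B` its partner in the same handle or comb tooth (`B = D` in the non-separating case, `B = F` in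
the separating one), `O` the algebra generated by the entries of `B`, and `M₀` the joint kernel,
that is, the space of vectors on which `A` acts as the identity matrix (`mem_jointKernel_iff`).

*Freeness.* The algebra `O` is spanned by the ordered monomials `det ^ c y ^ b x ^ a w ^ e` and
`det ^ c z ^ b x ^ a w ^ e`, where `y z - η x w = det` serves to eliminate products of `y` and `z`
(`Letters.longSpan_le`). These monomials are linearly independent over `M₀` (`KernelAction.indep`).
Multiplication by a power of `y` removes `z` up to lower terms. The entry `a¹₂` kills all monomials
without `w`, and turns `w ^ e` into a nonzero multiple of `y w ^ (e - 1)`, so a power of it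
isolates the terms with the highest power of `w`. On the remaining monomials `det ^ c y ^ b x ^ a`
the entry `a²₂` and `det_q A` act by scalars which determine `c` and `a + b`, because `s` is not a
root of unity, and `y a²₁ - λ w`, for a suitable scalar `λ` depending on `a + b`, replaces `x ^ a`
by a nonzero multiple of `det x ^ (a - 1)`. So `O ⊗ M₀ → M` is injective.

*The generated submodule.* The generators of the smaller algebra preserve `M₀`, because they
commute with `A` or are moved past it by conjugations with `R`, and a conjugate of `A` still acts
as the identity on `M₀`. The entries of every matrix other than `B` can be moved past those of `B`
without raising the degree in `B`, and then act on `M₀` through the smaller algebra; this is the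
last field of the structure `Frame`, which collects what the growth estimates need
(`Letters.frame`, `nonsepFrame`, `sepFrame`). Hence `O M₀` is a submodule. The monomials of degree
at most `n` grow like `n ^ dim G` (`card_expoBall_le`, `le_card_expoBall`), and moving `n` factors
past a monomial raises its degree by at most a multiple of `n`. Comparing dimensions from both
sides gives `gkDim (𝒜 P) = gkDim P + dim G`, with `𝒜` the skein algebra, for every nonzero
submodule `P` of `M₀` (`Frame.gkDim_span`), and with it the bound on `gkDim M₀`,
equidimensionality, and the last formula.

*Finite generation.* `P ↦ 𝒜 P` is strictly monotone on submodules of `M₀` (`Frame.isNoetherian`),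
so it suffices that `M` is Noetherian, and this holds since the skein algebras are left Noetherian.
To see the latter, the entries get weights such that any two generators commute up to a nonzero
scalar and terms of lower weight, where the determinants and their inverses have weight zero
(`GluingPattern.swappable`). Ordered monomials then span, leading exponents of left ideals form
upper sets in `ℕⁿ`, and Dickson's lemma applies (`QuasiCommute.isNoetherianRing`).
-/

noncomputable section
namespace QSkein

/-! ### The laws, entry by entry

Each law is solved for the products of the entries in one order. A suffix `_yx` means that the
products of an entry of `Y` with one of `X` are expressed by products in the opposite order; a
suffix `_xy` means the converse. -/

section Tables

set_option linter.unusedSimpArgs false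
set_option linter.unnecessarySeqFocus false

/-- A rewriting rule for a product, in the form needed inside right-associated products. -/
theorem mul_mul_of_eq {B : Type*} [Semigroup B] {a b r : B} (h : a * b = r) (c : B) :
    a * (b * c) = r * c := by
  rw [← mul_assoc, h]

variable {k : Type*} [Field k] {B : Type*} [Ring B] [Algebra k B]

/-- The relations between the entries `x`, `y`, `z`, `w` of a matrix of generators and its
`q`-determinant `δ`. They hold for both types of matrices: for reflection type `y`, `z` are the
entries `x²₂`, `x¹₁`, for FRT type they are `x¹₁`, `x²₂`; in both cases `x`, `w` are
`x¹₂`, `x²₁`. -/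
structure LetterRel (p h η γ γ' ξ ξ' ζ ζ' : k) (x y z w δ : B) : Prop where
  yx : y * x = h • (x * y)
  wy : w * y = h • (y * w)
  zy : z * y = δ + η • (x * w)
  yz : y * z = δ + η • (x * w)
  wx : w * x = p • (x * w) + γ • δ + γ' • (y * y)
  xz : x * z = ξ • (z * x) + ξ' • (y * x)
  wz : w * z = ζ • (z * w) + ζ' • (y * w)
  δx : δ * x = x * δ
  δy : δ * y = y * δ
  δz : δ * z = z * δ
  δw : δ * w = w * δ

variable {G : Gauge} {s q t : k} {Y X : Mat2 B}

/-- The relations among the entries of a matrix of reflection type. Its `q`-determinant is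
central. -/
theorem reflection_letters (hq : s ^ 2 = q) (hq0 : q ≠ 0) (ht : rScale G s = t) (ht0 : t ≠ 0)
    (h : Law.lhs G s X X .reflection = Law.rhs G s X X .reflection) :
    LetterRel (q ^ 2) (q ^ 2) (q ^ 2) (1 - q⁻¹ ^ 2) (q⁻¹ ^ 2 - 1) 1 (q⁻¹ ^ 2 - q⁻¹ ^ 4) 1
      (q⁻¹ ^ 2 - 1) (X 0 1) (X 1 1) (X 0 0) (X 1 0) (qdet (q ^ 2) X) := by
  have h' := fun a b c d => congrFun (congrFun h (a, b)) (c, d)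
  simp only [Fin.forall_fin_two, Law.lhs, Law.rhs, scal, rMat, rMat21, leg1, leg2, hq,
    ht, Matrix.mul_apply, Fintype.sum_prod_type, Fin.sum_univ_two] at h'
  simp [Algebra.algebraMap_eq_smul_one, add_mul, mul_add] at h'
  obtain ⟨⟨⟨-, e2, -⟩, -, e6, -⟩, ⟨⟨e8, -⟩, e10, e11⟩, -, e14⟩ := h'
  have zy : X 0 0 * X 1 1 = X 1 1 * X 0 0 := by
    linear_combination (norm := skip) (-t⁻¹ ^ 2 : k) • e10
    match_scalars <;> field_simp <;> ring
  have yx : X 1 1 * X 0 1 = q ^ 2 • (X 0 1 * X 1 1) := by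
    linear_combination (norm := skip) (t⁻¹ ^ 2 : k) • e11
    match_scalars <;> field_simp <;> ring
  have wy : X 1 0 * X 1 1 = q ^ 2 • (X 1 1 * X 1 0) := by
    linear_combination (norm := skip) (-t⁻¹ ^ 2 : k) • e14
    match_scalars <;> field_simp <;> ring
  have xz : X 0 1 * X 0 0 = X 0 0 * X 0 1 + (q⁻¹ ^ 2 - q⁻¹ ^ 4) • (X 1 1 * X 0 1) := by
    rw [yx]
    linear_combination (norm := skip) (t⁻¹ ^ 2 * q⁻¹ : k) • e2
    match_scalars <;> field_simp <;> ring
  have wz : X 1 0 * X 0 0 = X 0 0 * X 1 0 + (q⁻¹ ^ 2 - 1) • (X 1 1 * X 1 0) := by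
    linear_combination (norm := skip) (t⁻¹ ^ 2 * q⁻¹ : k) • e8
    match_scalars <;> field_simp <;> ring
  have wx : X 1 0 * X 0 1 =
      X 0 1 * X 1 0 + (1 - q⁻¹ ^ 2) • (X 0 0 * X 1 1 - X 1 1 * X 1 1) := by
    rw [zy]
    linear_combination (norm := skip) (-(t⁻¹ ^ 2 * q⁻¹) : k) • e6
    match_scalars <;> field_simp <;> ring
  have xy : X 0 1 * X 1 1 = q⁻¹ ^ 2 • (X 1 1 * X 0 1) := by
    rw [yx]
    match_scalars
    field_simp
  have comm : ∀ a ∈ ({X 0 1, X 1 1, X 0 0, X 1 0} : Set B),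
      qdet (q ^ 2) X * a = a * qdet (q ^ 2) X := by
    simp only [Set.mem_insert_iff, Set.mem_singleton_iff, forall_eq_or_imp, forall_eq, qdet]
    refine ⟨?_, ?_, ?_, ?_⟩
    all_goals
      simp only [mul_add, mul_sub, add_mul, sub_mul, smul_mul_assoc, mul_smul_comm, mul_assoc,
        smul_add, smul_sub, zy.symm, wy, xy, xz, wz, wx, mul_mul_of_eq zy.symm,
        mul_mul_of_eq wy, mul_mul_of_eq xy, mul_mul_of_eq xz, mul_mul_of_eq wz,
        mul_mul_of_eq wx]
      match_scalars <;> field_simp <;> ring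
  have hzy : X 0 0 * X 1 1 = qdet (q ^ 2) X + q ^ 2 • (X 0 1 * X 1 0) := by
    simp [qdet]
  refine ⟨yx, wy, hzy, zy ▸ hzy, ?_, by rw [xz, one_smul], by rw [wz, one_smul],
    comm _ (by simp), comm _ (by simp), comm _ (by simp), comm _ (by simp)⟩
  rw [wx, hzy]
  match_scalars <;> field_simp <;> ring

/-- The relations among the entries of a matrix of FRT type. Its `q`-determinant is central. -/
theorem frt_letters (hq : s ^ 2 = q) (hq0 : q ≠ 0) (ht : rScale G s = t) (ht0 : t ≠ 0)
    (h : Law.lhs G s X X .frt = Law.rhs G s X X .frt) :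
    LetterRel (q ^ 2) q q (q - q⁻¹) 0 q⁻¹ 0 q 0 (X 0 1) (X 0 0) (X 1 1) (X 1 0) (qdet q X) := by
  have h' := fun a b c d => congrFun (congrFun h (a, b)) (c, d)
  simp only [Fin.forall_fin_two, Law.lhs, Law.rhs, scal, rMat, rMat21, leg1, leg2, hq,
    ht, Matrix.mul_apply, Fintype.sum_prod_type, Fin.sum_univ_two] at h'
  simp [Algebra.algebraMap_eq_smul_one, add_mul] at h'
  obtain ⟨⟨⟨-, e1⟩, -⟩, ⟨⟨e4, e5⟩, e6, e7⟩, -, e9⟩ := h'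
  have zy : X 1 1 * X 0 0 = X 0 0 * X 1 1 := by
    linear_combination (norm := skip) (t⁻¹ : k) • e6
    match_scalars <;> field_simp <;> ring
  have yx : X 0 0 * X 0 1 = q • (X 0 1 * X 0 0) := by
    linear_combination (norm := skip) (-t⁻¹ : k) • e1
    match_scalars <;> field_simp <;> ring
  have xy : X 0 1 * X 0 0 = q⁻¹ • (X 0 0 * X 0 1) := by
    rw [yx]
    match_scalars
    field_simp
  have wy : X 1 0 * X 0 0 = q • (X 0 0 * X 1 0) := by
    linear_combination (norm := skip) (t⁻¹ : k) • e4
    match_scalars <;> field_simp <;> ring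
  have xz : X 0 1 * X 1 1 = q⁻¹ • (X 1 1 * X 0 1) := by
    linear_combination (norm := skip) (-(t⁻¹ * q⁻¹) : k) • e7
    match_scalars <;> field_simp <;> ring
  have wz : X 1 0 * X 1 1 = q • (X 1 1 * X 1 0) := by
    linear_combination (norm := skip) (-t⁻¹ : k) • e9
    match_scalars <;> field_simp <;> ring
  have wx : X 1 0 * X 0 1 = X 0 1 * X 1 0 + (q - q⁻¹) • (X 1 1 * X 0 0) := by
    rw [zy]
    linear_combination (norm := skip) (t⁻¹ : k) • e5
    match_scalars <;> field_simp <;> ring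
  have comm : ∀ a ∈ ({X 0 1, X 0 0, X 1 1, X 1 0} : Set B),
      qdet q X * a = a * qdet q X := by
    simp only [Set.mem_insert_iff, Set.mem_singleton_iff, forall_eq_or_imp, forall_eq, qdet]
    refine ⟨?_, ?_, ?_, ?_⟩
    all_goals
      simp only [mul_add, mul_sub, add_mul, sub_mul, smul_mul_assoc, mul_smul_comm, mul_assoc,
        smul_add, smul_sub, zy.symm, wy, xy, xz, wz, wx, mul_mul_of_eq zy.symm,
        mul_mul_of_eq wy, mul_mul_of_eq xy, mul_mul_of_eq xz, mul_mul_of_eq wz,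
        mul_mul_of_eq wx]
      match_scalars <;> field_simp <;> ring
  have hyz : X 0 0 * X 1 1 = qdet q X + q • (X 0 1 * X 1 0) := by
    simp [qdet]
  refine ⟨yx, wy, zy ▸ hyz, hyz, ?_, by rw [xz, zero_smul, add_zero],
    by rw [wz, zero_smul, add_zero],
    comm _ (by simp), comm _ (by simp), comm _ (by simp), comm _ (by simp)⟩
  rw [wx, zy, hyz]
  match_scalars <;> field_simp <;> ring

theorem smash_swap (hq : s ^ 2 = q) (hq0 : q ≠ 0) (ht : rScale G s = t) (ht0 : t ≠ 0)
    (h : Law.lhs G s Y X .smash = Law.rhs G s Y X .smash) :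
    (X 0 0 * Y 0 0 =
      (q ^ 2 * t ^ 2) • (Y 0 0 * X 0 0) + (q ^ 2 * t ^ 2 - t ^ 2) • (Y 0 1 * X 1 0) + (-(t ^ 2) +
        q⁻¹ ^ 2 * t ^ 2) • (Y 1 0 * X 0 1) + (-(t ^ 2) +
        2 * q⁻¹ ^ 2 * t ^ 2 - q⁻¹ ^ 4 * t ^ 2) • (Y 1 1 * X 1 1)) ∧
    (X 0 0 * Y 0 1 =
      (t ^ 2) • (Y 0 1 * X 0 0) + (q ^ 2 * t ^ 2 - t ^ 2) • (Y 0 0 * X 0 1) +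
        (q ^ 2 * t ^ 2 - 2 * t ^ 2 + q⁻¹ ^ 2 * t ^ 2) • (Y 0 1 * X 1 1) + (-(t ^ 2) +
        q⁻¹ ^ 2 * t ^ 2) • (Y 1 1 * X 0 1)) ∧
    (X 0 0 * Y 1 0 =
      (q ^ 2 * t ^ 2) • (Y 1 0 * X 0 0) + (q ^ 2 * t ^ 2 - t ^ 2) • (Y 1 1 * X 1 0)) ∧
    (X 0 0 * Y 1 1 =
      (t ^ 2) • (Y 1 1 * X 0 0) + (q ^ 2 * t ^ 2 - t ^ 2) • (Y 1 0 * X 0 1) +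
        (q ^ 2 * t ^ 2 - 2 * t ^ 2 + q⁻¹ ^ 2 * t ^ 2) • (Y 1 1 * X 1 1)) ∧
    (X 0 1 * Y 0 0 =
      (q ^ 2 * t ^ 2) • (Y 0 0 * X 0 1) + (q ^ 2 * t ^ 2 - t ^ 2) • (Y 0 1 * X 1 1)) ∧
    (X 0 1 * Y 0 1 =
      (q ^ 2 * t ^ 2) • (Y 0 1 * X 0 1)) ∧
    (X 0 1 * Y 1 0 =
      (t ^ 2) • (Y 1 0 * X 0 1) + (t ^ 2 - q⁻¹ ^ 2 * t ^ 2) • (Y 1 1 * X 1 1)) ∧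
    (X 0 1 * Y 1 1 =
      (t ^ 2) • (Y 1 1 * X 0 1)) ∧
    (X 1 0 * Y 0 0 =
      (t ^ 2) • (Y 0 0 * X 1 0) + (q ^ 2 * t ^ 2 - t ^ 2) • (Y 1 0 * X 0 0) + (-(t ^ 2) +
        q⁻¹ ^ 2 * t ^ 2) • (Y 1 0 * X 1 1) + (q ^ 2 * t ^ 2 - 2 * t ^ 2 +
        q⁻¹ ^ 2 * t ^ 2) • (Y 1 1 * X 1 0)) ∧
    (X 1 0 * Y 0 1 =
      (t ^ 2) • (Y 0 1 * X 1 0) + (t ^ 2 - q⁻¹ ^ 2 * t ^ 2) • (Y 0 0 * X 1 1) +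
        (q ^ 2 * t ^ 2 - 2 * t ^ 2 + q⁻¹ ^ 2 * t ^ 2) • (Y 1 0 * X 0 1) +
        (t ^ 2 - q⁻¹ ^ 2 * t ^ 2) • (Y 1 1 * X 0 0) + (-(2 * t ^ 2) +
        3 * q⁻¹ ^ 2 * t ^ 2 - q⁻¹ ^ 4 * t ^ 2) • (Y 1 1 * X 1 1)) ∧
    (X 1 0 * Y 1 0 =
      (q ^ 2 * t ^ 2) • (Y 1 0 * X 1 0)) ∧
    (X 1 0 * Y 1 1 =
      (q ^ 2 * t ^ 2) • (Y 1 1 * X 1 0) + (q ^ 2 * t ^ 2 - t ^ 2) • (Y 1 0 * X 1 1)) ∧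
    (X 1 1 * Y 0 0 =
      (t ^ 2) • (Y 0 0 * X 1 1) + (q ^ 2 * t ^ 2 - t ^ 2) • (Y 1 0 * X 0 1) +
        (q ^ 2 * t ^ 2 - 2 * t ^ 2 + q⁻¹ ^ 2 * t ^ 2) • (Y 1 1 * X 1 1)) ∧
    (X 1 1 * Y 0 1 =
      (q ^ 2 * t ^ 2) • (Y 0 1 * X 1 1) + (q ^ 2 * t ^ 2 - t ^ 2) • (Y 1 1 * X 0 1)) ∧
    (X 1 1 * Y 1 0 =
      (t ^ 2) • (Y 1 0 * X 1 1)) ∧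
    (X 1 1 * Y 1 1 =
      (q ^ 2 * t ^ 2) • (Y 1 1 * X 1 1)) := by
  have h' := fun a b c d => congrFun (congrFun h (a, b)) (c, d)
  simp only [Fin.forall_fin_two, Law.lhs, Law.rhs, scal, rMat, rInv, rMat21, rInv21, leg1, leg2, hq,
    ht, Matrix.mul_apply, Fintype.sum_prod_type, Fin.sum_univ_two] at h'
  simp [Algebra.algebraMap_eq_smul_one, add_mul, mul_add] at h'
  obtain ⟨⟨⟨⟨e0, e1⟩, e2, e3⟩, ⟨e4, e5⟩, e6, e7⟩, ⟨⟨e8, e9⟩, e10, e11⟩, ⟨e12, e13⟩, e14, e15⟩ := h'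
  refine ⟨?_, ?_, ?_, ?_, ?_, ?_, ?_, ?_, ?_, ?_, ?_, ?_, ?_, ?_, ?_, ?_⟩
  on_goal 1 => linear_combination (norm := skip) (-1 : k) • e0 + (q⁻¹ - q⁻¹ ^ 3 : k) • e9
  on_goal 2 => linear_combination (norm := skip) (-1 + q⁻¹ ^ 2 : k) • e1 + (-q⁻¹ : k) • e2 +
      (1 - q⁻¹ ^ 2 : k) • e11
  on_goal 3 => linear_combination (norm := skip) (-q : k) • e8
  on_goal 4 => linear_combination (norm := skip) (-q + q⁻¹ : k) • e9 + (-1 : k) • e10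
  on_goal 5 => linear_combination (norm := skip) (-1 : k) • e1
  on_goal 6 => linear_combination (norm := skip) (-q : k) • e3
  on_goal 7 => linear_combination (norm := skip) (-q⁻¹ : k) • e9
  on_goal 8 => linear_combination (norm := skip) (-1 : k) • e11
  on_goal 9 => linear_combination (norm := skip) (-1 : k) • e4 + (q⁻¹ - q⁻¹ ^ 3 : k) • e13
  on_goal 10 => linear_combination (norm := skip) (-1 + q⁻¹ ^ 2 : k) • e5 + (-q⁻¹ : k) • e6 +
      (1 - q⁻¹ ^ 2 : k) • e15
  on_goal 11 => linear_combination (norm := skip) (-q : k) • e12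
  on_goal 12 => linear_combination (norm := skip) (-q + q⁻¹ : k) • e13 + (-1 : k) • e14
  on_goal 13 => linear_combination (norm := skip) (-1 : k) • e5
  on_goal 14 => linear_combination (norm := skip) (-q : k) • e7
  on_goal 15 => linear_combination (norm := skip) (-q⁻¹ : k) • e13
  on_goal 16 => linear_combination (norm := skip) (-1 : k) • e15
  all_goals (match_scalars <;> field_simp <;> ring)

theorem smashFrt_swap (hq : s ^ 2 = q) (hq0 : q ≠ 0) (ht : rScale G s = t) (ht0 : t ≠ 0)
    (h : Law.lhs G s Y X .smashFrt = Law.rhs G s Y X .smashFrt) :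
    (∀ j, X 0 0 * Y 0 j =
      (q⁻¹ ^ 2 * t⁻¹ ^ 2) • (Y 0 j * X 0 0) + (t⁻¹ ^ 2 - 2 * q⁻¹ ^ 2 * t⁻¹ ^ 2 +
        q⁻¹ ^ 4 * t⁻¹ ^ 2) • (Y 0 j * X 1 1) + (-(q⁻¹ * t⁻¹ ^ 2) +
        q⁻¹ ^ 3 * t⁻¹ ^ 2) • (Y 1 j * X 0 1)) ∧
    (∀ j, X 0 0 * Y 1 j =
      (t⁻¹ ^ 2) • (Y 1 j * X 0 0) + (-(q * t⁻¹ ^ 2) + q⁻¹ * t⁻¹ ^ 2) • (Y 0 j * X 1 0)) ∧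
    (∀ j, X 0 1 * Y 0 j =
      (q⁻¹ * t⁻¹ ^ 2) • (Y 0 j * X 0 1)) ∧
    (∀ j, X 0 1 * Y 1 j =
      (q⁻¹ * t⁻¹ ^ 2) • (Y 1 j * X 0 1) + (-(t⁻¹ ^ 2) + q⁻¹ ^ 2 * t⁻¹ ^ 2) • (Y 0 j * X 1 1)) ∧
    (∀ j, X 1 0 * Y 0 j =
      (q⁻¹ * t⁻¹ ^ 2) • (Y 0 j * X 1 0) + (-(q⁻¹ ^ 2 * t⁻¹ ^ 2) +
        q⁻¹ ^ 4 * t⁻¹ ^ 2) • (Y 1 j * X 1 1)) ∧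
    (∀ j, X 1 0 * Y 1 j =
      (q⁻¹ * t⁻¹ ^ 2) • (Y 1 j * X 1 0)) ∧
    (∀ j, X 1 1 * Y 0 j =
      (t⁻¹ ^ 2) • (Y 0 j * X 1 1)) ∧
    (∀ j, X 1 1 * Y 1 j =
      (q⁻¹ ^ 2 * t⁻¹ ^ 2) • (Y 1 j * X 1 1)) := by
  have h' := fun a b c d => congrFun (congrFun h (a, b)) (c, d)
  simp only [Fin.forall_fin_two, Law.lhs, Law.rhs, scal, rMat, rInv, rMat21, rInv21, leg1, leg2, hq,
    ht, Matrix.mul_apply, Fintype.sum_prod_type, Fin.sum_univ_two] at h'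
  simp [Algebra.algebraMap_eq_smul_one, add_mul, mul_add] at h'
  obtain ⟨⟨⟨⟨e0, e1⟩, e2, e3⟩, ⟨e4, e5⟩, e6, e7⟩, ⟨⟨e8, e9⟩, e10, e11⟩, ⟨e12, e13⟩, e14, e15⟩ := h'
  simp only [Fin.forall_fin_two]
  refine ⟨⟨?_, ?_⟩, ⟨?_, ?_⟩, ⟨?_, ?_⟩, ⟨?_, ?_⟩, ⟨?_, ?_⟩, ⟨?_, ?_⟩, ⟨?_, ?_⟩, ?_, ?_⟩
  on_goal 1 => linear_combination (norm := skip) (-(q⁻¹ ^ 2 * t⁻¹ ^ 2) : k) • e0 +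
      (q⁻¹ * t⁻¹ ^ 2 - q⁻¹ ^ 3 * t⁻¹ ^ 2 : k) • e6 +
      (-(t⁻¹ ^ 2) +
      2 * q⁻¹ ^ 2 * t⁻¹ ^ 2 - q⁻¹ ^ 4 * t⁻¹ ^ 2 : k) • e10
  on_goal 2 => linear_combination (norm := skip) (-(q⁻¹ ^ 2 * t⁻¹ ^ 2) : k) • e1 +
      (q⁻¹ * t⁻¹ ^ 2 - q⁻¹ ^ 3 * t⁻¹ ^ 2 : k) • e7 +
      (-(t⁻¹ ^ 2) +
      2 * q⁻¹ ^ 2 * t⁻¹ ^ 2 - q⁻¹ ^ 4 * t⁻¹ ^ 2 : k) • e11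
  on_goal 3 => linear_combination (norm := skip) (-(t⁻¹ ^ 2) : k) • e4 +
      (q * t⁻¹ ^ 2 - q⁻¹ * t⁻¹ ^ 2 : k) • e8
  on_goal 4 => linear_combination (norm := skip) (-(t⁻¹ ^ 2) : k) • e5 +
      (q * t⁻¹ ^ 2 - q⁻¹ * t⁻¹ ^ 2 : k) • e9
  on_goal 5 => linear_combination (norm := skip) (-(q⁻¹ * t⁻¹ ^ 2) : k) • e2
  on_goal 6 => linear_combination (norm := skip) (-(q⁻¹ * t⁻¹ ^ 2) : k) • e3
  on_goal 7 => linear_combination (norm := skip) (-(q⁻¹ * t⁻¹ ^ 2) : k) • e6 +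
      (t⁻¹ ^ 2 - q⁻¹ ^ 2 * t⁻¹ ^ 2 : k) • e10
  on_goal 8 => linear_combination (norm := skip) (-(q⁻¹ * t⁻¹ ^ 2) : k) • e7 +
      (t⁻¹ ^ 2 - q⁻¹ ^ 2 * t⁻¹ ^ 2 : k) • e11
  on_goal 9 => linear_combination (norm := skip) (-(q⁻¹ * t⁻¹ ^ 2) : k) • e8 +
      (q⁻¹ ^ 2 * t⁻¹ ^ 2 - q⁻¹ ^ 4 * t⁻¹ ^ 2 : k) • e14
  on_goal 10 => linear_combination (norm := skip) (-(q⁻¹ * t⁻¹ ^ 2) : k) • e9 +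
      (q⁻¹ ^ 2 * t⁻¹ ^ 2 - q⁻¹ ^ 4 * t⁻¹ ^ 2 : k) • e15
  on_goal 11 => linear_combination (norm := skip) (-(q⁻¹ * t⁻¹ ^ 2) : k) • e12
  on_goal 12 => linear_combination (norm := skip) (-(q⁻¹ * t⁻¹ ^ 2) : k) • e13
  on_goal 13 => linear_combination (norm := skip) (-(t⁻¹ ^ 2) : k) • e10
  on_goal 14 => linear_combination (norm := skip) (-(t⁻¹ ^ 2) : k) • e11
  on_goal 15 => linear_combination (norm := skip) (-(q⁻¹ ^ 2 * t⁻¹ ^ 2) : k) • e14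
  on_goal 16 => linear_combination (norm := skip) (-(q⁻¹ ^ 2 * t⁻¹ ^ 2) : k) • e15
  all_goals (match_scalars <;> field_simp <;> ring)

theorem braidLoopLoop_yx (hq : s ^ 2 = q) (hq0 : q ≠ 0) (ht : rScale G s = t) (ht0 : t ≠ 0)
    (h : Law.lhs G s Y X .braidLoopLoop = Law.rhs G s Y X .braidLoopLoop) :
    (Y 0 0 * X 0 0 =
      X 0 0 * Y 0 0 + (-(q⁻¹ ^ 2) + q⁻¹ ^ 4) • (X 1 0 * Y 0 1)) ∧
    (Y 0 0 * X 0 1 =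
      X 0 1 * Y 0 0 + (1 - q⁻¹ ^ 2) • (X 0 0 * Y 0 1) + (-1 + q⁻¹ ^ 2) • (X 1 1 * Y 0 1)) ∧
    (Y 0 0 * X 1 0 =
      X 1 0 * Y 0 0) ∧
    (Y 0 0 * X 1 1 =
      X 1 1 * Y 0 0 + (1 - q⁻¹ ^ 2) • (X 1 0 * Y 0 1)) ∧
    (Y 0 1 * X 0 0 =
      X 0 0 * Y 0 1) ∧
    (Y 0 1 * X 0 1 =
      (q ^ 2) • (X 0 1 * Y 0 1)) ∧
    (Y 0 1 * X 1 0 =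
      (q⁻¹ ^ 2) • (X 1 0 * Y 0 1)) ∧
    (Y 0 1 * X 1 1 =
      X 1 1 * Y 0 1) ∧
    (Y 1 0 * X 0 0 =
      X 0 0 * Y 1 0 + (1 - q⁻¹ ^ 2) • (X 1 0 * Y 0 0) + (-1 + q⁻¹ ^ 2) • (X 1 0 * Y 1 1)) ∧
    (Y 1 0 * X 0 1 =
      (q⁻¹ ^ 2) • (X 0 1 * Y 1 0) + (-1 + q⁻¹ ^ 2) • (X 0 0 * Y 0 0) +
        (1 - q⁻¹ ^ 2) • (X 0 0 * Y 1 1) + (q ^ 2 - 1 - q⁻¹ ^ 2 + q⁻¹ ^ 4) • (X 1 0 * Y 0 1) +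
        (1 - q⁻¹ ^ 2) • (X 1 1 * Y 0 0) + (-1 + q⁻¹ ^ 2) • (X 1 1 * Y 1 1)) ∧
    (Y 1 0 * X 1 0 =
      (q ^ 2) • (X 1 0 * Y 1 0)) ∧
    (Y 1 0 * X 1 1 =
      X 1 1 * Y 1 0 + (-(q ^ 2) + 1) • (X 1 0 * Y 0 0) + (q ^ 2 - 1) • (X 1 0 * Y 1 1)) ∧
    (Y 1 1 * X 0 0 =
      X 0 0 * Y 1 1 + (1 - q⁻¹ ^ 2) • (X 1 0 * Y 0 1)) ∧
    (Y 1 1 * X 0 1 =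
      X 0 1 * Y 1 1 + (-(q ^ 2) + 1) • (X 0 0 * Y 0 1) + (q ^ 2 - 1) • (X 1 1 * Y 0 1)) ∧
    (Y 1 1 * X 1 0 =
      X 1 0 * Y 1 1) ∧
    (Y 1 1 * X 1 1 =
      X 1 1 * Y 1 1 + (-(q ^ 2) + 1) • (X 1 0 * Y 0 1)) := by
  have h' := fun a b c d => congrFun (congrFun h (a, b)) (c, d)
  simp only [Fin.forall_fin_two, Law.lhs, Law.rhs, scal, rMat, rInv, rMat21, rInv21, leg1, leg2, hq,
    ht, Matrix.mul_apply, Fintype.sum_prod_type, Fin.sum_univ_two] at h'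
  simp [Algebra.algebraMap_eq_smul_one, add_mul, mul_add] at h'
  obtain ⟨⟨⟨⟨e0, e1⟩, e2, e3⟩, ⟨e4, e5⟩, e6, e7⟩, ⟨⟨e8, e9⟩, e10, e11⟩, ⟨e12, e13⟩, e14, e15⟩ := h'
  refine ⟨?_, ?_, ?_, ?_, ?_, ?_, ?_, ?_, ?_, ?_, ?_, ?_, ?_, ?_, ?_, ?_⟩
  on_goal 1 => linear_combination (norm := skip) (1 : k) • e0 + (-q⁻¹ + q⁻¹ ^ 3 : k) • e6
  on_goal 2 => linear_combination (norm := skip) (q⁻¹ : k) • e1 + (1 - q⁻¹ ^ 2 : k) • e2 + (-1 +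
      q⁻¹ ^ 2 : k) • e7
  on_goal 3 => linear_combination (norm := skip) (q : k) • e4
  on_goal 4 => linear_combination (norm := skip) (1 : k) • e5 + (q - q⁻¹ : k) • e6
  on_goal 5 => linear_combination (norm := skip) (1 : k) • e2
  on_goal 6 => linear_combination (norm := skip) (q : k) • e3
  on_goal 7 => linear_combination (norm := skip) (q⁻¹ : k) • e6
  on_goal 8 => linear_combination (norm := skip) (1 : k) • e7
  on_goal 9 => linear_combination (norm := skip) (1 : k) • e8 + (-q⁻¹ + q⁻¹ ^ 3 : k) • e14
  on_goal 10 => linear_combination (norm := skip) (q⁻¹ : k) • e9 + (1 - q⁻¹ ^ 2 : k) • e10 + (-1 +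
      q⁻¹ ^ 2 : k) • e15
  on_goal 11 => linear_combination (norm := skip) (q : k) • e12
  on_goal 12 => linear_combination (norm := skip) (1 : k) • e13 + (q - q⁻¹ : k) • e14
  on_goal 13 => linear_combination (norm := skip) (1 : k) • e10
  on_goal 14 => linear_combination (norm := skip) (q : k) • e11
  on_goal 15 => linear_combination (norm := skip) (q⁻¹ : k) • e14
  on_goal 16 => linear_combination (norm := skip) (1 : k) • e15
  all_goals (match_scalars <;> field_simp <;> ring)

theorem braidLoopLoop_xy (hq : s ^ 2 = q) (hq0 : q ≠ 0) (ht : rScale G s = t) (ht0 : t ≠ 0)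
    (h : Law.lhs G s Y X .braidLoopLoop = Law.rhs G s Y X .braidLoopLoop) :
    (X 0 0 * Y 0 0 =
      Y 0 0 * X 0 0 + (1 - q⁻¹ ^ 2) • (Y 0 1 * X 1 0)) ∧
    (X 0 0 * Y 0 1 =
      Y 0 1 * X 0 0) ∧
    (X 0 0 * Y 1 0 =
      Y 1 0 * X 0 0 + (-1 + q⁻¹ ^ 2) • (Y 0 0 * X 1 0) + (1 - q⁻¹ ^ 2) • (Y 1 1 * X 1 0)) ∧
    (X 0 0 * Y 1 1 =
      Y 1 1 * X 0 0 + (-(q ^ 2) + 1) • (Y 0 1 * X 1 0)) ∧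
    (X 0 1 * Y 0 0 =
      Y 0 0 * X 0 1 + (-1 + q⁻¹ ^ 2) • (Y 0 1 * X 0 0) + (1 - q⁻¹ ^ 2) • (Y 0 1 * X 1 1)) ∧
    (X 0 1 * Y 0 1 =
      (q⁻¹ ^ 2) • (Y 0 1 * X 0 1)) ∧
    (X 0 1 * Y 1 0 =
      (q ^ 2) • (Y 1 0 * X 0 1) + (q ^ 2 - 1) • (Y 0 0 * X 0 0) + (-(q ^ 2) + 1) • (Y 0 0 * X 1 1) +
        (q ^ 4 - q ^ 2 - 1 + q⁻¹ ^ 2) • (Y 0 1 * X 1 0) + (-(q ^ 2) + 1) • (Y 1 1 * X 0 0) +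
        (q ^ 2 - 1) • (Y 1 1 * X 1 1)) ∧
    (X 0 1 * Y 1 1 =
      Y 1 1 * X 0 1 + (q ^ 2 - 1) • (Y 0 1 * X 0 0) + (-(q ^ 2) + 1) • (Y 0 1 * X 1 1)) ∧
    (X 1 0 * Y 0 0 =
      Y 0 0 * X 1 0) ∧
    (X 1 0 * Y 0 1 =
      (q ^ 2) • (Y 0 1 * X 1 0)) ∧
    (X 1 0 * Y 1 0 =
      (q⁻¹ ^ 2) • (Y 1 0 * X 1 0)) ∧
    (X 1 0 * Y 1 1 =
      Y 1 1 * X 1 0) ∧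
    (X 1 1 * Y 0 0 =
      Y 0 0 * X 1 1 + (-(q ^ 2) + 1) • (Y 0 1 * X 1 0)) ∧
    (X 1 1 * Y 0 1 =
      Y 0 1 * X 1 1) ∧
    (X 1 1 * Y 1 0 =
      Y 1 0 * X 1 1 + (q ^ 2 - 1) • (Y 0 0 * X 1 0) + (-(q ^ 2) + 1) • (Y 1 1 * X 1 0)) ∧
    (X 1 1 * Y 1 1 =
      Y 1 1 * X 1 1 + (q ^ 4 - q ^ 2) • (Y 0 1 * X 1 0)) := by
  have h' := fun a b c d => congrFun (congrFun h (a, b)) (c, d)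
  simp only [Fin.forall_fin_two, Law.lhs, Law.rhs, scal, rMat, rInv, rMat21, rInv21, leg1, leg2, hq,
    ht, Matrix.mul_apply, Fintype.sum_prod_type, Fin.sum_univ_two] at h'
  simp [Algebra.algebraMap_eq_smul_one, add_mul, mul_add] at h'
  obtain ⟨⟨⟨⟨e0, e1⟩, e2, e3⟩, ⟨e4, e5⟩, e6, e7⟩, ⟨⟨e8, e9⟩, e10, e11⟩, ⟨e12, e13⟩, e14, e15⟩ := h'
  refine ⟨?_, ?_, ?_, ?_, ?_, ?_, ?_, ?_, ?_, ?_, ?_, ?_, ?_, ?_, ?_, ?_⟩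
  on_goal 1 => linear_combination (norm := skip) (-1 : k) • e0
  on_goal 2 => linear_combination (norm := skip) (-1 : k) • e2
  on_goal 3 => linear_combination (norm := skip) (q - q⁻¹ : k) • e4 + (-1 : k) • e8
  on_goal 4 => linear_combination (norm := skip) (q - q⁻¹ : k) • e6 + (-1 : k) • e10
  on_goal 5 => linear_combination (norm := skip) (-q⁻¹ : k) • e1
  on_goal 6 => linear_combination (norm := skip) (-q⁻¹ : k) • e3
  on_goal 7 => linear_combination (norm := skip) (-(q ^ 2) + 1 : k) • e0 + (q ^ 2 - 1 : k) • e5 +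
      (-q : k) • e9
  on_goal 8 => linear_combination (norm := skip) (-(q ^ 2) + 1 : k) • e2 + (q ^ 2 - 1 : k) • e7 +
      (-q : k) • e11
  on_goal 9 => linear_combination (norm := skip) (-q : k) • e4
  on_goal 10 => linear_combination (norm := skip) (-q : k) • e6
  on_goal 11 => linear_combination (norm := skip) (-q⁻¹ : k) • e12
  on_goal 12 => linear_combination (norm := skip) (-q⁻¹ : k) • e14
  on_goal 13 => linear_combination (norm := skip) (-1 : k) • e5
  on_goal 14 => linear_combination (norm := skip) (-1 : k) • e7
  on_goal 15 => linear_combination (norm := skip) (-(q ^ 3) + q : k) • e4 + (-1 : k) • e13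
  on_goal 16 => linear_combination (norm := skip) (-(q ^ 3) + q : k) • e6 + (-1 : k) • e15
  all_goals (match_scalars <;> field_simp <;> ring)

theorem braidFrtLoop_yx (hq : s ^ 2 = q) (hq0 : q ≠ 0) (ht : rScale G s = t) (ht0 : t ≠ 0)
    (h : Law.lhs G s Y X .braidFrtLoop = Law.rhs G s Y X .braidFrtLoop) :
    (∀ j, Y 0 j * X 0 0 =
      X 0 0 * Y 0 j) ∧
    (∀ j, Y 0 j * X 0 1 =
      q • (X 0 1 * Y 0 j)) ∧
    (∀ j, Y 0 j * X 1 0 =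
      q⁻¹ • (X 1 0 * Y 0 j)) ∧
    (∀ j, Y 0 j * X 1 1 =
      X 1 1 * Y 0 j) ∧
    (∀ j, Y 1 j * X 0 0 =
      X 0 0 * Y 1 j + (1 - q⁻¹ ^ 2) • (X 1 0 * Y 0 j)) ∧
    (∀ j, Y 1 j * X 0 1 =
      q⁻¹ • (X 0 1 * Y 1 j) + (-q + q⁻¹) • (X 0 0 * Y 0 j) + (q - q⁻¹) • (X 1 1 * Y 0 j)) ∧
    (∀ j, Y 1 j * X 1 0 =
      q • (X 1 0 * Y 1 j)) ∧
    (∀ j, Y 1 j * X 1 1 =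
      X 1 1 * Y 1 j + (-(q ^ 2) + 1) • (X 1 0 * Y 0 j)) := by
  have h' := fun a b c d => congrFun (congrFun h (a, b)) (c, d)
  simp only [Fin.forall_fin_two, Law.lhs, Law.rhs, scal, rMat, rInv, rMat21, rInv21, leg1, leg2, hq,
    ht, Matrix.mul_apply, Fintype.sum_prod_type, Fin.sum_univ_two] at h'
  simp [Algebra.algebraMap_eq_smul_one, add_mul, mul_add] at h'
  obtain ⟨⟨⟨⟨e0, e1⟩, e2, e3⟩, ⟨e4, e5⟩, e6, e7⟩, ⟨⟨e8, e9⟩, e10, e11⟩, ⟨e12, e13⟩, e14, e15⟩ := h'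
  simp only [Fin.forall_fin_two]
  refine ⟨⟨?_, ?_⟩, ⟨?_, ?_⟩, ⟨?_, ?_⟩, ⟨?_, ?_⟩, ⟨?_, ?_⟩, ⟨?_, ?_⟩, ⟨?_, ?_⟩, ?_, ?_⟩
  on_goal 1 => linear_combination (norm := skip) (1 : k) • e0
  on_goal 2 => linear_combination (norm := skip) (1 : k) • e2
  on_goal 3 => linear_combination (norm := skip) (1 : k) • e1
  on_goal 4 => linear_combination (norm := skip) (1 : k) • e3
  on_goal 5 => linear_combination (norm := skip) (1 : k) • e4
  on_goal 6 => linear_combination (norm := skip) (1 : k) • e6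
  on_goal 7 => linear_combination (norm := skip) (1 : k) • e5
  on_goal 8 => linear_combination (norm := skip) (1 : k) • e7
  on_goal 9 => linear_combination (norm := skip) (1 : k) • e8
  on_goal 10 => linear_combination (norm := skip) (1 : k) • e10
  on_goal 11 => linear_combination (norm := skip) (1 : k) • e9
  on_goal 12 => linear_combination (norm := skip) (1 : k) • e11
  on_goal 13 => linear_combination (norm := skip) (1 : k) • e12
  on_goal 14 => linear_combination (norm := skip) (1 : k) • e14
  on_goal 15 => linear_combination (norm := skip) (1 : k) • e13
  on_goal 16 => linear_combination (norm := skip) (1 : k) • e15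
  all_goals (match_scalars <;> field_simp <;> ring)

theorem braidFrtLoop_xy (hq : s ^ 2 = q) (hq0 : q ≠ 0) (ht : rScale G s = t) (ht0 : t ≠ 0)
    (h : Law.lhs G s Y X .braidFrtLoop = Law.rhs G s Y X .braidFrtLoop) :
    (∀ j, X 0 0 * Y 0 j =
      Y 0 j * X 0 0) ∧
    (∀ j, X 0 0 * Y 1 j =
      Y 1 j * X 0 0 + (-q + q⁻¹) • (Y 0 j * X 1 0)) ∧
    (∀ j, X 0 1 * Y 0 j =
      q⁻¹ • (Y 0 j * X 0 1)) ∧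
    (∀ j, X 0 1 * Y 1 j =
      q • (Y 1 j * X 0 1) + (q ^ 2 - 1) • (Y 0 j * X 0 0) + (-(q ^ 2) + 1) • (Y 0 j * X 1 1)) ∧
    (∀ j, X 1 0 * Y 0 j =
      q • (Y 0 j * X 1 0)) ∧
    (∀ j, X 1 0 * Y 1 j =
      q⁻¹ • (Y 1 j * X 1 0)) ∧
    (∀ j, X 1 1 * Y 0 j =
      Y 0 j * X 1 1) ∧
    (∀ j, X 1 1 * Y 1 j =
      Y 1 j * X 1 1 + (q ^ 3 - q) • (Y 0 j * X 1 0)) := by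
  have h' := fun a b c d => congrFun (congrFun h (a, b)) (c, d)
  simp only [Fin.forall_fin_two, Law.lhs, Law.rhs, scal, rMat, rInv, rMat21, rInv21, leg1, leg2, hq,
    ht, Matrix.mul_apply, Fintype.sum_prod_type, Fin.sum_univ_two] at h'
  simp [Algebra.algebraMap_eq_smul_one, add_mul, mul_add] at h'
  obtain ⟨⟨⟨⟨e0, e1⟩, e2, e3⟩, ⟨e4, e5⟩, e6, e7⟩, ⟨⟨e8, e9⟩, e10, e11⟩, ⟨e12, e13⟩, e14, e15⟩ := h'
  simp only [Fin.forall_fin_two]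
  refine ⟨⟨?_, ?_⟩, ⟨?_, ?_⟩, ⟨?_, ?_⟩, ⟨?_, ?_⟩, ⟨?_, ?_⟩, ⟨?_, ?_⟩, ⟨?_, ?_⟩, ?_, ?_⟩
  on_goal 1 => linear_combination (norm := skip) (-1 : k) • e0
  on_goal 2 => linear_combination (norm := skip) (-1 : k) • e2
  on_goal 3 => linear_combination (norm := skip) (q - q⁻¹ : k) • e4 + (-1 : k) • e8
  on_goal 4 => linear_combination (norm := skip) (q - q⁻¹ : k) • e6 + (-1 : k) • e10
  on_goal 5 => linear_combination (norm := skip) (-q⁻¹ : k) • e1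
  on_goal 6 => linear_combination (norm := skip) (-q⁻¹ : k) • e3
  on_goal 7 => linear_combination (norm := skip) (-(q ^ 2) + 1 : k) • e0 + (q ^ 2 - 1 : k) • e5 +
      (-q : k) • e9
  on_goal 8 => linear_combination (norm := skip) (-(q ^ 2) + 1 : k) • e2 + (q ^ 2 - 1 : k) • e7 +
      (-q : k) • e11
  on_goal 9 => linear_combination (norm := skip) (-q : k) • e4
  on_goal 10 => linear_combination (norm := skip) (-q : k) • e6
  on_goal 11 => linear_combination (norm := skip) (-q⁻¹ : k) • e12
  on_goal 12 => linear_combination (norm := skip) (-q⁻¹ : k) • e14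
  on_goal 13 => linear_combination (norm := skip) (-1 : k) • e5
  on_goal 14 => linear_combination (norm := skip) (-1 : k) • e7
  on_goal 15 => linear_combination (norm := skip) (-(q ^ 3) + q : k) • e4 + (-1 : k) • e13
  on_goal 16 => linear_combination (norm := skip) (-(q ^ 3) + q : k) • e6 + (-1 : k) • e15
  all_goals (match_scalars <;> field_simp <;> ring)

theorem braidLoopFrt_yx (hq : s ^ 2 = q) (hq0 : q ≠ 0) (ht : rScale G s = t) (ht0 : t ≠ 0)
    (h : Law.lhs G s Y X .braidLoopFrt = Law.rhs G s Y X .braidLoopFrt) :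
    (∀ b, Y 0 0 * X 0 b =
      X 0 b * Y 0 0 + (-q⁻¹ + q⁻¹ ^ 3) • (X 1 b * Y 0 1)) ∧
    (∀ b, Y 0 0 * X 1 b =
      X 1 b * Y 0 0) ∧
    (∀ b, Y 0 1 * X 0 b =
      q • (X 0 b * Y 0 1)) ∧
    (∀ b, Y 0 1 * X 1 b =
      q⁻¹ • (X 1 b * Y 0 1)) ∧
    (∀ b, Y 1 0 * X 0 b =
      q⁻¹ • (X 0 b * Y 1 0) + (1 - q⁻¹ ^ 2) • (X 1 b * Y 0 0) + (-1 + q⁻¹ ^ 2) • (X 1 b * Y 1 1)) ∧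
    (∀ b, Y 1 0 * X 1 b =
      q • (X 1 b * Y 1 0)) ∧
    (∀ b, Y 1 1 * X 0 b =
      X 0 b * Y 1 1 + (q - q⁻¹) • (X 1 b * Y 0 1)) ∧
    (∀ b, Y 1 1 * X 1 b =
      X 1 b * Y 1 1) := by
  have h' := fun a b c d => congrFun (congrFun h (a, b)) (c, d)
  simp only [Fin.forall_fin_two, Law.lhs, Law.rhs, scal, rMat, rInv, rMat21, rInv21, leg1, leg2, hq,
    ht, Matrix.mul_apply, Fintype.sum_prod_type, Fin.sum_univ_two] at h'
  simp [Algebra.algebraMap_eq_smul_one, add_mul, mul_add] at h'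
  obtain ⟨⟨⟨⟨e0, e1⟩, e2, e3⟩, ⟨e4, e5⟩, e6, e7⟩, ⟨⟨e8, e9⟩, e10, e11⟩, ⟨e12, e13⟩, e14, e15⟩ := h'
  simp only [Fin.forall_fin_two]
  refine ⟨⟨?_, ?_⟩, ⟨?_, ?_⟩, ⟨?_, ?_⟩, ⟨?_, ?_⟩, ⟨?_, ?_⟩, ⟨?_, ?_⟩, ⟨?_, ?_⟩, ?_, ?_⟩
  on_goal 1 => linear_combination (norm := skip) (q⁻¹ * t⁻¹ : k) • e0 + (-(q⁻¹ * t⁻¹) +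
      q⁻¹ ^ 3 * t⁻¹ : k) • e6
  on_goal 2 => linear_combination (norm := skip) (q⁻¹ * t⁻¹ : k) • e1 + (-(q⁻¹ * t⁻¹) +
      q⁻¹ ^ 3 * t⁻¹ : k) • e7
  on_goal 3 => linear_combination (norm := skip) (t⁻¹ : k) • e4
  on_goal 4 => linear_combination (norm := skip) (t⁻¹ : k) • e5
  on_goal 5 => linear_combination (norm := skip) (t⁻¹ : k) • e2
  on_goal 6 => linear_combination (norm := skip) (t⁻¹ : k) • e3
  on_goal 7 => linear_combination (norm := skip) (q⁻¹ * t⁻¹ : k) • e6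
  on_goal 8 => linear_combination (norm := skip) (q⁻¹ * t⁻¹ : k) • e7
  on_goal 9 => linear_combination (norm := skip) (q⁻¹ * t⁻¹ : k) • e8 + (-(q⁻¹ * t⁻¹) +
      q⁻¹ ^ 3 * t⁻¹ : k) • e14
  on_goal 10 => linear_combination (norm := skip) (q⁻¹ * t⁻¹ : k) • e9 + (-(q⁻¹ * t⁻¹) +
      q⁻¹ ^ 3 * t⁻¹ : k) • e15
  on_goal 11 => linear_combination (norm := skip) (t⁻¹ : k) • e12
  on_goal 12 => linear_combination (norm := skip) (t⁻¹ : k) • e13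
  on_goal 13 => linear_combination (norm := skip) (t⁻¹ : k) • e10
  on_goal 14 => linear_combination (norm := skip) (t⁻¹ : k) • e11
  on_goal 15 => linear_combination (norm := skip) (q⁻¹ * t⁻¹ : k) • e14
  on_goal 16 => linear_combination (norm := skip) (q⁻¹ * t⁻¹ : k) • e15
  all_goals (match_scalars <;> field_simp <;> ring)

theorem braidFrtFrt_xy (hq : s ^ 2 = q) (hq0 : q ≠ 0) (ht : rScale G s = t) (ht0 : t ≠ 0)
    (h : Law.lhs G s Y X .braidFrtFrt = Law.rhs G s Y X .braidFrtFrt) :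
    (∀ b j, X 0 b * Y 0 j =
      (q⁻¹ * t⁻¹) • (Y 0 j * X 0 b)) ∧
    (∀ b j, X 0 b * Y 1 j =
      t⁻¹ • (Y 1 j * X 0 b) + (-(q * t⁻¹) + q⁻¹ * t⁻¹) • (Y 0 j * X 1 b)) ∧
    (∀ b j, X 1 b * Y 0 j =
      t⁻¹ • (Y 0 j * X 1 b)) ∧
    (∀ b j, X 1 b * Y 1 j =
      (q⁻¹ * t⁻¹) • (Y 1 j * X 1 b)) := by
  have h' := fun a b c d => congrFun (congrFun h (a, b)) (c, d)
  simp only [Fin.forall_fin_two, Law.lhs, Law.rhs, scal, rMat, rInv, rMat21, rInv21, leg1, leg2, hq,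
    ht, Matrix.mul_apply, Fintype.sum_prod_type, Fin.sum_univ_two] at h'
  simp [Algebra.algebraMap_eq_smul_one, add_mul, mul_add] at h'
  obtain ⟨⟨⟨⟨e0, e1⟩, e2, e3⟩, ⟨e4, e5⟩, e6, e7⟩, ⟨⟨e8, e9⟩, e10, e11⟩, ⟨e12, e13⟩, e14, e15⟩ := h'
  simp only [Fin.forall_fin_two]
  refine ⟨⟨⟨?_, ?_⟩, ?_, ?_⟩, ⟨⟨?_, ?_⟩, ?_, ?_⟩, ⟨⟨?_, ?_⟩, ?_, ?_⟩, ⟨?_, ?_⟩, ?_, ?_⟩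
  on_goal 1 => linear_combination (norm := skip) (-(q⁻¹ * t⁻¹) : k) • e0
  on_goal 2 => linear_combination (norm := skip) (-(q⁻¹ * t⁻¹) : k) • e2
  on_goal 3 => linear_combination (norm := skip) (-(q⁻¹ * t⁻¹) : k) • e1
  on_goal 4 => linear_combination (norm := skip) (-(q⁻¹ * t⁻¹) : k) • e3
  on_goal 5 => linear_combination (norm := skip) (q * t⁻¹ - q⁻¹ * t⁻¹ : k) • e4 + (-t⁻¹ : k) • e8
  on_goal 6 => linear_combination (norm := skip) (q * t⁻¹ - q⁻¹ * t⁻¹ : k) • e6 + (-t⁻¹ : k) • e10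
  on_goal 7 => linear_combination (norm := skip) (q * t⁻¹ - q⁻¹ * t⁻¹ : k) • e5 + (-t⁻¹ : k) • e9
  on_goal 8 => linear_combination (norm := skip) (q * t⁻¹ - q⁻¹ * t⁻¹ : k) • e7 + (-t⁻¹ : k) • e11
  on_goal 9 => linear_combination (norm := skip) (-t⁻¹ : k) • e4
  on_goal 10 => linear_combination (norm := skip) (-t⁻¹ : k) • e6
  on_goal 11 => linear_combination (norm := skip) (-t⁻¹ : k) • e5
  on_goal 12 => linear_combination (norm := skip) (-t⁻¹ : k) • e7
  on_goal 13 => linear_combination (norm := skip) (-(q⁻¹ * t⁻¹) : k) • e12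
  on_goal 14 => linear_combination (norm := skip) (-(q⁻¹ * t⁻¹) : k) • e14
  on_goal 15 => linear_combination (norm := skip) (-(q⁻¹ * t⁻¹) : k) • e13
  on_goal 16 => linear_combination (norm := skip) (-(q⁻¹ * t⁻¹) : k) • e15
  all_goals (match_scalars <;> field_simp <;> ring)

theorem endLoop_yx (hq : s ^ 2 = q) (hq0 : q ≠ 0) (ht : rScale G s = t) (ht0 : t ≠ 0)
    (h : Law.lhs G s Y X .endLoop = Law.rhs G s Y X .endLoop) :
    (∀ a, Y 0 0 * X a 0 =
      X a 0 * Y 0 0) ∧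
    (∀ a, Y 0 0 * X a 1 =
      X a 1 * Y 0 0 + (1 - q⁻¹ ^ 2) • (X a 0 * Y 0 1)) ∧
    (∀ a, Y 0 1 * X a 0 =
      q⁻¹ • (X a 0 * Y 0 1)) ∧
    (∀ a, Y 0 1 * X a 1 =
      q • (X a 1 * Y 0 1)) ∧
    (∀ a, Y 1 0 * X a 0 =
      q • (X a 0 * Y 1 0)) ∧
    (∀ a, Y 1 0 * X a 1 =
      q⁻¹ • (X a 1 * Y 1 0) + (-q + q⁻¹) • (X a 0 * Y 0 0) + (q - q⁻¹) • (X a 0 * Y 1 1)) ∧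
    (∀ a, Y 1 1 * X a 0 =
      X a 0 * Y 1 1) ∧
    (∀ a, Y 1 1 * X a 1 =
      X a 1 * Y 1 1 + (-(q ^ 2) + 1) • (X a 0 * Y 0 1)) := by
  have h' := fun a b c d => congrFun (congrFun h (a, b)) (c, d)
  simp only [Fin.forall_fin_two, Law.lhs, Law.rhs, scal, rMat, rInv, rMat21, rInv21, leg1, leg2, hq,
    ht, Matrix.mul_apply, Fintype.sum_prod_type, Fin.sum_univ_two] at h'
  simp [Algebra.algebraMap_eq_smul_one, add_mul, mul_add] at h'
  obtain ⟨⟨⟨⟨e0, e1⟩, e2, e3⟩, ⟨e4, e5⟩, e6, e7⟩, ⟨⟨e8, e9⟩, e10, e11⟩, ⟨e12, e13⟩, e14, e15⟩ := h'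
  simp only [Fin.forall_fin_two]
  refine ⟨⟨?_, ?_⟩, ⟨?_, ?_⟩, ⟨?_, ?_⟩, ⟨?_, ?_⟩, ⟨?_, ?_⟩, ⟨?_, ?_⟩, ⟨?_, ?_⟩, ?_, ?_⟩
  on_goal 1 => linear_combination (norm := skip) (q * t : k) • e0
  on_goal 2 => linear_combination (norm := skip) (q * t : k) • e4
  on_goal 3 => linear_combination (norm := skip) (t : k) • e1 + (q * t - q⁻¹ * t : k) • e2
  on_goal 4 => linear_combination (norm := skip) (t : k) • e5 + (q * t - q⁻¹ * t : k) • e6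
  on_goal 5 => linear_combination (norm := skip) (t : k) • e2
  on_goal 6 => linear_combination (norm := skip) (t : k) • e6
  on_goal 7 => linear_combination (norm := skip) (q * t : k) • e3
  on_goal 8 => linear_combination (norm := skip) (q * t : k) • e7
  on_goal 9 => linear_combination (norm := skip) (q * t : k) • e8
  on_goal 10 => linear_combination (norm := skip) (q * t : k) • e12
  on_goal 11 => linear_combination (norm := skip) (t : k) • e9 + (q * t - q⁻¹ * t : k) • e10
  on_goal 12 => linear_combination (norm := skip) (t : k) • e13 + (q * t - q⁻¹ * t : k) • e14
  on_goal 13 => linear_combination (norm := skip) (t : k) • e10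
  on_goal 14 => linear_combination (norm := skip) (t : k) • e14
  on_goal 15 => linear_combination (norm := skip) (q * t : k) • e11
  on_goal 16 => linear_combination (norm := skip) (q * t : k) • e15
  all_goals (match_scalars <;> field_simp <;> ring)

theorem endFrt_yx (hq : s ^ 2 = q) (hq0 : q ≠ 0) (ht : rScale G s = t) (ht0 : t ≠ 0)
    (h : Law.lhs G s Y X .endFrt = Law.rhs G s Y X .endFrt) :
    (∀ a j, Y 0 j * X a 0 =
      (q⁻¹ * t⁻¹) • (X a 0 * Y 0 j)) ∧
    (∀ a j, Y 0 j * X a 1 =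
      t⁻¹ • (X a 1 * Y 0 j)) ∧
    (∀ a j, Y 1 j * X a 0 =
      t⁻¹ • (X a 0 * Y 1 j)) ∧
    (∀ a j, Y 1 j * X a 1 =
      (q⁻¹ * t⁻¹) • (X a 1 * Y 1 j) + (-(q * t⁻¹) + q⁻¹ * t⁻¹) • (X a 0 * Y 0 j)) := by
  have h' := fun a b c d => congrFun (congrFun h (a, b)) (c, d)
  simp only [Fin.forall_fin_two, Law.lhs, Law.rhs, scal, rMat, rInv, rMat21, rInv21, leg1, leg2, hq,
    ht, Matrix.mul_apply, Fintype.sum_prod_type, Fin.sum_univ_two] at h'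
  simp [Algebra.algebraMap_eq_smul_one, add_mul, mul_add] at h'
  obtain ⟨⟨⟨⟨e0, e1⟩, e2, e3⟩, ⟨e4, e5⟩, e6, e7⟩, ⟨⟨e8, e9⟩, e10, e11⟩, ⟨e12, e13⟩, e14, e15⟩ := h'
  simp only [Fin.forall_fin_two]
  refine ⟨⟨⟨?_, ?_⟩, ?_, ?_⟩, ⟨⟨?_, ?_⟩, ?_, ?_⟩, ⟨⟨?_, ?_⟩, ?_, ?_⟩, ⟨?_, ?_⟩, ?_, ?_⟩
  on_goal 1 => linear_combination (norm := skip) (1 : k) • e0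
  on_goal 2 => linear_combination (norm := skip) (1 : k) • e2
  on_goal 3 => linear_combination (norm := skip) (1 : k) • e4
  on_goal 4 => linear_combination (norm := skip) (1 : k) • e6
  on_goal 5 => linear_combination (norm := skip) (1 : k) • e1
  on_goal 6 => linear_combination (norm := skip) (1 : k) • e3
  on_goal 7 => linear_combination (norm := skip) (1 : k) • e5
  on_goal 8 => linear_combination (norm := skip) (1 : k) • e7
  on_goal 9 => linear_combination (norm := skip) (1 : k) • e8
  on_goal 10 => linear_combination (norm := skip) (1 : k) • e10
  on_goal 11 => linear_combination (norm := skip) (1 : k) • e12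
  on_goal 12 => linear_combination (norm := skip) (1 : k) • e14
  on_goal 13 => linear_combination (norm := skip) (1 : k) • e9
  on_goal 14 => linear_combination (norm := skip) (1 : k) • e11
  on_goal 15 => linear_combination (norm := skip) (1 : k) • e13
  on_goal 16 => linear_combination (norm := skip) (1 : k) • e15
  all_goals (match_scalars <;> field_simp <;> ring)

end Tables


/-! ### The `q`-determinants commute with all generators up to scalars -/

section Determinants

set_option linter.unusedSimpArgs false
set_option linter.unnecessarySeqFocus false

variable {k : Type*} [Field k] {B : Type*} [Ring B] [Algebra k B]
variable {G : Gauge} {s q t : k} {Y X : Mat2 B}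

theorem det_smash (hq : s ^ 2 = q) (hq0 : q ≠ 0) (ht : rScale G s = t) (ht0 : t ≠ 0)
    (h : Law.lhs G s Y X .smash = Law.rhs G s Y X .smash)
    (hY : Law.lhs G s Y Y .reflection = Law.rhs G s Y Y .reflection)
    (hX : Law.lhs G s X X .reflection = Law.rhs G s X X .reflection) :
    (∀ i j, X i j * qdet (q ^ 2) Y = (q ^ 2 * t ^ 4) • (qdet (q ^ 2) Y * X i j)) ∧
    (∀ i j, qdet (q ^ 2) X * Y i j = (q ^ 2 * t ^ 4) • (Y i j * qdet (q ^ 2) X)) := by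
  have hs := smash_swap hq hq0 ht ht0 h
  have RY := reflection_letters hq hq0 ht ht0 hY
  have RX := reflection_letters hq hq0 ht ht0 hX
  simp only [Fin.forall_fin_two]
  refine ⟨⟨⟨?_, ?_⟩, ?_, ?_⟩, ⟨?_, ?_⟩, ?_, ?_⟩
  iterate 4
    conv_lhs => rw [qdet]
    simp only [← mul_assoc, mul_sub, add_mul, sub_mul, smul_mul_assoc, mul_smul_comm, smul_add,
      smul_sub, hs]
    simp only [mul_assoc, mul_add, mul_sub, smul_mul_assoc, mul_smul_comm, smul_add, smul_sub, hs]
    simp only [← mul_assoc, add_mul, smul_mul_assoc, smul_add, RY.yx, RY.wy, RY.zy, RY.yz, RY.wx,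
      RY.xz, RY.wz]
    match_scalars <;> field_simp <;> ring
  all_goals
    conv_lhs => rw [qdet]
    simp only [mul_assoc, mul_add, sub_mul, smul_mul_assoc, mul_smul_comm, smul_add, smul_sub, hs]
    simp only [← mul_assoc, add_mul, smul_mul_assoc, mul_smul_comm, smul_add, smul_sub, hs]
    simp only [mul_assoc, mul_add, mul_smul_comm, smul_add, RX.yx, RX.wy, RX.zy, RX.yz, RX.wx,
      RX.xz, RX.wz]
    match_scalars <;> field_simp <;> ring

theorem det_smashFrt (hq : s ^ 2 = q) (hq0 : q ≠ 0) (ht : rScale G s = t) (ht0 : t ≠ 0)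
    (h : Law.lhs G s Y X .smashFrt = Law.rhs G s Y X .smashFrt)
    (hY : Law.lhs G s Y Y .frt = Law.rhs G s Y Y .frt)
    (hX : Law.lhs G s X X .reflection = Law.rhs G s X X .reflection) :
    (∀ i j, X i j * qdet q Y = (q⁻¹ ^ 2 * t⁻¹ ^ 4) • (qdet q Y * X i j)) ∧
    (∀ i j, qdet (q ^ 2) X * Y i j = (q⁻¹ ^ 2 * t⁻¹ ^ 4) • (Y i j * qdet (q ^ 2) X)) := by
  have hs := smashFrt_swap hq hq0 ht ht0 h
  have RY := frt_letters hq hq0 ht ht0 hY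
  have RX := reflection_letters hq hq0 ht ht0 hX
  simp only [Fin.forall_fin_two]
  refine ⟨⟨⟨?_, ?_⟩, ?_, ?_⟩, ⟨?_, ?_⟩, ?_, ?_⟩
  iterate 4
    conv_lhs => rw [qdet]
    simp only [← mul_assoc, mul_sub, add_mul, sub_mul, smul_mul_assoc, mul_smul_comm, smul_add,
      smul_sub, hs]
    simp only [mul_assoc, mul_add, mul_sub, smul_mul_assoc, mul_smul_comm, smul_add, smul_sub, hs]
    simp only [← mul_assoc, add_mul, smul_mul_assoc, smul_add, RY.yx, RY.wy, RY.zy, RY.yz, RY.wx,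
      RY.xz, RY.wz]
    match_scalars <;> field_simp <;> ring
  all_goals
    conv_lhs => rw [qdet]
    simp only [mul_assoc, mul_add, sub_mul, smul_mul_assoc, mul_smul_comm, smul_add, smul_sub, hs]
    simp only [← mul_assoc, add_mul, smul_mul_assoc, mul_smul_comm, smul_add, smul_sub, hs]
    simp only [mul_assoc, mul_add, mul_smul_comm, smul_add, RX.yx, RX.wy, RX.zy, RX.yz, RX.wx,
      RX.xz, RX.wz]
    match_scalars <;> field_simp <;> ring

theorem det_braidLoopLoop (hq : s ^ 2 = q) (hq0 : q ≠ 0) (ht : rScale G s = t) (ht0 : t ≠ 0)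
    (h : Law.lhs G s Y X .braidLoopLoop = Law.rhs G s Y X .braidLoopLoop)
    (hY : Law.lhs G s Y Y .reflection = Law.rhs G s Y Y .reflection)
    (hX : Law.lhs G s X X .reflection = Law.rhs G s X X .reflection) :
    (∀ i j, Y i j * qdet (q ^ 2) X = qdet (q ^ 2) X * Y i j) ∧
    (∀ i j, qdet (q ^ 2) Y * X i j = X i j * qdet (q ^ 2) Y) := by
  have hs := braidLoopLoop_yx hq hq0 ht ht0 h
  have RY := reflection_letters hq hq0 ht ht0 hY
  have RX := reflection_letters hq hq0 ht ht0 hX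
  simp only [Fin.forall_fin_two]
  refine ⟨⟨⟨?_, ?_⟩, ?_, ?_⟩, ⟨?_, ?_⟩, ?_, ?_⟩
  iterate 4
    conv_lhs => rw [qdet]
    simp only [← mul_assoc, mul_sub, add_mul, sub_mul, smul_mul_assoc, mul_smul_comm, smul_add,
      smul_sub, hs]
    simp only [mul_assoc, mul_add, mul_sub, smul_mul_assoc, mul_smul_comm, smul_add, smul_sub, hs]
    simp only [← mul_assoc, add_mul, smul_mul_assoc, smul_add, RX.yx, RX.wy, RX.zy, RX.yz, RX.wx,
      RX.xz, RX.wz]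
    match_scalars <;> field_simp <;> ring
  all_goals
    conv_lhs => rw [qdet]
    simp only [mul_assoc, mul_add, sub_mul, smul_mul_assoc, mul_smul_comm, smul_add, smul_sub, hs]
    simp only [← mul_assoc, add_mul, smul_mul_assoc, mul_smul_comm, smul_add, smul_sub, hs]
    simp only [mul_assoc, mul_add, mul_smul_comm, smul_add, RY.yx, RY.wy, RY.zy, RY.yz, RY.wx,
      RY.xz, RY.wz]
    match_scalars <;> field_simp <;> ring

theorem det_braidFrtLoop (hq : s ^ 2 = q) (hq0 : q ≠ 0) (ht : rScale G s = t) (ht0 : t ≠ 0)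
    (h : Law.lhs G s Y X .braidFrtLoop = Law.rhs G s Y X .braidFrtLoop)
    (hY : Law.lhs G s Y Y .frt = Law.rhs G s Y Y .frt)
    (hX : Law.lhs G s X X .reflection = Law.rhs G s X X .reflection) :
    (∀ i j, Y i j * qdet (q ^ 2) X = qdet (q ^ 2) X * Y i j) ∧
    (∀ i j, qdet q Y * X i j = X i j * qdet q Y) := by
  have hs := braidFrtLoop_yx hq hq0 ht ht0 h
  have RY := frt_letters hq hq0 ht ht0 hY
  have RX := reflection_letters hq hq0 ht ht0 hX
  simp only [Fin.forall_fin_two]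
  refine ⟨⟨⟨?_, ?_⟩, ?_, ?_⟩, ⟨?_, ?_⟩, ?_, ?_⟩
  iterate 4
    conv_lhs => rw [qdet]
    simp only [← mul_assoc, mul_sub, add_mul, sub_mul, smul_mul_assoc, mul_smul_comm, smul_add,
      smul_sub, hs]
    simp only [mul_assoc, mul_add, mul_sub, smul_mul_assoc, mul_smul_comm, smul_add, smul_sub, hs]
    simp only [← mul_assoc, add_mul, smul_mul_assoc, smul_add, RX.yx, RX.wy, RX.zy, RX.yz, RX.wx,
      RX.xz, RX.wz]
    match_scalars <;> field_simp <;> ring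
  all_goals
    conv_lhs => rw [qdet]
    simp only [mul_assoc, mul_add, sub_mul, smul_mul_assoc, mul_smul_comm, smul_add, smul_sub, hs]
    simp only [← mul_assoc, add_mul, smul_mul_assoc, mul_smul_comm, smul_add, smul_sub, hs]
    simp only [mul_assoc, mul_add, mul_smul_comm, smul_add, RY.yx, RY.wy, RY.zy, RY.yz, RY.wx,
      RY.xz, RY.wz]
    match_scalars <;> field_simp <;> ring

theorem det_braidLoopFrt (hq : s ^ 2 = q) (hq0 : q ≠ 0) (ht : rScale G s = t) (ht0 : t ≠ 0)
    (h : Law.lhs G s Y X .braidLoopFrt = Law.rhs G s Y X .braidLoopFrt)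
    (hY : Law.lhs G s Y Y .reflection = Law.rhs G s Y Y .reflection)
    (hX : Law.lhs G s X X .frt = Law.rhs G s X X .frt) :
    (∀ i j, Y i j * qdet q X = qdet q X * Y i j) ∧
    (∀ i j, qdet (q ^ 2) Y * X i j = X i j * qdet (q ^ 2) Y) := by
  have hs := braidLoopFrt_yx hq hq0 ht ht0 h
  have RY := reflection_letters hq hq0 ht ht0 hY
  have RX := frt_letters hq hq0 ht ht0 hX
  simp only [Fin.forall_fin_two]
  refine ⟨⟨⟨?_, ?_⟩, ?_, ?_⟩, ⟨?_, ?_⟩, ?_, ?_⟩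
  iterate 4
    conv_lhs => rw [qdet]
    simp only [← mul_assoc, mul_sub, add_mul, sub_mul, smul_mul_assoc, mul_smul_comm, smul_add,
      smul_sub, hs]
    simp only [mul_assoc, mul_add, mul_sub, smul_mul_assoc, mul_smul_comm, smul_add, smul_sub, hs]
    simp only [← mul_assoc, add_mul, smul_mul_assoc, smul_add, RX.yx, RX.wy, RX.zy, RX.yz, RX.wx,
      RX.xz, RX.wz]
    match_scalars <;> field_simp <;> ring
  all_goals
    conv_lhs => rw [qdet]
    simp only [mul_assoc, mul_add, sub_mul, smul_mul_assoc, mul_smul_comm, smul_add, smul_sub, hs]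
    simp only [← mul_assoc, add_mul, smul_mul_assoc, mul_smul_comm, smul_add, smul_sub, hs]
    simp only [mul_assoc, mul_add, mul_smul_comm, smul_add, RY.yx, RY.wy, RY.zy, RY.yz, RY.wx,
      RY.xz, RY.wz]
    match_scalars <;> field_simp <;> ring

theorem det_braidFrtFrt (hq : s ^ 2 = q) (hq0 : q ≠ 0) (ht : rScale G s = t) (ht0 : t ≠ 0)
    (h : Law.lhs G s Y X .braidFrtFrt = Law.rhs G s Y X .braidFrtFrt)
    (hY : Law.lhs G s Y Y .frt = Law.rhs G s Y Y .frt)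
    (hX : Law.lhs G s X X .frt = Law.rhs G s X X .frt) :
    (∀ i j, X i j * qdet q Y = (q⁻¹ * t⁻¹ ^ 2) • (qdet q Y * X i j)) ∧
    (∀ i j, qdet q X * Y i j = (q⁻¹ * t⁻¹ ^ 2) • (Y i j * qdet q X)) := by
  have hs := braidFrtFrt_xy hq hq0 ht ht0 h
  have RY := frt_letters hq hq0 ht ht0 hY
  have RX := frt_letters hq hq0 ht ht0 hX
  simp only [Fin.forall_fin_two]
  refine ⟨⟨⟨?_, ?_⟩, ?_, ?_⟩, ⟨?_, ?_⟩, ?_, ?_⟩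
  iterate 4
    conv_lhs => rw [qdet]
    simp only [← mul_assoc, mul_sub, add_mul, sub_mul, smul_mul_assoc, mul_smul_comm, smul_add,
      smul_sub, hs]
    simp only [mul_assoc, mul_add, mul_sub, smul_mul_assoc, mul_smul_comm, smul_add, smul_sub, hs]
    simp only [← mul_assoc, add_mul, smul_mul_assoc, smul_add, RY.yx, RY.wy, RY.zy, RY.yz, RY.wx,
      RY.xz, RY.wz]
    match_scalars <;> field_simp <;> ring
  all_goals
    conv_lhs => rw [qdet]
    simp only [mul_assoc, mul_add, sub_mul, smul_mul_assoc, mul_smul_comm, smul_add, smul_sub, hs]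
    simp only [← mul_assoc, add_mul, smul_mul_assoc, mul_smul_comm, smul_add, smul_sub, hs]
    simp only [mul_assoc, mul_add, mul_smul_comm, smul_add, RX.yx, RX.wy, RX.zy, RX.yz, RX.wx,
      RX.xz, RX.wz]
    match_scalars <;> field_simp <;> ring

theorem det_endLoop (hq : s ^ 2 = q) (hq0 : q ≠ 0) (ht : rScale G s = t) (ht0 : t ≠ 0)
    (h : Law.lhs G s Y X .endLoop = Law.rhs G s Y X .endLoop)
    (hY : Law.lhs G s Y Y .reflection = Law.rhs G s Y Y .reflection)
    (hX : Law.lhs G s X X .frt = Law.rhs G s X X .frt) :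
    (∀ i j, Y i j * qdet q X = qdet q X * Y i j) ∧
    (∀ i j, qdet (q ^ 2) Y * X i j = X i j * qdet (q ^ 2) Y) := by
  have hs := endLoop_yx hq hq0 ht ht0 h
  have RY := reflection_letters hq hq0 ht ht0 hY
  have RX := frt_letters hq hq0 ht ht0 hX
  simp only [Fin.forall_fin_two]
  refine ⟨⟨⟨?_, ?_⟩, ?_, ?_⟩, ⟨?_, ?_⟩, ?_, ?_⟩
  iterate 4
    conv_lhs => rw [qdet]
    simp only [← mul_assoc, mul_sub, add_mul, sub_mul, smul_mul_assoc, mul_smul_comm, smul_add,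
      smul_sub, hs]
    simp only [mul_assoc, mul_add, mul_sub, smul_mul_assoc, mul_smul_comm, smul_add, smul_sub, hs]
    simp only [← mul_assoc, add_mul, smul_mul_assoc, smul_add, RX.yx, RX.wy, RX.zy, RX.yz, RX.wx,
      RX.xz, RX.wz]
    match_scalars <;> field_simp <;> ring
  all_goals
    conv_lhs => rw [qdet]
    simp only [mul_assoc, mul_add, sub_mul, smul_mul_assoc, mul_smul_comm, smul_add, smul_sub, hs]
    simp only [← mul_assoc, add_mul, smul_mul_assoc, mul_smul_comm, smul_add, smul_sub, hs]
    simp only [mul_assoc, mul_add, mul_smul_comm, smul_add, RY.yx, RY.wy, RY.zy, RY.yz, RY.wx,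
      RY.xz, RY.wz]
    match_scalars <;> field_simp <;> ring

theorem det_endFrt (hq : s ^ 2 = q) (hq0 : q ≠ 0) (ht : rScale G s = t) (ht0 : t ≠ 0)
    (h : Law.lhs G s Y X .endFrt = Law.rhs G s Y X .endFrt)
    (hY : Law.lhs G s Y Y .frt = Law.rhs G s Y Y .frt)
    (hX : Law.lhs G s X X .frt = Law.rhs G s X X .frt) :
    (∀ i j, Y i j * qdet q X = (q⁻¹ * t⁻¹ ^ 2) • (qdet q X * Y i j)) ∧
    (∀ i j, qdet q Y * X i j = (q⁻¹ * t⁻¹ ^ 2) • (X i j * qdet q Y)) := by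
  have hs := endFrt_yx hq hq0 ht ht0 h
  have RY := frt_letters hq hq0 ht ht0 hY
  have RX := frt_letters hq hq0 ht ht0 hX
  simp only [Fin.forall_fin_two]
  refine ⟨⟨⟨?_, ?_⟩, ?_, ?_⟩, ⟨?_, ?_⟩, ?_, ?_⟩
  iterate 4
    conv_lhs => rw [qdet]
    simp only [← mul_assoc, mul_sub, add_mul, sub_mul, smul_mul_assoc, mul_smul_comm, smul_add,
      smul_sub, hs]
    simp only [mul_assoc, mul_add, mul_sub, smul_mul_assoc, mul_smul_comm, smul_add, smul_sub, hs]
    simp only [← mul_assoc, add_mul, smul_mul_assoc, smul_add, RX.yx, RX.wy, RX.zy, RX.yz, RX.wx,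
      RX.xz, RX.wz]
    match_scalars <;> field_simp <;> ring
  all_goals
    conv_lhs => rw [qdet]
    simp only [mul_assoc, mul_add, sub_mul, smul_mul_assoc, mul_smul_comm, smul_add, smul_sub, hs]
    simp only [← mul_assoc, add_mul, smul_mul_assoc, mul_smul_comm, smul_add, smul_sub, hs]
    simp only [mul_assoc, mul_add, mul_smul_comm, smul_add, RY.yx, RY.wy, RY.zy, RY.yz, RY.wx,
      RY.xz, RY.wz]
    match_scalars <;> field_simp <;> ring

end Determinants


/-! ### Algebras whose generators commute up to scalars and terms of lower weight -/

section Weights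

variable {k A ι : Type*} [Field k] [Ring A] [Algebra k A] (x : ι → A) (wt : ι → ℕ)

/-- The span of the words in the generators `x i` whose weight is less than `n`. -/
def wordsBelow (n : ℕ) : Submodule k A :=
  Submodule.span k {a | ∃ l : List ι, (l.map wt).sum < n ∧ (l.map x).prod = a}

variable {x wt}

theorem word_mem_wordsBelow {n : ℕ} (l : List ι) (h : (l.map wt).sum < n) :
    (l.map x).prod ∈ wordsBelow (k := k) x wt n :=
  Submodule.subset_span ⟨l, h, rfl⟩

theorem word_mul_mem_wordsBelow {n : ℕ} (l : List ι) {a : A}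
    (ha : a ∈ wordsBelow (k := k) x wt n) :
    (l.map x).prod * a ∈ wordsBelow (k := k) x wt ((l.map wt).sum + n) := by
  induction ha using Submodule.span_induction with
  | mem a h =>
    obtain ⟨l', hl', rfl⟩ := h
    rw [← List.prod_append, ← List.map_append]
    exact word_mem_wordsBelow _ (by simpa using hl')
  | zero => simp
  | add a b _ _ ha hb => rw [mul_add]; exact add_mem ha hb
  | smul c a _ ha => rw [mul_smul_comm]; exact Submodule.smul_mem _ _ ha

theorem mem_wordsBelow_mul_word {n : ℕ} (l : List ι) {a : A}
    (ha : a ∈ wordsBelow (k := k) x wt n) :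
    a * (l.map x).prod ∈ wordsBelow (k := k) x wt (n + (l.map wt).sum) := by
  induction ha using Submodule.span_induction with
  | mem a h =>
    obtain ⟨l', hl', rfl⟩ := h
    rw [← List.prod_append, ← List.map_append]
    exact word_mem_wordsBelow _ (by simpa using hl')
  | zero => simp
  | add a b _ _ ha hb => rw [add_mul]; exact add_mem ha hb
  | smul c a _ ha => rw [smul_mul_assoc]; exact Submodule.smul_mem _ _ ha

variable (k x wt) in
/-- Any two generators commute up to a nonzero scalar and terms of lower weight. -/
def QuasiCommute : Prop :=
  ∀ i j, ∃ c : k, c ≠ 0 ∧ x i * x j - c • (x j * x i) ∈ wordsBelow (k := k) x wt (wt i + wt j)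

/-- Permuting the letters changes a word by a nonzero scalar and terms of lower weight. -/
theorem QuasiCommute.perm (h : QuasiCommute k x wt) {l l' : List ι} (p : l.Perm l') :
    ∃ c : k, c ≠ 0 ∧
      (l.map x).prod - c • (l'.map x).prod ∈ wordsBelow (k := k) x wt (l.map wt).sum := by
  induction p with
  | nil => exact ⟨1, one_ne_zero, by simp⟩
  | cons i _ ih =>
    obtain ⟨c, hc, ih⟩ := ih
    refine ⟨c, hc, ?_⟩
    have := word_mul_mem_wordsBelow [i] ih
    simpa [mul_sub] using this
  | swap i j l =>
    obtain ⟨c, hc, ih⟩ := h j i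
    refine ⟨c, hc, ?_⟩
    have := mem_wordsBelow_mul_word l ih
    simpa [sub_mul, mul_assoc, add_assoc] using this
  | trans p₁ _ ih₁ ih₂ =>
    obtain ⟨c₁, hc₁, h₁⟩ := ih₁
    obtain ⟨c₂, hc₂, h₂⟩ := ih₂
    refine ⟨c₁ * c₂, mul_ne_zero hc₁ hc₂, ?_⟩
    rw [← (p₁.map wt).sum_eq] at h₂
    have := add_mem h₁ (Submodule.smul_mem _ c₁ h₂)
    rwa [smul_sub, smul_smul, sub_add_sub_cancel] at this

variable (x wt) in
/-- The ordered monomial with a given exponent; the order of the letters is an arbitrary one. -/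
def monom (α : ι →₀ ℕ) : A := ((Finsupp.toMultiset α).toList.map x).prod

variable (wt) in
/-- The weight of an exponent. -/
def expWeight (α : ι →₀ ℕ) : ℕ := ((Finsupp.toMultiset α).map wt).sum

theorem expWeight_eq (α : ι →₀ ℕ) :
    expWeight wt α = ((Finsupp.toMultiset α).toList.map wt).sum := by
  rw [expWeight, ← Multiset.sum_coe, ← Multiset.map_coe, Multiset.coe_toList]

theorem expWeight_add (α β : ι →₀ ℕ) :
    expWeight wt (α + β) = expWeight wt α + expWeight wt β := by
  simp [expWeight]

variable (m : MonomialOrder ι)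

variable (wt) in
/-- Exponents are compared by weight first, and then by a monomial order. -/
def expKey (α : ι →₀ ℕ) : ℕ ×ₗ m.syn := toLex (expWeight wt α, m.toSyn α)

theorem expKey_lt {α β : ι →₀ ℕ} : expKey wt m α < expKey wt m β ↔
    expWeight wt α < expWeight wt β ∨
      expWeight wt α = expWeight wt β ∧ m.toSyn α < m.toSyn β :=
  Prod.Lex.lt_iff

theorem expKey_injective : Function.Injective (expKey wt m) := fun α β h => by
  have := congrArg (fun z => (ofLex z).2) h
  exact m.toSyn.injective this

theorem expKey_add_lt (γ : ι →₀ ℕ) {α β : ι →₀ ℕ} (h : expKey wt m α < expKey wt m β) :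
    expKey wt m (γ + α) < expKey wt m (γ + β) := by
  rw [expKey_lt] at h ⊢
  simpa [expWeight_add] using h

variable (k x wt) in
/-- The span of the ordered monomials below a given exponent. -/
def monomsBelow (α : ι →₀ ℕ) : Submodule k A :=
  Submodule.span k (monom x '' {β | expKey wt m β < expKey wt m α})

theorem monom_mem_monomsBelow {α β : ι →₀ ℕ} (h : expKey wt m β < expKey wt m α) :
    monom x β ∈ monomsBelow k x wt m α :=
  Submodule.subset_span ⟨β, h, rfl⟩

theorem monomsBelow_mono {α β : ι →₀ ℕ} (h : expKey wt m β ≤ expKey wt m α) :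
    monomsBelow k x wt m β ≤ monomsBelow k x wt m α :=
  Submodule.span_mono (Set.image_mono fun _ hγ => lt_of_lt_of_le hγ h)

/-- A word is a nonzero multiple of an ordered monomial, up to terms of lower weight. -/
theorem QuasiCommute.word [DecidableEq ι] (h : QuasiCommute k x wt) (l : List ι) :
    ∃ c : k, c ≠ 0 ∧ (l.map x).prod - c • monom x (Multiset.toFinsupp (l : Multiset ι)) ∈
      wordsBelow (k := k) x wt (l.map wt).sum := by
  apply h.perm
  rw [← Multiset.coe_eq_coe]
  simp

theorem expWeight_toFinsupp [DecidableEq ι] (l : List ι) :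
    expWeight wt (Multiset.toFinsupp (l : Multiset ι)) = (l.map wt).sum := by
  simp [expWeight]

/-- Words of weight below `n` are combinations of ordered monomials of weight below `n`. -/
theorem QuasiCommute.wordsBelow_le (h : QuasiCommute k x wt) (n : ℕ) :
    wordsBelow (k := k) x wt n ≤ Submodule.span k (monom x '' {β | expWeight wt β < n}) := by
  classical
  induction n using Nat.strong_induction_on with
  | _ n ih =>
    rw [wordsBelow, Submodule.span_le]
    rintro _ ⟨l, hl, rfl⟩
    obtain ⟨c, -, hc⟩ := h.word l
    have h1 := Submodule.span_mono
      (Set.image_mono (f := monom x) (fun β (hβ : expWeight wt β < _) => hβ.trans hl))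
      (ih _ hl hc)
    have h2 : monom x (Multiset.toFinsupp (l : Multiset ι)) ∈
        Submodule.span k (monom x '' {β | expWeight wt β < n}) :=
      Submodule.subset_span ⟨_, by simpa [expWeight_toFinsupp] using hl, rfl⟩
    have := add_mem h1 (Submodule.smul_mem _ c h2)
    rwa [sub_add_cancel] at this

theorem QuasiCommute.wordsBelow_le_monomsBelow (h : QuasiCommute k x wt) (α : ι →₀ ℕ) :
    wordsBelow (k := k) x wt (expWeight wt α) ≤ monomsBelow k x wt m α :=
  (h.wordsBelow_le _).trans (Submodule.span_mono (Set.image_mono fun _ hβ =>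
    (expKey_lt m).2 (Or.inl hβ)))

theorem QuasiCommute.monom_mul (h : QuasiCommute k x wt) (γ α : ι →₀ ℕ) :
    ∃ c : k, c ≠ 0 ∧ monom x γ * monom x α - c • monom x (γ + α) ∈
      monomsBelow k x wt m (γ + α) := by
  classical
  obtain ⟨c, hc, hm⟩ := h.word
    ((Finsupp.toMultiset γ).toList ++ (Finsupp.toMultiset α).toList)
  refine ⟨c, hc, h.wordsBelow_le_monomsBelow m _ ?_⟩
  rw [expWeight_add, expWeight_eq, expWeight_eq]
  rw [← Multiset.coe_add] at hm
  simpa [monom] using hm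

theorem QuasiCommute.monom_mul_mem (h : QuasiCommute k x wt) (γ α : ι →₀ ℕ) {a : A}
    (ha : a ∈ monomsBelow k x wt m α) : monom x γ * a ∈ monomsBelow k x wt m (γ + α) := by
  induction ha using Submodule.span_induction with
  | mem a ha =>
    obtain ⟨β, hβ, rfl⟩ := ha
    have hlt := expKey_add_lt m γ hβ
    obtain ⟨c, -, hc⟩ := h.monom_mul m γ β
    have := add_mem (monomsBelow_mono m hlt.le hc)
      (Submodule.smul_mem _ c (monom_mem_monomsBelow m hlt))
    rwa [sub_add_cancel] at this
  | zero => simp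
  | add a b _ _ ha hb => rw [mul_add]; exact add_mem ha hb
  | smul c a _ ha => rw [mul_smul_comm]; exact Submodule.smul_mem _ _ ha

theorem smul_mem_leftIdeal (I : Submodule A A) (c : k) {a : A} (ha : a ∈ I) : c • a ∈ I := by
  rw [← algebraMap_smul A c a]
  exact I.smul_mem _ ha

variable (k x wt) in
/-- The leading exponents of the elements of a left ideal. -/
def leadExps (I : Submodule A A) : Set (ι →₀ ℕ) :=
  {α | ∃ a ∈ I, a - monom x α ∈ monomsBelow k x wt m α}

/-- The leading exponents of a left ideal form an upper set: multiplying by a monomial shifts the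
leading exponent. -/
theorem QuasiCommute.leadExps_upper (h : QuasiCommute k x wt) (I : Submodule A A)
    {α β : ι →₀ ℕ} (hα : α ∈ leadExps k x wt m I) (hle : α ≤ β) :
    β ∈ leadExps k x wt m I := by
  obtain ⟨γ, rfl⟩ := exists_add_of_le hle
  rw [add_comm]
  obtain ⟨a, ha, hm⟩ := hα
  obtain ⟨c, hc, hm'⟩ := h.monom_mul m γ α
  refine ⟨c⁻¹ • (monom x γ * a), smul_mem_leftIdeal I _ (I.smul_mem _ ha), ?_⟩
  have := Submodule.smul_mem _ c⁻¹ (add_mem (h.monom_mul_mem m γ α hm) hm')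
  rwa [mul_sub, sub_add_sub_cancel, smul_sub, inv_smul_smul₀ hc] at this

theorem leadExps_mono {I J : Submodule A A} (h : I ≤ J) :
    leadExps k x wt m I ⊆ leadExps k x wt m J :=
  fun _ ⟨a, ha, hm⟩ => ⟨a, h ha, hm⟩

/-- A linear combination of monomials below `α` vanishes or has a leading monomial. -/
theorem exists_lead_of_mem_monomsBelow {α : ι →₀ ℕ} {a : A}
    (ha : a ∈ monomsBelow k x wt m α) :
    a = 0 ∨ ∃ β, expKey wt m β < expKey wt m α ∧ ∃ c : k,
      a - c • monom x β ∈ monomsBelow k x wt m β := by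
  induction ha using Submodule.span_induction with
  | mem a ha =>
    obtain ⟨β, hβ, rfl⟩ := ha
    exact Or.inr ⟨β, hβ, 1, by simp⟩
  | zero => exact Or.inl rfl
  | add a b _ _ ha hb =>
    rcases ha with rfl | ⟨β, hβ, c, hc⟩
    · simpa using hb
    rcases hb with rfl | ⟨γ, hγ, d, hd⟩
    · exact Or.inr ⟨β, hβ, c, by simpa using hc⟩
    right
    rcases lt_trichotomy (expKey wt m β) (expKey wt m γ) with hlt | heq | hlt
    · refine ⟨γ, hγ, d, ?_⟩
      have := add_mem (add_mem (monomsBelow_mono m hlt.le hc)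
        (Submodule.smul_mem _ c (monom_mem_monomsBelow m hlt))) hd
      rwa [sub_add_cancel, ← add_sub_assoc] at this
    · obtain rfl := expKey_injective m heq
      refine ⟨β, hβ, c + d, ?_⟩
      have := add_mem hc hd
      rwa [sub_add_sub_comm, ← add_smul] at this
    · refine ⟨β, hβ, c, ?_⟩
      have := add_mem (add_mem (monomsBelow_mono m hlt.le hd)
        (Submodule.smul_mem _ d (monom_mem_monomsBelow m hlt))) hc
      rwa [sub_add_cancel, ← add_sub_assoc, add_comm b a] at this
  | smul c a _ ha =>
    rcases ha with rfl | ⟨β, hβ, d, hd⟩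
    · exact Or.inl (smul_zero _)
    · refine Or.inr ⟨β, hβ, c * d, ?_⟩
      rw [mul_smul, ← smul_sub]
      exact Submodule.smul_mem _ _ hd

/-- Nested left ideals with the same leading exponents are equal. -/
theorem QuasiCommute.le_of_leadExps (hspan : ∀ a : A, ∃ α, a ∈ monomsBelow k x wt m α)
    {I J : Submodule A A} (hIJ : I ≤ J)
    (hE : leadExps k x wt m J ⊆ leadExps k x wt m I) : J ≤ I := by
  have key : ∀ κ : ℕ ×ₗ m.syn, ∀ α, expKey wt m α = κ →
      ∀ a ∈ J, a ∈ monomsBelow k x wt m α → a ∈ I := by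
    intro κ
    induction κ using WellFoundedLT.induction with
    | _ κ ih =>
      rintro α rfl a haJ ha
      rcases exists_lead_of_mem_monomsBelow m ha with rfl | ⟨β, hβ, c, hc⟩
      · exact I.zero_mem
      by_cases h0 : c = 0
      · subst h0
        exact ih _ hβ β rfl a haJ (by simpa using hc)
      obtain ⟨b, hbI, hb⟩ : β ∈ leadExps k x wt m I := by
        refine hE ⟨c⁻¹ • a, smul_mem_leftIdeal J _ haJ, ?_⟩
        have := Submodule.smul_mem _ c⁻¹ hc
        rwa [smul_sub, inv_smul_smul₀ h0] at this
      have hcb := smul_mem_leftIdeal I c hbI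
      have := ih _ hβ β rfl (a - c • b) (sub_mem haJ (hIJ hcb)) (by
        have := sub_mem hc (Submodule.smul_mem _ c hb)
        rwa [smul_sub, sub_sub_sub_cancel_right] at this)
      have := add_mem this hcb
      rwa [sub_add_cancel] at this
  intro a ha
  obtain ⟨α, hα⟩ := hspan a
  exact key _ α rfl a ha hα

/-- A noncommutative Hilbert basis theorem: leading exponents form upper sets of `ℕⁿ`, which
satisfy the ascending chain condition by Dickson's lemma. -/
theorem QuasiCommute.isNoetherianRing [Finite ι] (h : QuasiCommute k x wt)
    (hgen : Algebra.adjoin k (Set.range x) = ⊤) : IsNoetherianRing A := by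
  rcases isEmpty_or_nonempty ι with hι | ⟨⟨i₀⟩⟩
  · have hk : Function.Surjective (algebraMap k A) := fun a => by
      have : a ∈ Algebra.adjoin k (Set.range x) := hgen ▸ Algebra.mem_top
      rw [Set.range_eq_empty, Algebra.adjoin_empty] at this
      exact this
    exact isNoetherianRing_of_surjective k A (algebraMap k A) hk
  have : Fintype ι := Fintype.ofFinite ι
  let _ : LinearOrder ι := LinearOrder.lift' (Fintype.equivFin ι) (Fintype.equivFin ι).injective
  let m : MonomialOrder ι := MonomialOrder.lex
  have hspan : ∀ a : A, ∃ α, a ∈ monomsBelow k x wt m α := by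
    intro a
    have ha : a ∈ Submodule.span k (Submonoid.closure (Set.range x) : Set A) := by
      rw [← Algebra.adjoin_eq_span, hgen]; exact Submodule.mem_top
    induction ha using Submodule.span_induction with
    | mem a ha =>
      obtain ⟨l, rfl⟩ : ∃ l : List ι, (l.map x).prod = a := by
        obtain ⟨l, hl, rfl⟩ := Submonoid.exists_list_of_mem_closure ha
        have : l ∈ Set.range (List.map x) := by rw [Set.range_list_map]; exact hl
        obtain ⟨l', rfl⟩ := this
        exact ⟨l', rfl⟩
      obtain ⟨c, -, hc⟩ := h.word l
      set α := Multiset.toFinsupp (l : Multiset ι) with hα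
      have hlt : expKey wt m α < expKey wt m (α + Finsupp.single i₀ 1) := by
        have : m.toSyn α < m.toSyn (α + Finsupp.single i₀ 1) := by
          apply m.toSyn_strictMono
          exact lt_add_of_pos_right _ (by simp [pos_iff_ne_zero])
        rw [expKey_lt, expWeight_add]
        rcases Nat.eq_zero_or_pos (expWeight wt (Finsupp.single i₀ 1)) with h0 | h0
        · exact Or.inr ⟨by rw [h0, add_zero], this⟩
        · exact Or.inl (Nat.lt_add_of_pos_right h0)
      refine ⟨α + Finsupp.single i₀ 1, ?_⟩
      have h1 := monomsBelow_mono m hlt.le (h.wordsBelow_le_monomsBelow m α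
        (by rw [hα, expWeight_toFinsupp]; exact hc))
      have := add_mem h1 (Submodule.smul_mem _ c (monom_mem_monomsBelow m hlt))
      rwa [sub_add_cancel] at this
    | zero => exact ⟨0, zero_mem _⟩
    | add a b _ _ ha hb =>
      obtain ⟨α, hα⟩ := ha
      obtain ⟨β, hβ⟩ := hb
      rcases le_total (expKey wt m α) (expKey wt m β) with hle | hle
      · exact ⟨β, add_mem (monomsBelow_mono m hle hα) hβ⟩
      · exact ⟨α, add_mem hα (monomsBelow_mono m hle hβ)⟩
    | smul c a _ ha =>
      obtain ⟨α, hα⟩ := ha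
      exact ⟨α, Submodule.smul_mem _ _ hα⟩
  have hwf : WellFoundedGT (Submodule A A) := by
    rw [WellFoundedGT, isWellFounded_iff, RelEmbedding.wellFounded_iff_isEmpty]
    refine ⟨fun f => ?_⟩
    have hlt : ∀ i j, i < j → f i < f j := fun i j hij => f.map_rel_iff.2 hij
    have hex : ∀ i, ∃ α, α ∈ leadExps k x wt m (f (i + 1)) ∧ α ∉ leadExps k x wt m (f i) := by
      intro i
      by_contra hcon
      push Not at hcon
      exact (hlt i (i + 1) i.lt_succ_self).not_ge
        (QuasiCommute.le_of_leadExps m hspan (hlt i (i + 1) i.lt_succ_self).le hcon)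
    choose α h1 h2 using hex
    obtain ⟨i, j, hij, hle⟩ := wellQuasiOrdered_le α
    refine h2 j (h.leadExps_upper m _ (leadExps_mono m ?_ (h1 i)) hle)
    rcases Nat.lt_or_eq_of_le (Nat.succ_le_of_lt hij) with hlt' | heq
    · exact (hlt _ _ hlt').le
    · exact (congrArg f heq).le
  exact isNoetherian_iff'.2 hwf

end Weights


/-! ### Growth and Gelfand-Kirillov dimension -/

section Growth

set_option linter.unusedSectionVars false

variable {k A M N : Type*} [Field k] [Ring A] [Algebra k A]
  [AddCommGroup M] [Module k M] [Module A M] [IsScalarTower k A M]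
  [AddCommGroup N] [Module k N] [Module A N] [IsScalarTower k A N]

theorem fg_of_le {V W : Submodule k M} (hW : W.FG) (h : V ≤ W) : V.FG := by
  have : FiniteDimensional k W := Module.Finite.iff_fg.2 hW
  exact Module.Finite.iff_fg.1 (Submodule.finiteDimensional_of_le h)

theorem fg_smul {V : Submodule k A} {U : Submodule k M} (hV : V.FG) (hU : U.FG) :
    (V • U).FG := by
  refine fg_of_le (hV.map₂ (Algebra.lsmul k k M).toLinearMap hU) ?_
  exact Submodule.smul_le.2 fun a ha u hu =>
    Submodule.apply_mem_map₂ (Algebra.lsmul k k M).toLinearMap ha hu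

theorem growth_eq (V : Submodule k A) (U : Submodule k M) (n : ℕ) :
    growth V U n = Module.finrank k ((1 ⊔ V) ^ n • U : Submodule k M) := by
  have h : Submodule.span k {x : M | ∃ a ∈ (1 ⊔ V) ^ n, ∃ w ∈ U, x = a • w} =
      (1 ⊔ V) ^ n • U := by
    refine le_antisymm (Submodule.span_le.2 ?_) (Submodule.smul_le.2 fun a ha u hu =>
      Submodule.subset_span ⟨a, ha, u, hu, rfl⟩)
    rintro _ ⟨a, ha, u, hu, rfl⟩
    exact Submodule.smul_mem_smul ha hu
  rw [growth, h]

theorem fg_one_sup_pow {V : Submodule k A} (hV : V.FG) (n : ℕ) : ((1 ⊔ V) ^ n).FG :=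
  (Submodule.FG.sup ⟨{1}, by simp [Submodule.one_eq_span]⟩ hV).pow n

theorem finrank_le_of_le {V W : Submodule k M} (hW : W.FG) (h : V ≤ W) :
    Module.finrank k V ≤ Module.finrank k W := by
  have : FiniteDimensional k W := Module.Finite.iff_fg.2 hW
  exact Submodule.finrank_mono h

theorem growth_map (f : N →ₗ[A] M) (hf : Function.Injective f) (V : Submodule k A)
    (U : Submodule k N) (n : ℕ) :
    growth V (U.map (f.restrictScalars k)) n = growth V U n := by
  rw [growth_eq, growth_eq]
  have h : (1 ⊔ V) ^ n • U.map (f.restrictScalars k) =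
      ((1 ⊔ V) ^ n • U).map (f.restrictScalars k) := by
    refine le_antisymm (Submodule.smul_le.2 ?_) (Submodule.map_le_iff_le_comap.2
      (Submodule.smul_le.2 ?_))
    · rintro a ha _ ⟨u, hu, rfl⟩
      exact ⟨a • u, Submodule.smul_mem_smul ha hu, f.map_smul a u⟩
    · intro a ha u hu
      refine (congrArg (· ∈ (1 ⊔ V) ^ n • U.map (f.restrictScalars k)) (f.map_smul a u)).mpr ?_
      exact Submodule.smul_mem_smul ha ⟨u, hu, rfl⟩
  rw [h]
  exact (LinearEquiv.finrank_eq (Submodule.equivMapOfInjective (f.restrictScalars k) hf _)).symm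

variable (k A M) in
/-- The growth of the module is bounded by a polynomial of degree `d`. -/
def GrowthBound (d : ℝ≥0) : Prop :=
  ∀ (V : Submodule k A) (W : Submodule k M), V.FG → W.FG →
    ∃ c : ℝ, ∀ n : ℕ, 1 ≤ n → (growth V W n : ℝ) ≤ c * (n : ℝ) ^ (d : ℝ)

theorem gkDim_le {d : ℝ≥0} (h : GrowthBound k A M d) : gkDim k A M ≤ d :=
  iInf₂_le (f := fun (d : ℝ≥0) (_ : GrowthBound k A M d) => (d : ℝ≥0∞)) d h

theorem le_gkDim {x : ℝ≥0∞} (h : ∀ d : ℝ≥0, GrowthBound k A M d → x ≤ d) : x ≤ gkDim k A M :=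
  le_iInf₂ (f := fun (d : ℝ≥0) (_ : GrowthBound k A M d) => (d : ℝ≥0∞)) h

theorem GrowthBound.of_injective {d : ℝ≥0} (h : GrowthBound k A M d) (f : N →ₗ[A] M)
    (hf : Function.Injective f) : GrowthBound k A N d := by
  intro V U hV hU
  obtain ⟨c, hc⟩ := h V (U.map (f.restrictScalars k)) hV (hU.map _)
  exact ⟨c, fun n hn => by rw [← growth_map f hf]; exact hc n hn⟩

theorem gkDim_le_of_injective (f : N →ₗ[A] M) (hf : Function.Injective f) :
    gkDim k A N ≤ gkDim k A M :=
  le_gkDim fun _ hd => gkDim_le (hd.of_injective f hf)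

theorem gkDim_congr (f : N ≃ₗ[A] M) : gkDim k A N = gkDim k A M :=
  le_antisymm (gkDim_le_of_injective f.toLinearMap f.injective)
    (gkDim_le_of_injective f.symm.toLinearMap f.symm.injective)

theorem gkDim_of_subsingleton [Subsingleton M] : gkDim k A M = 0 := by
  refine le_antisymm ?_ bot_le
  refine (gkDim_le (d := 0) fun V U _ _ => ⟨0, fun n _ => ?_⟩).trans (by simp)
  rw [growth_eq, Subsingleton.elim ((1 ⊔ V) ^ n • U) ⊥]
  simp

variable {A' : Type*} [Ring A'] [Algebra k A'] (φ : A' →ₐ[k] A)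

/-- The growth of the restricted module is that of the module over the image of `φ`. -/
theorem growth_restrict (V : Submodule k A') (U : Submodule k M) (n : ℕ) :
    growth (M := Restrict φ M) V U n = growth (V.map φ.toLinearMap) U n := by
  have h : (1 ⊔ V.map φ.toLinearMap) ^ n = ((1 ⊔ V) ^ n).map φ.toLinearMap := by
    rw [Submodule.map_pow, Submodule.map_sup, Submodule.map_one]
  have hset : {x : Restrict φ M | ∃ a ∈ (1 ⊔ V) ^ n, ∃ w ∈ U, x = a • (show Restrict φ M from w)} =
      {x : M | ∃ a ∈ (1 ⊔ V.map φ.toLinearMap) ^ n, ∃ w ∈ U, x = a • w} := by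
    ext x
    constructor
    · rintro ⟨a, ha, w, hw, rfl⟩
      exact ⟨φ a, h ▸ ⟨a, ha, rfl⟩, w, hw, rfl⟩
    · rintro ⟨_, ha, w, hw, rfl⟩
      rw [h] at ha
      obtain ⟨a, ha, rfl⟩ := ha
      exact ⟨a, ha, w, hw, rfl⟩
  exact congrArg (fun t : Set M => Module.finrank k (Submodule.span k t)) hset

end Growth


/-! ### Modules generated by a free family of monomials over a subspace -/

section Frames

set_option linter.unusedSectionVars false

variable {k A A' O M : Type*} [Field k] [Ring A] [Algebra k A] [Ring A'] [Algebra k A']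
  [Ring O] [Algebra k O] [AddCommGroup M] [Module k M] [Module A M] [IsScalarTower k A M]

theorem one_smul_submodule (U : Submodule k M) : (1 : Submodule k A) • U = U := by
  refine le_antisymm (Submodule.smul_le.2 ?_) fun u hu => ?_
  · intro a ha u hu
    obtain ⟨c, rfl⟩ := Submodule.mem_one.1 ha
    rw [algebraMap_smul]
    exact Submodule.smul_mem _ c hu
  · rw [← one_smul A u]
    exact Submodule.smul_mem_smul (Submodule.one_le.1 le_rfl) hu

theorem mul_smul_submodule (I J : Submodule k A) (U : Submodule k M) :
    (I * J) • U = I • J • U := Submodule.smul_assoc I J U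

/-- The situation of Kashiwara's theorem: `N` is a subspace of the `A`-module `M`, stable under
`A'`, over which the elements `β i` of `O` are linearly independent, where the `β i` with
`i ∈ S n` are, up to rescaling `n`, a basis of the filtration by the powers of a generating
space `W` of `O`, whose dimension grows like `n ^ d`. Every element `a` of `A` can be moved past
the powers of `W`: modulo larger powers of `W` it acts on `N` through `A'`. -/
structure Frame (φ : A' →ₐ[k] A) (ψ : O →ₐ[k] A) (N : Submodule k M) (d : ℕ) where
  W : Submodule k O
  one_le : 1 ≤ W
  fg : W.FG
  exhaust : ∀ b, ∃ n, b ∈ W ^ n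
  I : Type
  β : I → O
  S : ℕ → Finset I
  bound : ℕ
  pow_le : ∀ n, W ^ n ≤ Submodule.span k (β '' S (2 * n))
  mem_pow : ∀ n, ∀ i ∈ S n, β i ∈ W ^ n
  card_le : ∀ n, (S n).card ≤ bound * (n + 1) ^ d
  le_card : ∀ n, n ^ d ≤ bound * (S n).card
  base : I
  β_base : β base = 1
  stable : ∀ a, ∀ m ∈ N, φ a • m ∈ N
  mem_base : ∃ n, base ∈ S n
  indep : ∀ f : I →₀ M, (∀ i ∈ f.support, ∃ n, i ∈ S n) → (∀ i, f i ∈ N) →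
    (f.sum fun i m => ψ (β i) • m) = 0 → f = 0
  act : ∀ a : A, ∃ l, ∃ V : Submodule k A', V.FG ∧ ∀ (n : ℕ) (U : Submodule k M), U ≤ N →
    ∀ x ∈ (W.map ψ.toLinearMap) ^ n • U,
      a • x ∈ (W.map ψ.toLinearMap) ^ (n + l) • V.map φ.toLinearMap • U

namespace Frame

variable {φ : A' →ₐ[k] A} {ψ : O →ₐ[k] A} {N : Submodule k M} {d : ℕ} (F : Frame φ ψ N d)

/-- The image of the generating space in `A`. -/
abbrev WA : Submodule k A := F.W.map ψ.toLinearMap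

theorem one_le_WA : 1 ≤ F.WA := by
  exact (Submodule.map_one (f := ψ)).symm.le.trans (Submodule.map_mono F.one_le)

theorem WA_pow (n : ℕ) : F.WA ^ n = (F.W ^ n).map ψ.toLinearMap := (Submodule.map_pow _ _ _).symm

theorem WA_mono {m n : ℕ} (h : m ≤ n) : F.WA ^ m ≤ F.WA ^ n :=
  pow_le_pow_right₀ F.one_le_WA h

theorem fg_WA : F.WA.FG := F.fg.map _

/-- The map `(m_i) ↦ ∑ β i m_i`, on families indexed by `S n`. -/
def comb (U : Submodule k M) (n : ℕ) : (F.S n → U) →ₗ[k] M where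
  toFun f := ∑ i : F.S n, ψ (F.β i) • (f i : M)
  map_add' f g := by simp [smul_add, Finset.sum_add_distrib]
  map_smul' c f := by
    rw [RingHom.id_apply, Finset.smul_sum]
    refine Finset.sum_congr rfl fun i _ => ?_
    rw [Pi.smul_apply, Submodule.coe_smul]
    exact ((Algebra.lsmul k k M (ψ (F.β i))).map_smul c _)

theorem smul_le_range_comb (U : Submodule k M) (n : ℕ) :
    F.WA ^ n • U ≤ LinearMap.range (F.comb U (2 * n)) := by
  classical
  rw [WA_pow]
  refine (Submodule.smul_mono_left (Submodule.map_mono (F.pow_le n))).trans ?_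
  refine Submodule.smul_le.2 ?_
  rintro _ ⟨b, hb, rfl⟩ u hu
  change ψ b • u ∈ _
  induction hb using Submodule.span_induction with
  | mem b hb =>
    obtain ⟨i, hi, rfl⟩ := hb
    refine ⟨Pi.single ⟨i, hi⟩ ⟨u, hu⟩, ?_⟩
    change ∑ j, _ = _
    rw [Finset.sum_eq_single ⟨i, hi⟩]
    · simp
    · intro j _ hj
      simp [Pi.single_eq_of_ne hj]
    · simp
  | zero => simp
  | add b c _ _ hb hc => rw [map_add, add_smul]; exact add_mem hb hc
  | smul c b _ hb =>
    rw [map_smul, smul_assoc]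
    exact Submodule.smul_mem _ c hb

theorem range_comb_le (U : Submodule k M) (n : ℕ) :
    LinearMap.range (F.comb U n) ≤ F.WA ^ n • U := by
  rintro _ ⟨f, rfl⟩
  refine sum_mem fun i _ => Submodule.smul_mem_smul ?_ (f i).2
  rw [WA_pow]
  exact ⟨_, F.mem_pow n i i.2, rfl⟩

theorem comb_injective {U : Submodule k M} (hU : U ≤ N) (n : ℕ) :
    Function.Injective (F.comb U n) := by
  classical
  rw [injective_iff_map_eq_zero]
  intro f hf
  let g : F.I →₀ M := Finsupp.onFinset (F.S n)
    (fun i => if h : i ∈ F.S n then (f ⟨i, h⟩ : M) else 0) (fun i hi => by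
      by_contra h
      simp [h] at hi)
  have hg : g = 0 := by
    apply F.indep
    · exact fun i hi => ⟨n, Finsupp.support_onFinset_subset hi⟩
    · intro i
      by_cases h : i ∈ F.S n
      · simpa [g, h] using hU (f ⟨i, h⟩).2
      · simp [g, h]
    · rw [Finsupp.onFinset_sum _ (by simp), ← Finset.sum_coe_sort]
      refine Eq.trans ?_ hf
      refine Finset.sum_congr rfl fun i _ => ?_
      simp
  funext i
  have := DFunLike.congr_fun hg i.1
  simpa [g] using this

theorem finrank_le {U : Submodule k M} (hU : U.FG) (n : ℕ) :
    Module.finrank k (F.WA ^ n • U : Submodule k M) ≤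
      (F.S (2 * n)).card * Module.finrank k U := by
  have : FiniteDimensional k U := Module.Finite.iff_fg.2 hU
  refine (Submodule.finrank_mono (F.smul_le_range_comb U n)).trans ?_
  refine (LinearMap.finrank_range_le _).trans ?_
  simp [Module.finrank_pi_fintype]

theorem le_finrank {U : Submodule k M} (hU : U.FG) (hN : U ≤ N) (n : ℕ) :
    (F.S n).card * Module.finrank k U ≤ Module.finrank k (F.WA ^ n • U : Submodule k M) := by
  have : FiniteDimensional k U := Module.Finite.iff_fg.2 hU
  refine le_trans ?_ (finrank_le_of_le (fg_smul (F.fg_WA.pow n) hU) (F.range_comb_le U n))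
  rw [LinearMap.finrank_range_of_inj (F.comb_injective hN n)]
  simp [Module.finrank_pi_fintype]

theorem smul_le (F : Frame φ ψ N d) {V : Submodule k A'} {U : Submodule k M} (hU : U ≤ N) :
    V.map φ.toLinearMap • U ≤ N := by
  refine Submodule.smul_le.2 ?_
  rintro _ ⟨a, -, rfl⟩ u hu
  exact F.stable a u (hU hu)

/-- The elements of a finite-dimensional subspace can be moved past the powers of `W` with a
uniform shift of the exponent. -/
theorem act_fg (F : Frame φ ψ N d) {V : Submodule k A} (hV : V.FG) :
    ∃ l, ∃ V' : Submodule k A', V'.FG ∧ ∀ (n : ℕ) (U : Submodule k M), U ≤ N →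
      V • (F.WA ^ n • U) ≤ F.WA ^ (n + l) • V'.map φ.toLinearMap • U := by
  induction V, hV using Submodule.fg_induction with
  | singleton a =>
    obtain ⟨l, V', hV', h⟩ := F.act a
    refine ⟨l, V', hV', fun n U hU => Submodule.smul_le.2 fun b hb x hx => ?_⟩
    obtain ⟨c, rfl⟩ := Submodule.mem_span_singleton.1 hb
    rw [smul_assoc]
    exact Submodule.smul_mem _ c (h n U hU x hx)
  | sup V₁ V₂ _ _ h₁ h₂ =>
    obtain ⟨l₁, V₁', hV₁, h₁⟩ := h₁
    obtain ⟨l₂, V₂', hV₂, h₂⟩ := h₂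
    refine ⟨l₁ + l₂, V₁' ⊔ V₂', hV₁.sup hV₂, fun n U hU => ?_⟩
    rw [Submodule.sup_smul]
    refine sup_le ((h₁ n U hU).trans ?_) ((h₂ n U hU).trans ?_)
    · exact Submodule.smul_mono (F.WA_mono (by omega))
        (Submodule.smul_mono_left (Submodule.map_mono le_sup_left))
    · exact Submodule.smul_mono (F.WA_mono (by omega))
        (Submodule.smul_mono_left (Submodule.map_mono le_sup_right))

/-- Products of `j` elements of `V` cost at most `j * l` in the power of `W`; this linear bound is
what makes the growth of `A U` comparable with that of `A' U`. -/
theorem act_pow (F : Frame φ ψ N d) {V : Submodule k A} (hV : V.FG) :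
    ∃ l, ∃ V' : Submodule k A', V'.FG ∧ ∀ (j n : ℕ) (U : Submodule k M), U ≤ N →
      (1 ⊔ V) ^ j • (F.WA ^ n • U) ≤
        F.WA ^ (n + j * l) • (((1 ⊔ V') ^ j).map φ.toLinearMap • U) := by
  obtain ⟨l, V', hV', h⟩ := F.act_fg hV
  refine ⟨l, V', hV', fun j => ?_⟩
  induction j with
  | zero =>
    intro n U _
    simp [Submodule.map_one, one_smul_submodule]
  | succ j ih =>
    intro n U hU
    have step : (1 ⊔ V) • (F.WA ^ n • U) ≤
        F.WA ^ (n + l) • (1 ⊔ V').map φ.toLinearMap • U := by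
      rw [Submodule.sup_smul, one_smul_submodule]
      refine sup_le ?_ ((h n U hU).trans ?_)
      · refine Submodule.smul_mono (F.WA_mono (by omega)) ?_
        conv_lhs => rw [← one_smul_submodule (A := A) U]
        refine Submodule.smul_mono_left ?_
        exact (Submodule.map_one (f := φ)).symm.le.trans (Submodule.map_mono le_sup_left)
      · exact Submodule.smul_mono le_rfl
          (Submodule.smul_mono_left (Submodule.map_mono le_sup_right))
    rw [pow_succ, mul_smul_submodule]
    refine (Submodule.smul_mono le_rfl step).trans ?_
    refine (ih _ _ (F.smul_le hU)).trans ?_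
    rw [← mul_smul_submodule (Submodule.map φ.toLinearMap ((1 ⊔ V') ^ j)),
      ← Submodule.map_mul, ← pow_succ]
    exact Submodule.smul_mono_left (F.WA_mono (by ring_nf; omega))

/-- The submodule generated by an `A'`-stable subspace `P` of `N` is `O P`. -/
theorem mem_span (F : Frame φ ψ N d) {P : Submodule k M} (hP : P ≤ N)
    (hst : ∀ a, ∀ m ∈ P, φ a • m ∈ P) {x : M} :
    x ∈ Submodule.span A (P : Set M) ↔ ∃ n, x ∈ F.WA ^ n • P := by
  have hVP : ∀ V : Submodule k A', V.map φ.toLinearMap • P ≤ P := fun V =>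
    Submodule.smul_le.2 (by rintro _ ⟨a, -, rfl⟩ u hu; exact hst a u hu)
  constructor
  · intro hx
    induction hx using Submodule.span_induction with
    | mem x hx => exact ⟨0, by rw [pow_zero]; rw [one_smul_submodule]; exact hx⟩
    | zero => exact ⟨0, zero_mem _⟩
    | add x y _ _ hx hy =>
      obtain ⟨n, hn⟩ := hx
      obtain ⟨m, hm⟩ := hy
      exact ⟨n + m, add_mem (Submodule.smul_mono_left (F.WA_mono (by omega)) hn)
        (Submodule.smul_mono_left (F.WA_mono (by omega)) hm)⟩
    | smul a x _ hx =>
      obtain ⟨n, hn⟩ := hx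
      obtain ⟨l, V, -, h⟩ := F.act a
      exact ⟨n + l, Submodule.smul_mono le_rfl (hVP V) (h n P hP x hn)⟩
  · rintro ⟨n, hn⟩
    induction hn using Submodule.smul_induction_on' with
    | smul a _ u hu => exact Submodule.smul_mem _ a (Submodule.subset_span hu)
    | add x _ y _ hx hy => exact add_mem hx hy

/-- The intersection of `N` with the submodule generated by an `A'`-stable subspace `P` of `N` is
`P`: compare the coefficients of `1`. -/
theorem mem_of_mem_span (F : Frame φ ψ N d) {P : Submodule k M} (hP : P ≤ N)
    (hst : ∀ a, ∀ m ∈ P, φ a • m ∈ P) {x : M}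
    (hx : x ∈ Submodule.span A (P : Set M)) (hxN : x ∈ N) : x ∈ P := by
  classical
  obtain ⟨n, hn⟩ := (F.mem_span hP hst).1 hx
  obtain ⟨f, hf⟩ := F.smul_le_range_comb P n hn
  let g : F.I →₀ M := Finsupp.onFinset (F.S (2 * n))
    (fun i => if h : i ∈ F.S (2 * n) then (f ⟨i, h⟩ : M) else 0) (fun i hi => by
      by_contra h
      simp [h] at hi)
  have hgP : ∀ i, g i ∈ P := by
    intro i
    by_cases h : i ∈ F.S (2 * n)
    · simp [g, h]
    · simp [g, h]
  have hg : (g.sum fun i m => ψ (F.β i) • m) = x := by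
    rw [Finsupp.onFinset_sum _ (by simp), ← Finset.sum_coe_sort]
    refine Eq.trans ?_ hf
    refine Finset.sum_congr rfl fun i _ => ?_
    simp
  have h0 : g - Finsupp.single F.base x = 0 := by
    apply F.indep
    · intro i hi
      rcases Finset.mem_union.1 (Finsupp.support_sub hi) with hi | hi
      · exact ⟨2 * n, Finsupp.support_onFinset_subset hi⟩
      · rw [Finset.mem_singleton.1 (Finsupp.support_single_subset hi)]
        exact F.mem_base
    · intro i
      rw [Finsupp.sub_apply, Finsupp.single_apply]
      split_ifs
      · exact sub_mem (hP (hgP i)) hxN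
      · rw [sub_zero]
        exact hP (hgP i)
    · rw [Finsupp.sum_sub_index (by intro i a b; rw [smul_sub]), hg,
        Finsupp.sum_single_index (by simp), F.β_base, map_one, one_smul, sub_self]
  have := DFunLike.congr_fun h0 F.base
  rw [Finsupp.sub_apply, Finsupp.single_eq_same, Finsupp.zero_apply, sub_eq_zero] at this
  exact this ▸ hgP _

/-- A finite-dimensional part of the submodule generated by `P` comes from a finite-dimensional part
of `P`. -/
theorem exists_fg (F : Frame φ ψ N d) {P : Submodule k M} (hP : P ≤ N)
    (hst : ∀ a, ∀ m ∈ P, φ a • m ∈ P)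
    {W₁ : Submodule k M} (hW : W₁.FG) (h : ∀ x ∈ W₁, x ∈ Submodule.span A (P : Set M)) :
    ∃ n, ∃ U ≤ P, U.FG ∧ W₁ ≤ F.WA ^ n • U := by
  induction W₁, hW using Submodule.fg_induction with
  | singleton x =>
    obtain ⟨n, hn⟩ := (F.mem_span hP hst).1 (h x (Submodule.mem_span_singleton_self x))
    suffices ∃ U ≤ P, U.FG ∧ x ∈ F.WA ^ n • U by
      obtain ⟨U, hU, hfg, hx⟩ := this
      exact ⟨n, U, hU, hfg, (Submodule.span_singleton_le_iff_mem _ _).2 hx⟩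
    clear h
    induction hn using Submodule.smul_induction_on' with
    | smul a ha u hu =>
      exact ⟨Submodule.span k {u}, (Submodule.span_singleton_le_iff_mem _ _).2 hu,
        Submodule.fg_span_singleton u,
        Submodule.smul_mem_smul ha (Submodule.mem_span_singleton_self u)⟩
    | add x _ y _ hx hy =>
      obtain ⟨U₁, h₁, fg₁, m₁⟩ := hx
      obtain ⟨U₂, h₂, fg₂, m₂⟩ := hy
      exact ⟨U₁ ⊔ U₂, sup_le h₁ h₂, fg₁.sup fg₂,
        add_mem (Submodule.smul_mono le_rfl le_sup_left m₁)
          (Submodule.smul_mono le_rfl le_sup_right m₂)⟩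
  | sup V₁ V₂ _ _ h₁ h₂ =>
    obtain ⟨n₁, U₁, hU₁, fg₁, le₁⟩ := h₁ fun x hx => h x (Submodule.mem_sup_left hx)
    obtain ⟨n₂, U₂, hU₂, fg₂, le₂⟩ := h₂ fun x hx => h x (Submodule.mem_sup_right hx)
    refine ⟨n₁ + n₂, U₁ ⊔ U₂, sup_le hU₁ hU₂, fg₁.sup fg₂, sup_le (le₁.trans ?_) (le₂.trans ?_)⟩
    · exact Submodule.smul_mono (F.WA_mono (by omega)) le_sup_left
    · exact Submodule.smul_mono (F.WA_mono (by omega)) le_sup_right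

end Frame

end Frames


/-! ### Kashiwara's theorem, given a frame -/

section FrameConclusion

set_option linter.unusedSectionVars false

variable {k A A' O M : Type*} [Field k] [Ring A] [Algebra k A] [Ring A'] [Algebra k A']
  [Ring O] [Algebra k O] [AddCommGroup M] [Module k M] [Module A M] [IsScalarTower k A M]

namespace Frame

variable {φ : A' →ₐ[k] A} {ψ : O →ₐ[k] A} {N : Submodule k M} {d : ℕ} (F : Frame φ ψ N d)

/-- A submodule of the restricted module, as a subspace of the original one. -/
def carrierSpace (P : Submodule A' (Restrict φ M)) : Submodule k M :=
  (P.restrictScalars k : Submodule k (Restrict φ M))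

theorem stable_carrierSpace (P : Submodule A' (Restrict φ M)) (a : A') :
    ∀ m ∈ carrierSpace P, φ a • m ∈ carrierSpace P :=
  fun m hm => P.smul_mem a (x := (m : Restrict φ M)) hm

theorem growth_carrierSpace (P : Submodule A' (Restrict φ M)) (V : Submodule k A')
    (U : Submodule k P) (n : ℕ) : growth V U n =
      Module.finrank k (((1 ⊔ V) ^ n).map φ.toLinearMap •
        (show Submodule k M from U.map (P.subtype.restrictScalars k)) : Submodule k M) := by
  rw [← growth_map P.subtype P.injective_subtype]
  refine (growth_restrict (M := M) φ V
    (show Submodule k M from U.map (P.subtype.restrictScalars k)) n).trans ?_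
  rw [growth_eq (A := A) (M := M), Submodule.map_pow, Submodule.map_sup, Submodule.map_one]

/-- The upper bound for the growth of the submodule generated by `P`: words of length `n` in `A`
take `W ^ n₀ U` into `W ^ (n₀ + n l)` times the words of length `n` in `A'` applied to `U`. -/
theorem growthBound_span (F : Frame φ ψ N d) {P : Submodule A' (Restrict φ M)}
    (hP : carrierSpace P ≤ N) {e : ℝ≥0} (he : GrowthBound k A' P e) :
    GrowthBound k A (Submodule.span A (carrierSpace P : Set M)) (e + d) := by
  set Q := Submodule.span A (carrierSpace P : Set M)
  intro V W hV hW
  obtain ⟨n₀, U, hU, hfg, hle⟩ := F.exists_fg hP (stable_carrierSpace P)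
    (W₁ := W.map (Q.subtype.restrictScalars k)) (hW.map _)
    (by rintro _ ⟨x, -, rfl⟩; exact x.2)
  obtain ⟨l, V', hV', h⟩ := F.act_pow hV
  let U' : Submodule k P := U.comap (P.subtype.restrictScalars k)
  have hmap : (show Submodule k M from U'.map (P.subtype.restrictScalars k)) = U := by
    ext x
    constructor
    · rintro ⟨y, hy, rfl⟩
      exact hy
    · intro hx
      exact ⟨⟨x, hU hx⟩, hx, rfl⟩
  have hU' : U'.FG := by
    have : (U'.map (P.subtype.restrictScalars k)).FG := by
      change (show Submodule k M from U'.map (P.subtype.restrictScalars k)).FG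
      rw [hmap]
      exact hfg
    exact Submodule.fg_of_fg_map_injective (P.subtype.restrictScalars k) P.injective_subtype this
  obtain ⟨c, hc⟩ := he V' U' hV' hU'
  have hc0 : 0 ≤ c := by
    have := hc 1 le_rfl
    simp only [Nat.cast_one, Real.one_rpow, mul_one] at this
    exact (Nat.cast_nonneg _).trans this
  refine ⟨F.bound * (2 * n₀ + 2 * l + 1 : ℕ) ^ d * c, fun n hn => ?_⟩
  have hn0 : (0 : ℝ) < n := by exact_mod_cast hn
  have hfgn : (((1 ⊔ V') ^ n).map φ.toLinearMap • U).FG :=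
    fg_smul ((fg_one_sup_pow hV' n).map _) hfg
  have h1 : growth V W n ≤
      F.bound * (2 * (n₀ + n * l) + 1) ^ d * growth V' U' n := by
    rw [← growth_map Q.subtype Q.injective_subtype, growth_eq, growth_carrierSpace, hmap]
    refine (finrank_le_of_le (fg_smul (F.fg_WA.pow _) hfgn)
      ((Submodule.smul_mono le_rfl hle).trans (h n n₀ U (hU.trans hP)))).trans ?_
    exact (F.finrank_le hfgn _).trans (Nat.mul_le_mul_right _ (F.card_le _))
  have h2 : F.bound * (2 * (n₀ + n * l) + 1) ^ d ≤
      F.bound * (2 * n₀ + 2 * l + 1) ^ d * n ^ d := by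
    rw [mul_assoc, ← mul_pow]
    refine Nat.mul_le_mul_left _ (Nat.pow_le_pow_left ?_ d)
    nlinarith
  have h3 : (growth V W n : ℝ) ≤
      (F.bound * (2 * n₀ + 2 * l + 1 : ℕ) ^ d * (n : ℝ) ^ d) * growth V' U' n := by
    exact_mod_cast h1.trans (Nat.mul_le_mul_right _ h2)
  refine h3.trans ((mul_le_mul_of_nonneg_left (hc n hn) (by positivity)).trans (le_of_eq ?_))
  rw [NNReal.coe_add, Real.rpow_add hn0, NNReal.coe_natCast, Real.rpow_natCast]
  ring

/-- The lower bound for the growth of the submodule generated by `P`: words of length `2 n` include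
the products of words of length `n` in `O` and words of length `n` in `A'`. -/
theorem growthBound_of_span (F : Frame φ ψ N d) {P : Submodule A' (Restrict φ M)}
    (hP : carrierSpace P ≤ N) (hP0 : P ≠ ⊥) {e : ℝ≥0}
    (he : GrowthBound k A (Submodule.span A (carrierSpace P : Set M)) e) :
    ∃ e' : ℝ≥0, e = e' + d ∧ GrowthBound k A' P e' := by
  set Q := Submodule.span A (carrierSpace P : Set M)
  have key : ∀ (V' : Submodule k A') (U : Submodule k P), V'.FG → U.FG → ∃ c : ℝ, ∀ n : ℕ,
      1 ≤ n → (n : ℝ) ^ d * growth V' U n ≤ c * (n : ℝ) ^ (e : ℝ) := by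
    intro V' U hV' hU
    let U₁ : Submodule k M := U.map (P.subtype.restrictScalars k)
    have hU₁ : U₁ ≤ carrierSpace P := by
      rintro _ ⟨x, -, rfl⟩
      exact x.2
    have hU₁fg : U₁.FG := hU.map (P.subtype.restrictScalars k)
    let U₂ : Submodule k Q := U₁.comap (Q.subtype.restrictScalars k)
    have hmap : U₂.map (Q.subtype.restrictScalars k) = U₁ := by
      ext x
      constructor
      · rintro ⟨y, hy, rfl⟩
        exact hy
      · intro hx
        exact ⟨⟨x, Submodule.subset_span (hU₁ hx)⟩, hx, rfl⟩
    have hU₂ : U₂.FG :=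
      Submodule.fg_of_fg_map_injective (Q.subtype.restrictScalars k) Q.injective_subtype
        (hmap.symm ▸ hU₁fg)
    obtain ⟨c, hc⟩ := he (V'.map φ.toLinearMap ⊔ F.WA) U₂ ((hV'.map _).sup F.fg_WA) hU₂
    refine ⟨F.bound * (c * 2 ^ (e : ℝ)), fun n hn => ?_⟩
    have hfgn : (((1 ⊔ V') ^ n).map φ.toLinearMap • U₁).FG :=
      fg_smul ((fg_one_sup_pow hV' n).map _) hU₁fg
    have h1 : (F.S n).card * growth V' U n ≤
        growth (V'.map φ.toLinearMap ⊔ F.WA) U₂ (2 * n) := by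
      rw [← growth_map Q.subtype Q.injective_subtype, growth_carrierSpace P V' U n,
        growth_eq (A := A) (M := M), hmap]
      refine (F.le_finrank hfgn (smul_le F (hU₁.trans hP)) n).trans (finrank_le_of_le
        (fg_smul (fg_one_sup_pow ((hV'.map _).sup F.fg_WA) _) hU₁fg) ?_)
      rw [← mul_smul_submodule]
      refine Submodule.smul_mono_left ?_
      rw [two_mul, pow_add, Submodule.map_pow, Submodule.map_sup]
      refine mul_le_mul' (pow_le_pow_left' (le_sup_right.trans le_sup_right) n)
        (pow_le_pow_left' (sup_le_sup ?_ le_sup_left) n)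
      exact (Submodule.map_one (f := φ)).le
    have h2 : ((n ^ d * growth V' U n : ℕ) : ℝ) ≤
        (F.bound * growth (V'.map φ.toLinearMap ⊔ F.WA) U₂ (2 * n) : ℕ) := by
      exact_mod_cast (Nat.mul_le_mul_right _ (F.le_card n)).trans
        ((mul_assoc _ _ _).le.trans (Nat.mul_le_mul_left _ h1))
    push_cast at h2
    refine h2.trans ?_
    have h3 := hc (2 * n) (by omega)
    rw [Nat.cast_mul, Nat.cast_ofNat, Real.mul_rpow (by norm_num) (by positivity)] at h3
    calc (F.bound : ℝ) * growth (V'.map φ.toLinearMap ⊔ F.WA) U₂ (2 * n)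
        ≤ F.bound * (c * (2 ^ (e : ℝ) * (n : ℝ) ^ (e : ℝ))) :=
          mul_le_mul_of_nonneg_left h3 (by positivity)
      _ = F.bound * (c * 2 ^ (e : ℝ)) * (n : ℝ) ^ (e : ℝ) := by ring
  obtain ⟨p, hp, hp0⟩ := P.ne_bot_iff.1 hP0
  -- The growth of a nonzero vector is at least one, so the exponent is at least `d`.
  have hde : (d : ℝ≥0) ≤ e := by
    obtain ⟨c, hc⟩ := key ⊥ (Submodule.span k {⟨p, hp⟩}) Submodule.fg_bot
      (Submodule.fg_span_singleton _)
    have hone : ∀ n : ℕ, growth (⊥ : Submodule k A') (Submodule.span k {(⟨p, hp⟩ : P)}) n = 1 := by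
      intro n
      rw [growth_eq, sup_bot_eq, one_pow, one_smul_submodule]
      exact finrank_span_singleton (by simpa [Subtype.ext_iff] using hp0)
    by_contra hlt
    push Not at hlt
    have hpos : 0 < (d : ℝ) - e := sub_pos.2 (by exact_mod_cast hlt)
    have hbdd : ∀ n : ℕ, 1 ≤ n → (n : ℝ) ^ ((d : ℝ) - e) ≤ c := by
      intro n hn
      have hn0 : (0 : ℝ) < n := by exact_mod_cast hn
      have := hc n hn
      rw [hone, Nat.cast_one, mul_one] at this
      rw [Real.rpow_sub hn0, Real.rpow_natCast]
      exact (div_le_iff₀ (Real.rpow_pos_of_pos hn0 _)).2 this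
    have htend := (tendsto_rpow_atTop hpos).comp tendsto_natCast_atTop_atTop
    obtain ⟨n, hn1, hn2⟩ := ((htend.eventually_gt_atTop c).and
      (Filter.eventually_ge_atTop 1)).exists
    exact absurd (hbdd n hn2) (not_le.2 hn1)
  refine ⟨e - d, (tsub_add_cancel_of_le hde).symm, fun V' U hV' hU => ?_⟩
  obtain ⟨c, hc⟩ := key V' U hV' hU
  refine ⟨c, fun n hn => ?_⟩
  have hn0 : (0 : ℝ) < n := by exact_mod_cast hn
  rw [NNReal.coe_sub hde, NNReal.coe_natCast, Real.rpow_sub hn0, Real.rpow_natCast, ← mul_div_assoc,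
    le_div_iff₀ (by positivity), mul_comm]
  exact hc n hn

/-- The submodule generated by `P` has the Gelfand-Kirillov dimension of `P`, increased by the
growth exponent of `O`. -/
theorem gkDim_span (F : Frame φ ψ N d) {P : Submodule A' (Restrict φ M)}
    (hP : carrierSpace P ≤ N) (hP0 : P ≠ ⊥) :
    gkDim k A (Submodule.span A (carrierSpace P : Set M)) = gkDim k A' P + d := by
  apply le_antisymm
  · rw [← tsub_le_iff_right]
    refine le_gkDim fun e he => tsub_le_iff_right.2 ?_
    exact_mod_cast gkDim_le (F.growthBound_span hP he)
  · refine le_gkDim fun e he => ?_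
    obtain ⟨e', rfl, he'⟩ := F.growthBound_of_span hP hP0 he
    push_cast
    exact add_le_add_left (gkDim_le he') _

/-- The subspace `N`, as a submodule of the restricted module. -/
def toSubmodule (F : Frame φ ψ N d) : Submodule A' (Restrict φ M) where
  carrier := {m : M | m ∈ N}
  zero_mem' := N.zero_mem
  add_mem' := N.add_mem
  smul_mem' a m hm := F.stable a m hm

/-- If `M` is Noetherian, so is `N`: the map from submodules of `N` to the submodules of `M`
generated by them is strictly monotone. -/
theorem isNoetherian (F : Frame φ ψ N d) [IsNoetherian A M] : IsNoetherian A' F.toSubmodule := by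
  rw [isNoetherian_iff']
  let f : Submodule A' F.toSubmodule → Submodule A M := fun P =>
    Submodule.span A (carrierSpace (P.map F.toSubmodule.subtype) : Set M)
  have hN : ∀ P : Submodule A' F.toSubmodule,
      carrierSpace (P.map F.toSubmodule.subtype) ≤ N := by
    rintro P _ ⟨x, -, rfl⟩
    exact x.2
  have hle : ∀ P Q, f P ≤ f Q → P ≤ Q := by
    intro P Q h x hx
    have h1 : (show M from x.1) ∈ f Q := h (Submodule.subset_span ⟨x, hx, rfl⟩)
    obtain ⟨y, hy, hxy⟩ := F.mem_of_mem_span (hN Q) (stable_carrierSpace _) h1 x.2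
    rwa [← Subtype.ext hxy]
  have hmono : StrictMono f := by
    intro P Q h
    refine lt_of_le_not_ge (Submodule.span_mono ?_) fun h' => h.not_ge (hle _ _ h')
    rintro _ ⟨x, hx, rfl⟩
    exact ⟨x, h.le hx, rfl⟩
  exact hmono.wellFoundedGT

theorem span_ne_bot {P : Submodule A' (Restrict φ M)} (hP0 : P ≠ ⊥) :
    Submodule.span A (carrierSpace P : Set M) ≠ ⊥ := by
  obtain ⟨p, hp, hp0⟩ := P.ne_bot_iff.1 hP0
  exact fun h => hp0 (Submodule.span_eq_bot.1 h p hp)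

theorem actionMap_tmul (b : O) (m : N) : actionMap ψ N (b ⊗ₜ m) = ψ b • (m : M) := rfl

theorem exists_tensor_sum (F : Frame φ ψ N d) (z : O ⊗[k] N) :
    ∃ f : F.I →₀ N, (∀ i ∈ f.support, ∃ n, i ∈ F.S n) ∧ z = f.sum fun i m => F.β i ⊗ₜ m := by
  classical
  induction z using TensorProduct.induction_on with
  | zero => exact ⟨0, by simp, by simp⟩
  | add x y hx hy =>
    obtain ⟨f, hf, rfl⟩ := hx
    obtain ⟨g, hg, rfl⟩ := hy
    exact ⟨f + g, fun i hi => (Finset.mem_union.1 (Finsupp.support_add hi)).elim (hf i) (hg i),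
      (Finsupp.sum_add_index' (by simp) (by simp [TensorProduct.tmul_add])).symm⟩
  | tmul b m =>
    obtain ⟨n, hn⟩ := F.exhaust b
    obtain ⟨c, hc, rfl⟩ := (Finsupp.mem_span_image_iff_linearCombination k).1 (F.pow_le n hn)
    refine ⟨c.mapRange (fun a => a • m) (by simp), fun i hi => ⟨2 * n, ?_⟩, ?_⟩
    · exact hc (Finsupp.support_mapRange hi)
    rw [Finsupp.linearCombination_apply, Finsupp.sum_mapRange_index (by simp), Finsupp.sum,
      Finsupp.sum, TensorProduct.sum_tmul]
    simp [TensorProduct.smul_tmul]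

theorem actionMap_injective (F : Frame φ ψ N d) : Function.Injective (actionMap ψ N) := by
  rw [injective_iff_map_eq_zero]
  intro z hz
  obtain ⟨f, hfS, rfl⟩ := F.exists_tensor_sum z
  have h : f.mapRange (fun m : N => (m : M)) rfl = 0 := by
    apply F.indep
    · exact fun i hi => hfS i (Finsupp.support_mapRange hi)
    · intro i
      simp
    · rw [Finsupp.sum_mapRange_index (by simp)]
      rw [Finsupp.sum, map_sum] at hz
      simp only [actionMap_tmul] at hz
      exact hz
  have hf : f = 0 := by
    ext i
    simpa using DFunLike.congr_fun h i
  rw [hf, Finsupp.sum_zero_index]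

theorem range_actionMap (F : Frame φ ψ N d) : LinearMap.range (actionMap ψ N) =
    (Submodule.span A (N : Set M)).restrictScalars k := by
  apply le_antisymm
  · rintro _ ⟨z, rfl⟩
    induction z using TensorProduct.induction_on with
    | zero => simp
    | add x y hx hy => rw [map_add]; exact add_mem hx hy
    | tmul b m => exact Submodule.smul_mem _ (ψ b) (Submodule.subset_span m.2)
  · intro x hx
    obtain ⟨n, hn⟩ := (F.mem_span le_rfl F.stable).1 hx
    rw [F.WA_pow] at hn
    have hle : ((F.W ^ n).map ψ.toLinearMap) • N ≤ LinearMap.range (actionMap ψ N) := by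
      refine Submodule.smul_le.2 ?_
      rintro _ ⟨b, -, rfl⟩ m hm
      exact ⟨b ⊗ₜ ⟨m, hm⟩, rfl⟩
    exact hle hn

theorem gkDim_toSubmodule_le (F : Frame φ ψ N d) {n : ℕ} (hM : gkDim k A M ≤ (n + d : ℕ)) :
    gkDim k A' F.toSubmodule ≤ n := by
  by_cases h0 : F.toSubmodule = ⊥
  · have : Subsingleton F.toSubmodule := (Submodule.subsingleton_iff_eq_bot).2 h0
    rw [gkDim_of_subsingleton]
    exact bot_le
  · have h1 := F.gkDim_span (P := F.toSubmodule) le_rfl h0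
    have h2 := gkDim_le_of_injective (k := k) (A := A)
      (Submodule.span A (carrierSpace F.toSubmodule : Set M)).subtype
      (Submodule.injective_subtype _)
    rw [h1] at h2
    have h3 := h2.trans hM
    push_cast at h3
    exact (ENNReal.add_le_add_iff_right (ENNReal.natCast_ne_top d)).1 h3

theorem gkDim_of_equidimensional (F : Frame φ ψ N d) {n : ℕ}
    (heq : IsEquidimensional k A M (n + d)) : IsEquidimensional k A' F.toSubmodule n := by
  intro P hP
  let P' := P.map F.toSubmodule.subtype
  have hP'N : carrierSpace P' ≤ N := by
    rintro _ ⟨x, -, rfl⟩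
    exact x.2
  have hP' : P' ≠ ⊥ := fun h => hP ((Submodule.map_injective_of_injective
    F.toSubmodule.injective_subtype) (h.trans (Submodule.map_bot _).symm))
  have h1 := F.gkDim_span hP'N hP'
  rw [heq _ (span_ne_bot hP')] at h1
  push_cast at h1
  have h2 := (ENNReal.add_left_inj (ENNReal.natCast_ne_top d)).1 h1
  rw [h2]
  exact gkDim_congr (Submodule.equivMapOfInjective _ F.toSubmodule.injective_subtype P)

/-- Kashiwara's theorem for holonomic modules, given a frame. -/
theorem conclusion (F : Frame φ ψ N d) [IsNoetherianRing A] {n : ℕ}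
    (hM : IsHolonomic k A M (n + d)) :
    ∃ M₀ : Submodule A' (Restrict φ M), (∀ m : M, m ∈ M₀ ↔ m ∈ N) ∧
      IsHolonomic k A' M₀ n ∧
      (IsEquidimensional k A M (n + d) → IsEquidimensional k A' M₀ n) ∧
      Function.Injective (actionMap ψ N) ∧
      LinearMap.range (actionMap ψ N) =
        (Submodule.span A (N : Set M)).restrictScalars k ∧
      (M₀ ≠ ⊥ → gkDim k A (Submodule.span A (N : Set M)) = gkDim k A' M₀ + d) := by
  have hfin := hM.1
  have hnoeth : IsNoetherian A M := isNoetherian_of_isNoetherianRing_of_finite A M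
  have hn' := F.isNoetherian
  have hfg : Module.Finite A' F.toSubmodule := Module.IsNoetherian.finite A' F.toSubmodule
  exact ⟨F.toSubmodule, fun m => Iff.rfl, ⟨hfg, F.gkDim_toSubmodule_le hM.2⟩,
    F.gkDim_of_equidimensional, F.actionMap_injective, F.range_actionMap,
    fun h => F.gkDim_span (P := F.toSubmodule) le_rfl h⟩

end Frame

end FrameConclusion


/-! ### Ordered monomials in the entries of one matrix -/

section Monomials

/-- The exponents of the determinant: all integers for `GL₂`, only `0` for `SL₂`. -/
def Gauge.detExp : Gauge → AddSubgroup ℤ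
  | .GL2 => ⊤
  | .SL2 => ⊥

/-- The exponent of the determinant itself. -/
def Gauge.detOne : Gauge → ℤ
  | .GL2 => 1
  | .SL2 => 0

theorem Gauge.detOne_mem (G : Gauge) : G.detOne ∈ G.detExp := by
  cases G <;> simp [Gauge.detOne, Gauge.detExp]

theorem Gauge.natAbs_detOne (G : Gauge) : G.detOne.natAbs ≤ 1 := by
  cases G <;> simp [Gauge.detOne]

/-- The four entries of a matrix of reflection or FRT type, in the order suitable for ordered
monomials, and their invertible determinant. -/
structure Letters (G : Gauge) (k B : Type*) [Field k] [Ring B] [Algebra k B] where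
  (x y z w : B)
  u : Bˣ
  (p h η γ γ' ξ ξ' ζ ζ' : k)
  p_ne : p ≠ 0
  h_ne : h ≠ 0
  η_ne : η ≠ 0
  rel : LetterRel p h η γ γ' ξ ξ' ζ ζ' x y z w (u : B)
  u_eq : G = .SL2 → u = 1

/-- Exponents of monomials: of the determinant, of `y` (or of `z`, if negative), of `x` and
of `w`. -/
abbrev Expo : Type := ℤ × ℤ × ℕ × ℕ

namespace Letters

variable {G : Gauge} {k B : Type*} [Field k] [Ring B] [Algebra k B] (L : Letters G k B)

/-- Powers of the determinant. -/
def D (c : ℤ) : B := ((L.u ^ c : Bˣ) : B)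

theorem D_zero : L.D 0 = 1 := by simp [D]

theorem D_add (c c' : ℤ) : L.D (c + c') = L.D c * L.D c' := by simp [D, zpow_add]

theorem D_detOne : L.D G.detOne = L.u := by
  cases G with
  | GL2 => simp [D, Gauge.detOne]
  | SL2 => simp [D, Gauge.detOne, L.u_eq rfl]

theorem commute_D {b : B} (h : L.u * b = b * L.u) (c : ℤ) : b * L.D c = L.D c * b :=
  ((Commute.units_zpow_left (u := L.u) (a := b) h c).eq).symm

/-- `y ^ j` for `j ≥ 0`, and `z ^ (-j)` for `j < 0`. -/
def yz : ℤ → B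
  | .ofNat n => L.y ^ n
  | .negSucc n => L.z ^ (n + 1)

/-- The ordered monomials. -/
def mono (i : Expo) : B := L.D i.1 * (L.yz i.2.1 * (L.x ^ i.2.2.1 * L.w ^ i.2.2.2))

/-- The degree of a monomial; the determinant counts twice. -/
def deg (i : Expo) : ℕ := 2 * i.1.natAbs + i.2.1.natAbs + i.2.2.1 + i.2.2.2

/-- Monomials in which both `z` and `y` may occur. -/
def longMono (c : ℤ) (f b a e : ℕ) : B := L.D c * (L.z ^ f * (L.y ^ b * (L.x ^ a * L.w ^ e)))

/-- The span of the monomials of degree at most `n` with at most `f` factors `z`. -/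
def longSpan (f n : ℕ) : Submodule k B :=
  Submodule.span k {v | ∃ c ∈ G.detExp, ∃ f' ≤ f, ∃ b a e : ℕ,
    2 * c.natAbs + f' + b + a + e ≤ n ∧ v = L.longMono c f' b a e}

variable {L}

theorem longMono_mem {c : ℤ} (hc : c ∈ G.detExp) {f f' b a e n : ℕ} (hf : f' ≤ f)
    (h : 2 * c.natAbs + f' + b + a + e ≤ n) : L.longMono c f' b a e ∈ L.longSpan f n :=
  Submodule.subset_span ⟨c, hc, f', hf, b, a, e, h, rfl⟩

theorem longSpan_mono {f f' n n' : ℕ} (hf : f ≤ f') (hn : n ≤ n') :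
    L.longSpan f n ≤ L.longSpan f' n' := by
  refine Submodule.span_mono ?_
  rintro _ ⟨c, hc, g, hg, b, a, e, h, rfl⟩
  exact ⟨c, hc, g, hg.trans hf, b, a, e, h.trans hn, rfl⟩

/-- To prove that left multiplication by `t` maps one span into another one, it suffices to
look at monomials. -/
theorem mul_mem_of_longMono {t : B} {f n : ℕ} {S : Submodule k B}
    (H : ∀ c ∈ G.detExp, ∀ f' ≤ f, ∀ b a e : ℕ, 2 * c.natAbs + f' + b + a + e ≤ n →
      t * L.longMono c f' b a e ∈ S) {v : B} (hv : v ∈ L.longSpan f n) : t * v ∈ S := by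
  induction hv using Submodule.span_induction with
  | mem v hv =>
    obtain ⟨c, hc, f', hf, b, a, e, h, rfl⟩ := hv
    exact H c hc f' hf b a e h
  | zero => simp
  | add v w _ _ hv hw => rw [mul_add]; exact add_mem hv hw
  | smul r v _ hv => rw [mul_smul_comm]; exact S.smul_mem r hv

theorem D_mul_mem {c : ℤ} (hc : c ∈ G.detExp) {f n : ℕ} {v : B} (hv : v ∈ L.longSpan f n) :
    L.D c * v ∈ L.longSpan f (n + 2 * c.natAbs) := by
  refine mul_mem_of_longMono (fun c' hc' f' hf b a e h => ?_) hv
  rw [longMono, ← mul_assoc, ← D_add]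
  exact longMono_mem (add_mem hc hc') hf (by have := Int.natAbs_add_le c c'; omega)

theorem u_mul_mem {f n : ℕ} {v : B} (hv : v ∈ L.longSpan f n) :
    (L.u : B) * v ∈ L.longSpan f (n + 2) := by
  rw [← D_detOne]
  exact longSpan_mono le_rfl (by have := G.natAbs_detOne; omega) (D_mul_mem G.detOne_mem hv)

theorem z_mul_mem {f n : ℕ} {v : B} (hv : v ∈ L.longSpan f n) :
    L.z * v ∈ L.longSpan (f + 1) (n + 1) := by
  refine mul_mem_of_longMono (fun c hc f' hf b a e h => ?_) hv
  rw [longMono, ← mul_assoc, L.commute_D L.rel.δz, mul_assoc, ← mul_assoc L.z, ← pow_succ']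
  exact longMono_mem hc (by omega) (by omega)

theorem y_mul_mem {f n : ℕ} {v : B} (hv : v ∈ L.longSpan f n) :
    L.y * v ∈ L.longSpan f (n + 1) := by
  refine mul_mem_of_longMono (fun c hc f' hf b a e h => ?_) hv
  have hyz : L.y * L.z ^ f' = L.z ^ f' * L.y :=
    (show Commute L.y L.z from L.rel.yz.trans L.rel.zy.symm).pow_right f'
  rw [longMono, ← mul_assoc, L.commute_D L.rel.δy, mul_assoc, ← mul_assoc L.y, hyz, mul_assoc,
    ← mul_assoc L.y, ← pow_succ']
  exact longMono_mem hc hf (by omega)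

/-- The tail `y ^ b x ^ a w ^ e` of a monomial. -/
abbrev tail (L : Letters G k B) (b a e : ℕ) : B := L.y ^ b * (L.x ^ a * L.w ^ e)

theorem z_pow_mul_mem {f b a e f' n : ℕ} (hf : f ≤ f') (hn : f + b + a + e ≤ n) :
    L.z ^ f * L.tail b a e ∈ L.longSpan f' n := by
  have := longMono_mem (L := L) (c := 0) (zero_mem G.detExp) (b := b) (a := a) (e := e)
    (n := n) hf (by simpa using hn)
  rwa [longMono, D_zero, one_mul] at this

theorem tail_mem {b a e n : ℕ} (f : ℕ) (hn : b + a + e ≤ n) : L.tail b a e ∈ L.longSpan f n := by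
  have := z_pow_mul_mem (L := L) (f := 0) (f' := f) (b := b) (a := a) (e := e) (n := n)
    (by omega) (by omega)
  rwa [pow_zero, one_mul] at this

theorem x_mul_tail (b a e : ℕ) : L.x * L.tail b a e ∈ L.longSpan 0 (b + a + e + 1) := by
  have hxy : L.x * L.y = L.h⁻¹ • (L.y * L.x) := by
    rw [L.rel.yx, inv_smul_smul₀ L.h_ne]
  induction b with
  | zero =>
    rw [tail, pow_zero, one_mul, ← mul_assoc, ← pow_succ']
    have := tail_mem (L := L) (b := 0) (a := a + 1) (e := e) 0 (le_refl _)
    rw [tail, pow_zero, one_mul] at this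
    exact longSpan_mono le_rfl (by omega) this
  | succ b ih =>
    rw [tail, pow_succ', mul_assoc, ← mul_assoc, hxy, smul_mul_assoc, mul_assoc]
    exact Submodule.smul_mem _ _ (longSpan_mono le_rfl (by omega) (y_mul_mem ih))

theorem x_mul_mem {f n : ℕ} {v : B} (hv : v ∈ L.longSpan f n) :
    L.x * v ∈ L.longSpan f (n + 1) := by
  have key : ∀ f' b a e : ℕ,
      L.x * (L.z ^ f' * L.tail b a e) ∈ L.longSpan f' (f' + b + a + e + 1) := by
    intro f' b a e
    induction f' with
    | zero =>
      rw [pow_zero, one_mul]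
      exact longSpan_mono le_rfl (by omega) (x_mul_tail b a e)
    | succ f' ih =>
      rw [pow_succ', mul_assoc, ← mul_assoc, L.rel.xz, add_mul, smul_mul_assoc, smul_mul_assoc,
        mul_assoc, mul_assoc]
      refine add_mem (Submodule.smul_mem _ _ ?_) (Submodule.smul_mem _ _ ?_)
      · exact longSpan_mono le_rfl (by omega) (z_mul_mem ih)
      · exact longSpan_mono (by omega) (by omega) (y_mul_mem ih)
  refine mul_mem_of_longMono (fun c hc f' hf b a e h => ?_) hv
  rw [longMono, ← mul_assoc, L.commute_D L.rel.δx, mul_assoc]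
  exact longSpan_mono hf (by omega) (D_mul_mem hc (key f' b a e))

theorem w_mul_tail (b a e : ℕ) : L.w * L.tail b a e ∈ L.longSpan 0 (b + a + e + 1) := by
  induction b with
  | zero =>
    induction a with
    | zero =>
      rw [tail, pow_zero, one_mul, pow_zero, one_mul, ← pow_succ']
      have := tail_mem (L := L) (b := 0) (a := 0) (e := e + 1) 0 (le_refl _)
      rw [tail, pow_zero, one_mul, pow_zero, one_mul] at this
      exact longSpan_mono le_rfl (by omega) this
    | succ a ih =>
      rw [tail, pow_zero, one_mul] at ih ⊢
      have hmem : L.x ^ a * L.w ^ e ∈ L.longSpan 0 (a + e) := by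
        have := tail_mem (L := L) (b := 0) (a := a) (e := e) 0 (le_refl _)
        rw [tail, pow_zero, one_mul] at this
        exact longSpan_mono le_rfl (by omega) this
      rw [pow_succ', mul_assoc, ← mul_assoc, L.rel.wx, add_mul, add_mul, smul_mul_assoc,
        smul_mul_assoc, smul_mul_assoc, mul_assoc, mul_assoc]
      refine add_mem (add_mem (Submodule.smul_mem _ _ ?_) (Submodule.smul_mem _ _ ?_))
        (Submodule.smul_mem _ _ ?_)
      · exact longSpan_mono le_rfl (by omega) (x_mul_mem ih)
      · exact longSpan_mono le_rfl (by omega) (u_mul_mem hmem)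
      · exact longSpan_mono le_rfl (by omega) (y_mul_mem (y_mul_mem hmem))
  | succ b ih =>
    rw [tail, pow_succ', mul_assoc, ← mul_assoc, L.rel.wy, smul_mul_assoc, mul_assoc]
    exact Submodule.smul_mem _ _ (longSpan_mono le_rfl (by omega) (y_mul_mem ih))

theorem w_mul_mem {f n : ℕ} {v : B} (hv : v ∈ L.longSpan f n) :
    L.w * v ∈ L.longSpan f (n + 1) := by
  have key : ∀ f' b a e : ℕ,
      L.w * (L.z ^ f' * L.tail b a e) ∈ L.longSpan f' (f' + b + a + e + 1) := by
    intro f' b a e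
    induction f' with
    | zero =>
      rw [pow_zero, one_mul]
      exact longSpan_mono le_rfl (by omega) (w_mul_tail b a e)
    | succ f' ih =>
      rw [pow_succ', mul_assoc, ← mul_assoc, L.rel.wz, add_mul, smul_mul_assoc, smul_mul_assoc,
        mul_assoc, mul_assoc]
      refine add_mem (Submodule.smul_mem _ _ ?_) (Submodule.smul_mem _ _ ?_)
      · exact longSpan_mono le_rfl (by omega) (z_mul_mem ih)
      · exact longSpan_mono (by omega) (by omega) (y_mul_mem ih)
  refine mul_mem_of_longMono (fun c hc f' hf b a e h => ?_) hv
  rw [longMono, ← mul_assoc, L.commute_D L.rel.δw, mul_assoc]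
  exact longSpan_mono hf (by omega) (D_mul_mem hc (key f' b a e))

variable (L) in
/-- The span of the ordered monomials of degree at most `n`. -/
def monoSpan (n : ℕ) : Submodule k B :=
  Submodule.span k (L.mono '' {i | i.1 ∈ G.detExp ∧ deg i ≤ n})

/-- Monomials in which both `z` and `y` occur are eliminated by means of
`z y = det + η x w`; this lowers the number of factors `z`. -/
theorem longSpan_le (f n : ℕ) : L.longSpan f n ≤ L.monoSpan n := by
  induction f with
  | zero =>
    refine Submodule.span_le.2 ?_
    rintro _ ⟨c, hc, f', hf, b, a, e, h, rfl⟩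
    obtain rfl : f' = 0 := by omega
    refine Submodule.subset_span ⟨(c, (b : ℤ), a, e), ⟨hc, ?_⟩, ?_⟩
    · simp only [deg, Int.natAbs_natCast]
      omega
    · rw [longMono, pow_zero, one_mul]
      rfl
  | succ f ih =>
    refine Submodule.span_le.2 ?_
    rintro _ ⟨c, hc, f', hf, b, a, e, h, rfl⟩
    rcases Nat.lt_or_ge f f' with hlt | hge
    · obtain rfl : f' = f + 1 := by omega
      rcases b with _ | b
      · refine Submodule.subset_span ⟨(c, Int.negSucc f, a, e), ⟨hc, ?_⟩, ?_⟩
        · simp only [deg, Int.natAbs_negSucc]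
          omega
        · rw [longMono, pow_zero, one_mul]
          rfl
      · have hzy : Commute L.z L.y := L.rel.zy.trans L.rel.yz.symm
        have heq : L.longMono c (f + 1) (b + 1) a e = (L.u + L.η • (L.x * L.w)) *
            L.longMono c f b a e := by
          have h1 : L.z ^ (f + 1) * (L.y ^ (b + 1) * (L.x ^ a * L.w ^ e)) =
              L.z * L.y * (L.z ^ f * (L.y ^ b * (L.x ^ a * L.w ^ e))) := by
            have h2 : L.z ^ f * L.y = L.y * L.z ^ f := hzy.pow_left f
            rw [pow_succ', pow_succ', mul_assoc, mul_assoc L.y, ← mul_assoc (L.z ^ f) L.y, h2]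
            simp only [mul_assoc]
          rw [longMono, longMono, h1, L.rel.zy]
          rw [← mul_assoc, ← L.commute_D, mul_assoc]
          rw [add_mul, mul_add, smul_mul_assoc, mul_smul_comm, mul_assoc, ← L.rel.δw,
            ← mul_assoc L.x, ← L.rel.δx, mul_assoc]
        rw [heq, add_mul, smul_mul_assoc, mul_assoc]
        have hm := longMono_mem (L := L) hc (f := f) (b := b) (a := a) (e := e) (le_refl f)
          (le_refl _)
        refine ih (add_mem ?_ (Submodule.smul_mem _ _ ?_))
        · exact longSpan_mono le_rfl (by omega) (u_mul_mem hm)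
        · exact longSpan_mono le_rfl (by omega) (x_mul_mem (w_mul_mem hm))
    · exact ih (longMono_mem hc hge h)

variable (L) in
/-- The generating space: the entries, and the inverse of the determinant. -/
def genSpace : Submodule k B := Submodule.span k {1, L.x, L.y, L.z, L.w, ((L.u⁻¹ : Bˣ) : B)}

theorem one_le_genSpace : 1 ≤ L.genSpace := Submodule.one_le.2 (Submodule.subset_span (by simp))

theorem fg_genSpace : L.genSpace.FG := Submodule.fg_span (by simp)

theorem D_neg_detOne : L.D (-G.detOne) = ((L.u⁻¹ : Bˣ) : B) := by
  have h : L.u ^ G.detOne = L.u := Units.ext L.D_detOne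
  rw [D, zpow_neg, h]

/-- Left multiplication by an entry raises the degree by at most one, and left multiplication by the
inverse of the determinant raises it by at most two. -/
theorem genSpace_pow_le (n : ℕ) : L.genSpace ^ n ≤ L.longSpan n (2 * n) := by
  induction n with
  | zero =>
    rw [pow_zero, Submodule.one_le]
    have := tail_mem (L := L) (b := 0) (a := 0) (e := 0) 0 (le_refl _)
    simpa [tail] using this
  | succ n ih =>
    rw [pow_succ']
    refine Submodule.mul_le.2 fun a ha v hv => ?_
    replace hv := ih hv
    induction ha using Submodule.span_induction with
    | mem a ha =>
      rcases ha with rfl | rfl | rfl | rfl | rfl | rfl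
      · rw [one_mul]; exact longSpan_mono (by omega) (by omega) hv
      · exact longSpan_mono (by omega) (by omega) (x_mul_mem hv)
      · exact longSpan_mono (by omega) (by omega) (y_mul_mem hv)
      · exact longSpan_mono (by omega) (by omega) (z_mul_mem hv)
      · exact longSpan_mono (by omega) (by omega) (w_mul_mem hv)
      · rw [← D_neg_detOne]
        exact longSpan_mono (by omega) (by have := G.natAbs_detOne; rw [Int.natAbs_neg]; omega)
          (D_mul_mem (neg_mem G.detOne_mem) hv)
    | zero => simp
    | add a b _ _ ha hb => rw [add_mul]; exact add_mem ha hb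
    | smul c a _ ha => rw [smul_mul_assoc]; exact Submodule.smul_mem _ c ha

theorem pow_genSpace_mono {m n : ℕ} (h : m ≤ n) : L.genSpace ^ m ≤ L.genSpace ^ n :=
  pow_le_pow_right₀ one_le_genSpace h

theorem u_mem_genSpace : (L.u : B) ∈ L.genSpace ^ 2 := by
  have h : (L.u : B) = L.z * L.y - L.η • (L.x * L.w) := by rw [L.rel.zy]; abel
  rw [h, sq]
  exact sub_mem (Submodule.mul_mem_mul (Submodule.subset_span (by simp))
      (Submodule.subset_span (by simp)))
    (Submodule.smul_mem _ _ (Submodule.mul_mem_mul (Submodule.subset_span (by simp))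
      (Submodule.subset_span (by simp))))

theorem D_mem_genSpace (c : ℤ) : L.D c ∈ L.genSpace ^ (2 * c.natAbs) := by
  rw [pow_mul]
  rcases c with n | n
  · rw [Int.ofNat_eq_natCast, Int.natAbs_natCast, D, zpow_natCast, Units.val_pow_eq_pow_val]
    exact Submodule.pow_mem_pow _ u_mem_genSpace n
  · rw [Int.natAbs_negSucc, D, zpow_negSucc, ← inv_pow, Units.val_pow_eq_pow_val]
    refine Submodule.pow_mem_pow _ (pow_genSpace_mono (m := 1) (by omega) ?_) _
    rw [pow_one]
    exact Submodule.subset_span (by simp)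

theorem mono_mem_genSpace (i : Expo) : L.mono i ∈ L.genSpace ^ deg i := by
  obtain ⟨c, j, a, e⟩ := i
  simp only [deg, mono]
  rw [add_assoc, add_assoc, pow_add]
  refine Submodule.mul_mem_mul (D_mem_genSpace c) ?_
  rw [← add_assoc, add_assoc, pow_add]
  refine Submodule.mul_mem_mul ?_ ?_
  · rcases j with n | n
    · exact Submodule.pow_mem_pow _ (Submodule.subset_span (by simp)) n
    · exact Submodule.pow_mem_pow _ (Submodule.subset_span (by simp)) (n + 1)
  · rw [pow_add]
    exact Submodule.mul_mem_mul (Submodule.pow_mem_pow _ (Submodule.subset_span (by simp)) a)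
      (Submodule.pow_mem_pow _ (Submodule.subset_span (by simp)) e)

end Letters

/-- The exponents of the determinant of absolute value at most `n`. -/
def Gauge.detBall (n : ℕ) : Gauge → Finset ℤ
  | .GL2 => Finset.Icc (-n) n
  | .SL2 => {0}

theorem Gauge.mem_detBall {G : Gauge} {n : ℕ} {c : ℤ} :
    c ∈ G.detBall n ↔ c ∈ G.detExp ∧ c.natAbs ≤ n := by
  cases G with
  | GL2 =>
    simp only [Gauge.detBall, Gauge.detExp, Finset.mem_Icc, AddSubgroup.mem_top, true_and]
    omega
  | SL2 =>
    simp only [Gauge.detBall, Gauge.detExp, Finset.mem_singleton, AddSubgroup.mem_bot]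
    omega

/-- The exponents of the ordered monomials of degree at most `n`. -/
def expoBall (G : Gauge) (n : ℕ) : Finset Expo :=
  (G.detBall n ×ˢ Finset.Icc (-n : ℤ) n ×ˢ Finset.range (n + 1) ×ˢ Finset.range (n + 1)).filter
    fun i => Letters.deg i ≤ n

theorem mem_expoBall {G : Gauge} {n : ℕ} {i : Expo} :
    i ∈ expoBall G n ↔ i.1 ∈ G.detExp ∧ Letters.deg i ≤ n := by
  simp only [expoBall, Finset.mem_filter, Finset.mem_product, Gauge.mem_detBall, Finset.mem_Icc,
    Finset.mem_range]
  refine ⟨fun h => ⟨h.1.1.1, h.2⟩, fun h => ⟨⟨⟨h.1, ?_⟩, ?_, ?_, ?_⟩, h.2⟩⟩ <;>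
    · have := h.2
      simp only [Letters.deg] at this
      omega

theorem card_expoBall_le (G : Gauge) (n : ℕ) :
    (expoBall G n).card ≤ 8 ^ G.dim * (n + 1) ^ G.dim := by
  refine (Finset.card_filter_le _ _).trans ?_
  have hI : (Finset.Icc (-n : ℤ) n).card = 2 * n + 1 := by simp; omega
  simp only [Finset.card_product, hI, Finset.card_range]
  cases G with
  | GL2 =>
    simp only [Gauge.detBall, hI, Gauge.dim]
    have h : 2 * n + 1 ≤ 2 * (n + 1) := by omega
    calc (2 * n + 1) * ((2 * n + 1) * ((n + 1) * (n + 1)))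
        ≤ (2 * (n + 1)) * ((2 * (n + 1)) * ((n + 1) * (n + 1))) := by gcongr
      _ = 4 * (n + 1) ^ 4 := by ring
      _ ≤ 8 ^ 4 * (n + 1) ^ 4 := by gcongr; norm_num
  | SL2 =>
    simp only [Gauge.detBall, Finset.card_singleton, Gauge.dim]
    have h : 2 * n + 1 ≤ 2 * (n + 1) := by omega
    calc 1 * ((2 * n + 1) * ((n + 1) * (n + 1)))
        ≤ 1 * ((2 * (n + 1)) * ((n + 1) * (n + 1))) := by gcongr
      _ = 2 * (n + 1) ^ 3 := by ring
      _ ≤ 8 ^ 3 * (n + 1) ^ 3 := by gcongr; norm_num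

theorem le_card_expoBall (G : Gauge) (n : ℕ) :
    n ^ G.dim ≤ 8 ^ G.dim * (expoBall G n).card := by
  obtain ⟨m, hm, hnm⟩ : ∃ m, 5 * m ≤ n ∧ n ≤ 8 * (m + 1) := ⟨n / 5, by omega, by omega⟩
  have hI : (Finset.Icc (-m : ℤ) m).card = 2 * m + 1 := by simp; omega
  have hsub : G.detBall m ×ˢ Finset.Icc (-m : ℤ) m ×ˢ Finset.range (m + 1) ×ˢ
      Finset.range (m + 1) ⊆ expoBall G n := by
    intro i hi
    simp only [Finset.mem_product, Gauge.mem_detBall, Finset.mem_Icc, Finset.mem_range] at hi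
    refine mem_expoBall.2 ⟨hi.1.1, ?_⟩
    simp only [Letters.deg]
    omega
  have hcard := Finset.card_le_card hsub
  simp only [Finset.card_product, hI, Finset.card_range] at hcard
  refine (Nat.pow_le_pow_left hnm _).trans ?_
  rw [mul_pow]
  refine Nat.mul_le_mul_left _ (le_trans ?_ hcard)
  have h : m + 1 ≤ 2 * m + 1 := by omega
  cases G with
  | GL2 =>
    simp only [Gauge.detBall, hI, Gauge.dim]
    calc (m + 1) ^ 4 = (m + 1) * ((m + 1) * ((m + 1) * (m + 1))) := by ring
      _ ≤ _ := by gcongr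
  | SL2 =>
    simp only [Gauge.detBall, Finset.card_singleton, Gauge.dim]
    calc (m + 1) ^ 3 = 1 * ((m + 1) * ((m + 1) * (m + 1))) := by ring
      _ ≤ _ := by gcongr

theorem Letters.genSpace_pow_le_span {G : Gauge} {k B : Type*} [Field k] [Ring B] [Algebra k B]
    (L : Letters G k B) (n : ℕ) :
    L.genSpace ^ n ≤ Submodule.span k (L.mono '' expoBall G (2 * n)) := by
  refine (genSpace_pow_le n).trans ((longSpan_le _ _).trans (Submodule.span_mono ?_))
  exact Set.image_mono fun i hi => mem_expoBall.2 hi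

end Monomials


/-! ### Linear independence over a subspace of a module -/

section IndepOver

set_option linter.unusedSectionVars false

variable {k A M ι κ : Type*} [Field k] [Ring A] [Algebra k A] [AddCommGroup M] [Module k M]
  [Module A M] [IsScalarTower k A M]

theorem smul_comm_of_tower (c : k) (a : A) (m : M) : a • c • m = c • a • m :=
  (Algebra.lsmul k k M a).map_smul c m

/-- The elements `P i`, `i ∈ s`, of the algebra are linearly independent over the subspace `N`
of the module. -/
def IndepOver (N : Submodule k M) (s : Set ι) (P : ι → A) : Prop :=
  ∀ (t : Finset ι) (m : ι → M), (t : Set ι) ⊆ s → (∀ i, m i ∈ N) → ∑ i ∈ t, P i • m i = 0 →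
    ∀ i ∈ t, m i = 0

variable {N : Submodule k M}

/-- Only the indices that occur in the sum matter, so a family may be reindexed along a map that is
injective on them. -/
theorem IndepOver.reindex {s : Set κ} {Q : κ → A} (hQ : IndepOver N s Q) (t : Finset ι)
    (τ : ι → κ) (hτ : Set.InjOn τ t) (hs : ∀ i ∈ t, τ i ∈ s) (m : ι → M) (hm : ∀ i, m i ∈ N)
    (h : ∑ i ∈ t, Q (τ i) • m i = 0) : ∀ i ∈ t, m i = 0 := by
  classical
  intro i hi
  have : Nonempty ι := ⟨i⟩
  have hinv : ∀ i ∈ t, Function.invFunOn τ t (τ i) = i := fun i hi =>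
    hτ.leftInvOn_invFunOn hi
  have h' := hQ (t.image τ) (fun l => m (Function.invFunOn τ t l))
    (by
      intro l hl
      obtain ⟨i, hi, rfl⟩ := Finset.mem_image.1 hl
      exact hs i hi) (fun _ => hm _) (by
      rw [Finset.sum_image hτ]
      exact (Finset.sum_congr rfl fun i hi => by rw [hinv i hi]).trans h)
    (τ i) (Finset.mem_image_of_mem τ hi)
  rwa [hinv i hi] at h'

/-- A family is independent if it is triangular with respect to an independent family. -/
theorem IndepOver.triangular {s : Set κ} {Q : κ → A} (hQ : IndepOver N s Q) (t : Finset ι)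
    (P : ι → A) (τ : ι → κ) (hτ : Set.InjOn τ t) (rank : κ → ℕ)
    (H : ∀ i ∈ t, τ i ∈ s ∧ ∃ r : k, r ≠ 0 ∧
      P i - r • Q (τ i) ∈ Submodule.span k (Q '' {l | l ∈ s ∧ rank l < rank (τ i)}))
    (m : ι → M) (hm : ∀ i, m i ∈ N) (h : ∑ i ∈ t, P i • m i = 0) : ∀ i ∈ t, m i = 0 := by
  classical
  by_contra hcon
  push Not at hcon
  obtain ⟨i₁, hi₁, hne₁⟩ := hcon
  obtain ⟨i₀, hi₀, hmax⟩ := Finset.exists_max_image (t.filter fun i => m i ≠ 0)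
    (fun i => rank (τ i)) ⟨i₁, Finset.mem_filter.2 ⟨hi₁, hne₁⟩⟩
  obtain ⟨hi₀t, hne₀⟩ := Finset.mem_filter.1 hi₀
  have hex : ∀ i, ∃ (r : k) (C : κ →₀ k), i ∈ t → r ≠ 0 ∧
      (C.support : Set κ) ⊆ {l | l ∈ s ∧ rank l < rank (τ i)} ∧
      P i = r • Q (τ i) + Finsupp.linearCombination k Q C := by
    intro i
    by_cases hi : i ∈ t
    · obtain ⟨-, r, hr, hmem⟩ := H i hi
      obtain ⟨C, hC, hC'⟩ := (Finsupp.mem_span_image_iff_linearCombination k).1 hmem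
      exact ⟨r, C, fun _ => ⟨hr, hC, by rw [hC']; abel⟩⟩
    · exact ⟨0, 0, fun h => absurd h hi⟩
  choose r C hrC using hex
  let c : ι → κ →₀ k := fun i => Finsupp.single (τ i) (r i) + C i
  have hP : ∀ i ∈ t, P i = Finsupp.linearCombination k Q (c i) := by
    intro i hi
    rw [(hrC i hi).2.2, map_add, Finsupp.linearCombination_single]
  let T : Finset κ := t.biUnion fun i => (c i).support
  have hTs : (T : Set κ) ⊆ s := by
    intro l hl
    obtain ⟨i, hi, hl⟩ := Finset.mem_biUnion.1 hl
    rcases Finset.mem_union.1 (Finsupp.support_add hl) with h1 | h1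
    · rw [Finset.mem_singleton.1 (Finsupp.support_single_subset h1)]
      exact (H i hi).1
    · exact ((hrC i hi).2.1 h1).1
  have hsum : ∑ l ∈ T, Q l • (∑ i ∈ t, c i l • m i) = 0 := by
    rw [← h]
    simp only [Finset.smul_sum]
    rw [Finset.sum_comm]
    refine Finset.sum_congr rfl fun i hi => ?_
    rw [hP i hi, Finsupp.linearCombination_apply, Finsupp.sum, Finset.sum_smul]
    symm
    refine (Finset.sum_subset (Finset.subset_biUnion_of_mem (fun i => (c i).support) hi)
      fun l _ hl => ?_).trans (Finset.sum_congr rfl fun l _ => ?_)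
    · rw [Finsupp.notMem_support_iff.1 hl, zero_smul, zero_smul]
    · rw [smul_assoc, smul_comm_of_tower]
  have hcoef : ∑ i ∈ t, c i (τ i₀) • m i = r i₀ • m i₀ := by
    rw [Finset.sum_eq_single_of_mem i₀ hi₀t]
    · congr 1
      have : C i₀ (τ i₀) = 0 := by
        by_contra hne
        exact lt_irrefl _ ((hrC i₀ hi₀t).2.1 (Finsupp.mem_support_iff.2 hne)).2
      simp [c, this]
    · intro i hi hii
      by_cases hmi : m i = 0
      · rw [hmi, smul_zero]
      · have h1 : C i (τ i₀) = 0 := by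
          by_contra hne
          have h2 := ((hrC i hi).2.1 (Finsupp.mem_support_iff.2 hne)).2
          exact absurd (hmax i (Finset.mem_filter.2 ⟨hi, hmi⟩)) (not_le.2 h2)
        have h3 : τ i ≠ τ i₀ := fun h => hii (hτ hi hi₀t h)
        simp [c, h1, h3]
  have hn : ∀ l, (∑ i ∈ t, c i l • m i) ∈ N := fun l =>
    sum_mem fun i _ => N.smul_mem _ (hm i)
  have key : (∑ i ∈ t, c i (τ i₀) • m i) = 0 := by
    by_cases hT : τ i₀ ∈ T
    · exact hQ T _ hTs hn hsum _ hT
    · refine Finset.sum_eq_zero fun i hi => ?_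
      have : c i (τ i₀) = 0 := by
        by_contra hne
        exact hT (Finset.mem_biUnion.2 ⟨i, hi, Finsupp.mem_support_iff.2 hne⟩)
      rw [this, zero_smul]
  rw [hcoef] at key
  exact hne₀ ((smul_eq_zero.1 key).resolve_left (hrC i₀ hi₀t).1)

/-- In a vanishing sum of eigenvectors the terms with a given eigenvalue sum up to zero. -/
theorem sum_eigenvectors_eq_zero [DecidableEq k] (T : A) (t : Finset ι) (v : ι → M) (μ : ι → k)
    (hv : ∀ i ∈ t, T • v i = μ i • v i) (h : ∑ i ∈ t, v i = 0) (lam : k) :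
    ∑ i ∈ t.filter (fun i => μ i = lam), v i = 0 := by
  induction hn : (t.filter (fun i => μ i ≠ lam)).card using Nat.strong_induction_on
    generalizing t v with
  | _ n ih =>
    by_cases hex : ∃ j ∈ t, μ j ≠ lam
    · obtain ⟨j, hj, hjl⟩ := hex
      -- `T - μ j` kills the eigenvectors with the eigenvalue `μ j`.
      have h1 : ∑ i ∈ t.filter (fun i => μ i ≠ μ j), (μ i - μ j) • v i = 0 := by
        have h2 : ∑ i ∈ t, (μ i - μ j) • v i = 0 := by
          have h3 : T • ∑ i ∈ t, v i = ∑ i ∈ t, μ i • v i := by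
            rw [Finset.smul_sum]
            exact Finset.sum_congr rfl hv
          simp only [sub_smul, Finset.sum_sub_distrib]
          rw [← h3, ← Finset.smul_sum, h, smul_zero, smul_zero, sub_zero]
        rw [Finset.sum_filter]
        refine (Finset.sum_congr rfl fun i _ => ?_).trans h2
        split_ifs with h4
        · rfl
        · rw [not_not.1 h4, sub_self, zero_smul]
      have h5 := ih ((t.filter (fun i => μ i ≠ μ j)).filter (fun i => μ i ≠ lam)).card
        (by
          rw [← hn]
          refine Finset.card_lt_card (Finset.ssubset_iff_subset_ne.2 ⟨?_, fun heq => ?_⟩)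
          · exact Finset.filter_subset_filter _ (Finset.filter_subset _ _)
          · have : j ∈ t.filter (fun i => μ i ≠ lam) := Finset.mem_filter.2 ⟨hj, hjl⟩
            rw [← heq] at this
            exact (Finset.mem_filter.1 (Finset.mem_filter.1 this).1).2 rfl)
        (t.filter (fun i => μ i ≠ μ j)) (fun i => (μ i - μ j) • v i)
        (fun i hi => by
          rw [smul_comm_of_tower, hv i (Finset.mem_filter.1 hi).1, smul_comm])
        h1 rfl
      rw [Finset.filter_filter] at h5
      have h6 : t.filter (fun i => μ i ≠ μ j ∧ μ i = lam) = t.filter (fun i => μ i = lam) := by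
        refine Finset.filter_congr fun i _ => ⟨fun h => h.2, fun h => ⟨?_, h⟩⟩
        rw [h]
        exact hjl.symm
      rw [h6] at h5
      have h7 : ∑ i ∈ t.filter (fun i => μ i = lam), (μ i - μ j) • v i =
          (lam - μ j) • ∑ i ∈ t.filter (fun i => μ i = lam), v i := by
        rw [Finset.smul_sum]
        exact Finset.sum_congr rfl fun i hi => by rw [(Finset.mem_filter.1 hi).2]
      rw [h7] at h5
      exact (smul_eq_zero.1 h5).resolve_left (sub_ne_zero.2 hjl.symm)
    · push Not at hex
      rw [Finset.filter_true_of_mem hex, h]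

end IndepOver


/-! ### Independence of the monomials over the joint kernel -/

section KernelAction

set_option linter.unusedSectionVars false

variable {G : Gauge} {k A M : Type*} [Field k] [Ring A] [Algebra k A] [AddCommGroup M] [Module k M]
  [Module A M] [IsScalarTower k A M]

/-- How the entries `E = a¹₂`, `K = a²₂`, `F = a²₁` and the determinant `Δ` of the matrix `A`
move past the letters, given that on the subspace `N` they act as `0`, `1`, `0` and `1`. The
numbers `lam n`, `cof a` describe the operator `y F - lam n w`, which lowers the exponent of `x`
in the monomials `y ^ b x ^ a` with `a + b = n`. -/
structure KernelAction (L : Letters G k A) (N : Submodule k M) where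
  (E K F Δ : A)
  E_N : ∀ m ∈ N, E • m = 0
  K_N : ∀ m ∈ N, K • m = m
  Δ_N : ∀ m ∈ N, Δ • m = m
  (e₁ e₂ e₃ e₄ κ κ' k₁ d d' δ' g₁ g₂ f₁ : k)
  (f₂ f₃ lam cof : ℕ → k)
  e₁_ne : e₁ ≠ 0
  e₂_ne : e₂ ≠ 0
  e₄_ne : e₄ ≠ 0
  d_ne : d ≠ 0
  d'_ne : d' ≠ 0
  Ey : E * L.y = e₁ • (L.y * E)
  Ex : E * L.x = e₂ • (L.x * E)
  Ew : E * L.w = e₃ • (L.w * E) + e₄ • (L.y * K)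
  Ky : K * L.y = κ • (L.y * K)
  Kx : K * L.x = κ • (L.x * K) + κ' • (L.y * E)
  Kw : K * L.w = k₁ • (L.w * K)
  Δy : Δ * L.y = δ' • (L.y * Δ)
  Δx : Δ * L.x = δ' • (L.x * Δ)
  Eu : E * L.u = d • (L.u * E)
  Ku : K * L.u = d • (L.u * K)
  Δu : Δ * L.u = d' • (L.u * Δ)
  pow_ne : ∀ e, 1 ≤ e → (e₃ * L.h) ^ e ≠ k₁ ^ e
  separate : ∀ c ∈ G.detExp, ∀ c' ∈ G.detExp, ∀ n n' : ℕ, d ^ c * κ ^ n = d ^ c' * κ ^ n' →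
    d' ^ c * δ' ^ n = d' ^ c' * δ' ^ n' → c = c' ∧ n = n'
  g₁_ne : g₁ ≠ 0
  F_N : ∀ m ∈ N, F • m = 0
  Fy : F * L.y = g₁ • (L.y * F) + g₂ • (L.w * K)
  Fx : ∀ a : ℕ, ∀ m ∈ N, F • L.x • L.x ^ a • m = f₁ • L.x • F • L.x ^ a • m +
    f₂ a • L.z • L.x ^ a • m + f₃ a • L.y • L.x ^ a • m
  lam_zero : lam 0 = 0
  lam_ne : ∀ n, lam (n + 1) ≠ 0
  lam_y : ∀ n, g₁ * lam n + g₂ * κ ^ n = L.h * lam (n + 1)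
  lam_x : ∀ a, f₁ * L.h * lam a + f₂ a * L.η = L.p * lam (a + 1)
  f₃_eq : ∀ a, f₃ a = L.γ' * lam (a + 1)
  cof_zero : cof 0 = 0
  cof_ne : ∀ a, cof (a + 1) ≠ 0
  cof_succ : ∀ a, cof (a + 1) = f₁ * L.h * cof a + f₂ a - L.γ * lam (a + 1)

theorem mul_pow_of_mul {T b : A} {c : k} (h : T * b = c • (b * T)) (n : ℕ) :
    T * b ^ n = c ^ n • (b ^ n * T) := by
  induction n with
  | zero => simp
  | succ n ih =>
    rw [pow_succ, ← mul_assoc, ih, smul_mul_assoc, mul_assoc, h, mul_smul_comm, smul_smul,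
      ← mul_assoc, pow_succ]

theorem Letters.mul_D {L : Letters G k A} {T : A} {c : k} (hc : c ≠ 0)
    (h : T * L.u = c • (L.u * T)) (n : ℤ) : T * L.D n = c ^ n • (L.D n * T) := by
  have hnat : ∀ n : ℕ, T * L.D n = c ^ n • (L.D n * T) := by
    intro n
    have := mul_pow_of_mul h n
    simpa [Letters.D] using this
  rcases n with n | n
  · simpa using hnat n
  · have h1 : L.D (Int.negSucc n) * L.D (n + 1 : ℕ) = 1 := by
      rw [← L.D_add, ← L.D_zero]
      congr 1
      omega
    have h2 : L.D (n + 1 : ℕ) * L.D (Int.negSucc n) = 1 := by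
      rw [← L.D_add, ← L.D_zero]
      congr 1
      omega
    have h3 := hnat (n + 1)
    have h4 : L.D (Int.negSucc n) * (T * L.D (n + 1 : ℕ)) * L.D (Int.negSucc n) =
        c ^ (n + 1) • (L.D (Int.negSucc n) * (L.D (n + 1 : ℕ) * T) * L.D (Int.negSucc n)) := by
      rw [h3, mul_smul_comm, smul_mul_assoc]
    rw [← mul_assoc, mul_assoc, h2, mul_one, ← mul_assoc, h1, one_mul] at h4
    rw [zpow_negSucc, h4, inv_smul_smul₀ (pow_ne_zero _ hc)]

/-- Monomials without `z`. -/
def Letters.pure (L : Letters G k A) (i : ℤ × ℕ × ℕ × ℕ) : A :=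
  L.D i.1 * (L.y ^ i.2.1 * (L.x ^ i.2.2.1 * L.w ^ i.2.2.2))

theorem Letters.D_smul_cancel (L : Letters G k A) {c : ℤ} {m : M} (h : L.D c • m = 0) : m = 0 := by
  have h1 : L.D (-c) • L.D c • m = 0 := by rw [h, smul_zero]
  rwa [← mul_smul, ← L.D_add, neg_add_cancel, L.D_zero, one_smul] at h1

namespace KernelAction

variable {L : Letters G k A} {N : Submodule k M} (X : KernelAction L N)

theorem E_pow_smul (X : KernelAction L N) {m : M} (hm : m ∈ N) (a b : ℕ) :
    X.E • L.y ^ b • L.x ^ a • m = 0 := by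
  rw [← mul_smul, mul_pow_of_mul X.Ey, smul_assoc, mul_smul, ← mul_smul X.E,
    mul_pow_of_mul X.Ex, smul_assoc, mul_smul, X.E_N m hm]
  simp

theorem K_x_pow (X : KernelAction L N) {m : M} (hm : m ∈ N) (a : ℕ) :
    X.K • L.x ^ a • m = X.κ ^ a • L.x ^ a • m := by
  induction a with
  | zero => simp [X.K_N m hm]
  | succ a ih =>
    have hE := X.E_pow_smul hm a 0
    rw [pow_zero, one_smul] at hE
    rw [pow_succ', mul_smul, ← mul_smul X.K, X.Kx, add_smul, smul_assoc, smul_assoc, mul_smul, ih,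
      mul_smul, hE, smul_zero, smul_zero, add_zero, smul_comm_of_tower, smul_smul, ← pow_succ']

theorem K_pow_smul (X : KernelAction L N) {m : M} (hm : m ∈ N) (a b : ℕ) :
    X.K • L.y ^ b • L.x ^ a • m = X.κ ^ (a + b) • L.y ^ b • L.x ^ a • m := by
  rw [← mul_smul, mul_pow_of_mul X.Ky, smul_assoc, mul_smul, X.K_x_pow hm, smul_comm_of_tower,
    smul_smul, ← pow_add, add_comm]

theorem Δ_pow_smul (X : KernelAction L N) {m : M} (hm : m ∈ N) (a b : ℕ) :
    X.Δ • L.y ^ b • L.x ^ a • m = X.δ' ^ (a + b) • L.y ^ b • L.x ^ a • m := by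
  rw [← mul_smul, mul_pow_of_mul X.Δy, smul_assoc, mul_smul, ← mul_smul X.Δ,
    mul_pow_of_mul X.Δx, smul_assoc, mul_smul, X.Δ_N m hm, smul_comm_of_tower,
    smul_smul, ← pow_add, add_comm]

theorem yF_x_pow (X : KernelAction L N) {m : M} (hm : m ∈ N) (a : ℕ) :
    L.y • X.F • L.x ^ a • m =
      X.lam a • L.w • L.x ^ a • m + X.cof a • (L.u : A) • L.x ^ (a - 1) • m := by
  induction a with
  | zero => simp [X.lam_zero, X.cof_zero, X.F_N m hm]
  | succ a ih =>
    have hxu : X.cof a • L.x • (L.u : A) • L.x ^ (a - 1) • m =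
        X.cof a • (L.u : A) • L.x ^ a • m := by
      rcases a with _ | a
      · rw [X.cof_zero, zero_smul, zero_smul]
      · rw [← mul_smul L.x, ← L.rel.δx, mul_smul, Nat.add_sub_cancel, ← mul_smul L.x, ← pow_succ']
    have hyx : L.y • L.x • X.F • L.x ^ a • m = L.h • L.x • L.y • X.F • L.x ^ a • m := by
      rw [← mul_smul, L.rel.yx, smul_assoc, mul_smul]
    have hyz : L.y • L.z • L.x ^ a • m = (L.u : A) • L.x ^ a • m +
        L.η • L.x • L.w • L.x ^ a • m := by
      rw [← mul_smul, L.rel.yz, add_smul, smul_assoc, mul_smul]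
    have hwx : L.w • L.x • L.x ^ a • m = L.p • L.x • L.w • L.x ^ a • m +
        L.γ • (L.u : A) • L.x ^ a • m + L.γ' • L.y • L.y • L.x ^ a • m := by
      rw [← mul_smul, L.rel.wx, add_smul, add_smul, smul_assoc, smul_assoc, smul_assoc, mul_smul,
        mul_smul]
    rw [pow_succ', mul_smul, X.Fx a m hm, smul_add, smul_add, smul_comm_of_tower,
      smul_comm_of_tower, smul_comm_of_tower, hyx, ih, hyz, smul_add, smul_comm_of_tower _ L.x,
      smul_comm_of_tower _ L.x, hxu, hwx, Nat.add_sub_cancel, X.cof_succ, X.f₃_eq]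
    have h1 := X.lam_x a
    generalize L.x • L.w • L.x ^ a • m = v₁
    generalize (L.u : A) • L.x ^ a • m = v₂
    generalize L.y • L.y • L.x ^ a • m = v₃
    linear_combination (norm := skip) h1 • v₁
    module

/-- The operator `y F - lam (a + b) w` lowers the exponent of `x` in `y ^ b x ^ a m` by one. -/
theorem yF (X : KernelAction L N) {m : M} (hm : m ∈ N) (b a : ℕ) :
    L.y • X.F • L.y ^ b • L.x ^ a • m = X.lam (a + b) • L.w • L.y ^ b • L.x ^ a • m +
      (X.g₁ ^ b * X.cof a) • (L.u : A) • L.y ^ b • L.x ^ (a - 1) • m := by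
  induction b with
  | zero => simpa using X.yF_x_pow hm a
  | succ b ih =>
    have hF : X.F • L.y • L.y ^ b • L.x ^ a • m = X.g₁ • L.y • X.F • L.y ^ b • L.x ^ a • m +
        (X.g₂ * X.κ ^ (a + b)) • L.w • L.y ^ b • L.x ^ a • m := by
      rw [← mul_smul, X.Fy, add_smul, smul_assoc, smul_assoc, mul_smul, mul_smul,
        X.K_pow_smul hm, smul_comm_of_tower _ L.w, smul_smul X.g₂]
    have hyu : L.y • (L.u : A) • L.y ^ b • L.x ^ (a - 1) • m =
        (L.u : A) • L.y • L.y ^ b • L.x ^ (a - 1) • m := by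
      rw [← mul_smul, ← L.rel.δy, mul_smul]
    have hwy : L.w • L.y • L.y ^ b • L.x ^ a • m = L.h • L.y • L.w • L.y ^ b • L.x ^ a • m := by
      rw [← mul_smul, L.rel.wy, smul_assoc, mul_smul]
    rw [pow_succ' L.y, mul_smul, mul_smul L.y, hF, ih, smul_add, smul_comm_of_tower,
      smul_comm_of_tower, smul_add, smul_comm_of_tower _ L.y, smul_comm_of_tower _ L.y, hyu, hwy,
      ← add_assoc a b 1]
    have h1 := X.lam_y (a + b)
    generalize L.y • L.w • L.y ^ b • L.x ^ a • m = v₁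
    generalize (L.u : A) • L.y • L.y ^ b • L.x ^ (a - 1) • m = v₂
    linear_combination (norm := skip) h1 • v₁
    module

theorem F_y_pow (X : KernelAction L N) {m : M} (hm : m ∈ N) (n : ℕ) :
    X.F • L.y ^ (n + 1) • m = (L.h * X.lam (n + 1)) • L.w • L.y ^ n • m := by
  have h1 := X.yF hm n 0
  rw [X.cof_zero, mul_zero, zero_smul, add_zero, pow_zero, one_smul, zero_add] at h1
  have h2 := X.K_pow_smul hm 0 n
  rw [pow_zero, one_smul, zero_add] at h2
  rw [pow_succ', mul_smul, ← mul_smul X.F, X.Fy, add_smul, smul_assoc, smul_assoc, mul_smul,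
    mul_smul, h1, h2, smul_comm_of_tower _ L.w, smul_smul X.g₁, smul_smul X.g₂, ← add_smul, X.lam_y]

theorem eq_zero_of_y_pow (X : KernelAction L N) {m : M} (hm : m ∈ N) (n : ℕ)
    (h : L.y ^ n • m = 0) : m = 0 := by
  induction n with
  | zero => simpa using h
  | succ n ih =>
    have hw : L.w • L.y ^ n • m = 0 := by
      have h1 := X.F_y_pow hm n
      rw [h, smul_zero] at h1
      exact (smul_eq_zero.1 h1.symm).resolve_left (mul_ne_zero L.h_ne (X.lam_ne n))
    have hz : L.z • L.y ^ (n + 1) • m = 0 := by rw [h, smul_zero]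
    rw [pow_succ', mul_smul, ← mul_smul, L.rel.zy, add_smul, smul_assoc, mul_smul, hw, smul_zero,
      smul_zero, add_zero, ← L.D_detOne] at hz
    exact ih (L.D_smul_cancel hz)

/-- Independence of the monomials `y ^ (n - a) x ^ a` of a fixed degree `n`, by induction on `n`:
`y F - lam n w` reduces the degree and kills only the term `y ^ n`. -/
theorem eq_zero_of_sum (X : KernelAction L N) (n : ℕ) (m : ℕ → M) (hm : ∀ a, m a ∈ N)
    (h : ∑ a ∈ Finset.range (n + 1), L.y ^ (n - a) • L.x ^ a • m a = 0) :
    ∀ a ≤ n, m a = 0 := by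
  induction n generalizing m with
  | zero =>
    intro a ha
    obtain rfl : a = 0 := by omega
    simpa using h
  | succ n ih =>
    have h1 : L.u • ∑ a ∈ Finset.range (n + 1),
        L.y ^ (n - a) • L.x ^ a • ((X.g₁ ^ (n - a) * X.cof (a + 1)) • m (a + 1)) = 0 := by
      have h2 : L.y • X.F • (∑ a ∈ Finset.range (n + 1 + 1), L.y ^ (n + 1 - a) • L.x ^ a • m a) -
          X.lam (n + 1) • L.w • (∑ a ∈ Finset.range (n + 1 + 1),
            L.y ^ (n + 1 - a) • L.x ^ a • m a) = 0 := by
        rw [h]; simp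
      rw [← h2]
      simp only [Finset.smul_sum]
      rw [← Finset.sum_sub_distrib, Finset.sum_range_succ' _ (n + 1)]
      have h3 : ∀ a ≤ n + 1, L.y • X.F • L.y ^ (n + 1 - a) • L.x ^ a • m a -
          X.lam (n + 1) • L.w • L.y ^ (n + 1 - a) • L.x ^ a • m a =
          (X.g₁ ^ (n + 1 - a) * X.cof a) • (L.u : A) • L.y ^ (n + 1 - a) • L.x ^ (a - 1) • m a := by
        intro a ha
        rw [X.yF (hm a), Nat.add_sub_cancel' ha]
        abel
      rw [h3 0 (by omega), X.cof_zero, mul_zero, zero_smul, add_zero]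
      refine Finset.sum_congr rfl fun a ha => ?_
      rw [h3 (a + 1) (by have := Finset.mem_range.1 ha; omega), Nat.add_sub_add_right,
        Nat.add_sub_cancel]
      simp only [Units.smul_def, smul_comm_of_tower]
    have h4 : ∑ a ∈ Finset.range (n + 1),
        L.y ^ (n - a) • L.x ^ a • ((X.g₁ ^ (n - a) * X.cof (a + 1)) • m (a + 1)) = 0 := by
      rw [Units.smul_def, ← L.D_detOne] at h1
      exact L.D_smul_cancel h1
    have h5 := ih _ (fun a => N.smul_mem _ (hm (a + 1))) h4
    have h6 : ∀ a ≤ n, m (a + 1) = 0 := fun a ha =>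
      (smul_eq_zero.1 (h5 a ha)).resolve_left
        (mul_ne_zero (pow_ne_zero _ X.g₁_ne) (X.cof_ne _))
    rw [Finset.sum_range_succ', Finset.sum_eq_zero fun a ha => by
      rw [h6 a (by have := Finset.mem_range.1 ha; omega), smul_zero, smul_zero], zero_add,
      pow_zero, one_smul] at h
    intro a ha
    rcases a with _ | a
    · exact X.eq_zero_of_y_pow (hm 0) _ h
    · exact h6 a (by omega)

/-- Independence of the monomials without `z` and `w`: the eigenvalues of `K` and `Δ` tell the
exponent of the determinant and the total degree in `x` and `y`. -/
theorem indep_xy (X : KernelAction L N) : IndepOver N {i : ℤ × ℕ × ℕ | i.1 ∈ G.detExp}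
    (fun i => L.D i.1 * (L.y ^ i.2.1 * L.x ^ i.2.2)) := by
  classical
  intro t m ht hm h i₀ hi₀
  obtain ⟨c₀, b₀, a₀⟩ := i₀
  let v : ℤ × ℕ × ℕ → M := fun i => (L.D i.1 * (L.y ^ i.2.1 * L.x ^ i.2.2)) • m i
  have hv : ∀ i, v i = L.D i.1 • L.y ^ i.2.1 • L.x ^ i.2.2 • m i := fun i => by
    simp only [v, mul_smul]
  have hK : ∀ i ∈ t, X.K • v i = (X.d ^ i.1 * X.κ ^ (i.2.2 + i.2.1)) • v i := by
    intro i _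
    rw [hv, ← mul_smul, L.mul_D X.d_ne X.Ku, smul_assoc, mul_smul, X.K_pow_smul (hm i),
      smul_comm_of_tower, smul_smul]
  have hΔ : ∀ i ∈ t, X.Δ • v i = (X.d' ^ i.1 * X.δ' ^ (i.2.2 + i.2.1)) • v i := by
    intro i _
    rw [hv, ← mul_smul, L.mul_D X.d'_ne X.Δu, smul_assoc, mul_smul, X.Δ_pow_smul (hm i),
      smul_comm_of_tower, smul_smul]
  have h1 := sum_eigenvectors_eq_zero X.K t v _ hK h (X.d ^ c₀ * X.κ ^ (a₀ + b₀))
  have h2 := sum_eigenvectors_eq_zero X.Δ _ v _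
    (fun i hi => hΔ i (Finset.mem_filter.1 hi).1) h1 (X.d' ^ c₀ * X.δ' ^ (a₀ + b₀))
  rw [Finset.filter_filter] at h2
  have h3 : ∀ i ∈ t, ((X.d ^ i.1 * X.κ ^ (i.2.2 + i.2.1) = X.d ^ c₀ * X.κ ^ (a₀ + b₀) ∧
      X.d' ^ i.1 * X.δ' ^ (i.2.2 + i.2.1) = X.d' ^ c₀ * X.δ' ^ (a₀ + b₀)) ↔
      (i.1 = c₀ ∧ i.2.2 + i.2.1 = a₀ + b₀)) := by
    intro i hi
    refine ⟨fun h => X.separate _ (ht hi) _ (ht hi₀) _ _ h.1 h.2, fun h => ?_⟩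
    rw [h.1, h.2]
    exact ⟨rfl, rfl⟩
  rw [Finset.filter_congr h3] at h2
  -- Rewrite the sum over the monomials of degree `a₀ + b₀` as a sum over the exponent of `x`.
  let m' : ℕ → M := fun a => if (c₀, a₀ + b₀ - a, a) ∈ t then m (c₀, a₀ + b₀ - a, a) else 0
  have h4 : ∑ a ∈ Finset.range (a₀ + b₀ + 1), L.y ^ (a₀ + b₀ - a) • L.x ^ a • m' a = 0 := by
    apply L.D_smul_cancel (c := c₀)
    rw [← h2, Finset.smul_sum]
    symm
    have himg : t.filter (fun i => i.1 = c₀ ∧ i.2.2 + i.2.1 = a₀ + b₀) ⊆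
        (Finset.range (a₀ + b₀ + 1)).image fun a => (c₀, a₀ + b₀ - a, a) := by
      rintro ⟨c, b, a⟩ hi
      obtain ⟨-, hc, hab⟩ := Finset.mem_filter.1 hi
      simp only at hc hab
      refine Finset.mem_image.2 ⟨a, Finset.mem_range.2 (by omega), ?_⟩
      rw [hc]
      congr 2
      omega
    have hinj : Set.InjOn (fun a : ℕ => (c₀, a₀ + b₀ - a, a))
        (Finset.range (a₀ + b₀ + 1)) := fun a _ a' _ h => by
      simpa using (Prod.ext_iff.1 (Prod.ext_iff.1 h).2).2
    have hsum : ∑ i ∈ t.filter (fun i => i.1 = c₀ ∧ i.2.2 + i.2.1 = a₀ + b₀), v i =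
        ∑ i ∈ (Finset.range (a₀ + b₀ + 1)).image (fun a => (c₀, a₀ + b₀ - a, a)),
          if i ∈ t then v i else 0 := by
      rw [← Finset.sum_subset himg]
      · exact Finset.sum_congr rfl fun i hi => (if_pos (Finset.mem_filter.1 hi).1).symm
      · intro i hi hni
        refine if_neg fun hit => hni ?_
        obtain ⟨a, ha, rfl⟩ := Finset.mem_image.1 hi
        have := Finset.mem_range.1 ha
        exact Finset.mem_filter.2 ⟨hit, rfl, by simp only; omega⟩
    rw [hsum, Finset.sum_image hinj]
    refine Finset.sum_congr rfl fun a _ => ?_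
    simp only [m']
    split_ifs
    · rw [hv]
    · simp
  have h5 := X.eq_zero_of_sum (a₀ + b₀) m' (fun a => by
    simp only [m']
    split_ifs
    · exact hm _
    · exact N.zero_mem) h4 a₀ (by omega)
  simpa [m', hi₀] using h5

/-- The coefficient in `E w ^ e m = coef e • y w ^ (e - 1) m`. -/
def coef (X : KernelAction L N) (e : ℕ) : k :=
  X.e₄ * ((X.e₃ * L.h) ^ e - X.k₁ ^ e) / (X.e₃ * L.h - X.k₁)

theorem coef_ne (X : KernelAction L N) (e : ℕ) : X.coef (e + 1) ≠ 0 := by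
  have h1 := X.pow_ne 1 le_rfl
  rw [pow_one, pow_one] at h1
  exact div_ne_zero (mul_ne_zero X.e₄_ne (sub_ne_zero.2 (X.pow_ne _ (by omega))))
    (sub_ne_zero.2 h1)

theorem coef_succ (X : KernelAction L N) (e : ℕ) :
    X.coef (e + 1) = X.e₃ * L.h * X.coef e + X.e₄ * X.k₁ ^ e := by
  have h1 := X.pow_ne 1 le_rfl
  rw [pow_one, pow_one] at h1
  have h2 := sub_ne_zero.2 h1
  rw [coef, coef, mul_div_assoc', div_add' _ _ _ h2]
  congr 1
  ring

theorem K_w_pow (X : KernelAction L N) {m : M} (hm : m ∈ N) (e : ℕ) :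
    X.K • L.w ^ e • m = X.k₁ ^ e • L.w ^ e • m := by
  rw [← mul_smul, mul_pow_of_mul X.Kw, smul_assoc, mul_smul, X.K_N m hm]

theorem E_w_pow (X : KernelAction L N) {m : M} (hm : m ∈ N) (e : ℕ) :
    X.E • L.w ^ (e + 1) • m = X.coef (e + 1) • L.y • L.w ^ e • m := by
  induction e with
  | zero =>
    have h1 := X.pow_ne 1 le_rfl
    rw [pow_one, pow_one] at h1
    have : X.coef 1 = X.e₄ := by
      rw [coef, pow_one, pow_one, mul_div_assoc, div_self (sub_ne_zero.2 h1), mul_one]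
    rw [zero_add, this, pow_one, ← mul_smul, X.Ew, add_smul, smul_assoc, smul_assoc, mul_smul,
      mul_smul, X.E_N m hm, X.K_N m hm]
    simp
  | succ e ih =>
    rw [pow_succ', mul_smul, ← mul_smul X.E, X.Ew, add_smul, smul_assoc, smul_assoc, mul_smul,
      mul_smul, ih, X.K_w_pow hm, X.coef_succ (e + 1), smul_comm_of_tower, ← mul_smul L.w L.y,
      L.rel.wy, smul_assoc, mul_smul, smul_comm_of_tower _ L.y, ← mul_smul L.w, ← pow_succ',
      smul_smul, smul_smul, smul_smul X.e₄, ← add_smul]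
    congr 1
    ring

theorem E_pure (X : KernelAction L N) {m : M} (hm : m ∈ N) (c : ℤ) (b a e : ℕ) :
    X.E • L.pure (c, b, a, e + 1) • m =
      (X.d ^ c * X.e₁ ^ b * X.e₂ ^ a * X.coef (e + 1) * L.h⁻¹ ^ a) •
        L.pure (c, b + 1, a, e) • m := by
  have hxy : L.x * L.y = L.h⁻¹ • (L.y * L.x) := by
    rw [L.rel.yx, inv_smul_smul₀ L.h_ne]
  have hyx : ∀ a : ℕ, L.x ^ a * L.y = L.h⁻¹ ^ a • (L.y * L.x ^ a) := by
    intro a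
    induction a with
    | zero => simp
    | succ a ih =>
      rw [pow_succ', mul_assoc, ih, mul_smul_comm, ← mul_assoc, hxy, smul_mul_assoc, smul_smul,
        ← pow_succ, mul_assoc]
  simp only [Letters.pure, mul_smul]
  rw [← mul_smul X.E, L.mul_D X.d_ne X.Eu, smul_assoc, mul_smul, ← mul_smul X.E,
    mul_pow_of_mul X.Ey, smul_assoc, mul_smul, ← mul_smul X.E, mul_pow_of_mul X.Ex, smul_assoc,
    mul_smul, X.E_w_pow hm]
  simp only [smul_comm_of_tower (A := A)]
  rw [← mul_smul (L.x ^ a), hyx, pow_succ]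
  simp only [smul_assoc, smul_comm_of_tower (A := A), mul_smul]

theorem E_pure_zero (X : KernelAction L N) {m : M} (hm : m ∈ N) (c : ℤ) (b a : ℕ) :
    X.E • L.pure (c, b, a, 0) • m = 0 := by
  simp only [Letters.pure, mul_smul, pow_zero, one_smul]
  rw [← mul_smul X.E, L.mul_D X.d_ne X.Eu, smul_assoc, mul_smul, X.E_pow_smul hm]
  simp

theorem E_pow_pure (X : KernelAction L N) (e : ℕ) (c : ℤ) (b a : ℕ) : ∃ r : k, r ≠ 0 ∧
    ∀ m ∈ N, X.E ^ e • L.pure (c, b, a, e) • m = r • L.pure (c, b + e, a, 0) • m := by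
  induction e generalizing b with
  | zero => exact ⟨1, one_ne_zero, fun m _ => by simp⟩
  | succ e ih =>
    obtain ⟨r, hr, h⟩ := ih (b + 1)
    refine ⟨X.d ^ c * X.e₁ ^ b * X.e₂ ^ a * X.coef (e + 1) * L.h⁻¹ ^ a * r, ?_, fun m hm => ?_⟩
    · exact mul_ne_zero (mul_ne_zero (mul_ne_zero (mul_ne_zero (mul_ne_zero
        (zpow_ne_zero _ X.d_ne) (pow_ne_zero _ X.e₁_ne)) (pow_ne_zero _ X.e₂_ne)) (X.coef_ne e))
        (pow_ne_zero _ (inv_ne_zero L.h_ne))) hr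
    · rw [pow_succ, mul_smul, X.E_pure hm, smul_comm_of_tower, h m hm, smul_smul,
        show b + 1 + e = b + (e + 1) by omega]

theorem E_pow_pure_zero (X : KernelAction L N) (e j : ℕ) (c : ℤ) (b a : ℕ) {m : M} (hm : m ∈ N)
    (hj : e < j) : X.E ^ j • L.pure (c, b, a, e) • m = 0 := by
  obtain ⟨i, rfl⟩ : ∃ i, j = i + 1 + e := ⟨j - 1 - e, by omega⟩
  obtain ⟨r, -, h⟩ := X.E_pow_pure e c b a
  rw [pow_add, mul_smul, h m hm, smul_comm_of_tower, pow_succ, mul_smul, X.E_pure_zero hm,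
    smul_zero, smul_zero]

/-- Independence of the monomials without `z`: a power of `E` isolates the terms with the
largest exponent of `w`. -/
theorem indep_pure (X : KernelAction L N) :
    IndepOver N {i : ℤ × ℕ × ℕ × ℕ | i.1 ∈ G.detExp} L.pure := by
  classical
  intro t m ht hm h
  by_contra hcon
  push Not at hcon
  obtain ⟨i₁, hi₁, hne₁⟩ := hcon
  obtain ⟨i₀, hi₀, hmax⟩ := Finset.exists_max_image (t.filter fun i => m i ≠ 0)
    (fun i => i.2.2.2) ⟨i₁, Finset.mem_filter.2 ⟨hi₁, hne₁⟩⟩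
  obtain ⟨hi₀t, hne₀⟩ := Finset.mem_filter.1 hi₀
  have hex : ∀ i : ℤ × ℕ × ℕ × ℕ, ∃ r : k, r ≠ 0 ∧ ∀ m ∈ N, X.E ^ i.2.2.2 • L.pure i • m =
      r • L.pure (i.1, i.2.1 + i.2.2.2, i.2.2.1, 0) • m := fun i => X.E_pow_pure _ _ _ _
  choose r hr hE using hex
  set e₀ := i₀.2.2.2
  have h1 : ∑ i ∈ t.filter (fun i => i.2.2.2 = e₀),
      (L.D i.1 * (L.y ^ (i.2.1 + e₀) * L.x ^ i.2.2.1)) • (r i • m i) = 0 := by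
    have h2 : X.E ^ e₀ • ∑ i ∈ t, L.pure i • m i = 0 := by rw [h, smul_zero]
    rw [← h2, Finset.smul_sum, Finset.sum_filter]
    refine Finset.sum_congr rfl fun i hi => ?_
    split_ifs with hie
    · rw [← hie, hE i _ (hm i), smul_comm_of_tower]
      simp [Letters.pure]
    · by_cases hmi : m i = 0
      · simp [hmi]
      · have := hmax i (Finset.mem_filter.2 ⟨hi, hmi⟩)
        exact (X.E_pow_pure_zero _ _ _ _ _ (hm i) (lt_of_le_of_ne this hie)).symm
  have h3 := X.indep_xy.reindex (t.filter (fun i => i.2.2.2 = e₀))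
    (fun i => (i.1, i.2.1 + e₀, i.2.2.1)) (by
      rintro ⟨c, b, a, e⟩ hi ⟨c', b', a', e'⟩ hi' heq
      have hi2 := (Finset.mem_filter.1 hi).2
      have hi2' := (Finset.mem_filter.1 hi').2
      simp only [Prod.mk.injEq] at heq hi2 hi2' ⊢
      omega)
    (fun i hi => ht (Finset.mem_filter.1 hi).1) (fun i => r i • m i)
    (fun i => N.smul_mem _ (hm i)) h1 i₀ (Finset.mem_filter.2 ⟨hi₀t, rfl⟩)
  exact hne₀ ((smul_eq_zero.1 h3).resolve_left (hr i₀))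

end KernelAction

end KernelAction


section EliminateZ

set_option linter.unusedSectionVars false

variable {G : Gauge} {k A M : Type*} [Field k] [Ring A] [Algebra k A] [AddCommGroup M] [Module k M]
  [Module A M] [IsScalarTower k A M]

namespace Letters

variable (L : Letters G k A)

/-- The span of the monomials without `z` in which the exponent of `x` is less than `n`. -/
def lowSpan (n : ℕ) : Submodule k A :=
  Submodule.span k (L.pure '' {l | l.1 ∈ G.detExp ∧ l.2.2.1 < n})

variable {L}

theorem pure_mem_lowSpan {c : ℤ} (hc : c ∈ G.detExp) (b e : ℕ) {a n : ℕ} (h : a < n) :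
    L.pure (c, b, a, e) ∈ L.lowSpan n := Submodule.subset_span ⟨_, ⟨hc, h⟩, rfl⟩

theorem map_lowSpan {n : ℕ} {S : Submodule k A} (f : A →ₗ[k] A)
    (H : ∀ c ∈ G.detExp, ∀ b a e : ℕ, a < n → f (L.pure (c, b, a, e)) ∈ S) {v : A}
    (hv : v ∈ L.lowSpan n) : f v ∈ S := by
  have : L.lowSpan n ≤ S.comap f := by
    refine Submodule.span_le.2 ?_
    rintro _ ⟨⟨c, b, a, e⟩, ⟨hc, ha⟩, rfl⟩
    exact H c hc b a e ha
  exact this hv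

theorem D_mul_lowSpan {c : ℤ} (hc : c ∈ G.detExp) {n : ℕ} {v : A} (hv : v ∈ L.lowSpan n) :
    L.D c * v ∈ L.lowSpan n := by
  refine map_lowSpan (LinearMap.mulLeft k (L.D c)) (fun c' hc' b a e h => ?_) hv
  rw [LinearMap.mulLeft_apply, pure, ← mul_assoc, ← D_add]
  exact pure_mem_lowSpan (add_mem hc hc') b e h

theorem y_pow_mul_lowSpan (f : ℕ) {n : ℕ} {v : A} (hv : v ∈ L.lowSpan n) :
    L.y ^ f * v ∈ L.lowSpan n := by
  refine map_lowSpan (LinearMap.mulLeft k (L.y ^ f)) (fun c hc b a e h => ?_) hv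
  have hu : (L.u : A) * L.y ^ f = L.y ^ f * L.u :=
    ((show Commute (L.u : A) L.y from L.rel.δy).pow_right f).eq
  rw [LinearMap.mulLeft_apply, pure, ← mul_assoc, L.commute_D hu, mul_assoc, ← mul_assoc (L.y ^ f),
    ← pow_add]
  exact pure_mem_lowSpan hc (f + b) e h

theorem x_mul_pure (c : ℤ) (b a e : ℕ) :
    L.x * L.pure (c, b, a, e) = L.h⁻¹ ^ b • L.pure (c, b, a + 1, e) := by
  have hxy : L.x * L.y = L.h⁻¹ • (L.y * L.x) := by
    rw [L.rel.yx, inv_smul_smul₀ L.h_ne]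
  rw [pure, ← mul_assoc, L.commute_D L.rel.δx, mul_assoc, ← mul_assoc L.x, mul_pow_of_mul hxy,
    smul_mul_assoc, mul_smul_comm, mul_assoc, ← mul_assoc L.x, ← pow_succ', pure]

theorem x_mul_lowSpan {n : ℕ} {v : A} (hv : v ∈ L.lowSpan n) : L.x * v ∈ L.lowSpan (n + 1) := by
  refine map_lowSpan (LinearMap.mulLeft k L.x) (fun c hc b a e h => ?_) hv
  rw [LinearMap.mulLeft_apply, x_mul_pure]
  exact Submodule.smul_mem _ _ (pure_mem_lowSpan hc b e (by omega))

theorem lowSpan_mul_w_pow (f : ℕ) {n : ℕ} {v : A} (hv : v ∈ L.lowSpan n) :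
    v * L.w ^ f ∈ L.lowSpan n := by
  refine map_lowSpan (LinearMap.mulRight k (L.w ^ f)) (fun c hc b a e h => ?_) hv
  rw [LinearMap.mulRight_apply, pure, mul_assoc, mul_assoc, mul_assoc, ← pow_add]
  exact pure_mem_lowSpan hc b (e + f) h

theorem lowSpan_mono {m n : ℕ} (h : m ≤ n) : L.lowSpan m ≤ L.lowSpan n :=
  Submodule.span_mono (Set.image_mono fun _ hl => ⟨hl.1, hl.2.trans_le h⟩)

theorem x_pow_mul_w_pow_mem {a n : ℕ} (e : ℕ) (h : a < n) : L.x ^ a * L.w ^ e ∈ L.lowSpan n := by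
  have := pure_mem_lowSpan (L := L) (c := 0) (zero_mem _) 0 e h
  simpa [pure, D_zero] using this

theorem w_mul_x_pow (a : ℕ) : L.w * L.x ^ a - L.p ^ a • (L.x ^ a * L.w) ∈ L.lowSpan a := by
  induction a with
  | zero => simp
  | succ a ih =>
    have heq : L.w * L.x ^ (a + 1) - L.p ^ (a + 1) • (L.x ^ (a + 1) * L.w) =
        L.p • (L.x * (L.w * L.x ^ a - L.p ^ a • (L.x ^ a * L.w))) + L.γ • (L.u * L.x ^ a) +
          L.γ' • (L.y ^ 2 * L.x ^ a) := by
      rw [pow_succ' L.x, ← mul_assoc, L.rel.wx, sq, pow_succ' L.p]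
      simp only [add_mul, smul_mul_assoc, mul_sub, smul_sub, mul_smul_comm, smul_smul, mul_assoc]
      abel
    rw [heq]
    have hx : L.x ^ a ∈ L.lowSpan (a + 1) := by
      simpa using x_pow_mul_w_pow_mem (L := L) 0 (Nat.lt_succ_self a)
    refine add_mem (add_mem (Submodule.smul_mem _ _ (x_mul_lowSpan ih))
      (Submodule.smul_mem _ _ ?_)) (Submodule.smul_mem _ _ (y_pow_mul_lowSpan 2 hx))
    rw [← D_detOne]
    exact D_mul_lowSpan G.detOne_mem hx

/-- As `y z = det + η x w`, the leading term of `y ^ f z ^ f x ^ a w ^ e` is a multiple of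
`x ^ (a + f) w ^ (e + f)`. -/
theorem y_pow_z_pow (f a e : ℕ) : ∃ r : k, r ≠ 0 ∧
    L.y ^ f * L.z ^ f * (L.x ^ a * L.w ^ e) - r • (L.x ^ (a + f) * L.w ^ (e + f)) ∈
      L.lowSpan (a + f) := by
  induction f generalizing a e with
  | zero => exact ⟨1, one_ne_zero, by simp⟩
  | succ f ih =>
    have hyz : Commute L.y L.z := L.rel.yz.trans L.rel.zy.symm
    -- By induction, `y ^ f z ^ f` raises the exponent of `x` by at most `f`.
    have hlow : ∀ {n : ℕ} {v : A}, v ∈ L.lowSpan n →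
        L.y ^ f * L.z ^ f * v ∈ L.lowSpan (n + f) := by
      intro n v hv
      refine map_lowSpan (LinearMap.mulLeft k (L.y ^ f * L.z ^ f)) (fun c hc b a e h => ?_) hv
      have hu : (L.u : A) * (L.y ^ f * L.z ^ f) = L.y ^ f * L.z ^ f * L.u :=
        (((show Commute (L.u : A) L.y from L.rel.δy).pow_right f).mul_right
          ((show Commute (L.u : A) L.z from L.rel.δz).pow_right f)).eq
      have hy : L.y ^ f * L.z ^ f * L.y ^ b = L.y ^ b * (L.y ^ f * L.z ^ f) :=
        (((Commute.refl L.y).pow_pow f b).mul_left (hyz.symm.pow_pow f b)).eq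
      obtain ⟨r, -, hr⟩ := ih a e
      have hmem : L.y ^ f * L.z ^ f * (L.x ^ a * L.w ^ e) ∈ L.lowSpan (n + f) := by
        rw [← sub_add_cancel (L.y ^ f * L.z ^ f * (L.x ^ a * L.w ^ e))
          (r • (L.x ^ (a + f) * L.w ^ (e + f)))]
        exact add_mem (lowSpan_mono (by omega) hr)
          (Submodule.smul_mem _ _ (x_pow_mul_w_pow_mem _ (by omega)))
      rw [LinearMap.mulLeft_apply, pure, ← mul_assoc, L.commute_D hu.symm.symm, mul_assoc,
        ← mul_assoc (L.y ^ f * L.z ^ f), hy, mul_assoc]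
      exact D_mul_lowSpan hc (y_pow_mul_lowSpan b hmem)
    obtain ⟨r, hr, hmem⟩ := ih (a + 1) (e + 1)
    refine ⟨L.η * L.p ^ a * r, mul_ne_zero (mul_ne_zero L.η_ne (pow_ne_zero _ L.p_ne)) hr, ?_⟩
    have h1 : L.y ^ (f + 1) * L.z ^ (f + 1) = L.y ^ f * L.z ^ f * (L.u + L.η • (L.x * L.w)) := by
      rw [← L.rel.yz, pow_succ, pow_succ, mul_assoc, ← mul_assoc L.y, (hyz.pow_right f).eq]
      simp only [mul_assoc]
    have heq : L.y ^ (f + 1) * L.z ^ (f + 1) * (L.x ^ a * L.w ^ e) -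
        (L.η * L.p ^ a * r) • (L.x ^ (a + (f + 1)) * L.w ^ (e + (f + 1))) =
        L.y ^ f * L.z ^ f * (L.u * (L.x ^ a * L.w ^ e)) +
        L.η • (L.y ^ f * L.z ^ f *
          (L.x * (L.w * L.x ^ a - L.p ^ a • (L.x ^ a * L.w)) * L.w ^ e)) +
        (L.η * L.p ^ a) • (L.y ^ f * L.z ^ f * (L.x ^ (a + 1) * L.w ^ (e + 1)) -
          r • (L.x ^ (a + 1 + f) * L.w ^ (e + 1 + f))) := by
      rw [h1, show a + (f + 1) = a + 1 + f by omega, show e + (f + 1) = e + 1 + f by omega]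
      simp only [mul_add, add_mul, smul_mul_assoc, mul_sub, sub_mul, smul_sub, mul_smul_comm,
        smul_smul, mul_assoc, pow_succ' L.x a, pow_succ' L.w e]
      abel
    rw [heq]
    refine add_mem (add_mem ?_ (Submodule.smul_mem _ _ ?_)) (Submodule.smul_mem _ _ ?_)
    · refine lowSpan_mono (by omega) (hlow (n := a + 1) ?_)
      rw [← D_detOne]
      exact D_mul_lowSpan G.detOne_mem (x_pow_mul_w_pow_mem _ (by omega))
    · exact lowSpan_mono (by omega)
        (hlow (n := a + 1) (lowSpan_mul_w_pow _ (x_mul_lowSpan (w_mul_x_pow a))))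
    · exact lowSpan_mono (by omega) hmem

end Letters

/-- The ordered monomials are independent over the joint kernel: multiplication by a power of `y`
turns them into a family which is triangular with respect to the monomials without `z`. -/
theorem KernelAction.indep {L : Letters G k A} {N : Submodule k M} (X : KernelAction L N) :
    IndepOver N {i : Expo | i.1 ∈ G.detExp} L.mono := by
  classical
  intro t m ht hm h
  obtain ⟨J, hJ⟩ : ∃ J, ∀ i ∈ t, i.2.1.natAbs ≤ J :=
    ⟨t.sup fun i => i.2.1.natAbs, fun i hi => Finset.le_sup (f := fun i => i.2.1.natAbs) hi⟩
  let τ : Expo → ℤ × ℕ × ℕ × ℕ := fun i =>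
    (i.1, (J + i.2.1).toNat, i.2.2.1 + (-i.2.1).toNat, i.2.2.2 + (-i.2.1).toNat)
  refine X.indep_pure.triangular t (fun i => L.y ^ J * L.mono i) τ ?_ (fun l => l.2.2.1)
    ?_ m hm ?_
  · rintro ⟨c, j, a, e⟩ hi ⟨c', j', a', e'⟩ hi' heq
    have h1 := hJ _ hi
    have h2 := hJ _ hi'
    simp only [τ, Prod.mk.injEq] at heq h1 h2 ⊢
    omega
  · rintro ⟨c, j, a, e⟩ hi
    have hj := hJ _ hi
    have hu : (L.u : A) * L.y ^ J = L.y ^ J * L.u :=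
      ((show Commute (L.u : A) L.y from L.rel.δy).pow_right J).eq
    have hmono : ∀ v : A, L.y ^ J * (L.D c * v) = L.D c * (L.y ^ J * v) := fun v => by
      rw [← mul_assoc, L.commute_D hu, mul_assoc]
    refine ⟨ht hi, ?_⟩
    rcases j with n | n
    · have hτ : τ (c, Int.ofNat n, a, e) = (c, J + n, a, e) := by
        simp only [τ, Prod.mk.injEq, Int.ofNat_eq_natCast, true_and]
        omega
      refine ⟨1, one_ne_zero, ?_⟩
      rw [hτ, one_smul, Letters.mono, hmono, Letters.yz, ← mul_assoc (L.y ^ J), ← pow_add,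
        Letters.pure, sub_self]
      exact zero_mem _
    · rw [Int.natAbs_negSucc] at hj
      obtain ⟨b, rfl⟩ : ∃ b, J = b + (n + 1) := ⟨J - (n + 1), by omega⟩
      have hτ : τ (c, Int.negSucc n, a, e) = (c, b, a + (n + 1), e + (n + 1)) := by
        simp only [τ, Prod.mk.injEq, true_and]
        omega
      obtain ⟨r, hr, hmem⟩ := L.y_pow_z_pow (n + 1) a e
      refine ⟨r, hr, ?_⟩
      rw [hτ, Letters.mono, hmono, Letters.yz, Letters.pure, ← mul_smul_comm, ← mul_smul_comm,
        ← mul_sub, pow_add, mul_assoc, ← mul_sub, ← mul_assoc (L.y ^ (n + 1))]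
      exact Letters.D_mul_lowSpan (ht hi) (Letters.y_pow_mul_lowSpan b hmem)
  · simp only [mul_smul]
    rw [← Finset.smul_sum, h, smul_zero]

end EliminateZ


/-! ### Moving elements past the monomials -/

section Exchange

set_option linter.unusedSectionVars false

variable {G : Gauge} {k A A' O M : Type*} [Field k] [Ring A] [Algebra k A] [Ring A'] [Algebra k A']
  [Ring O] [Algebra k O] [AddCommGroup M] [Module k M] [Module A M] [IsScalarTower k A M]

/-- The elements that lie in some power of `W`. -/
def powUnion (W : Submodule k O) (hW : 1 ≤ W) : Subalgebra k O where
  carrier := {b | ∃ n, b ∈ W ^ n}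
  mul_mem' := by
    rintro a b ⟨m, hm⟩ ⟨n, hn⟩
    exact ⟨m + n, pow_add W m n ▸ Submodule.mul_mem_mul hm hn⟩
  add_mem' := by
    rintro a b ⟨m, hm⟩ ⟨n, hn⟩
    exact ⟨m + n, add_mem (pow_le_pow_right₀ hW (by omega) hm)
      (pow_le_pow_right₀ hW (by omega) hn)⟩
  algebraMap_mem' c := ⟨0, by rw [pow_zero]; exact Submodule.algebraMap_mem c⟩

/-- The elements that can be moved past the powers of `W`, modulo larger powers of `W`, so as to
act on subspaces of `N` through `A'`. -/
def actSubalgebra (φ : A' →ₐ[k] A) (N : Submodule k M) (W : Submodule k A) (hW : 1 ≤ W)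
    (hst : ∀ a, ∀ m ∈ N, φ a • m ∈ N) : Subalgebra k A where
  carrier := {a | ∃ l, ∃ V : Submodule k A', V.FG ∧ ∀ (n : ℕ) (U : Submodule k M), U ≤ N →
    ∀ x ∈ W ^ n • U, a • x ∈ W ^ (n + l) • V.map φ.toLinearMap • U}
  mul_mem' := by
    rintro a b ⟨l, V, hV, h⟩ ⟨l', V', hV', h'⟩
    refine ⟨l' + l, V * V', hV.mul hV', fun n U hU x hx => ?_⟩
    have hU' : V'.map φ.toLinearMap • U ≤ N := Submodule.smul_le.2 (by
      rintro _ ⟨c, -, rfl⟩ u hu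
      exact hst c u (hU hu))
    rw [mul_smul, Submodule.map_mul, mul_smul_submodule, ← add_assoc]
    exact h (n + l') _ hU' _ (h' n U hU x hx)
  add_mem' := by
    rintro a b ⟨l, V, hV, h⟩ ⟨l', V', hV', h'⟩
    refine ⟨l + l', V ⊔ V', hV.sup hV', fun n U hU x hx => ?_⟩
    rw [add_smul]
    refine add_mem (Submodule.smul_mono ?_ (Submodule.smul_mono_left ?_) (h n U hU x hx))
      (Submodule.smul_mono ?_ (Submodule.smul_mono_left ?_) (h' n U hU x hx))
    · exact pow_le_pow_right₀ hW (by omega)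
    · exact Submodule.map_mono le_sup_left
    · exact pow_le_pow_right₀ hW (by omega)
    · exact Submodule.map_mono le_sup_right
  algebraMap_mem' c := by
    refine ⟨0, 1, ⟨{1}, by simp [Submodule.one_eq_span]⟩, fun n U _ x hx => ?_⟩
    rw [algebraMap_smul, Submodule.map_one, one_smul_submodule]
    exact Submodule.smul_mem _ c hx

variable {φ : A' →ₐ[k] A} {N : Submodule k M} {W : Submodule k A} {hW : 1 ≤ W}
  {hst : ∀ a, ∀ m ∈ N, φ a • m ∈ N}

theorem mem_actSubalgebra_of_mem_pow {a : A} {l : ℕ} (h : a ∈ W ^ l) :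
    a ∈ actSubalgebra φ N W hW hst := by
  refine ⟨l, 1, ⟨{1}, by simp [Submodule.one_eq_span]⟩, fun n U _ x hx => ?_⟩
  rw [Submodule.map_one, one_smul_submodule, add_comm, pow_add, mul_smul_submodule]
  exact Submodule.smul_mem_smul h hx

theorem mem_actSubalgebra_of_exchange {X : Submodule k A} (V : Submodule k A') (hV : V.FG)
    (h : X * W ≤ W * X) (hX : ∀ U ≤ N, X • U ≤ V.map φ.toLinearMap • U) {a : A} (ha : a ∈ X) :
    a ∈ actSubalgebra φ N W hW hst := by
  have hn : ∀ n : ℕ, X * W ^ n ≤ W ^ n * X := by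
    intro n
    induction n with
    | zero => simp
    | succ n ih =>
      rw [pow_succ, ← mul_assoc]
      refine (mul_le_mul' ih le_rfl).trans ?_
      rw [mul_assoc, mul_assoc]
      exact mul_le_mul' le_rfl h
  refine ⟨0, V, hV, fun n U hU x hx => ?_⟩
  have h1 : a • x ∈ X • W ^ n • U := Submodule.smul_mem_smul ha hx
  rw [← mul_smul_submodule] at h1
  have h2 := Submodule.smul_mono_left (hn n) h1
  rw [mul_smul_submodule] at h2
  exact Submodule.smul_mono le_rfl (hX U hU) h2

/-- The span of the entries of a matrix. -/
def entrySpan (X : Mat2 A) : Submodule k A := Submodule.span k (Set.range fun p : Fin 2 × Fin 2 =>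
  X p.1 p.2)

theorem fg_entrySpan (X : Mat2 A) : (entrySpan (k := k) X).FG :=
  Submodule.fg_span (Set.finite_range _)

theorem entry_mem (X : Mat2 A) (i j : Fin 2) : X i j ∈ entrySpan (k := k) X :=
  Submodule.subset_span ⟨(i, j), rfl⟩

theorem mul_entry_mem (X Y : Mat2 A) (i j a b : Fin 2) :
    X i j * Y a b ∈ entrySpan (k := k) X * entrySpan Y :=
  Submodule.mul_mem_mul (entry_mem X i j) (entry_mem Y a b)

/-- The entries of `X` and its determinant `qdet c X` can be moved to the right of the entries of
`Y` and of its determinant `qdet c' Y`. -/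
structure Exchange (c c' : k) (X Y : Mat2 A) : Prop where
  entry : ∀ i j a b, X i j * Y a b ∈ entrySpan (k := k) Y * entrySpan X
  entry_det : ∃ r : k, r ≠ 0 ∧ ∀ i j, X i j * qdet c' Y = r • (qdet c' Y * X i j)
  det_entry : ∃ r : k, r ≠ 0 ∧ ∀ a b, qdet c X * Y a b = r • (Y a b * qdet c X)

theorem mul_inv_of_mul {x u v : A} {r : k} (hr : r ≠ 0) (huv : u * v = 1) (hvu : v * u = 1)
    (h : x * u = r • (u * x)) : x * v = r⁻¹ • (v * x) := by
  have h1 : v * (x * u) * v = r • (v * (u * x) * v) := by rw [h, mul_smul_comm, smul_mul_assoc]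
  rw [← mul_assoc, mul_assoc, huv, mul_one, ← mul_assoc, hvu, one_mul] at h1
  rw [h1, inv_smul_smul₀ hr]

theorem inv_mul_of_mul {x u v : A} {r : k} (hr : r ≠ 0) (huv : u * v = 1) (hvu : v * u = 1)
    (h : u * x = r • (x * u)) : v * x = r⁻¹ • (x * v) := by
  have h1 : v * (u * x) * v = r • (v * (x * u) * v) := by rw [h, mul_smul_comm, smul_mul_assoc]
  rw [← mul_assoc, hvu, one_mul, ← mul_assoc, mul_assoc (v * x), huv, mul_one] at h1
  rw [h1, inv_smul_smul₀ hr]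

theorem mul_qdet_of_mul {δ : A} {Y : Mat2 A} {r : k} (h : ∀ a b, δ * Y a b = r • (Y a b * δ))
    (c : k) : δ * qdet c Y = r ^ 2 • (qdet c Y * δ) := by
  have h2 : ∀ a b i j, δ * (Y a b * Y i j) = r ^ 2 • (Y a b * Y i j * δ) := by
    intro a b i j
    rw [← mul_assoc, h, smul_mul_assoc, mul_assoc, h, mul_smul_comm, smul_smul, ← sq, mul_assoc]
  rw [qdet, mul_sub, mul_smul_comm, h2, h2, sub_mul, smul_sub, smul_mul_assoc, smul_comm]

theorem span_exchange {S T : Set A}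
    (h : ∀ s ∈ S, ∀ t ∈ T, s * t ∈ Submodule.span k T * Submodule.span k S) :
    Submodule.span k S * Submodule.span k T ≤ Submodule.span k T * Submodule.span k S := by
  rw [Submodule.span_mul_span]
  refine Submodule.span_le.2 ?_
  rintro _ ⟨s, hs, t, ht, rfl⟩
  exact h s hs t ht

/-- The space spanned by `1`, the entries of `Y`, and `v`. -/
def spaceOf (Y : Mat2 A) (v : A) : Submodule k A :=
  Submodule.span k (insert 1 (insert v (Set.range fun p : Fin 2 × Fin 2 => Y p.1 p.2)))

theorem Exchange.entrySpan_mul_le {c c' : k} {X Y : Mat2 A} (H : Exchange c c' X Y) {v : A}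
    (h₁ : qdet c' Y * v = 1) (h₂ : v * qdet c' Y = 1) :
    entrySpan X * spaceOf Y v ≤ spaceOf (k := k) Y v * entrySpan X := by
  refine span_exchange ?_
  rintro _ ⟨⟨i, j⟩, rfl⟩ t ht
  change X i j * t ∈ _
  rcases ht with rfl | rfl | ⟨⟨a, b⟩, rfl⟩
  · have := Submodule.mul_mem_mul (Submodule.subset_span (R := k) (Set.mem_insert (1 : A)
      (insert v (Set.range fun p : Fin 2 × Fin 2 => Y p.1 p.2)))) (entry_mem X i j)
    rwa [one_mul, ← mul_one (X i j)] at this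
  · obtain ⟨r, hr, h⟩ := H.entry_det
    rw [mul_inv_of_mul hr h₁ h₂ (h i j)]
    exact Submodule.smul_mem _ _
      (Submodule.mul_mem_mul (Submodule.subset_span (by simp)) (entry_mem X i j))
  · have hle : entrySpan Y ≤ spaceOf (k := k) Y v :=
      Submodule.span_mono fun x hx => Or.inr (Or.inr hx)
    exact (mul_le_mul' hle le_rfl : _ ≤ spaceOf (k := k) Y v * entrySpan X) (H.entry i j a b)

theorem Exchange.detInv_mul_le {c c' : k} {X Y : Mat2 A} (H : Exchange c c' X Y) {v w : A}
    (h₁ : qdet c' Y * v = 1) (h₂ : v * qdet c' Y = 1) (h₃ : qdet c X * w = 1)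
    (h₄ : w * qdet c X = 1) :
    Submodule.span k {w} * spaceOf Y v ≤ spaceOf (k := k) Y v * Submodule.span k {w} := by
  obtain ⟨r, hr, h⟩ := H.det_entry
  have hw : w ∈ Submodule.span k {w} := Submodule.mem_span_singleton_self w
  have key : ∀ a b, w * Y a b = r⁻¹ • (Y a b * w) := fun a b => inv_mul_of_mul hr h₃ h₄ (h a b)
  refine span_exchange ?_
  rintro x hx t ht
  rw [Set.mem_singleton_iff.1 hx]
  rcases ht with rfl | rfl | ⟨⟨a, b⟩, rfl⟩
  · have := Submodule.mul_mem_mul (Submodule.subset_span (R := k) (Set.mem_insert (1 : A)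
      (insert v (Set.range fun p : Fin 2 × Fin 2 => Y p.1 p.2)))) hw
    rw [mul_one]
    rwa [one_mul] at this
  · rw [mul_inv_of_mul (pow_ne_zero 2 (inv_ne_zero hr)) h₁ h₂ (mul_qdet_of_mul key c')]
    exact Submodule.smul_mem _ _ (Submodule.mul_mem_mul (Submodule.subset_span (by simp)) hw)
  · change w * Y a b ∈ _
    rw [key]
    exact Submodule.smul_mem _ _ (Submodule.mul_mem_mul
      (Submodule.subset_span (Or.inr (Or.inr ⟨(a, b), rfl⟩))) hw)

/-- A matrix over `A'` whose image can be moved past `Y` acts on `N` through `A'`. -/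
theorem Exchange.mem_actSubalgebra {c c' : k} {X : Mat2 A'} {Y : Mat2 A} {v : A}
    (H : Exchange c c' (X.map φ) Y) (h₁ : qdet c' Y * v = 1) (h₂ : v * qdet c' Y = 1)
    (hv : W = spaceOf Y v) (i j : Fin 2) : φ (X i j) ∈ actSubalgebra φ N W hW hst := by
  subst hv
  refine mem_actSubalgebra_of_exchange (entrySpan X) (fg_entrySpan X)
    (H.entrySpan_mul_le h₁ h₂) (fun U _ => ?_) (entry_mem (X.map φ) i j)
  refine Submodule.smul_mono_left (Submodule.span_le.2 ?_)
  rintro _ ⟨⟨a, b⟩, rfl⟩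
  exact ⟨X a b, entry_mem X a b, rfl⟩

theorem Exchange.detInv_mem_actSubalgebra {c c' : k} {X : Mat2 A'} {w : A'} {Y : Mat2 A} {v : A}
    (H : Exchange c c' (X.map φ) Y) (h₁ : qdet c' Y * v = 1) (h₂ : v * qdet c' Y = 1)
    (h₃ : qdet c X * w = 1) (h₄ : w * qdet c X = 1) (hv : W = spaceOf Y v) :
    φ w ∈ actSubalgebra φ N W hW hst := by
  subst hv
  refine mem_actSubalgebra_of_exchange (Submodule.span k {w}) (Submodule.fg_span_singleton w)
    (H.detInv_mul_le h₁ h₂ (w := φ w) ?_ ?_) (fun U _ => ?_)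
    (Submodule.mem_span_singleton_self _)
  · rw [← map_qdet, ← map_mul, h₃, map_one]
  · rw [← map_qdet, ← map_mul, h₄, map_one]
  · refine Submodule.smul_mono_left (Submodule.span_le.2 ?_)
    rintro _ rfl
    exact ⟨w, Submodule.mem_span_singleton_self w, rfl⟩

/-- A matrix that acts on `N` by scalars and can be moved past `Y`. -/
theorem Exchange.mem_actSubalgebra_of_scalar {c c' : k} {X Y : Mat2 A} {v : A}
    (H : Exchange c c' X Y) (h₁ : qdet c' Y * v = 1) (h₂ : v * qdet c' Y = 1)
    (hv : W = spaceOf Y v) {T : Mat2 k} (hT : ∀ i j, ∀ m ∈ N, X i j • m = T i j • m)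
    (i j : Fin 2) : X i j ∈ actSubalgebra φ N W hW hst := by
  subst hv
  refine mem_actSubalgebra_of_exchange 1 ⟨{1}, by simp [Submodule.one_eq_span]⟩
    (H.entrySpan_mul_le h₁ h₂) (fun U hU => ?_) (entry_mem X i j)
  rw [Submodule.map_one, one_smul_submodule]
  refine Submodule.smul_le.2 fun a ha u hu => ?_
  induction ha using Submodule.span_induction with
  | mem a ha =>
    obtain ⟨⟨i, j⟩, rfl⟩ := ha
    rw [hT _ _ _ (hU hu)]
    exact U.smul_mem _ hu
  | zero => rw [zero_smul]; exact U.zero_mem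
  | add a b _ _ ha hb => rw [add_smul]; exact U.add_mem ha hb
  | smul r a _ ha => rw [smul_assoc]; exact U.smul_mem r ha

theorem Exchange.detInv_mem_actSubalgebra_of_scalar {c c' : k} {X Y : Mat2 A} {v w : A}
    (H : Exchange c c' X Y) (h₁ : qdet c' Y * v = 1) (h₂ : v * qdet c' Y = 1)
    (h₃ : qdet c X * w = 1) (h₄ : w * qdet c X = 1)
    (hv : W = spaceOf Y v) (hw : ∀ m ∈ N, w • m = m) : w ∈ actSubalgebra φ N W hW hst := by
  subst hv
  refine mem_actSubalgebra_of_exchange 1 ⟨{1}, by simp [Submodule.one_eq_span]⟩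
    (H.detInv_mul_le h₁ h₂ h₃ h₄) (fun U hU => ?_) (Submodule.mem_span_singleton_self w)
  rw [Submodule.map_one, one_smul_submodule]
  refine Submodule.smul_le.2 fun a ha u hu => ?_
  obtain ⟨r, rfl⟩ := Submodule.mem_span_singleton.1 ha
  rw [smul_assoc, hw u (hU hu)]
  exact U.smul_mem r hu

end Exchange

/-! ### The frame given by the ordered monomials -/

section FrameOfLetters

variable {G : Gauge} {k A A' O M : Type*} [Field k] [Ring A] [Algebra k A] [Ring A'] [Algebra k A']
  [Ring O] [Algebra k O] [AddCommGroup M] [Module k M] [Module A M] [IsScalarTower k A M]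

/-- The image of the letters under a homomorphism. -/
def Letters.map (L : Letters G k O) (ψ : O →ₐ[k] A) : Letters G k A where
  x := ψ L.x
  y := ψ L.y
  z := ψ L.z
  w := ψ L.w
  u := Units.map (ψ : O →* A) L.u
  p := L.p
  h := L.h
  η := L.η
  γ := L.γ
  γ' := L.γ'
  ξ := L.ξ
  ξ' := L.ξ'
  ζ := L.ζ
  ζ' := L.ζ'
  p_ne := L.p_ne
  h_ne := L.h_ne
  η_ne := L.η_ne
  rel := by
    obtain ⟨h1, h2, h3, h4, h5, h6, h7, h8, h9, h10, h11⟩ := L.rel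
    constructor <;> simp only [Units.coe_map, MonoidHom.coe_coe, ← map_mul, h1, h2, h3, h4, h5, h6,
      h7, h8, h9, h10, h11, map_add, map_smul]
  u_eq hG := by rw [L.u_eq hG, map_one]

theorem Letters.map_mono (L : Letters G k O) (ψ : O →ₐ[k] A) (i : Expo) :
    ψ (L.mono i) = (L.map ψ).mono i := by
  have hD : ∀ c, ψ (L.D c) = (L.map ψ).D c := by
    intro c
    simp only [Letters.D, Letters.map, ← map_zpow, Units.coe_map, MonoidHom.coe_coe]
  have hyz : ∀ j, ψ (L.yz j) = (L.map ψ).yz j := by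
    intro j
    cases j <;> simp [Letters.yz, Letters.map]
  simp only [Letters.mono, map_mul, hD, hyz, map_pow]
  rfl

/-- The frame given by the ordered monomials. -/
def Letters.frame (L : Letters G k O) (φ : A' →ₐ[k] A) (ψ : O →ₐ[k] A) (N : Submodule k M)
    (X : KernelAction (L.map ψ) N) (hexh : ∀ b, ∃ n, b ∈ L.genSpace ^ n)
    (hst : ∀ a, ∀ m ∈ N, φ a • m ∈ N) (hW : 1 ≤ L.genSpace.map ψ.toLinearMap)
    (hact : ∀ a, a ∈ actSubalgebra φ N (L.genSpace.map ψ.toLinearMap) hW hst) :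
    Frame φ ψ N G.dim where
  W := L.genSpace
  one_le := Letters.one_le_genSpace
  fg := Letters.fg_genSpace
  exhaust := hexh
  I := Expo
  β := L.mono
  S := expoBall G
  bound := 8 ^ G.dim
  pow_le := L.genSpace_pow_le_span
  mem_pow n i hi := Letters.pow_genSpace_mono (mem_expoBall.1 hi).2 (Letters.mono_mem_genSpace i)
  card_le := card_expoBall_le G
  le_card := le_card_expoBall G
  base := (0, 0, 0, 0)
  β_base := by simp [Letters.mono, L.D_zero, Letters.yz]
  mem_base := ⟨0, mem_expoBall.2 ⟨zero_mem _, le_rfl⟩⟩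
  stable := hst
  indep f hf hN h := by
    simp only [L.map_mono] at h
    ext i
    by_cases hi : i ∈ f.support
    · refine X.indep f.support f (fun i hi => ?_) hN h i hi
      obtain ⟨n, hn⟩ := hf i hi
      exact (mem_expoBall.1 hn).1
    · exact Finsupp.notMem_support_iff.1 hi
  act := hact

end FrameOfLetters


/-! ### Moving the entries of one matrix past those of another one -/

section LawConsequences

set_option linter.unusedSectionVars false

variable {k B : Type*} [Field k] [Ring B] [Algebra k B] {G : Gauge} {s q t : k} {Y X : Mat2 B}

theorem exchange_smash (hq : s ^ 2 = q) (hq0 : q ≠ 0) (ht : rScale G s = t) (ht0 : t ≠ 0)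
    (h : Law.lhs G s Y X .smash = Law.rhs G s Y X .smash)
    (hY : Law.lhs G s Y Y .reflection = Law.rhs G s Y Y .reflection)
    (hX : Law.lhs G s X X .reflection = Law.rhs G s X X .reflection) :
    Exchange (q ^ 2) (q ^ 2) X Y := by
  obtain ⟨h1, h2⟩ := det_smash hq hq0 ht ht0 h hY hX
  have hs := smash_swap hq hq0 ht ht0 h
  refine ⟨?_, ⟨_, ?_, h1⟩, ⟨_, ?_, h2⟩⟩
  · simp only [Fin.forall_fin_two, hs]
    repeat' first
      | apply And.intro
      | apply add_mem
      | apply Submodule.smul_mem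
      | apply mul_entry_mem
  all_goals simp [hq0, ht0]

theorem exchange_smashFrt (hq : s ^ 2 = q) (hq0 : q ≠ 0) (ht : rScale G s = t) (ht0 : t ≠ 0)
    (h : Law.lhs G s Y X .smashFrt = Law.rhs G s Y X .smashFrt)
    (hY : Law.lhs G s Y Y .frt = Law.rhs G s Y Y .frt)
    (hX : Law.lhs G s X X .reflection = Law.rhs G s X X .reflection) :
    Exchange (q ^ 2) q X Y := by
  obtain ⟨h1, h2⟩ := det_smashFrt hq hq0 ht ht0 h hY hX
  have hs := smashFrt_swap hq hq0 ht ht0 h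
  refine ⟨?_, ⟨_, ?_, h1⟩, ⟨_, ?_, h2⟩⟩
  · simp only [Fin.forall_fin_two, hs]
    repeat' first
      | apply And.intro
      | apply add_mem
      | apply Submodule.smul_mem
      | apply mul_entry_mem
  all_goals simp [hq0, ht0]

theorem exchange_braidLoopLoop (hq : s ^ 2 = q) (hq0 : q ≠ 0) (ht : rScale G s = t) (ht0 : t ≠ 0)
    (h : Law.lhs G s Y X .braidLoopLoop = Law.rhs G s Y X .braidLoopLoop)
    (hY : Law.lhs G s Y Y .reflection = Law.rhs G s Y Y .reflection)
    (hX : Law.lhs G s X X .reflection = Law.rhs G s X X .reflection) :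
    Exchange (q ^ 2) (q ^ 2) Y X := by
  obtain ⟨h1, h2⟩ := det_braidLoopLoop hq hq0 ht ht0 h hY hX
  have hs := braidLoopLoop_yx hq hq0 ht ht0 h
  refine ⟨?_, ⟨1, one_ne_zero, ?_⟩, ⟨1, one_ne_zero, ?_⟩⟩
  · simp only [Fin.forall_fin_two, hs]
    repeat' first
      | apply And.intro
      | apply add_mem
      | apply Submodule.smul_mem
      | apply mul_entry_mem
  · simpa using h1
  · simpa using h2

theorem exchange_braidFrtLoop (hq : s ^ 2 = q) (hq0 : q ≠ 0) (ht : rScale G s = t) (ht0 : t ≠ 0)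
    (h : Law.lhs G s Y X .braidFrtLoop = Law.rhs G s Y X .braidFrtLoop)
    (hY : Law.lhs G s Y Y .frt = Law.rhs G s Y Y .frt)
    (hX : Law.lhs G s X X .reflection = Law.rhs G s X X .reflection) :
    Exchange q (q ^ 2) Y X := by
  obtain ⟨h1, h2⟩ := det_braidFrtLoop hq hq0 ht ht0 h hY hX
  have hs := braidFrtLoop_yx hq hq0 ht ht0 h
  refine ⟨?_, ⟨1, one_ne_zero, ?_⟩, ⟨1, one_ne_zero, ?_⟩⟩
  · simp only [Fin.forall_fin_two, hs]
    repeat' first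
      | apply And.intro
      | apply add_mem
      | apply Submodule.smul_mem
      | apply mul_entry_mem
  · simpa using h1
  · simpa using h2

theorem exchange_braidFrtLoop_xy (hq : s ^ 2 = q) (hq0 : q ≠ 0) (ht : rScale G s = t) (ht0 : t ≠ 0)
    (h : Law.lhs G s Y X .braidFrtLoop = Law.rhs G s Y X .braidFrtLoop)
    (hY : Law.lhs G s Y Y .frt = Law.rhs G s Y Y .frt)
    (hX : Law.lhs G s X X .reflection = Law.rhs G s X X .reflection) :
    Exchange (q ^ 2) q X Y := by
  obtain ⟨h1, h2⟩ := det_braidFrtLoop hq hq0 ht ht0 h hY hX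
  have hs := braidFrtLoop_xy hq hq0 ht ht0 h
  refine ⟨?_, ⟨1, one_ne_zero, ?_⟩, ⟨1, one_ne_zero, ?_⟩⟩
  · simp only [Fin.forall_fin_two, hs]
    repeat' first
      | apply And.intro
      | apply add_mem
      | apply Submodule.smul_mem
      | apply mul_entry_mem
  · simpa using fun i j => (h2 i j).symm
  · simpa using fun i j => (h1 i j).symm

theorem exchange_braidFrtFrt (hq : s ^ 2 = q) (hq0 : q ≠ 0) (ht : rScale G s = t) (ht0 : t ≠ 0)
    (h : Law.lhs G s Y X .braidFrtFrt = Law.rhs G s Y X .braidFrtFrt)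
    (hY : Law.lhs G s Y Y .frt = Law.rhs G s Y Y .frt)
    (hX : Law.lhs G s X X .frt = Law.rhs G s X X .frt) :
    Exchange q q X Y := by
  obtain ⟨h1, h2⟩ := det_braidFrtFrt hq hq0 ht ht0 h hY hX
  have hs := braidFrtFrt_xy hq hq0 ht ht0 h
  refine ⟨?_, ⟨_, ?_, h1⟩, ⟨_, ?_, h2⟩⟩
  · simp only [Fin.forall_fin_two, hs]
    repeat' first
      | apply And.intro
      | apply add_mem
      | apply Submodule.smul_mem
      | apply mul_entry_mem
  all_goals simp [hq0, ht0]

theorem exchange_endLoop (hq : s ^ 2 = q) (hq0 : q ≠ 0) (ht : rScale G s = t) (ht0 : t ≠ 0)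
    (h : Law.lhs G s Y X .endLoop = Law.rhs G s Y X .endLoop)
    (hY : Law.lhs G s Y Y .reflection = Law.rhs G s Y Y .reflection)
    (hX : Law.lhs G s X X .frt = Law.rhs G s X X .frt) :
    Exchange (q ^ 2) q Y X := by
  obtain ⟨h1, h2⟩ := det_endLoop hq hq0 ht ht0 h hY hX
  have hs := endLoop_yx hq hq0 ht ht0 h
  refine ⟨?_, ⟨1, one_ne_zero, ?_⟩, ⟨1, one_ne_zero, ?_⟩⟩
  · simp only [Fin.forall_fin_two, hs]
    repeat' first
      | apply And.intro
      | apply add_mem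
      | apply Submodule.smul_mem
      | apply mul_entry_mem
  · simpa using h1
  · simpa using h2

theorem exchange_endFrt (hq : s ^ 2 = q) (hq0 : q ≠ 0) (ht : rScale G s = t) (ht0 : t ≠ 0)
    (h : Law.lhs G s Y X .endFrt = Law.rhs G s Y X .endFrt)
    (hY : Law.lhs G s Y Y .frt = Law.rhs G s Y Y .frt)
    (hX : Law.lhs G s X X .frt = Law.rhs G s X X .frt) :
    Exchange q q Y X := by
  obtain ⟨h1, h2⟩ := det_endFrt hq hq0 ht ht0 h hY hX
  have hs := endFrt_yx hq hq0 ht ht0 h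
  refine ⟨?_, ⟨_, ?_, h1⟩, ⟨_, ?_, h2⟩⟩
  · simp only [Fin.forall_fin_two, hs]
    repeat' first
      | apply And.intro
      | apply add_mem
      | apply Submodule.smul_mem
      | apply mul_entry_mem
  all_goals simp [hq0, ht0]

end LawConsequences

/-! ### The joint kernel -/

section JointKernel

set_option linter.unusedSectionVars false
set_option linter.unnecessarySeqFocus false

variable {k B M : Type*} [Field k] [Ring B] [Algebra k B] [AddCommGroup M] [Module k M] [Module B M]
  [IsScalarTower k B M] {G : Gauge} {s q t : k} {Y X : Mat2 B}

/-- The matrix acts on the vector as the identity matrix. -/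
def FixedBy (k : Type*) [Field k] [Module k M] (X : Mat2 B) (m : M) : Prop :=
  ∀ i j, X i j • m = (1 : Mat2 k) i j • m

theorem FixedBy.eqs {m : M} (h : FixedBy k X m) :
    X 0 0 • m = m ∧ X 0 1 • m = 0 ∧ X 1 0 • m = 0 ∧ X 1 1 • m = m :=
  ⟨by simpa using h 0 0, by simpa using h 0 1, by simpa using h 1 0, by simpa using h 1 1⟩

theorem FixedBy.qdet_smul {m : M} (h : FixedBy k X m) (c : k) : qdet c X • m = m := by
  obtain ⟨h1, h2, h3, h4⟩ := h.eqs
  rw [qdet, sub_smul, smul_assoc, mul_smul, mul_smul, h4, h3, h1]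
  simp

/-- On the joint kernel the whole matrix acts as the identity. -/
theorem mem_jointKernel_iff {c : k} {m : M} :
    m ∈ jointKernel k M X (qdet c X) ↔ FixedBy k X m := by
  constructor
  · rintro ⟨h1, h2, h3, h4⟩
    rw [sub_smul, one_smul, sub_eq_zero] at h4 h1
    rw [qdet, sub_smul, smul_assoc, mul_smul, mul_smul, h4, h3, smul_zero, smul_zero,
      sub_zero] at h1
    rw [FixedBy]
    simp [Fin.forall_fin_two, h1, h2, h3, h4]
  · intro h
    obtain ⟨h1, h2, h3, h4⟩ := h.eqs
    exact ⟨by rw [sub_smul, h.qdet_smul, one_smul, sub_self], h2, h3,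
      by rw [sub_smul, h4, one_smul, sub_self]⟩

theorem FixedBy.smul_of_commute {m : M} (h : FixedBy k X m) {b : B}
    (hb : ∀ i j, X i j * b = b * X i j) : FixedBy k X (b • m) := fun i j => by
  rw [← mul_smul, hb, mul_smul, h i j, smul_comm_of_tower]

/-- The entries of `Y` commute with those of `R X₂ R⁻¹`, and on vectors fixed by `X` this matrix
acts as the identity too; hence they preserve the fixed vectors. -/
theorem fixedBy_smul_braidLoopLoop (hq : s ^ 2 = q) (hq0 : q ≠ 0) (ht : rScale G s = t)
    (ht0 : t ≠ 0) (h : Law.lhs G s Y X .braidLoopLoop = Law.rhs G s Y X .braidLoopLoop) {m : M}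
    (hm : FixedBy k X m) (a b : Fin 2) : FixedBy k X (Y a b • m) := by
  have hs := braidLoopLoop_xy hq hq0 ht ht0 h
  obtain ⟨h00, h01, h10, h11⟩ := hm.eqs
  revert a b
  simp only [FixedBy, Fin.forall_fin_two, ← mul_smul, hs, add_smul, smul_assoc]
  simp only [mul_smul, h00, h01, h10, h11, smul_zero, add_zero, zero_add]
  generalize Y 0 0 • m = v₀, Y 0 1 • m = v₁, Y 1 0 • m = v₂, Y 1 1 • m = v₃
  simp only [Matrix.one_apply_eq, ne_eq, zero_ne_one, one_ne_zero, not_false_eq_true,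
    Matrix.one_apply_ne, one_smul, zero_smul]
  refine ⟨⟨⟨⟨?_, ?_⟩, ?_, ?_⟩, ⟨?_, ?_⟩, ?_, ?_⟩, ⟨⟨?_, ?_⟩, ?_, ?_⟩, ⟨?_, ?_⟩, ?_, ?_⟩ <;>
    first
    | trivial
    | match_scalars <;> field_simp <;> ring

theorem fixedBy_smul_braidFrtLoop (hq : s ^ 2 = q) (hq0 : q ≠ 0) (ht : rScale G s = t)
    (ht0 : t ≠ 0) (h : Law.lhs G s Y X .braidFrtLoop = Law.rhs G s Y X .braidFrtLoop) {m : M}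
    (hm : FixedBy k X m) (a b : Fin 2) : FixedBy k X (Y a b • m) := by
  have hs := braidFrtLoop_xy hq hq0 ht ht0 h
  obtain ⟨h00, h01, h10, h11⟩ := hm.eqs
  revert a b
  simp only [FixedBy, Fin.forall_fin_two, ← mul_smul, hs, add_smul, smul_assoc]
  simp only [mul_smul, h00, h01, h10, h11, smul_zero, add_zero, zero_add]
  generalize Y 0 0 • m = v₀, Y 0 1 • m = v₁, Y 1 0 • m = v₂, Y 1 1 • m = v₃
  simp only [Matrix.one_apply_eq, ne_eq, zero_ne_one, one_ne_zero, not_false_eq_true,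
    Matrix.one_apply_ne, one_smul, zero_smul]
  refine ⟨⟨⟨⟨?_, ?_⟩, ?_, ?_⟩, ⟨?_, ?_⟩, ?_, ?_⟩, ⟨⟨?_, ?_⟩, ?_, ?_⟩, ⟨?_, ?_⟩, ?_, ?_⟩ <;>
    first
    | trivial
    | match_scalars <;> field_simp <;> ring

theorem fixedBy_smul_braidLoopLoop_left (hq : s ^ 2 = q) (hq0 : q ≠ 0) (ht : rScale G s = t)
    (ht0 : t ≠ 0) (h : Law.lhs G s Y X .braidLoopLoop = Law.rhs G s Y X .braidLoopLoop) {m : M}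
    (hm : FixedBy k Y m) (a b : Fin 2) : FixedBy k Y (X a b • m) := by
  have hs := braidLoopLoop_yx hq hq0 ht ht0 h
  obtain ⟨h00, h01, h10, h11⟩ := hm.eqs
  revert a b
  simp only [FixedBy, Fin.forall_fin_two, ← mul_smul, hs, add_smul, smul_assoc]
  simp only [mul_smul, h00, h01, h10, h11, smul_zero, add_zero, zero_add]
  generalize X 0 0 • m = v₀, X 0 1 • m = v₁, X 1 0 • m = v₂, X 1 1 • m = v₃
  simp only [Matrix.one_apply_eq, ne_eq, zero_ne_one, one_ne_zero, not_false_eq_true,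
    Matrix.one_apply_ne, one_smul, zero_smul]
  refine ⟨⟨⟨⟨?_, ?_⟩, ?_, ?_⟩, ⟨?_, ?_⟩, ?_, ?_⟩, ⟨⟨?_, ?_⟩, ?_, ?_⟩, ⟨?_, ?_⟩, ?_, ?_⟩ <;>
    first
    | trivial
    | match_scalars <;> field_simp <;> ring

theorem fixedBy_smul_braidLoopFrt (hq : s ^ 2 = q) (hq0 : q ≠ 0) (ht : rScale G s = t)
    (ht0 : t ≠ 0) (h : Law.lhs G s Y X .braidLoopFrt = Law.rhs G s Y X .braidLoopFrt) {m : M}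
    (hm : FixedBy k Y m) (a b : Fin 2) : FixedBy k Y (X a b • m) := by
  have hs := braidLoopFrt_yx hq hq0 ht ht0 h
  obtain ⟨h00, h01, h10, h11⟩ := hm.eqs
  revert a b
  simp only [FixedBy, Fin.forall_fin_two, ← mul_smul, hs, add_smul, smul_assoc]
  simp only [mul_smul, h00, h01, h10, h11, smul_zero, add_zero, zero_add]
  generalize X 0 0 • m = v₀, X 0 1 • m = v₁, X 1 0 • m = v₂, X 1 1 • m = v₃
  simp only [Matrix.one_apply_eq, ne_eq, zero_ne_one, one_ne_zero, not_false_eq_true,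
    Matrix.one_apply_ne, one_smul, zero_smul]
  refine ⟨⟨⟨⟨?_, ?_⟩, ?_, ?_⟩, ⟨?_, ?_⟩, ?_, ?_⟩, ⟨⟨?_, ?_⟩, ?_, ?_⟩, ⟨?_, ?_⟩, ?_, ?_⟩ <;>
    first
    | trivial
    | match_scalars <;> field_simp <;> ring

end JointKernel


/-! ### The letters of one matrix and the action on the joint kernel -/

section Instances

set_option linter.unusedSectionVars false

variable {k B M : Type*} [Field k] [Ring B] [Algebra k B] [AddCommGroup M] [Module k M] [Module B M]
  [IsScalarTower k B M] {G : Gauge} {s q t : k} {Y X : Mat2 B}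

/-- The letters of a matrix of reflection type. -/
def Letters.ofReflection (hq : s ^ 2 = q) (hq0 : q ≠ 0) (ht : rScale G s = t) (ht0 : t ≠ 0)
    (h : Law.lhs G s X X .reflection = Law.rhs G s X X .reflection) (u : Bˣ)
    (hu : (u : B) = qdet (q ^ 2) X) (hG : G = .SL2 → u = 1) : Letters G k B where
  x := X 0 1
  y := X 1 1
  z := X 0 0
  w := X 1 0
  u := u
  p := q ^ 2
  h := q ^ 2
  η := q ^ 2
  γ := 1 - q⁻¹ ^ 2
  γ' := q⁻¹ ^ 2 - 1
  ξ := 1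
  ξ' := q⁻¹ ^ 2 - q⁻¹ ^ 4
  ζ := 1
  ζ' := q⁻¹ ^ 2 - 1
  p_ne := pow_ne_zero 2 hq0
  h_ne := pow_ne_zero 2 hq0
  η_ne := pow_ne_zero 2 hq0
  rel := by rw [hu]; exact reflection_letters hq hq0 ht ht0 h
  u_eq := hG

/-- The letters of a matrix of FRT type. -/
def Letters.ofFrt (hq : s ^ 2 = q) (hq0 : q ≠ 0) (ht : rScale G s = t) (ht0 : t ≠ 0)
    (h : Law.lhs G s X X .frt = Law.rhs G s X X .frt) (u : Bˣ)
    (hu : (u : B) = qdet q X) (hG : G = .SL2 → u = 1) : Letters G k B where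
  x := X 0 1
  y := X 0 0
  z := X 1 1
  w := X 1 0
  u := u
  p := q ^ 2
  h := q
  η := q
  γ := q - q⁻¹
  γ' := 0
  ξ := q⁻¹
  ξ' := 0
  ζ := q
  ζ' := 0
  p_ne := pow_ne_zero 2 hq0
  h_ne := hq0
  η_ne := hq0
  rel := by rw [hu]; exact frt_letters hq hq0 ht ht0 h
  u_eq := hG

theorem zpow_injective_of_pow_ne_one (hs : s ≠ 0) (hgen : ∀ l : ℕ, 1 ≤ l → s ^ l ≠ 1) {a b : ℤ}
    (h : s ^ a = s ^ b) : a = b := by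
  wlog hab : a ≤ b generalizing a b
  · exact (this h.symm (by omega)).symm
  by_contra hne
  refine hgen (b - a).toNat (by omega) ?_
  rw [← zpow_natCast, Int.toNat_of_nonneg (by omega), zpow_sub₀ hs, h, div_self]
  exact zpow_ne_zero _ hs

/-- Powers of `s` determine the exponent `c` of the determinant and the degree `n`, from the
eigenvalues of `a²₂` and of the determinant of `A`; here `e = 1` in the reflection case, and
`e = -1` in the FRT case. -/
theorem separate_of_zpow (hs : s ≠ 0) (hgen : ∀ l : ℕ, 1 ≤ l → s ^ l ≠ 1) {d κ d' δ' : k}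
    {e a : ℤ} (he : e ≠ 0)
    (h : G = .GL2 → d = s ^ (4 * e) ∧ κ = s ^ a ∧ d' = s ^ (8 * e) ∧ δ' = s ^ (4 * e) ∧
      a ≠ 2 * e)
    (h' : G = .SL2 → κ = s ^ (2 : ℤ)) {c : ℤ} (hc : c ∈ G.detExp) {c' : ℤ} (hc' : c' ∈ G.detExp)
    {n n' : ℕ} (h₁ : d ^ c * κ ^ n = d ^ c' * κ ^ n')
    (h₂ : d' ^ c * δ' ^ n = d' ^ c' * δ' ^ n') : c = c' ∧ n = n' := by
  have comb : ∀ (i j c : ℤ) (n : ℕ), (s ^ i) ^ c * (s ^ j) ^ n = s ^ (i * c + j * n) := by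
    intro i j c n
    rw [zpow_add₀ hs, zpow_mul, zpow_mul, zpow_natCast]
  cases G with
  | GL2 =>
    obtain ⟨rfl, rfl, rfl, rfl, ha⟩ := h rfl
    rw [comb, comb] at h₁ h₂
    have e₁ := zpow_injective_of_pow_ne_one hs hgen h₁
    have e₂ := zpow_injective_of_pow_ne_one hs hgen h₂
    have e₃ : (2 * (c - c') + ((n : ℤ) - n')) * (4 * e) = 0 := by linear_combination e₂
    have e₄ : 2 * (c - c') + ((n : ℤ) - n') = 0 := by
      rcases mul_eq_zero.1 e₃ with h | h
      · exact h
      · omega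
    have e₅ : ((n : ℤ) - n') * (a - 2 * e) = 0 := by
      linear_combination e₁ - 2 * e * e₄
    have e₆ : (n : ℤ) - n' = 0 := (mul_eq_zero.1 e₅).resolve_right (sub_ne_zero.2 ha)
    omega
  | SL2 =>
    obtain rfl : c = 0 := hc
    obtain rfl : c' = 0 := hc'
    rw [h' rfl] at h₁
    have e₁ : s ^ (2 * (n : ℤ)) = s ^ (2 * (n' : ℤ)) := by
      simpa [zpow_mul] using h₁
    have e₂ := zpow_injective_of_pow_ne_one hs hgen e₁
    omega

theorem q_pow_ne_one (hgen : ∀ l : ℕ, 1 ≤ l → s ^ l ≠ 1) (hq : s ^ 2 = q) {n : ℕ} (hn : 1 ≤ n) :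
    (q ^ 2) ^ n ≠ 1 := by
  rw [← hq, ← pow_mul, ← pow_mul]
  exact hgen _ (by omega)

/-- The action of `A` on the products of the letters of `D` with vectors in the joint kernel. -/
def reflectionAction (hs : s ≠ 0) (hgen : ∀ l : ℕ, 1 ≤ l → s ^ l ≠ 1) (hq : s ^ 2 = q)
    (hq0 : q ≠ 0) (ht : rScale G s = t) (ht0 : t ≠ 0)
    (h : Law.lhs G s Y X .smash = Law.rhs G s Y X .smash)
    (hY : Law.lhs G s Y Y .reflection = Law.rhs G s Y Y .reflection)
    (hX : Law.lhs G s X X .reflection = Law.rhs G s X X .reflection) (u : Bˣ)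
    (hu : (u : B) = qdet (q ^ 2) Y) (hG : G = .SL2 → u = 1) (N : Submodule k M)
    (hN : ∀ m ∈ N, FixedBy k X m) :
    KernelAction (Letters.ofReflection hq hq0 ht ht0 hY u hu hG) N where
  E := X 0 1
  K := X 1 1
  F := X 1 0
  Δ := qdet (q ^ 2) X
  E_N m hm := (hN m hm).eqs.2.1
  K_N m hm := (hN m hm).eqs.2.2.2
  Δ_N m hm := (hN m hm).qdet_smul _
  F_N m hm := (hN m hm).eqs.2.2.1
  e₁ := t ^ 2
  e₂ := q ^ 2 * t ^ 2
  e₃ := t ^ 2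
  e₄ := t ^ 2 - q⁻¹ ^ 2 * t ^ 2
  κ := q ^ 2 * t ^ 2
  κ' := q ^ 2 * t ^ 2 - t ^ 2
  k₁ := t ^ 2
  d := q ^ 2 * t ^ 4
  d' := (q ^ 2 * t ^ 4) ^ 2
  δ' := q ^ 2 * t ^ 4
  g₁ := q ^ 2 * t ^ 2
  g₂ := q ^ 2 * t ^ 2 - t ^ 2
  f₁ := t ^ 2
  f₂ a := t ^ 2 * (1 - q⁻¹ ^ 2) * (t ^ 2) ^ a * (q ^ 2) ^ a
  f₃ a := t ^ 2 * (1 - q⁻¹ ^ 2) * (t ^ 2) ^ a * (q⁻¹ ^ 2 - (q ^ 2) ^ a)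
  lam n := (t ^ 2) ^ n * q⁻¹ ^ 2 * ((q ^ 2) ^ n - 1)
  cof a := (t ^ 2) ^ a * q⁻¹ ^ 4 * ((q ^ 2) ^ a - 1)
  e₁_ne := by simp [ht0]
  e₂_ne := by simp [hq0, ht0]
  e₄_ne := by
    have h1 := q_pow_ne_one hgen hq le_rfl
    rw [pow_one] at h1
    have h2 : t ^ 2 - q⁻¹ ^ 2 * t ^ 2 = t ^ 2 * q⁻¹ ^ 2 * (q ^ 2 - 1) := by field_simp
    rw [h2]
    simp [hq0, ht0, sub_ne_zero.2 h1]
  d_ne := by simp [hq0, ht0]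
  d'_ne := by simp [hq0, ht0]
  Ey := (smash_swap hq hq0 ht ht0 h).2.2.2.2.2.2.2.1
  Ex := (smash_swap hq hq0 ht ht0 h).2.2.2.2.2.1
  Ew := (smash_swap hq hq0 ht ht0 h).2.2.2.2.2.2.1
  Ky := (smash_swap hq hq0 ht ht0 h).2.2.2.2.2.2.2.2.2.2.2.2.2.2.2
  Kx := (smash_swap hq hq0 ht ht0 h).2.2.2.2.2.2.2.2.2.2.2.2.2.1
  Kw := (smash_swap hq hq0 ht ht0 h).2.2.2.2.2.2.2.2.2.2.2.2.2.2.1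
  Δy := (det_smash hq hq0 ht ht0 h hY hX).2 1 1
  Δx := (det_smash hq hq0 ht ht0 h hY hX).2 0 1
  Eu := by
    change X 0 1 * (u : B) = _ • ((u : B) * X 0 1)
    rw [hu]
    exact (det_smash hq hq0 ht ht0 h hY hX).1 0 1
  Ku := by
    change X 1 1 * (u : B) = _ • ((u : B) * X 1 1)
    rw [hu]
    exact (det_smash hq hq0 ht ht0 h hY hX).1 1 1
  Δu := by
    change qdet (q ^ 2) X * (u : B) = _ • ((u : B) * qdet (q ^ 2) X)
    rw [hu]
    exact mul_qdet_of_mul (det_smash hq hq0 ht ht0 h hY hX).2 _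
  pow_ne e he := by
    change (t ^ 2 * q ^ 2) ^ e ≠ (t ^ 2) ^ e
    rw [mul_pow]
    intro h1
    have h2 : (t ^ 2) ^ e ≠ 0 := pow_ne_zero _ (pow_ne_zero _ ht0)
    exact q_pow_ne_one hgen hq he (mul_left_cancel₀ h2 (h1.trans (mul_one _).symm))
  separate c hc c' hc' n n' h₁ h₂ := by
    refine separate_of_zpow (G := G) hs hgen (e := 1) (a := 4) one_ne_zero ?_ ?_ hc hc' h₁ h₂
    · rintro rfl
      rw [← ht, ← hq, rScale]
      refine ⟨?_, ?_, ?_, ?_, by norm_num⟩ <;> norm_num <;> ring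
    · rintro rfl
      rw [← ht, ← hq, rScale]
      field_simp
  g₁_ne := by simp [hq0, ht0]
  Fy := (smash_swap hq hq0 ht ht0 h).2.2.2.2.2.2.2.2.2.2.2.1
  Fx a m hm := by
    obtain ⟨s00, s01, s02, s03, s10, s11, s12, s13, s20, s21, s22, s23, s30, s31, s32, s33⟩ :=
      smash_swap hq hq0 ht ht0 h
    obtain ⟨h00, h01, h10, h11⟩ := (hN m hm).eqs
    have hE : ∀ a : ℕ, X 0 1 • Y 0 1 ^ a • m = 0 := by
      intro a
      rw [← mul_smul, mul_pow_of_mul s11, smul_assoc, mul_smul, h01, smul_zero, smul_zero]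
    have hK : ∀ a : ℕ, X 1 1 • Y 0 1 ^ a • m = (q ^ 2 * t ^ 2) ^ a • Y 0 1 ^ a • m := by
      intro a
      induction a with
      | zero => simp [h11]
      | succ a ih =>
        rw [pow_succ', mul_smul, ← mul_smul (X 1 1), s31, add_smul, smul_assoc, smul_assoc,
          mul_smul (Y 0 1), mul_smul (Y 1 1), ih, hE, smul_zero, smul_zero, add_zero,
          smul_comm_of_tower, smul_smul, ← pow_succ']
    have hH : ∀ a : ℕ, X 0 0 • Y 0 1 ^ a • m =
        ((t ^ 2) ^ a * (q⁻¹ ^ 2 + (1 - q⁻¹ ^ 2) * (q ^ 2) ^ a)) • Y 0 1 ^ a • m := by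
      intro a
      induction a with
      | zero => simp [h00]
      | succ a ih =>
        rw [pow_succ', mul_smul, ← mul_smul (X 0 0), s01]
        simp only [add_smul _ _ (Y 0 1 ^ a • m), smul_assoc, mul_smul (Y _ _), ih, hE, hK,
          smul_zero, add_zero, smul_comm_of_tower (A := B)]
        generalize Y 0 1 • Y 0 1 ^ a • m = v
        rw [mul_pow]
        match_scalars
        field_simp
        ring
    change X 1 0 • Y 0 1 • Y 0 1 ^ a • m = t ^ 2 • Y 0 1 • X 1 0 • Y 0 1 ^ a • m +
      _ • Y 0 0 • Y 0 1 ^ a • m + _ • Y 1 1 • Y 0 1 ^ a • m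
    rw [← mul_smul, s21]
    simp only [add_smul _ _ (Y 0 1 ^ a • m), smul_assoc, mul_smul (Y _ _), hH, hE, hK,
      smul_zero, add_zero, smul_comm_of_tower (A := B)]
    generalize Y 0 1 • X 1 0 • Y 0 1 ^ a • m = v₁, Y 0 0 • Y 0 1 ^ a • m = v₂,
      Y 1 1 • Y 0 1 ^ a • m = v₃
    rw [mul_pow]
    match_scalars <;> field_simp
    ring
  lam_zero := by simp
  lam_ne n := by
    have h1 := q_pow_ne_one hgen hq (n := n + 1) (by omega)
    simp [hq0, ht0, sub_ne_zero.2 h1]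
  lam_y n := by
    change _ = q ^ 2 * _
    rw [mul_pow]
    field_simp
    ring
  lam_x a := by
    change t ^ 2 * q ^ 2 * _ + _ * q ^ 2 = q ^ 2 * _
    field_simp
    ring
  f₃_eq a := by
    change _ = (q⁻¹ ^ 2 - 1) * _
    field_simp
    ring
  cof_zero := by simp
  cof_ne a := by
    have h1 := q_pow_ne_one hgen hq (n := a + 1) (by omega)
    simp [hq0, ht0, sub_ne_zero.2 h1]
  cof_succ a := by
    change _ = t ^ 2 * q ^ 2 * _ + _ - (1 - q⁻¹ ^ 2) * _
    field_simp
    ring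

/-- The action of `A` on the products of the letters of `F` with vectors in the joint kernel. -/
def frtAction (hs : s ≠ 0) (hgen : ∀ l : ℕ, 1 ≤ l → s ^ l ≠ 1) (hq : s ^ 2 = q)
    (hq0 : q ≠ 0) (ht : rScale G s = t) (ht0 : t ≠ 0)
    (h : Law.lhs G s Y X .smashFrt = Law.rhs G s Y X .smashFrt)
    (hY : Law.lhs G s Y Y .frt = Law.rhs G s Y Y .frt)
    (hX : Law.lhs G s X X .reflection = Law.rhs G s X X .reflection) (u : Bˣ)
    (hu : (u : B) = qdet q Y) (hG : G = .SL2 → u = 1) (N : Submodule k M)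
    (hN : ∀ m ∈ N, FixedBy k X m) :
    KernelAction (Letters.ofFrt hq hq0 ht ht0 hY u hu hG) N where
  E := X 0 1
  K := X 1 1
  F := X 1 0
  Δ := qdet (q ^ 2) X
  E_N m hm := (hN m hm).eqs.2.1
  K_N m hm := (hN m hm).eqs.2.2.2
  Δ_N m hm := (hN m hm).qdet_smul _
  F_N m hm := (hN m hm).eqs.2.2.1
  e₁ := q⁻¹ * t⁻¹ ^ 2
  e₂ := q⁻¹ * t⁻¹ ^ 2
  e₃ := q⁻¹ * t⁻¹ ^ 2
  e₄ := -(t⁻¹ ^ 2) + q⁻¹ ^ 2 * t⁻¹ ^ 2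
  κ := t⁻¹ ^ 2
  κ' := 0
  k₁ := q⁻¹ ^ 2 * t⁻¹ ^ 2
  d := q⁻¹ ^ 2 * t⁻¹ ^ 4
  d' := (q⁻¹ ^ 2 * t⁻¹ ^ 4) ^ 2
  δ' := q⁻¹ ^ 2 * t⁻¹ ^ 4
  g₁ := q⁻¹ * t⁻¹ ^ 2
  g₂ := -(q⁻¹ ^ 2 * t⁻¹ ^ 2) + q⁻¹ ^ 4 * t⁻¹ ^ 2
  f₁ := q⁻¹ * t⁻¹ ^ 2
  f₂ a := (-(q⁻¹ ^ 2 * t⁻¹ ^ 2) + q⁻¹ ^ 4 * t⁻¹ ^ 2) * (t⁻¹ ^ 2) ^ a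
  f₃ _ := 0
  lam n := (t⁻¹ ^ 2) ^ n * q⁻¹ ^ 3 * ((q⁻¹ ^ 2) ^ n - 1)
  cof a := (t⁻¹ ^ 2) ^ a * q⁻¹ ^ 4 * ((q⁻¹ ^ 2) ^ a - 1)
  e₁_ne := by simp [hq0, ht0]
  e₂_ne := by simp [hq0, ht0]
  e₄_ne := by
    have h1 := q_pow_ne_one hgen hq le_rfl
    rw [pow_one] at h1
    have h2 : -(t⁻¹ ^ 2) + q⁻¹ ^ 2 * t⁻¹ ^ 2 = t⁻¹ ^ 2 * q⁻¹ ^ 2 * (1 - q ^ 2) := by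
      field_simp
      ring
    rw [h2]
    simp [hq0, ht0, sub_ne_zero.2 h1.symm]
  d_ne := by simp [hq0, ht0]
  d'_ne := by simp [hq0, ht0]
  Ey := (smashFrt_swap hq hq0 ht ht0 h).2.2.1 0
  Ex := (smashFrt_swap hq hq0 ht ht0 h).2.2.1 1
  Ew := (smashFrt_swap hq hq0 ht ht0 h).2.2.2.1 0
  Ky := (smashFrt_swap hq hq0 ht ht0 h).2.2.2.2.2.2.1 0
  Kx := by
    rw [zero_smul, add_zero]
    exact (smashFrt_swap hq hq0 ht ht0 h).2.2.2.2.2.2.1 1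
  Kw := (smashFrt_swap hq hq0 ht ht0 h).2.2.2.2.2.2.2 0
  Δy := (det_smashFrt hq hq0 ht ht0 h hY hX).2 0 0
  Δx := (det_smashFrt hq hq0 ht ht0 h hY hX).2 0 1
  Eu := by
    change X 0 1 * (u : B) = _ • ((u : B) * X 0 1)
    rw [hu]
    exact (det_smashFrt hq hq0 ht ht0 h hY hX).1 0 1
  Ku := by
    change X 1 1 * (u : B) = _ • ((u : B) * X 1 1)
    rw [hu]
    exact (det_smashFrt hq hq0 ht ht0 h hY hX).1 1 1
  Δu := by
    change qdet (q ^ 2) X * (u : B) = _ • ((u : B) * qdet (q ^ 2) X)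
    rw [hu]
    exact mul_qdet_of_mul (det_smashFrt hq hq0 ht ht0 h hY hX).2 _
  pow_ne e he := by
    change (q⁻¹ * t⁻¹ ^ 2 * q) ^ e ≠ (q⁻¹ ^ 2 * t⁻¹ ^ 2) ^ e
    intro h1
    refine q_pow_ne_one hgen hq he ?_
    have h2 : q⁻¹ * t⁻¹ ^ 2 * q = q ^ 2 * (q⁻¹ ^ 2 * t⁻¹ ^ 2) := by field_simp
    rw [h2, mul_pow] at h1
    have h3 : (q⁻¹ ^ 2 * t⁻¹ ^ 2) ^ e ≠ 0 := pow_ne_zero _ (by simp [hq0, ht0])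
    exact mul_right_cancel₀ h3 (h1.trans (one_mul _).symm)
  separate c hc c' hc' n n' h₁ h₂ := by
    refine separate_of_zpow (G := G) hs hgen (e := -1) (a := 0) (by norm_num) ?_ ?_ hc hc' h₁ h₂
    · rintro rfl
      rw [← ht, ← hq, rScale]
      refine ⟨?_, ?_, ?_, ?_, by norm_num⟩ <;> norm_num <;> field_simp
    · rintro rfl
      rw [← ht, rScale, inv_inv]
      norm_cast
  g₁_ne := by simp [hq0, ht0]
  Fy := (smashFrt_swap hq hq0 ht ht0 h).2.2.2.2.1 0
  Fx a m hm := by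
    obtain ⟨-, -, -, -, s20, -, s30, -⟩ := smashFrt_swap hq hq0 ht ht0 h
    have hK : X 1 1 • Y 0 1 ^ a • m = (t⁻¹ ^ 2) ^ a • Y 0 1 ^ a • m := by
      rw [← mul_smul, mul_pow_of_mul (s30 1), smul_assoc, mul_smul, (hN m hm).eqs.2.2.2]
    change X 1 0 • Y 0 1 • Y 0 1 ^ a • m = (q⁻¹ * t⁻¹ ^ 2) • Y 0 1 • X 1 0 • Y 0 1 ^ a • m +
      _ • Y 1 1 • Y 0 1 ^ a • m + (0 : k) • Y 0 0 • Y 0 1 ^ a • m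
    rw [← mul_smul, s20 1, add_smul, smul_assoc, smul_assoc, mul_smul (Y 0 1), mul_smul (Y 1 1), hK,
      smul_comm_of_tower _ (Y 1 1), smul_smul _ _ (Y 1 1 • _), zero_smul, add_zero]
  lam_zero := by simp
  lam_ne n := by
    have h1 := q_pow_ne_one hgen hq (n := n + 1) (by omega)
    have h2 : (q⁻¹ ^ 2) ^ (n + 1) - 1 ≠ 0 := by
      rw [inv_pow, inv_pow]
      exact sub_ne_zero.2 fun h => h1 (inv_eq_one.1 h)
    simp only [ne_eq, mul_eq_zero, h2, or_false]
    simp [hq0, ht0]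
  lam_y n := by
    change _ = q * _
    rw [pow_succ (t⁻¹ ^ 2), pow_succ (q⁻¹ ^ 2)]
    generalize (t⁻¹ ^ 2) ^ n = P, (q⁻¹ ^ 2) ^ n = Q
    field_simp
    ring
  lam_x a := by
    change q⁻¹ * t⁻¹ ^ 2 * q * _ + _ * q = q ^ 2 * _
    rw [pow_succ (t⁻¹ ^ 2), pow_succ (q⁻¹ ^ 2)]
    generalize (t⁻¹ ^ 2) ^ a = P, (q⁻¹ ^ 2) ^ a = Q
    field_simp
    ring
  f₃_eq a := by
    change _ = 0 * _
    rw [zero_mul]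
  cof_zero := by simp
  cof_ne a := by
    have h1 := q_pow_ne_one hgen hq (n := a + 1) (by omega)
    have h2 : (q⁻¹ ^ 2) ^ (a + 1) - 1 ≠ 0 := by
      rw [inv_pow, inv_pow]
      exact sub_ne_zero.2 fun h => h1 (inv_eq_one.1 h)
    simp only [ne_eq, mul_eq_zero, h2, or_false]
    simp [hq0, ht0]
  cof_succ a := by
    change _ = q⁻¹ * t⁻¹ ^ 2 * q * _ + _ - (q - q⁻¹) * _
    rw [pow_succ (t⁻¹ ^ 2), pow_succ (q⁻¹ ^ 2)]
    generalize (t⁻¹ ^ 2) ^ a = P, (q⁻¹ ^ 2) ^ a = Q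
    field_simp
    ring

end Instances


/-! ### Weights of the generators

With suitable weights each entry of each of the tables has a single term of highest weight, the
product of the same two entries in the opposite order. -/

section Leading

set_option linter.unusedSimpArgs false
set_option linter.unnecessarySeqFocus false

variable {k B : Type*} [Field k] [Ring B] [Algebra k B]

/-- Up to terms in `T`, the element `e` is a nonzero scalar multiple of `m`. -/
def Leading (T : Submodule k B) (m e : B) : Prop := ∃ c : k, c ≠ 0 ∧ e - c • m ∈ T

theorem Leading.smul (T : Submodule k B) {c : k} (hc : c ≠ 0) (m : B) : Leading T m (c • m) :=
  ⟨c, hc, by simp⟩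

theorem Leading.refl (T : Submodule k B) (m : B) : Leading T m m :=
  ⟨1, one_ne_zero, by simp⟩

theorem Leading.add {T : Submodule k B} {m e f : B} (h : Leading T m e) (hf : f ∈ T) :
    Leading T m (e + f) := by
  obtain ⟨c, hc, h⟩ := h
  exact ⟨c, hc, by rw [add_sub_right_comm]; exact add_mem h hf⟩

theorem Leading.symm {T : Submodule k B} {m e : B} (h : Leading T m e) : Leading T e m := by
  obtain ⟨c, hc, h⟩ := h
  refine ⟨c⁻¹, inv_ne_zero hc, ?_⟩
  have := T.smul_mem (-c⁻¹) h
  rwa [smul_sub, smul_smul, neg_mul, inv_mul_cancel₀ hc, neg_smul, neg_smul, one_smul,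
    sub_neg_eq_add, neg_add_eq_sub] at this

/-- The weights of the entries of a matrix of reflection type. The parameter `l` decreases from
left to right along a comb, and makes `x¹₂` heavier and `x²₁` lighter. -/
def loopWeight (b l : ℕ) : Mat2 ℕ := !![b + 4, b + 2 + l; b + 2 - l, b]

/-- The weights of the entries of a matrix of FRT type. -/
def frtWeight (b l : ℕ) : Mat2 ℕ := !![b + 1, 2 * b; b - l, 2 * b - l]

/-- The entries of `Y` move past those of `X`, up to nonzero scalars and terms of lower weight,
where `T n` stands for the terms of weight less than `n`. -/
def LeadingSwap (T : ℕ → Submodule k B) (v w : Mat2 ℕ) (Y X : Mat2 B) : Prop :=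
  ∀ i j i' j', Leading (T (v i j + w i' j')) (X i' j' * Y i j) (Y i j * X i' j')

theorem LeadingSwap.symm {T : ℕ → Submodule k B} {v w : Mat2 ℕ} {Y X : Mat2 B}
    (h : LeadingSwap T v w Y X) : LeadingSwap T w v X Y := fun i j i' j' => by
  rw [add_comm]
  exact (h i' j' i j).symm

variable {G : Gauge} {s q t : k} {Y X : Mat2 B} {T : ℕ → Submodule k B} {b l l' : ℕ}

theorem leadingSwap_reflection (hq : s ^ 2 = q) (hq0 : q ≠ 0) (ht : rScale G s = t) (ht0 : t ≠ 0)
    (h : Law.lhs G s X X .reflection = Law.rhs G s X X .reflection) (hl : l + 5 ≤ b)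
    (hT : ∀ i j i' j' n, loopWeight b l i j + loopWeight b l i' j' < n → X i j * X i' j' ∈ T n)
    (hδ : ∀ n, 0 < n → qdet (q ^ 2) X ∈ T n) :
    LeadingSwap T (loopWeight b l) (loopWeight b l) X X := by
  have R := reflection_letters hq hq0 ht ht0 h
  have yx : ∀ T : Submodule k B, Leading T (X 0 1 * X 1 1) (X 1 1 * X 0 1) := fun T => by
    rw [R.yx]
    exact .smul _ (pow_ne_zero 2 hq0) _
  have wy : ∀ T : Submodule k B, Leading T (X 1 1 * X 1 0) (X 1 0 * X 1 1) := fun T => by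
    rw [R.wy]
    exact .smul _ (pow_ne_zero 2 hq0) _
  have zy : ∀ T : Submodule k B, Leading T (X 1 1 * X 0 0) (X 0 0 * X 1 1) := fun T => by
    rw [R.zy, R.yz]
    exact .refl _ _
  have wx : Leading (T (loopWeight b l 1 0 + loopWeight b l 0 1))
      (X 0 1 * X 1 0) (X 1 0 * X 0 1) := by
    rw [R.wx]
    refine ((Leading.smul _ (pow_ne_zero 2 hq0) _).add ?_).add ?_
    · exact Submodule.smul_mem _ _ (hδ _ (by simp [loopWeight]))
    · exact Submodule.smul_mem _ _ (hT _ _ _ _ _ (by simp [loopWeight]; omega))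
  have xz : Leading (T (loopWeight b l 0 1 + loopWeight b l 0 0))
      (X 0 0 * X 0 1) (X 0 1 * X 0 0) := by
    rw [R.xz]
    refine (Leading.smul _ one_ne_zero _).add ?_
    exact Submodule.smul_mem _ _ (hT _ _ _ _ _ (by simp [loopWeight]; omega))
  have wz : Leading (T (loopWeight b l 1 0 + loopWeight b l 0 0))
      (X 0 0 * X 1 0) (X 1 0 * X 0 0) := by
    rw [R.wz]
    refine (Leading.smul _ one_ne_zero _).add ?_
    exact Submodule.smul_mem _ _ (hT _ _ _ _ _ (by simp [loopWeight]; omega))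
  simp only [LeadingSwap, Fin.forall_fin_two]
  exact ⟨⟨⟨⟨.refl _ _, add_comm (loopWeight b l 0 1) _ ▸ xz.symm⟩,
    add_comm (loopWeight b l 1 0) _ ▸ wz.symm, zy _⟩, ⟨xz, .refl _ _⟩,
    add_comm (loopWeight b l 1 0) _ ▸ wx.symm, (yx _).symm⟩,
    ⟨⟨wz, wx⟩, .refl _ _, wy _⟩, ⟨(zy _).symm, yx _⟩, (wy _).symm, .refl _ _⟩

theorem leadingSwap_frt (hq : s ^ 2 = q) (hq0 : q ≠ 0) (ht : rScale G s = t) (ht0 : t ≠ 0)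
    (h : Law.lhs G s X X .frt = Law.rhs G s X X .frt) (hl : l + 5 ≤ b)
    (hδ : ∀ n, 0 < n → qdet q X ∈ T n) :
    LeadingSwap T (frtWeight b l) (frtWeight b l) X X := by
  have R := frt_letters hq hq0 ht ht0 h
  have yx : ∀ T : Submodule k B, Leading T (X 0 1 * X 0 0) (X 0 0 * X 0 1) := fun T => by
    rw [R.yx]
    exact .smul _ hq0 _
  have wy : ∀ T : Submodule k B, Leading T (X 0 0 * X 1 0) (X 1 0 * X 0 0) := fun T => by
    rw [R.wy]
    exact .smul _ hq0 _
  have zy : ∀ T : Submodule k B, Leading T (X 0 0 * X 1 1) (X 1 1 * X 0 0) := fun T => by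
    rw [R.zy, R.yz]
    exact .refl _ _
  have xz : ∀ T : Submodule k B, Leading T (X 1 1 * X 0 1) (X 0 1 * X 1 1) := fun T => by
    rw [R.xz, zero_smul, add_zero]
    exact .smul _ (inv_ne_zero hq0) _
  have wz : ∀ T : Submodule k B, Leading T (X 1 1 * X 1 0) (X 1 0 * X 1 1) := fun T => by
    rw [R.wz, zero_smul, add_zero]
    exact .smul _ hq0 _
  have wx : ∀ n, 0 < n → Leading (T n) (X 0 1 * X 1 0) (X 1 0 * X 0 1) := fun n hn => by
    rw [R.wx, zero_smul, add_zero]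
    exact (Leading.smul _ (pow_ne_zero 2 hq0) _).add (Submodule.smul_mem _ _ (hδ _ hn))
  simp only [LeadingSwap, Fin.forall_fin_two]
  exact ⟨⟨⟨⟨.refl _ _, yx _⟩, (wy _).symm, (zy _).symm⟩, ⟨(yx _).symm, .refl _ _⟩,
    (wx _ (by simp [frtWeight]; omega)).symm, xz _⟩,
    ⟨⟨wy _, wx _ (by simp [frtWeight]; omega)⟩, .refl _ _, wz _⟩,
    ⟨zy _, (xz _).symm⟩, (wz _).symm, .refl _ _⟩

theorem leadingSwap_smash (hq : s ^ 2 = q) (hq0 : q ≠ 0) (ht : rScale G s = t)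
    (ht0 : t ≠ 0) (h : Law.lhs G s Y X .smash = Law.rhs G s Y X .smash)
    (hl : l + 5 ≤ b) (hll : l = l' + 2)
    (hT : ∀ i j i' j' n, loopWeight b l i j + loopWeight b l' i' j' < n → Y i j * X i' j' ∈ T n) :
    LeadingSwap T (loopWeight b l') (loopWeight b l) X Y := by
  have hs := smash_swap hq hq0 ht ht0 h
  simp only [LeadingSwap, Fin.forall_fin_two, hs]
  refine ⟨⟨⟨⟨?_, ?_⟩, ?_, ?_⟩, ⟨?_, ?_⟩, ?_, ?_⟩, ⟨⟨?_, ?_⟩, ?_, ?_⟩, ⟨?_, ?_⟩, ?_, ?_⟩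
  all_goals
    repeat' first
      | exact Leading.refl _ _
      | exact Leading.smul _ (by simp [hq0, ht0]) _
      | refine Leading.add ?_ (Submodule.smul_mem _ _ (hT _ _ _ _ _ ?_))
  all_goals
    simp [loopWeight, frtWeight] <;> omega

theorem leadingSwap_smashFrt (hq : s ^ 2 = q) (hq0 : q ≠ 0) (ht : rScale G s = t)
    (ht0 : t ≠ 0) (h : Law.lhs G s Y X .smashFrt = Law.rhs G s Y X .smashFrt)
    (hl : l + 5 ≤ b) (hll : l = l')
    (hT : ∀ i j i' j' n, frtWeight b l i j + loopWeight b l' i' j' < n → Y i j * X i' j' ∈ T n) :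
    LeadingSwap T (loopWeight b l') (frtWeight b l) X Y := by
  have hs := smashFrt_swap hq hq0 ht ht0 h
  simp only [LeadingSwap, Fin.forall_fin_two, hs]
  refine ⟨⟨⟨⟨?_, ?_⟩, ?_, ?_⟩, ⟨?_, ?_⟩, ?_, ?_⟩, ⟨⟨?_, ?_⟩, ?_, ?_⟩, ⟨?_, ?_⟩, ?_, ?_⟩
  all_goals
    repeat' first
      | exact Leading.refl _ _
      | exact Leading.smul _ (by simp [hq0, ht0]) _
      | refine Leading.add ?_ (Submodule.smul_mem _ _ (hT _ _ _ _ _ ?_))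
  all_goals
    simp [loopWeight, frtWeight] <;> omega

theorem leadingSwap_braidLoopLoop (hq : s ^ 2 = q) (hq0 : q ≠ 0) (ht : rScale G s = t)
    (ht0 : t ≠ 0) (h : Law.lhs G s Y X .braidLoopLoop = Law.rhs G s Y X .braidLoopLoop)
    (hl : l + 5 ≤ b) (hl' : l' + 5 ≤ b) (hll : l + 6 ≤ l')
    (hT : ∀ i j i' j' n, loopWeight b l' i j + loopWeight b l i' j' < n → X i j * Y i' j' ∈ T n) :
    LeadingSwap T (loopWeight b l) (loopWeight b l') Y X := by
  have hs := braidLoopLoop_yx hq hq0 ht ht0 h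
  simp only [LeadingSwap, Fin.forall_fin_two, hs]
  refine ⟨⟨⟨⟨?_, ?_⟩, ?_, ?_⟩, ⟨?_, ?_⟩, ?_, ?_⟩, ⟨⟨?_, ?_⟩, ?_, ?_⟩, ⟨?_, ?_⟩, ?_, ?_⟩
  all_goals
    repeat' first
      | exact Leading.refl _ _
      | exact Leading.smul _ (by simp [hq0, ht0]) _
      | refine Leading.add ?_ (Submodule.smul_mem _ _ (hT _ _ _ _ _ ?_))
  all_goals
    simp [loopWeight, frtWeight] <;> omega

theorem leadingSwap_braidFrtLoop (hq : s ^ 2 = q) (hq0 : q ≠ 0) (ht : rScale G s = t)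
    (ht0 : t ≠ 0) (h : Law.lhs G s Y X .braidFrtLoop = Law.rhs G s Y X .braidFrtLoop)
    (hl : l + 5 ≤ b) (hl' : l' + 5 ≤ b) (hll : l + 6 ≤ l')
    (hT : ∀ i j i' j' n, loopWeight b l' i j + frtWeight b l i' j' < n → X i j * Y i' j' ∈ T n) :
    LeadingSwap T (frtWeight b l) (loopWeight b l') Y X := by
  have hs := braidFrtLoop_yx hq hq0 ht ht0 h
  simp only [LeadingSwap, Fin.forall_fin_two, hs]
  refine ⟨⟨⟨⟨?_, ?_⟩, ?_, ?_⟩, ⟨?_, ?_⟩, ?_, ?_⟩, ⟨⟨?_, ?_⟩, ?_, ?_⟩, ⟨?_, ?_⟩, ?_, ?_⟩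
  all_goals
    repeat' first
      | exact Leading.refl _ _
      | exact Leading.smul _ (by simp [hq0, ht0]) _
      | refine Leading.add ?_ (Submodule.smul_mem _ _ (hT _ _ _ _ _ ?_))
  all_goals
    simp [loopWeight, frtWeight] <;> omega

theorem leadingSwap_braidLoopFrt (hq : s ^ 2 = q) (hq0 : q ≠ 0) (ht : rScale G s = t)
    (ht0 : t ≠ 0) (h : Law.lhs G s Y X .braidLoopFrt = Law.rhs G s Y X .braidLoopFrt)
    (hl : l + 5 ≤ b) (hl' : l' + 5 ≤ b) (hll : l + 6 ≤ l')
    (hT : ∀ i j i' j' n, frtWeight b l' i j + loopWeight b l i' j' < n → X i j * Y i' j' ∈ T n) :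
    LeadingSwap T (loopWeight b l) (frtWeight b l') Y X := by
  have hs := braidLoopFrt_yx hq hq0 ht ht0 h
  simp only [LeadingSwap, Fin.forall_fin_two, hs]
  refine ⟨⟨⟨⟨?_, ?_⟩, ?_, ?_⟩, ⟨?_, ?_⟩, ?_, ?_⟩, ⟨⟨?_, ?_⟩, ?_, ?_⟩, ⟨?_, ?_⟩, ?_, ?_⟩
  all_goals
    repeat' first
      | exact Leading.refl _ _
      | exact Leading.smul _ (by simp [hq0, ht0]) _
      | refine Leading.add ?_ (Submodule.smul_mem _ _ (hT _ _ _ _ _ ?_))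
  all_goals
    simp [loopWeight, frtWeight] <;> omega

theorem leadingSwap_braidFrtFrt (hq : s ^ 2 = q) (hq0 : q ≠ 0) (ht : rScale G s = t)
    (ht0 : t ≠ 0) (h : Law.lhs G s Y X .braidFrtFrt = Law.rhs G s Y X .braidFrtFrt)
    (hl : l + 5 ≤ b) (hl' : l' + 5 ≤ b) (hll : l + 6 ≤ l')
    (hT : ∀ i j i' j' n, frtWeight b l i j + frtWeight b l' i' j' < n → Y i j * X i' j' ∈ T n) :
    LeadingSwap T (frtWeight b l') (frtWeight b l) X Y := by
  have hs := braidFrtFrt_xy hq hq0 ht ht0 h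
  simp only [LeadingSwap, Fin.forall_fin_two, hs]
  refine ⟨⟨⟨⟨?_, ?_⟩, ?_, ?_⟩, ⟨?_, ?_⟩, ?_, ?_⟩, ⟨⟨?_, ?_⟩, ?_, ?_⟩, ⟨?_, ?_⟩, ?_, ?_⟩
  all_goals
    repeat' first
      | exact Leading.refl _ _
      | exact Leading.smul _ (by simp [hq0, ht0]) _
      | refine Leading.add ?_ (Submodule.smul_mem _ _ (hT _ _ _ _ _ ?_))
  all_goals
    simp [loopWeight, frtWeight] <;> omega

theorem leadingSwap_endLoop (hq : s ^ 2 = q) (hq0 : q ≠ 0) (ht : rScale G s = t)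
    (ht0 : t ≠ 0) (h : Law.lhs G s Y X .endLoop = Law.rhs G s Y X .endLoop)
    (hl : l + 5 ≤ b) (hl' : l' + 5 ≤ b)
    (hT : ∀ i j i' j' n, frtWeight b l' i j + loopWeight b l i' j' < n → X i j * Y i' j' ∈ T n) :
    LeadingSwap T (loopWeight b l) (frtWeight b l') Y X := by
  have hs := endLoop_yx hq hq0 ht ht0 h
  simp only [LeadingSwap, Fin.forall_fin_two, hs]
  refine ⟨⟨⟨⟨?_, ?_⟩, ?_, ?_⟩, ⟨?_, ?_⟩, ?_, ?_⟩, ⟨⟨?_, ?_⟩, ?_, ?_⟩, ⟨?_, ?_⟩, ?_, ?_⟩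
  all_goals
    repeat' first
      | exact Leading.refl _ _
      | exact Leading.smul _ (by simp [hq0, ht0]) _
      | refine Leading.add ?_ (Submodule.smul_mem _ _ (hT _ _ _ _ _ ?_))
  all_goals
    simp [loopWeight, frtWeight] <;> omega

theorem leadingSwap_endFrt (hq : s ^ 2 = q) (hq0 : q ≠ 0) (ht : rScale G s = t)
    (ht0 : t ≠ 0) (h : Law.lhs G s Y X .endFrt = Law.rhs G s Y X .endFrt)
    (hl : l + 5 ≤ b) (hl' : l' + 5 ≤ b)
    (hT : ∀ i j i' j' n, frtWeight b l' i j + frtWeight b l i' j' < n → X i j * Y i' j' ∈ T n) :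
    LeadingSwap T (frtWeight b l) (frtWeight b l') Y X := by
  have hs := endFrt_yx hq hq0 ht ht0 h
  simp only [LeadingSwap, Fin.forall_fin_two, hs]
  refine ⟨⟨⟨⟨?_, ?_⟩, ?_, ?_⟩, ⟨?_, ?_⟩, ?_, ?_⟩, ⟨⟨?_, ?_⟩, ?_, ?_⟩, ⟨?_, ?_⟩, ?_, ?_⟩
  all_goals
    repeat' first
      | exact Leading.refl _ _
      | exact Leading.smul _ (by simp [hq0, ht0]) _
      | refine Leading.add ?_ (Submodule.smul_mem _ _ (hT _ _ _ _ _ ?_))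
  all_goals
    simp [loopWeight, frtWeight] <;> omega

theorem commute_of_law (h : Law.lhs G s Y X .commute = Law.rhs G s Y X .commute) (i j i' j') :
    Y i j * X i' j' = X i' j' * Y i j := by
  have h' := fun a b c d => congrFun (congrFun h (a, b)) (c, d)
  simp only [Fin.forall_fin_two, Law.lhs, Law.rhs, leg1, leg2, Matrix.mul_apply,
    Fintype.sum_prod_type, Fin.sum_univ_two] at h'
  simp at h'
  revert i j i' j'
  simp only [Fin.forall_fin_two]
  tauto

end Leading


/-! ### The algebras of gluing patterns are Noetherian -/

section SkewCommute

variable {k B : Type*} [Field k] [Ring B] [Algebra k B]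

variable (k) in
/-- Commutation up to a nonzero scalar. -/
def SkewCommute (a b : B) : Prop := ∃ c : k, c ≠ 0 ∧ a * b = c • (b * a)

theorem SkewCommute.symm {a b : B} (h : SkewCommute k a b) : SkewCommute k b a := by
  obtain ⟨c, hc, h⟩ := h
  exact ⟨c⁻¹, inv_ne_zero hc, by rw [h, inv_smul_smul₀ hc]⟩

theorem SkewCommute.inv_right {a u v : B} (huv : u * v = 1) (hvu : v * u = 1)
    (h : SkewCommute k a u) : SkewCommute k a v := by
  obtain ⟨c, hc, h⟩ := h
  exact ⟨c⁻¹, inv_ne_zero hc, mul_inv_of_mul hc huv hvu h⟩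

theorem SkewCommute.leading {a b : B} (h : SkewCommute k a b) (T : Submodule k B) :
    Leading T (b * a) (a * b) := by
  obtain ⟨c, hc, h⟩ := h
  exact h ▸ .smul T hc _

end SkewCommute

namespace Presentation

variable {k : Type*} [Field k] (G : Gauge) (s : k) (P : Presentation)

/-- Generators of the algebra: the entries of the matrices, the `q`-determinants (`true`) and
their inverses (`false`). -/
def gens : P.Idx × (Fin 2 × Fin 2 ⊕ Bool) → Alg G s P
  | (x, .inl (i, j)) => mat G s P x i j
  | (x, .inr true) => det G s P x
  | (x, .inr false) => detInv G s P x

/-- The weights of the generators; the `q`-determinants and their inverses have weight zero. -/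
def genWeight (ω : P.Idx → Mat2 ℕ) : P.Idx × (Fin 2 × Fin 2 ⊕ Bool) → ℕ
  | (x, .inl (i, j)) => ω x i j
  | (_, .inr _) => 0

/-- The span of the words of weight less than `n` in the generators. -/
abbrev lowWords (ω : P.Idx → Mat2 ℕ) (n : ℕ) : Submodule k (Alg G s P) :=
  wordsBelow (gens G s P) (genWeight P ω) n

variable {G s P} {ω : P.Idx → Mat2 ℕ}

theorem mat_mul_mat_mem_lowWords {x y : P.Idx} {i j i' j' : Fin 2} {n : ℕ}
    (h : ω x i j + ω y i' j' < n) :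
    mat G s P x i j * mat G s P y i' j' ∈ lowWords G s P ω n := by
  have := word_mem_wordsBelow (k := k) (x := gens G s P) (wt := genWeight P ω) (n := n)
    [(x, .inl (i, j)), (y, .inl (i', j'))] (by simpa [genWeight] using h)
  simpa [gens] using this

theorem det_mem_lowWords {x : P.Idx} {n : ℕ} (h : 0 < n) :
    det G s P x ∈ lowWords G s P ω n := by
  have := word_mem_wordsBelow (k := k) (x := gens G s P) (wt := genWeight P ω) (n := n)
    [(x, .inr true)] (by simpa [genWeight] using h)
  simpa [gens] using this

variable (G s P ω) in
/-- The generators of `y` move past those of `x`, up to nonzero scalars and terms of lower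
weight. -/
structure Swappable (y x : P.Idx) : Prop where
  entry : LeadingSwap (lowWords G s P ω) (ω y) (ω x) (mat G s P y) (mat G s P x)
  right : ∃ c : k, c ≠ 0 ∧ ∀ i j,
    mat G s P y i j * det G s P x = c • (det G s P x * mat G s P y i j)
  left : ∃ c : k, c ≠ 0 ∧ ∀ i j,
    det G s P y * mat G s P x i j = c • (mat G s P x i j * det G s P y)

theorem Swappable.det_det {y x : P.Idx} (h : Swappable G s P ω y x) :
    SkewCommute k (det G s P y) (det G s P x) := by
  obtain ⟨c, hc, h⟩ := h.left
  exact ⟨c ^ 2, pow_ne_zero 2 hc, mul_qdet_of_mul h _⟩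

theorem Swappable.symm {y x : P.Idx} (h : Swappable G s P ω y x) : Swappable G s P ω x y where
  entry := h.entry.symm
  right := by
    obtain ⟨c, hc, h⟩ := h.left
    exact ⟨c⁻¹, inv_ne_zero hc, fun i j => by rw [h, inv_smul_smul₀ hc]⟩
  left := by
    obtain ⟨c, hc, h⟩ := h.right
    exact ⟨c⁻¹, inv_ne_zero hc, fun i j => by rw [h, inv_smul_smul₀ hc]⟩

theorem Swappable.det_gens {y x : P.Idx} (h : Swappable G s P ω y x)
    (a : Fin 2 × Fin 2 ⊕ Bool) : SkewCommute k (det G s P y) (gens G s P (x, a)) := by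
  match a with
  | .inl (i, j) =>
    obtain ⟨c, hc, h⟩ := h.left
    exact ⟨c, hc, h i j⟩
  | .inr true => exact h.det_det
  | .inr false => exact h.det_det.inv_right (det_mul_detInv x) (detInv_mul_det x)

theorem Swappable.inr_gens {y x : P.Idx} (h : Swappable G s P ω y x) (e : Bool)
    (a : Fin 2 × Fin 2 ⊕ Bool) : SkewCommute k (gens G s P (y, .inr e)) (gens G s P (x, a)) := by
  cases e with
  | true => exact h.det_gens a
  | false => exact ((h.det_gens a).symm.inv_right (det_mul_detInv y) (detInv_mul_det y)).symm

/-- The generators of the algebra quasi-commute, the determinants and their inverses having weight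
zero. -/
theorem quasiCommute_of_swappable (h : ∀ y x, Swappable G s P ω y x) :
    QuasiCommute k (gens G s P) (genWeight P ω) := by
  rintro ⟨y, (⟨i, j⟩ | e)⟩ ⟨x, a⟩
  · match a with
    | .inl (i', j') => exact (h y x).entry i j i' j'
    | .inr e => exact ((h x y).inr_gens e (.inl (i, j))).symm.leading _
  · exact ((h y x).inr_gens e a).leading _

theorem adjoin_gens : Algebra.adjoin k (Set.range (gens G s P)) = ⊤ := by
  refine eq_top_iff.2 fun a _ => mem_of_generators _ (fun x i j => ?_) (fun x => ?_) a
  · exact Algebra.subset_adjoin ⟨(x, .inl (i, j)), rfl⟩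
  · exact Algebra.subset_adjoin ⟨(x, .inr false), rfl⟩

theorem isNoetherianRing_of_swappable [Finite P.Idx] (h : ∀ y x, Swappable G s P ω y x) :
    IsNoetherianRing (Alg G s P) :=
  (quasiCommute_of_swappable h).isNoetherianRing adjoin_gens

theorem det_of_loop {x : P.Idx} (hx : P.loop x) :
    det G s P x = qdet ((s ^ 2) ^ 2) (mat G s P x) := by
  rw [det, detConst, if_pos hx]

theorem det_of_not_loop {x : P.Idx} (hx : ¬ P.loop x) :
    det G s P x = qdet (s ^ 2) (mat G s P x) := by
  rw [det, detConst, if_neg hx]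

end Presentation

namespace GluingPattern

open Presentation

variable {k : Type*} [Field k] {G : Gauge} {s : k} {P : GluingPattern}

open Classical in
/-- The parameter of the weights of a matrix in a gluing pattern, for a function `rank` that
decreases along combs. The two matrices of a handle differ by a small amount. -/
def slope (rank : P.Block → ℕ) (x : P.Block × Cycle) : ℕ :=
  8 * rank x.1 + if x.2 = .compl ∧ P.handle x.1 then 2 else 0

open Classical in
/-- The weights of the entries of a matrix in a gluing pattern. -/
def weight (rank : P.Block → ℕ) (R : ℕ) (x : P.Block × Cycle) : Mat2 ℕ :=
  if P.IsLoop x then loopWeight (8 * (R + 1)) (slope rank x)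
  else frtWeight (8 * (R + 1)) (slope rank x)

variable {rank : P.Block → ℕ} {R : ℕ}

theorem weight_of_loop {x : P.Block × Cycle} (hx : P.IsLoop x) :
    weight rank R x = loopWeight (8 * (R + 1)) (slope rank x) := if_pos hx

theorem weight_of_not_loop {x : P.Block × Cycle} (hx : ¬ P.IsLoop x) :
    weight rank R x = frtWeight (8 * (R + 1)) (slope rank x) := if_neg hx

theorem slope_add_le (hR : ∀ i, rank i ≤ R) (x : P.Block × Cycle) :
    slope rank x + 5 ≤ 8 * (R + 1) := by
  have := hR x.1
  unfold slope
  split <;> omega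

theorem slope_add_le_slope {x y : P.Block × Cycle} (h : rank y.1 < rank x.1) :
    slope rank y + 6 ≤ slope rank x := by
  unfold slope
  split <;> split <;> omega

theorem swappable_self (hs : s ≠ 0) (hR : ∀ i, rank i ≤ R) (x : P.Block × Cycle) :
    Swappable G s P.pres (weight rank R) x x := by
  have hq0 := pow_ne_zero 2 hs
  have ht0 := rScale_ne_zero G hs
  by_cases hx : P.IsLoop x
  · have h := law_eq (G := G) (s := s) (P := P.pres) (Laws.reflection x hx)
    have R' := reflection_letters rfl hq0 rfl ht0 h
    have hd := det_of_loop (G := G) (s := s) (P := P.pres) (x := x) hx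
    have hc : ∀ i j, det G s P.pres x * mat G s P.pres x i j =
        mat G s P.pres x i j * det G s P.pres x := by
      rw [hd]
      simp only [Fin.forall_fin_two]
      exact ⟨⟨R'.δz, R'.δx⟩, R'.δw, R'.δy⟩
    refine ⟨?_, ⟨1, one_ne_zero, fun i j => ?_⟩, ⟨1, one_ne_zero, fun i j => ?_⟩⟩
    · rw [weight_of_loop hx]
      refine leadingSwap_reflection rfl hq0 rfl ht0 h (slope_add_le hR x) ?_ ?_
      · intro i j i' j' n hn
        exact mat_mul_mat_mem_lowWords (by rwa [weight_of_loop hx])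
      · intro n hn
        rw [← hd]
        exact det_mem_lowWords hn
    · rw [one_smul, hc]
    · rw [one_smul, hc]
  · have h := law_eq (G := G) (s := s) (P := P.pres) (Laws.frt x hx)
    have R' := frt_letters rfl hq0 rfl ht0 h
    have hd := det_of_not_loop (G := G) (s := s) (P := P.pres) (x := x) hx
    have hc : ∀ i j, det G s P.pres x * mat G s P.pres x i j =
        mat G s P.pres x i j * det G s P.pres x := by
      rw [hd]
      simp only [Fin.forall_fin_two]
      exact ⟨⟨R'.δy, R'.δx⟩, R'.δw, R'.δz⟩
    refine ⟨?_, ⟨1, one_ne_zero, fun i j => ?_⟩, ⟨1, one_ne_zero, fun i j => ?_⟩⟩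
    · rw [weight_of_not_loop hx]
      refine leadingSwap_frt rfl hq0 rfl ht0 h (slope_add_le hR x) ?_
      intro n hn
      rw [← hd]
      exact det_mem_lowWords hn
    · rw [one_smul, hc]
    · rw [one_smul, hc]

/-- Matrices whose entries commute. -/
theorem swappable_of_commute {ω : P.Block × Cycle → Mat2 ℕ} {y x : P.Block × Cycle}
    (h : P.Laws .commute y x) : Swappable G s P.pres ω y x := by
  have hc := commute_of_law (law_eq (G := G) (s := s) (P := P.pres) h)
  refine ⟨fun i j i' j' => ?_, ⟨1, one_ne_zero, fun i j => ?_⟩, ⟨1, one_ne_zero, fun i j => ?_⟩⟩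
  · rw [hc]
    exact .refl _ _
  · have := mul_qdet_of_mul (r := (1 : k)) (Y := mat G s P.pres x) (δ := mat G s P.pres y i j)
      (fun a b => by rw [hc, one_smul]) (detConst s P.pres x)
    rwa [one_pow] at this
  · have := mul_qdet_of_mul (r := (1 : k)) (Y := mat G s P.pres y) (δ := mat G s P.pres x i j)
      (fun a b => by rw [hc, one_smul]) (detConst s P.pres y)
    rw [one_pow, one_smul] at this
    rw [one_smul]
    exact this.symm

theorem det_of_isLoop {x : P.Block × Cycle} (hx : P.IsLoop x) :
    det G s P.pres x = qdet ((s ^ 2) ^ 2) (mat G s P.pres x) := det_of_loop (P := P.pres) hx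

theorem det_of_not_isLoop {x : P.Block × Cycle} (hx : ¬ P.IsLoop x) :
    det G s P.pres x = qdet (s ^ 2) (mat G s P.pres x) := det_of_not_loop (P := P.pres) hx

theorem reflection_eq {x : P.Block × Cycle} (hx : P.IsLoop x) :
    Law.lhs G s (mat G s P.pres x) (mat G s P.pres x) .reflection =
      Law.rhs G s (mat G s P.pres x) (mat G s P.pres x) .reflection :=
  law_eq (P := P.pres) (Laws.reflection x hx)

theorem frt_eq {x : P.Block × Cycle} (hx : ¬ P.IsLoop x) :
    Law.lhs G s (mat G s P.pres x) (mat G s P.pres x) .frt =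
      Law.rhs G s (mat G s P.pres x) (mat G s P.pres x) .frt :=
  law_eq (P := P.pres) (Laws.frt x hx)

theorem swappable_smash (hs : s ≠ 0) (hR : ∀ i, rank i ≤ R) {y x : P.Block × Cycle}
    (h : P.Laws .smash y x) (hy : P.IsLoop y) (hx : P.IsLoop x)
    (hyx : slope rank y = slope rank x + 2) :
    Swappable G s P.pres (weight rank R) y x := by
  have hq0 := pow_ne_zero 2 hs
  have ht0 := rScale_ne_zero G hs
  have hl := law_eq (G := G) (s := s) (P := P.pres) h
  have hd := det_smash rfl hq0 rfl ht0 hl (reflection_eq hy) (reflection_eq hx)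
  rw [← det_of_isLoop hy, ← det_of_isLoop hx] at hd
  have hT : ∀ a b i j i' j' n, weight rank R a i j + weight rank R b i' j' < n →
      mat G s P.pres a i j * mat G s P.pres b i' j' ∈ lowWords G s P.pres (weight rank R) n :=
    fun a b i j i' j' n hn => mat_mul_mat_mem_lowWords hn
  have he := (leadingSwap_smash (T := lowWords G s P.pres (weight rank R)) rfl hq0 rfl ht0 hl
    (slope_add_le hR y) hyx (weight_of_loop hy ▸ weight_of_loop hx ▸ hT y x)).symm
  rw [← weight_of_loop hy, ← weight_of_loop hx] at he
  have hr : Swappable G s P.pres (weight rank R) x y :=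
    ⟨he.symm, ⟨_, by simp [hs, ht0], hd.1⟩, ⟨_, by simp [hs, ht0], hd.2⟩⟩
  exact hr.symm

theorem swappable_smashFrt (hs : s ≠ 0) (hR : ∀ i, rank i ≤ R) {y x : P.Block × Cycle}
    (h : P.Laws .smashFrt y x) (hy : ¬ P.IsLoop y) (hx : P.IsLoop x)
    (hyx : slope rank y = slope rank x) :
    Swappable G s P.pres (weight rank R) y x := by
  have hq0 := pow_ne_zero 2 hs
  have ht0 := rScale_ne_zero G hs
  have hl := law_eq (G := G) (s := s) (P := P.pres) h
  have hd := det_smashFrt rfl hq0 rfl ht0 hl (frt_eq hy) (reflection_eq hx)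
  rw [← det_of_not_isLoop hy, ← det_of_isLoop hx] at hd
  have hT : ∀ a b i j i' j' n, weight rank R a i j + weight rank R b i' j' < n →
      mat G s P.pres a i j * mat G s P.pres b i' j' ∈ lowWords G s P.pres (weight rank R) n :=
    fun a b i j i' j' n hn => mat_mul_mat_mem_lowWords hn
  have he := (leadingSwap_smashFrt (T := lowWords G s P.pres (weight rank R)) rfl hq0 rfl ht0 hl
    (slope_add_le hR y) hyx (weight_of_not_loop hy ▸ weight_of_loop hx ▸ hT y x)).symm
  rw [← weight_of_not_loop hy, ← weight_of_loop hx] at he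
  have hr : Swappable G s P.pres (weight rank R) x y :=
    ⟨he.symm, ⟨_, by simp [hs, ht0], hd.1⟩, ⟨_, by simp [hs, ht0], hd.2⟩⟩
  exact hr.symm

theorem swappable_braidLoopLoop (hs : s ≠ 0) (hR : ∀ i, rank i ≤ R) {y x : P.Block × Cycle}
    (h : P.Laws .braidLoopLoop y x) (hy : P.IsLoop y) (hx : P.IsLoop x)
    (hr : rank y.1 < rank x.1) :
    Swappable G s P.pres (weight rank R) y x := by
  have hq0 := pow_ne_zero 2 hs
  have ht0 := rScale_ne_zero G hs
  have hl := law_eq (G := G) (s := s) (P := P.pres) h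
  have hd := det_braidLoopLoop rfl hq0 rfl ht0 hl (reflection_eq hy) (reflection_eq hx)
  rw [← det_of_isLoop hy, ← det_of_isLoop hx] at hd
  have hT : ∀ a b i j i' j' n, weight rank R a i j + weight rank R b i' j' < n →
      mat G s P.pres a i j * mat G s P.pres b i' j' ∈ lowWords G s P.pres (weight rank R) n :=
    fun a b i j i' j' n hn => mat_mul_mat_mem_lowWords hn
  have he := leadingSwap_braidLoopLoop (T := lowWords G s P.pres (weight rank R)) rfl hq0 rfl ht0 hl
    (slope_add_le hR y) (slope_add_le hR x) (slope_add_le_slope hr)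
    (weight_of_loop hy ▸ weight_of_loop hx ▸ hT x y)
  rw [← weight_of_loop hy, ← weight_of_loop hx] at he
  exact ⟨he, ⟨1, one_ne_zero, by simpa using hd.1⟩, ⟨1, one_ne_zero, by simpa using hd.2⟩⟩

theorem swappable_braidFrtLoop (hs : s ≠ 0) (hR : ∀ i, rank i ≤ R) {y x : P.Block × Cycle}
    (h : P.Laws .braidFrtLoop y x) (hy : ¬ P.IsLoop y) (hx : P.IsLoop x)
    (hr : rank y.1 < rank x.1) :
    Swappable G s P.pres (weight rank R) y x := by
  have hq0 := pow_ne_zero 2 hs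
  have ht0 := rScale_ne_zero G hs
  have hl := law_eq (G := G) (s := s) (P := P.pres) h
  have hd := det_braidFrtLoop rfl hq0 rfl ht0 hl (frt_eq hy) (reflection_eq hx)
  rw [← det_of_not_isLoop hy, ← det_of_isLoop hx] at hd
  have hT : ∀ a b i j i' j' n, weight rank R a i j + weight rank R b i' j' < n →
      mat G s P.pres a i j * mat G s P.pres b i' j' ∈ lowWords G s P.pres (weight rank R) n :=
    fun a b i j i' j' n hn => mat_mul_mat_mem_lowWords hn
  have he := leadingSwap_braidFrtLoop (T := lowWords G s P.pres (weight rank R)) rfl hq0 rfl ht0 hl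
    (slope_add_le hR y) (slope_add_le hR x) (slope_add_le_slope hr)
    (weight_of_not_loop hy ▸ weight_of_loop hx ▸ hT x y)
  rw [← weight_of_not_loop hy, ← weight_of_loop hx] at he
  exact ⟨he, ⟨1, one_ne_zero, by simpa using hd.1⟩, ⟨1, one_ne_zero, by simpa using hd.2⟩⟩

theorem swappable_braidLoopFrt (hs : s ≠ 0) (hR : ∀ i, rank i ≤ R) {y x : P.Block × Cycle}
    (h : P.Laws .braidLoopFrt y x) (hy : P.IsLoop y) (hx : ¬ P.IsLoop x)
    (hr : rank y.1 < rank x.1) :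
    Swappable G s P.pres (weight rank R) y x := by
  have hq0 := pow_ne_zero 2 hs
  have ht0 := rScale_ne_zero G hs
  have hl := law_eq (G := G) (s := s) (P := P.pres) h
  have hd := det_braidLoopFrt rfl hq0 rfl ht0 hl (reflection_eq hy) (frt_eq hx)
  rw [← det_of_isLoop hy, ← det_of_not_isLoop hx] at hd
  have hT : ∀ a b i j i' j' n, weight rank R a i j + weight rank R b i' j' < n →
      mat G s P.pres a i j * mat G s P.pres b i' j' ∈ lowWords G s P.pres (weight rank R) n :=
    fun a b i j i' j' n hn => mat_mul_mat_mem_lowWords hn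
  have he := leadingSwap_braidLoopFrt (T := lowWords G s P.pres (weight rank R)) rfl hq0 rfl ht0 hl
    (slope_add_le hR y) (slope_add_le hR x) (slope_add_le_slope hr)
    (weight_of_loop hy ▸ weight_of_not_loop hx ▸ hT x y)
  rw [← weight_of_loop hy, ← weight_of_not_loop hx] at he
  exact ⟨he, ⟨1, one_ne_zero, by simpa using hd.1⟩, ⟨1, one_ne_zero, by simpa using hd.2⟩⟩

theorem swappable_braidFrtFrt (hs : s ≠ 0) (hR : ∀ i, rank i ≤ R) {y x : P.Block × Cycle}
    (h : P.Laws .braidFrtFrt y x) (hy : ¬ P.IsLoop y) (hx : ¬ P.IsLoop x)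
    (hr : rank y.1 < rank x.1) :
    Swappable G s P.pres (weight rank R) y x := by
  have hq0 := pow_ne_zero 2 hs
  have ht0 := rScale_ne_zero G hs
  have hl := law_eq (G := G) (s := s) (P := P.pres) h
  have hd := det_braidFrtFrt rfl hq0 rfl ht0 hl (frt_eq hy) (frt_eq hx)
  rw [← det_of_not_isLoop hy, ← det_of_not_isLoop hx] at hd
  have hT : ∀ a b i j i' j' n, weight rank R a i j + weight rank R b i' j' < n →
      mat G s P.pres a i j * mat G s P.pres b i' j' ∈ lowWords G s P.pres (weight rank R) n :=
    fun a b i j i' j' n hn => mat_mul_mat_mem_lowWords hn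
  have he := (leadingSwap_braidFrtFrt (T := lowWords G s P.pres (weight rank R)) rfl hq0 rfl ht0 hl
    (slope_add_le hR y) (slope_add_le hR x) (slope_add_le_slope hr)
    (weight_of_not_loop hy ▸ weight_of_not_loop hx ▸ hT y x)).symm
  rw [← weight_of_not_loop hy, ← weight_of_not_loop hx] at he
  have hr : Swappable G s P.pres (weight rank R) x y :=
    ⟨he.symm, ⟨_, by simp [hs, ht0], hd.1⟩, ⟨_, by simp [hs, ht0], hd.2⟩⟩
  exact hr.symm

theorem swappable_endLoop (hs : s ≠ 0) (hR : ∀ i, rank i ≤ R) {y x : P.Block × Cycle}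
    (h : P.Laws .endLoop y x) (hy : P.IsLoop y) (hx : ¬ P.IsLoop x) :
    Swappable G s P.pres (weight rank R) y x := by
  have hq0 := pow_ne_zero 2 hs
  have ht0 := rScale_ne_zero G hs
  have hl := law_eq (G := G) (s := s) (P := P.pres) h
  have hd := det_endLoop rfl hq0 rfl ht0 hl (reflection_eq hy) (frt_eq hx)
  rw [← det_of_isLoop hy, ← det_of_not_isLoop hx] at hd
  have hT : ∀ a b i j i' j' n, weight rank R a i j + weight rank R b i' j' < n →
      mat G s P.pres a i j * mat G s P.pres b i' j' ∈ lowWords G s P.pres (weight rank R) n :=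
    fun a b i j i' j' n hn => mat_mul_mat_mem_lowWords hn
  have he := leadingSwap_endLoop (T := lowWords G s P.pres (weight rank R)) rfl hq0 rfl ht0 hl
    (slope_add_le hR y) (slope_add_le hR x) (weight_of_loop hy ▸ weight_of_not_loop hx ▸ hT x y)
  rw [← weight_of_loop hy, ← weight_of_not_loop hx] at he
  exact ⟨he, ⟨1, one_ne_zero, by simpa using hd.1⟩, ⟨1, one_ne_zero, by simpa using hd.2⟩⟩

theorem swappable_endFrt (hs : s ≠ 0) (hR : ∀ i, rank i ≤ R) {y x : P.Block × Cycle}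
    (h : P.Laws .endFrt y x) (hy : ¬ P.IsLoop y) (hx : ¬ P.IsLoop x) :
    Swappable G s P.pres (weight rank R) y x := by
  have hq0 := pow_ne_zero 2 hs
  have ht0 := rScale_ne_zero G hs
  have hl := law_eq (G := G) (s := s) (P := P.pres) h
  have hd := det_endFrt rfl hq0 rfl ht0 hl (frt_eq hy) (frt_eq hx)
  rw [← det_of_not_isLoop hy, ← det_of_not_isLoop hx] at hd
  have hT : ∀ a b i j i' j' n, weight rank R a i j + weight rank R b i' j' < n →
      mat G s P.pres a i j * mat G s P.pres b i' j' ∈ lowWords G s P.pres (weight rank R) n :=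
    fun a b i j i' j' n hn => mat_mul_mat_mem_lowWords hn
  have he := leadingSwap_endFrt (T := lowWords G s P.pres (weight rank R)) rfl hq0 rfl ht0 hl
    (slope_add_le hR y) (slope_add_le hR x) (weight_of_not_loop hy ▸ weight_of_not_loop hx ▸ hT x y)
  rw [← weight_of_not_loop hy, ← weight_of_not_loop hx] at he
  exact ⟨he, ⟨_, by simp [hs, ht0], hd.1⟩, ⟨_, by simp [hs, ht0], hd.2⟩⟩

theorem swappable_compl_A (hs : s ≠ 0) (hR : ∀ i, rank i ≤ R) (i : P.Block) :
    Swappable G s P.pres (weight rank R) (i, .compl) (i, .A) := by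
  by_cases hi : P.handle i
  · exact swappable_smash hs hR (.smash i hi) (Or.inr hi) (Or.inl rfl) (by simp [slope, hi])
  · exact swappable_smashFrt hs hR (.smashFrt i hi) (by simp [IsLoop, hi]) (Or.inl rfl)
      (by simp [slope, hi])

theorem swappable_of_before (hs : s ≠ 0) (hR : ∀ i, rank i ≤ R) {x y : P.Block × Cycle}
    (h : P.before x.1 y.1) (hr : rank y.1 < rank x.1) :
    Swappable G s P.pres (weight rank R) y x := by
  by_cases hx : P.IsLoop x <;> by_cases hy : P.IsLoop y
  · exact swappable_braidLoopLoop hs hR (.braidLoopLoop _ _ h hy hx) hy hx hr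
  · exact swappable_braidFrtLoop hs hR (.braidFrtLoop _ _ h hy hx) hy hx hr
  · exact swappable_braidLoopFrt hs hR (.braidLoopFrt _ _ h hy hx) hy hx hr
  · exact swappable_braidFrtFrt hs hR (.braidFrtFrt _ _ h hy hx) hy hx hr

theorem swappable_of_feeds (hs : s ≠ 0) (hR : ∀ i, rank i ≤ R) {x y : P.Block × Cycle}
    (h : P.feeds x.1 y.1) : Swappable G s P.pres (weight rank R) y x := by
  by_cases hx : P.IsLoop x
  · exact swappable_of_commute (.commuteFeeds _ _ h hx)
  by_cases hy : P.IsLoop y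
  · exact swappable_endLoop hs hR (.endLoop _ _ h hy hx) hy hx
  · exact swappable_endFrt hs hR (.endFrt _ _ h hy hx) hy hx

theorem swappable (hs : s ≠ 0) (hR : ∀ i, rank i ≤ R)
    (hr : ∀ i j, P.before i j → rank j < rank i) (y x : P.Block × Cycle) :
    Swappable G s P.pres (weight rank R) y x := by
  by_cases hne : x.1 = y.1
  · obtain ⟨i, a⟩ := x
    obtain ⟨j, b⟩ := y
    obtain rfl : i = j := hne
    cases a <;> cases b
    · exact swappable_self hs hR _
    · exact swappable_compl_A hs hR i
    · exact (swappable_compl_A hs hR i).symm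
    · exact swappable_self hs hR _
  by_cases h1 : P.before x.1 y.1
  · exact swappable_of_before hs hR h1 (hr _ _ h1)
  by_cases h2 : P.before y.1 x.1
  · exact (swappable_of_before hs hR h2 (hr _ _ h2)).symm
  by_cases h3 : P.feeds x.1 y.1
  · exact swappable_of_feeds hs hR h3
  by_cases h4 : P.feeds y.1 x.1
  · exact (swappable_of_feeds hs hR h4).symm
  exact swappable_of_commute (.commuteFar _ _ hne h1 h2 h3 h4)

instance : Finite Cycle :=
  Finite.of_surjective (fun b : Bool => if b then Cycle.A else Cycle.compl) fun c => by
    cases c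
    · exact ⟨true, rfl⟩
    · exact ⟨false, rfl⟩

/-- The algebra of a gluing pattern is left Noetherian, if the order on its combs embeds into the
natural numbers. -/
theorem isNoetherianRing (hs : s ≠ 0) [Finite P.Block] (rank : P.Block → ℕ)
    (hr : ∀ i j, P.before i j → rank j < rank i) : IsNoetherianRing (PatternAlg G s P) := by
  obtain ⟨R, hR⟩ := (Set.finite_range rank).bddAbove
  have : Finite P.pres.Idx := inferInstanceAs (Finite (P.Block × Cycle))
  exact isNoetherianRing_of_swappable (swappable hs (fun i => hR ⟨i, rfl⟩) hr)

/-- The position of a block in the standard pattern, counted from the right. -/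
def stdRank (g r : ℕ) : StdBlock g r → ℕ
  | .inl i => g + r - i
  | .inr j => r - j

theorem stdRank_lt {g r : ℕ} {i j : StdBlock g r} (h : (std g r).before i j) :
    stdRank g r j < stdRank g r i := by
  change Sum.Lex _ _ i j at h
  cases h with
  | @inl a b h =>
    have : (a : ℕ) < b := h
    simp only [stdRank]
    omega
  | @inr a b h =>
    have : (a : ℕ) < b := h
    simp only [stdRank]
    omega
  | sep a b =>
    simp only [stdRank]
    omega

/-- The position of a block in the pattern adapted to a separating curve, counted from the
right. -/
def sepRank (g₁ r₁ g₂ r₂ : ℕ) : (sep g₁ r₁ g₂ r₂).Block → ℕ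
  | .inl i => stdRank g₁ r₁ i + 1
  | .inr (.inl _) => 0
  | .inr (.inr i) => stdRank g₂ r₂ i

theorem sepRank_lt {g₁ r₁ g₂ r₂ : ℕ} : ∀ i j : (sep g₁ r₁ g₂ r₂).Block,
    (sep g₁ r₁ g₂ r₂).before i j → sepRank g₁ r₁ g₂ r₂ j < sepRank g₁ r₁ g₂ r₂ i
  | .inl _, .inl _, h => Nat.succ_lt_succ (stdRank_lt h)
  | .inl _, .inr (.inl _), _ => Nat.succ_pos _
  | .inr (.inr _), .inr (.inr _), h => stdRank_lt h
  | .inl _, .inr (.inr _), h => h.elim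
  | .inr (.inl _), _, h => h.elim
  | .inr (.inr _), .inl _, h => h.elim
  | .inr (.inr _), .inr (.inl _), h => h.elim

theorem skeinAlg_isNoetherianRing (G : Gauge) (hs : s ≠ 0) (g r : ℕ) :
    IsNoetherianRing (SkeinAlg G s g r) :=
  have : Finite (std g r).Block := inferInstanceAs (Finite (StdBlock g r))
  isNoetherianRing hs (stdRank g r) fun _ _ => stdRank_lt

theorem sepAlg_isNoetherianRing (G : Gauge) (hs : s ≠ 0) (g₁ r₁ g₂ r₂ : ℕ) :
    IsNoetherianRing (SepAlg G s g₁ r₁ g₂ r₂) :=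
  have : Finite (sep g₁ r₁ g₂ r₂).Block :=
    inferInstanceAs (Finite (StdBlock g₁ r₁ ⊕ (Unit ⊕ StdBlock g₂ r₂)))
  isNoetherianRing hs (sepRank g₁ r₁ g₂ r₂) sepRank_lt

end GluingPattern


/-! ### The frames of the two coordinate algebras -/

section CoordinateAlgebras

open Presentation

variable {k : Type*} [Field k] {G : Gauge} {s : k}

theorem one_le_spaceOf {A : Type*} [Ring A] [Algebra k A] (Y : Mat2 A) (v : A) :
    1 ≤ spaceOf (k := k) Y v :=
  Submodule.one_le.2 (Submodule.subset_span (Set.mem_insert _ _))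

theorem entry_mem_spaceOf {A : Type*} [Ring A] [Algebra k A] (Y : Mat2 A) (v : A) (i j : Fin 2) :
    Y i j ∈ spaceOf (k := k) Y v :=
  Submodule.subset_span (Or.inr (Or.inr ⟨(i, j), rfl⟩))

theorem self_mem_spaceOf {A : Type*} [Ring A] [Algebra k A] (Y : Mat2 A) (v : A) :
    v ∈ spaceOf (k := k) Y v :=
  Submodule.subset_span (Or.inr (Or.inl rfl))

theorem map_spaceOf {A C : Type*} [Ring A] [Algebra k A] [Ring C] [Algebra k C] (f : A →ₐ[k] C)
    (Y : Mat2 A) (v : A) : (spaceOf Y v).map f.toLinearMap = spaceOf (k := k) (Y.map f) (f v) := by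
  rw [spaceOf, spaceOf, Submodule.map_span, Set.image_insert_eq, Set.image_insert_eq,
    ← Set.range_comp]
  simp only [AlgHom.toLinearMap_apply, map_one]
  rfl

theorem exists_mem_spaceOf_pow {P : Presentation} (x : P.Idx) (hx : ∀ y, y = x) (b : Alg G s P) :
    ∃ n, b ∈ spaceOf (k := k) (mat G s P x) (detInv G s P x) ^ n := by
  refine mem_of_generators (powUnion _ (one_le_spaceOf _ _)) (fun y i j => ?_) (fun y => ?_) b
  · rw [hx y]
    exact ⟨1, by rw [pow_one]; exact entry_mem_spaceOf _ _ i j⟩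
  · rw [hx y]
    exact ⟨1, by rw [pow_one]; exact self_mem_spaceOf _ _⟩

variable (G s) in
/-- The `q`-determinant as a unit. -/
def detUnit (P : Presentation) (x : P.Idx) : (Alg G s P)ˣ :=
  ⟨det G s P x, detInv G s P x, det_mul_detInv x, detInv_mul_det x⟩

theorem detUnit_eq_one {P : Presentation} (x : P.Idx) (hG : G = .SL2) : detUnit G s P x = 1 :=
  Units.ext (det_eq_one hG x)

theorem map_law {C A : Type*} [Ring A] [Algebra k A] [Ring C] [Algebra k C] (f : C →ₐ[k] A)
    {Y X : Mat2 C} {l : Law} (h : l.lhs G s Y X = l.rhs G s Y X) :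
    l.lhs G s (Y.map f) (X.map f) = l.rhs G s (Y.map f) (X.map f) := by
  rw [← Law.map_lhs, ← Law.map_rhs, h]

variable {A A' M : Type*} [Ring A] [Algebra k A] [Ring A'] [Algebra k A'] [AddCommGroup M]
  [Module k M] [Module A M] [IsScalarTower k A M] {P : Presentation}

/-- The letters of a matrix of generators of reflection type. -/
def loopLetters (hs : s ≠ 0) {x : P.Idx} (hx : P.loop x) (hl : P.law .reflection x x) :
    Letters G k (Alg G s P) :=
  Letters.ofReflection rfl (pow_ne_zero 2 hs) rfl (rScale_ne_zero G hs) (law_eq hl)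
    (detUnit G s P x) (det_of_loop hx) (detUnit_eq_one _)

theorem loopLetters_genSpace (hs : s ≠ 0) {x : P.Idx} (hx : P.loop x)
    (hl : P.law .reflection x x) : (loopLetters (G := G) hs hx hl).genSpace =
      spaceOf (mat G s P x) (detInv G s P x) := by
  rw [Letters.genSpace, spaceOf]
  congr 1
  ext a
  simp only [Set.mem_insert_iff, Set.mem_singleton_iff, Set.mem_range, Prod.exists,
    Fin.exists_fin_two, loopLetters, Letters.ofReflection, detUnit, Units.inv_mk]
  tauto

/-- The action of `X` on products of the letters of the matrix of reflection type. -/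
def loopLettersAction (hs : s ≠ 0) (hgen : ∀ l : ℕ, 1 ≤ l → s ^ l ≠ 1) {x : P.Idx}
    (hx : P.loop x) (hl : P.law .reflection x x) (ψ : Alg G s P →ₐ[k] A) (N : Submodule k M)
    {X : Mat2 A}
    (h : Law.lhs G s ((mat G s P x).map ψ) X .smash =
      Law.rhs G s ((mat G s P x).map ψ) X .smash)
    (hX : Law.lhs G s X X .reflection = Law.rhs G s X X .reflection)
    (hN : ∀ m ∈ N, FixedBy k X m) : KernelAction ((loopLetters (G := G) hs hx hl).map ψ) N :=
  reflectionAction hs hgen rfl (pow_ne_zero 2 hs) rfl (rScale_ne_zero G hs) h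
    (map_law ψ (law_eq hl)) hX (Units.map (ψ : Alg G s P →* A) (detUnit G s P x))
    ((congrArg ψ (det_of_loop hx)).trans (map_qdet ψ _ (mat G s P x)))
    (fun hG => (congrArg _ (detUnit_eq_one x hG)).trans (map_one _)) N hN

/-- A matrix of reflection type, paired with a matrix `X` as in the algebra of `q`-difference
operators, gives a frame over a space on which `X` acts as the identity. -/
def loopFrame (hs : s ≠ 0) (hgen : ∀ l : ℕ, 1 ≤ l → s ^ l ≠ 1) (φ : A' →ₐ[k] A) {x : P.Idx}
    (hP : ∀ y, y = x) (hx : P.loop x) (hl : P.law .reflection x x)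
    (ψ : Alg G s P →ₐ[k] A) (N : Submodule k M) {X Y : Mat2 A} {v : A}
    (hY : (mat G s P x).map ψ = Y) (hv : ψ (detInv G s P x) = v)
    (h : Law.lhs G s Y X .smash = Law.rhs G s Y X .smash)
    (hX : Law.lhs G s X X .reflection = Law.rhs G s X X .reflection)
    (hN : ∀ m ∈ N, FixedBy k X m) (hst : ∀ a, ∀ m ∈ N, φ a • m ∈ N)
    (hact : ∀ a, a ∈ actSubalgebra φ N (spaceOf Y v) (one_le_spaceOf Y v) hst) :
    Frame φ ψ N G.dim :=
  have hW : (loopLetters (G := G) hs hx hl).genSpace.map ψ.toLinearMap = spaceOf Y v := by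
    rw [loopLetters_genSpace, map_spaceOf, hY, hv]
  (loopLetters hs hx hl).frame φ ψ N
    (loopLettersAction hs hgen hx hl ψ N (by rw [hY]; exact h) hX hN)
    (fun b => by rw [loopLetters_genSpace]; exact exists_mem_spaceOf_pow x hP b) hst
    (by rw [hW]; exact one_le_spaceOf Y v) fun a => by
      obtain ⟨l, V, hV, H⟩ := hact a
      rw [← hW] at H
      exact ⟨l, V, hV, H⟩

/-- The letters of a matrix of generators of FRT type. -/
def frtLetters (hs : s ≠ 0) {x : P.Idx} (hx : ¬ P.loop x) (hl : P.law .frt x x) :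
    Letters G k (Alg G s P) :=
  Letters.ofFrt rfl (pow_ne_zero 2 hs) rfl (rScale_ne_zero G hs) (law_eq hl)
    (detUnit G s P x) (det_of_not_loop hx) (detUnit_eq_one _)

theorem frtLetters_genSpace (hs : s ≠ 0) {x : P.Idx} (hx : ¬ P.loop x)
    (hl : P.law .frt x x) : (frtLetters (G := G) hs hx hl).genSpace =
      spaceOf (mat G s P x) (detInv G s P x) := by
  rw [Letters.genSpace, spaceOf]
  congr 1
  ext a
  simp only [Set.mem_insert_iff, Set.mem_singleton_iff, Set.mem_range, Prod.exists,
    Fin.exists_fin_two, frtLetters, Letters.ofFrt, detUnit, Units.inv_mk]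
  tauto

/-- The action of `X` on products of the letters of the matrix of FRT type. -/
def frtLettersAction (hs : s ≠ 0) (hgen : ∀ l : ℕ, 1 ≤ l → s ^ l ≠ 1) {x : P.Idx}
    (hx : ¬ P.loop x) (hl : P.law .frt x x) (ψ : Alg G s P →ₐ[k] A) (N : Submodule k M)
    {X : Mat2 A}
    (h : Law.lhs G s ((mat G s P x).map ψ) X .smashFrt =
      Law.rhs G s ((mat G s P x).map ψ) X .smashFrt)
    (hX : Law.lhs G s X X .reflection = Law.rhs G s X X .reflection)
    (hN : ∀ m ∈ N, FixedBy k X m) : KernelAction ((frtLetters (G := G) hs hx hl).map ψ) N :=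
  frtAction hs hgen rfl (pow_ne_zero 2 hs) rfl (rScale_ne_zero G hs) h
    (map_law ψ (law_eq hl)) hX (Units.map (ψ : Alg G s P →* A) (detUnit G s P x))
    ((congrArg ψ (det_of_not_loop hx)).trans (map_qdet ψ _ (mat G s P x)))
    (fun hG => (congrArg _ (detUnit_eq_one x hG)).trans (map_one _)) N hN

/-- The analogue of `loopFrame` for a matrix of FRT type. -/
def frtFrame (hs : s ≠ 0) (hgen : ∀ l : ℕ, 1 ≤ l → s ^ l ≠ 1) (φ : A' →ₐ[k] A) {x : P.Idx}
    (hP : ∀ y, y = x) (hx : ¬ P.loop x) (hl : P.law .frt x x)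
    (ψ : Alg G s P →ₐ[k] A) (N : Submodule k M) {X Y : Mat2 A} {v : A}
    (hY : (mat G s P x).map ψ = Y) (hv : ψ (detInv G s P x) = v)
    (h : Law.lhs G s Y X .smashFrt = Law.rhs G s Y X .smashFrt)
    (hX : Law.lhs G s X X .reflection = Law.rhs G s X X .reflection)
    (hN : ∀ m ∈ N, FixedBy k X m) (hst : ∀ a, ∀ m ∈ N, φ a • m ∈ N)
    (hact : ∀ a, a ∈ actSubalgebra φ N (spaceOf Y v) (one_le_spaceOf Y v) hst) :
    Frame φ ψ N G.dim :=
  have hW : (frtLetters (G := G) hs hx hl).genSpace.map ψ.toLinearMap = spaceOf Y v := by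
    rw [frtLetters_genSpace, map_spaceOf, hY, hv]
  (frtLetters hs hx hl).frame φ ψ N
    (frtLettersAction hs hgen hx hl ψ N (by rw [hY]; exact h) hX hN)
    (fun b => by rw [frtLetters_genSpace]; exact exists_mem_spaceOf_pow x hP b) hst
    (by rw [hW]; exact one_le_spaceOf Y v) fun a => by
      obtain ⟨l, V, hV, H⟩ := hact a
      rw [← hW] at H
      exact ⟨l, V, hV, H⟩

end CoordinateAlgebras


/-! ### Matrices in a gluing pattern -/

namespace GluingPattern

open Presentation

section

variable {k : Type*} [Field k] {G : Gauge} {s : k} {P : GluingPattern}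

theorem detConst_of_isLoop {x : P.Block × Cycle} (hx : P.IsLoop x) :
    detConst s P.pres x = (s ^ 2) ^ 2 := if_pos hx

theorem detConst_of_not_isLoop {x : P.Block × Cycle} (hx : ¬ P.IsLoop x) :
    detConst s P.pres x = s ^ 2 := if_neg hx

variable (G s P) in
/-- The entries and the determinant of the matrix `x` can be moved to the right of those of the
matrix `y`. -/
abbrev MovesPast (x y : P.Block × Cycle) : Prop :=
  Exchange (detConst s P.pres x) (detConst s P.pres y) (mat G s P.pres x) (mat G s P.pres y)

theorem movesPast_of_before (hs : s ≠ 0) {x y : P.Block × Cycle} (h : P.before y.1 x.1)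
    (hy : P.IsLoop y) : MovesPast G s P x y := by
  have hq0 := pow_ne_zero 2 hs
  have ht0 := rScale_ne_zero G hs
  rw [MovesPast, detConst_of_isLoop hy]
  by_cases hx : P.IsLoop x
  · rw [detConst_of_isLoop hx]
    exact exchange_braidLoopLoop rfl hq0 rfl ht0
      (law_eq (P := P.pres) (Laws.braidLoopLoop y x h hx hy)) (reflection_eq hx) (reflection_eq hy)
  · rw [detConst_of_not_isLoop hx]
    exact exchange_braidFrtLoop rfl hq0 rfl ht0
      (law_eq (P := P.pres) (Laws.braidFrtLoop y x h hx hy)) (frt_eq hx) (reflection_eq hy)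

theorem movesPast_of_after (hs : s ≠ 0) {x y : P.Block × Cycle} (h : P.before x.1 y.1)
    (hy : ¬ P.IsLoop y) : MovesPast G s P x y := by
  have hq0 := pow_ne_zero 2 hs
  have ht0 := rScale_ne_zero G hs
  rw [MovesPast, detConst_of_not_isLoop hy]
  by_cases hx : P.IsLoop x
  · rw [detConst_of_isLoop hx]
    exact exchange_braidFrtLoop_xy rfl hq0 rfl ht0
      (law_eq (P := P.pres) (Laws.braidFrtLoop x y h hy hx)) (frt_eq hy) (reflection_eq hx)
  · rw [detConst_of_not_isLoop hx]
    exact exchange_braidFrtFrt rfl hq0 rfl ht0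
      (law_eq (P := P.pres) (Laws.braidFrtFrt x y h hy hx)) (frt_eq hy) (frt_eq hx)

theorem movesPast_of_feeds (hs : s ≠ 0) {x y : P.Block × Cycle} (h : P.feeds y.1 x.1)
    (hy : ¬ P.IsLoop y) : MovesPast G s P x y := by
  have hq0 := pow_ne_zero 2 hs
  have ht0 := rScale_ne_zero G hs
  rw [MovesPast, detConst_of_not_isLoop hy]
  by_cases hx : P.IsLoop x
  · rw [detConst_of_isLoop hx]
    exact exchange_endLoop rfl hq0 rfl ht0
      (law_eq (P := P.pres) (Laws.endLoop y x h hx hy)) (reflection_eq hx) (frt_eq hy)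
  · rw [detConst_of_not_isLoop hx]
    exact exchange_endFrt rfl hq0 rfl ht0
      (law_eq (P := P.pres) (Laws.endFrt y x h hx hy)) (frt_eq hx) (frt_eq hy)

theorem movesPast_compl (hs : s ≠ 0) (i : P.Block) : MovesPast G s P (i, .A) (i, .compl) := by
  have hq0 := pow_ne_zero 2 hs
  have ht0 := rScale_ne_zero G hs
  have hA : P.IsLoop (i, .A) := Or.inl rfl
  rw [MovesPast, detConst_of_isLoop hA]
  by_cases hi : P.handle i
  · have hy : P.IsLoop (i, .compl) := Or.inr hi
    rw [detConst_of_isLoop hy]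
    exact exchange_smash rfl hq0 rfl ht0 (law_eq (P := P.pres) (Laws.smash i hi))
      (reflection_eq hy) (reflection_eq hA)
  · have hy : ¬ P.IsLoop (i, .compl) := by simp [IsLoop, hi]
    rw [detConst_of_not_isLoop hy]
    exact exchange_smashFrt rfl hq0 rfl ht0 (law_eq (P := P.pres) (Laws.smashFrt i hi))
      (frt_eq hy) (reflection_eq hA)

theorem smash_eq {i : P.Block} (hi : P.handle i) :
    Law.lhs G s (mat G s P.pres (i, .compl)) (mat G s P.pres (i, .A)) .smash =
      Law.rhs G s (mat G s P.pres (i, .compl)) (mat G s P.pres (i, .A)) .smash :=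
  law_eq (P := P.pres) (Laws.smash i hi)

theorem smashFrt_eq {i : P.Block} (hi : ¬ P.handle i) :
    Law.lhs G s (mat G s P.pres (i, .compl)) (mat G s P.pres (i, .A)) .smashFrt =
      Law.rhs G s (mat G s P.pres (i, .compl)) (mat G s P.pres (i, .A)) .smashFrt :=
  law_eq (P := P.pres) (Laws.smashFrt i hi)

theorem loopHom_mat (x : P.Block × Cycle) (hx : P.IsLoop x) :
    (mat G s reflectionPres ()).map (loopHom G s P x hx) = mat G s P.pres x := by
  refine Matrix.ext fun i j => ?_
  exact map_mat G s (P := reflectionPres) (Q := P.pres) (fun _ => x) _ _ () i j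

theorem loopHom_detInv (x : P.Block × Cycle) (hx : P.IsLoop x) :
    loopHom G s P x hx (detInv G s reflectionPres ()) = detInv G s P.pres x :=
  map_detInv G s (P := reflectionPres) (Q := P.pres) (fun _ => x) _ _ ()

theorem frtHom_mat (x : P.Block × Cycle) (hx : ¬ P.IsLoop x) :
    (mat G s frtPres ()).map (frtHom G s P x hx) = mat G s P.pres x := by
  refine Matrix.ext fun i j => ?_
  exact map_mat G s (P := frtPres) (Q := P.pres) (fun _ => x) _ _ () i j

theorem frtHom_detInv (x : P.Block × Cycle) (hx : ¬ P.IsLoop x) :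
    frtHom G s P x hx (detInv G s frtPres ()) = detInv G s P.pres x :=
  map_detInv G s (P := frtPres) (Q := P.pres) (fun _ => x) _ _ ()

variable {M : Type*} [AddCommGroup M] [Module k M] [Module (PatternAlg G s P) M]
  [IsScalarTower k (PatternAlg G s P) M]

variable (G s P M) in
/-- The generators with index `x` preserve the space of vectors on which the matrix `a` acts as
the identity. -/
structure Preserves (x a : P.Block × Cycle) : Prop where
  entry : ∀ m : M, FixedBy k (mat G s P.pres a) m → ∀ i j,
    FixedBy k (mat G s P.pres a) (mat G s P.pres x i j • m)
  detInv : ∀ m : M, FixedBy k (mat G s P.pres a) m →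
    FixedBy k (mat G s P.pres a) (detInv G s P.pres x • m)

theorem Preserves.of_det {x a : P.Block × Cycle}
    (h : ∀ m : M, FixedBy k (mat G s P.pres a) m → ∀ i j,
      FixedBy k (mat G s P.pres a) (mat G s P.pres x i j • m))
    (hd : ∀ i j, mat G s P.pres a i j * det G s P.pres x =
      det G s P.pres x * mat G s P.pres a i j) : Preserves G s P M x a := by
  refine ⟨h, fun m hm => hm.smul_of_commute fun i j => ?_⟩
  have := mul_inv_of_mul (k := k) one_ne_zero (det_mul_detInv (P := P.pres) x)
    (detInv_mul_det (P := P.pres) x) ((hd i j).trans (one_smul k _).symm)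
  rwa [inv_one, one_smul] at this

theorem preserves_of_before (hs : s ≠ 0) {x a : P.Block × Cycle} (h : P.before a.1 x.1)
    (ha : P.IsLoop a) : Preserves G s P M x a := by
  have hq0 := pow_ne_zero 2 hs
  have ht0 := rScale_ne_zero G hs
  by_cases hx : P.IsLoop x
  · have hl := law_eq (G := G) (s := s) (P := P.pres) (Laws.braidLoopLoop a x h hx ha)
    refine .of_det (fun m hm => fixedBy_smul_braidLoopLoop rfl hq0 rfl ht0 hl hm) fun i j => ?_
    rw [det_of_isLoop hx]
    exact ((det_braidLoopLoop rfl hq0 rfl ht0 hl (reflection_eq hx) (reflection_eq ha)).2 i j).symm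
  · have hl := law_eq (G := G) (s := s) (P := P.pres) (Laws.braidFrtLoop a x h hx ha)
    refine .of_det (fun m hm => fixedBy_smul_braidFrtLoop rfl hq0 rfl ht0 hl hm) fun i j => ?_
    rw [det_of_not_isLoop hx]
    exact ((det_braidFrtLoop rfl hq0 rfl ht0 hl (frt_eq hx) (reflection_eq ha)).2 i j).symm

theorem preserves_of_after (hs : s ≠ 0) {x a : P.Block × Cycle} (h : P.before x.1 a.1)
    (ha : P.IsLoop a) : Preserves G s P M x a := by
  have hq0 := pow_ne_zero 2 hs
  have ht0 := rScale_ne_zero G hs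
  by_cases hx : P.IsLoop x
  · have hl := law_eq (G := G) (s := s) (P := P.pres) (Laws.braidLoopLoop x a h ha hx)
    refine .of_det (fun m hm => fixedBy_smul_braidLoopLoop_left rfl hq0 rfl ht0 hl hm)
      fun i j => ?_
    rw [det_of_isLoop hx]
    exact (det_braidLoopLoop rfl hq0 rfl ht0 hl (reflection_eq ha) (reflection_eq hx)).1 i j
  · have hl := law_eq (G := G) (s := s) (P := P.pres) (Laws.braidLoopFrt x a h ha hx)
    refine .of_det (fun m hm => fixedBy_smul_braidLoopFrt rfl hq0 rfl ht0 hl hm) fun i j => ?_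
    rw [det_of_not_isLoop hx]
    exact (det_braidLoopFrt rfl hq0 rfl ht0 hl (reflection_eq ha) (frt_eq hx)).1 i j

theorem preserves_of_feeds {x a : P.Block × Cycle} (h : P.feeds a.1 x.1)
    (ha : P.IsLoop a) : Preserves G s P M x a := by
  have hc := commute_of_law
    (law_eq (G := G) (s := s) (P := P.pres) (Laws.commuteFeeds a x h ha))
  refine ⟨fun m hm i j => hm.smul_of_commute fun i' j' => (hc i j i' j').symm,
    fun m hm => hm.smul_of_commute fun i j => ?_⟩
  exact (commute_detInv fun i' j' => (hc i' j' i j).symm : Commute _ _).eq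

end

/-! ### The frames of the two decompositions -/

section

variable {k : Type*} [Field k] {G : Gauge} {s : k} {P Q : GluingPattern}

theorem embHom_mem (e : Emb P Q) (S : Subalgebra k (PatternAlg G s Q))
    (h : ∀ x : P.Block × Cycle, (∀ i j, mat G s Q.pres (e.f x.1, x.2) i j ∈ S) ∧
      detInv G s Q.pres (e.f x.1, x.2) ∈ S) (a : PatternAlg G s P) : embHom G s e a ∈ S := by
  refine mem_of_generators (S.comap (embHom G s e)) (fun x i j => ?_) (fun x => ?_) a
  · exact (congrArg (· ∈ S) (embHom_mat G s e x i j)).mpr ((h x).1 i j)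
  · exact (congrArg (· ∈ S) (embHom_detInv G s e x)).mpr (h x).2

variable {A' M : Type*} [Ring A'] [Algebra k A'] [AddCommGroup M] [Module k M]
  [Module (PatternAlg G s Q) M] [IsScalarTower k (PatternAlg G s Q) M]

variable (k) in
/-- The elements that preserve a subspace. -/
def stabilizer {A : Type*} [Ring A] [Algebra k A] [Module A M] [IsScalarTower k A M]
    (N : Submodule k M) : Subalgebra k A where
  carrier := {a | ∀ m ∈ N, a • m ∈ N}
  mul_mem' ha hb m hm := by rw [mul_smul]; exact ha _ (hb _ hm)
  add_mem' ha hb m hm := by rw [add_smul]; exact add_mem (ha _ hm) (hb _ hm)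
  algebraMap_mem' c m hm := by rw [algebraMap_smul]; exact N.smul_mem c hm

theorem embHom_smul_mem (e : Emb P Q) {N : Submodule k M} {a : Q.Block × Cycle}
    (hN : ∀ m, m ∈ N ↔ FixedBy k (mat G s Q.pres a) m)
    (h : ∀ x : P.Block × Cycle, Preserves G s Q M (e.f x.1, x.2) a) (b : PatternAlg G s P) :
    embHom G s e b ∈ stabilizer k (A := PatternAlg G s Q) N :=
  embHom_mem e (stabilizer k N)
    (fun x => ⟨fun i j m hm => (hN _).2 ((h x).entry m ((hN m).1 hm) i j),
    fun m hm => (hN _).2 ((h x).detInv m ((hN m).1 hm))⟩) b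

variable {φ : A' →ₐ[k] PatternAlg G s Q} {N : Submodule k M} {y : Q.Block × Cycle}
  {hst : ∀ a, ∀ m ∈ N, φ a • m ∈ N}

variable (φ N y hst) in
/-- The elements that can be moved past the powers of the space of generators with index `y`, so
as to act on `N` through `φ`. -/
abbrev actOver : Subalgebra k (PatternAlg G s Q) :=
  actSubalgebra φ N (spaceOf (mat G s Q.pres y) (detInv G s Q.pres y)) (one_le_spaceOf _ _) hst

theorem self_mem_actOver :
    (∀ i j, mat G s Q.pres y i j ∈ actOver φ N y hst) ∧
      detInv G s Q.pres y ∈ actOver φ N y hst :=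
  ⟨fun i j => mem_actSubalgebra_of_mem_pow (l := 1)
      (by rw [pow_one]; exact entry_mem_spaceOf _ _ i j),
    mem_actSubalgebra_of_mem_pow (l := 1) (by rw [pow_one]; exact self_mem_spaceOf _ _)⟩

/-- The generators of the subalgebra given by an embedded pattern, acting through `φ`. -/
theorem emb_mem_actOver (e : Emb P Q) (α : PatternAlg G s P →ₐ[k] A')
    (hα : ∀ a, φ (α a) = embHom G s e a) (x : P.Block × Cycle)
    (h : MovesPast G s Q (e.f x.1, x.2) y) :
    (∀ i j, mat G s Q.pres (e.f x.1, x.2) i j ∈ actOver φ N y hst) ∧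
      detInv G s Q.pres (e.f x.1, x.2) ∈ actOver φ N y hst := by
  have hm : ((mat G s P.pres x).map α).map φ = mat G s Q.pres (e.f x.1, x.2) := by
    ext i j
    exact (hα _).trans (embHom_mat G s e x i j)
  have hc : detConst s P.pres x = detConst s Q.pres (e.f x.1, x.2) := by
    by_cases hx : P.IsLoop x
    · rw [detConst_of_isLoop hx, detConst_of_isLoop ((e.isLoop x).1 hx)]
    · rw [detConst_of_not_isLoop hx, detConst_of_not_isLoop (mt (e.isLoop x).2 hx)]
  rw [MovesPast, ← hm, ← hc] at h
  constructor
  · intro i j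
    rw [← hm]
    exact h.mem_actSubalgebra (det_mul_detInv (P := Q.pres) y)
      (detInv_mul_det (P := Q.pres) y) rfl i j
  · rw [← (hα _).trans (embHom_detInv G s e x)]
    refine h.detInv_mem_actSubalgebra (det_mul_detInv (P := Q.pres) y)
      (detInv_mul_det (P := Q.pres) y) ?_ ?_ rfl
    · rw [← map_qdet, ← map_mul, ← map_one α]
      exact congrArg α (det_mul_detInv (P := P.pres) x)
    · rw [← map_qdet, ← map_mul, ← map_one α]
      exact congrArg α (detInv_mul_det (P := P.pres) x)

/-- The generators of the matrix that acts on `N` as the identity. -/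
theorem fixed_mem_actOver {a : Q.Block × Cycle}
    (hN : ∀ m, m ∈ N ↔ FixedBy k (mat G s Q.pres a) m) (h : MovesPast G s Q a y) :
    (∀ i j, mat G s Q.pres a i j ∈ actOver φ N y hst) ∧
      detInv G s Q.pres a ∈ actOver φ N y hst := by
  refine ⟨h.mem_actSubalgebra_of_scalar (det_mul_detInv (P := Q.pres) y)
      (detInv_mul_det (P := Q.pres) y) rfl (T := 1)
    fun i j m hm => (hN m).1 hm i j, ?_⟩
  refine h.detInv_mem_actSubalgebra_of_scalar (det_mul_detInv (P := Q.pres) y)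
      (detInv_mul_det (P := Q.pres) y)
    (det_mul_detInv (P := Q.pres) a)
      (detInv_mul_det (P := Q.pres) a) rfl fun m hm => ?_
  have h1 : det G s Q.pres a • m = m := ((hN m).1 hm).qdet_smul _
  calc detInv G s Q.pres a • m = detInv G s Q.pres a • det G s Q.pres a • m := by rw [h1]
    _ = m := by
      rw [← mul_smul]
      exact (congrArg (· • m) (detInv_mul_det (P := Q.pres) a)).trans (one_smul _ m)

end

section Nonseparating

variable {k : Type*} [Field k] {G : Gauge} {s : k} {g r : ℕ} {M : Type*} [AddCommGroup M]
  [Module k M] [Module (SkeinAlg G s (g + 1) r) M] [IsScalarTower k (SkeinAlg G s (g + 1) r) M]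

theorem mem_nonsepKernel (m : M) : m ∈ nonsepKernel G s g r M ↔
    FixedBy k (mat G s (std (g + 1) r).pres (Sum.inl 0, Cycle.A)) m :=
  mem_jointKernel_iff

theorem before_stdEmb (i : StdBlock g r) :
    (std (g + 1) r).before (Sum.inl 0) ((stdEmb g r).f i) := by
  cases i with
  | inl i => exact Sum.Lex.inl (Fin.succ_pos i)
  | inr j => exact Sum.Lex.sep _ _

theorem nonsepIncl_smul_mem (hs : s ≠ 0) (a : SkeinAlg G s g r) :
    ∀ m ∈ nonsepKernel G s g r M, nonsepIncl G s g r a • m ∈ nonsepKernel G s g r M :=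
  embHom_smul_mem (stdEmb g r) mem_nonsepKernel
    (fun x => preserves_of_before hs (before_stdEmb x.1) (Or.inl rfl)) a

variable (M) in
/-- The frame of the non-separating case. -/
def nonsepFrame (hs : s ≠ 0) (hgen : ∀ l : ℕ, 1 ≤ l → s ^ l ≠ 1) :
    Frame (nonsepIncl G s g r) (nonsepCompl G s g r) (nonsepKernel G s g r M) G.dim :=
  loopFrame hs hgen (nonsepIncl G s g r) (P := reflectionPres) (x := ()) (fun _ => rfl) trivial rfl
    (nonsepCompl G s g r) (nonsepKernel G s g r M)
    (X := mat G s (std (g + 1) r).pres (Sum.inl 0, Cycle.A))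
    (Y := mat G s (std (g + 1) r).pres (Sum.inl 0, Cycle.compl))
    (loopHom_mat _ _) (loopHom_detInv _ _) (smash_eq rfl)
    (reflection_eq (Or.inl rfl)) (fun m hm => (mem_nonsepKernel m).1 hm)
    (nonsepIncl_smul_mem hs) (by
      have key : ∀ x : StdBlock (g + 1) r × Cycle,
          (∀ i j, mat G s (std (g + 1) r).pres x i j ∈ actOver (nonsepIncl G s g r)
            (nonsepKernel G s g r M) (Sum.inl 0, Cycle.compl) (nonsepIncl_smul_mem hs)) ∧
          detInv G s (std (g + 1) r).pres x ∈ actOver (nonsepIncl G s g r)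
            (nonsepKernel G s g r M) (Sum.inl 0, Cycle.compl) (nonsepIncl_smul_mem hs) := by
        have emb := fun x : StdBlock g r × Cycle =>
          emb_mem_actOver (G := G) (s := s) (hst := nonsepIncl_smul_mem (G := G) (M := M) hs)
            (stdEmb g r) (AlgHom.id k _) (fun _ => rfl) x
            (movesPast_of_before (P := std (g + 1) r) (y := (Sum.inl 0, Cycle.compl)) hs
              (before_stdEmb x.1) (Or.inr rfl))
        rintro ⟨i | j, c⟩
        · refine Fin.cases ?_ (fun i => emb (Sum.inl i, c)) i
          cases c
          · exact fixed_mem_actOver mem_nonsepKernel (movesPast_compl hs _)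
          · exact self_mem_actOver
        · exact emb (Sum.inr j, c)
      exact mem_of_generators _ (fun x => (key x).1) fun x => (key x).2)

end Nonseparating

section Separating

variable {k : Type*} [Field k] {G : Gauge} {s : k} {g₁ r₁ g₂ r₂ : ℕ} {M : Type*} [AddCommGroup M]
  [Module k M] [Module (SepAlg G s g₁ r₁ g₂ r₂) M] [IsScalarTower k (SepAlg G s g₁ r₁ g₂ r₂) M]

theorem mem_sepKernel (m : M) : m ∈ sepKernel G s g₁ r₁ g₂ r₂ M ↔
    FixedBy k (mat G s (sep g₁ r₁ g₂ r₂).pres (Sum.inr (Sum.inl ()), Cycle.A)) m :=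
  mem_jointKernel_iff

theorem sepIncl_smul_mem (hs : s ≠ 0) (t : SkeinAlg G s g₁ r₁ ⊗[k] SkeinAlg G s g₂ r₂) :
    ∀ m ∈ sepKernel G s g₁ r₁ g₂ r₂ M,
      sepIncl G s g₁ r₁ g₂ r₂ t • m ∈ sepKernel G s g₁ r₁ g₂ r₂ M := by
  change sepIncl G s g₁ r₁ g₂ r₂ t ∈
    stabilizer k (A := SepAlg G s g₁ r₁ g₂ r₂) (sepKernel G s g₁ r₁ g₂ r₂ M)
  induction t with
  | zero => rw [map_zero]; exact zero_mem _
  | add t t' ht ht' => rw [map_add]; exact add_mem ht ht'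
  | tmul a b =>
    rw [sepIncl, Algebra.TensorProduct.lift_tmul]
    exact mul_mem
      (embHom_smul_mem (sepEmb₁ g₁ r₁ g₂ r₂) mem_sepKernel
        (fun x => preserves_of_after hs trivial (Or.inl rfl)) a)
      (embHom_smul_mem (sepEmb₂ g₁ r₁ g₂ r₂) mem_sepKernel
        (fun x => preserves_of_feeds trivial (Or.inl rfl)) b)

variable (M) in
/-- The frame of the separating case. -/
def sepFrame (hs : s ≠ 0) (hgen : ∀ l : ℕ, 1 ≤ l → s ^ l ≠ 1) :
    Frame (sepIncl G s g₁ r₁ g₂ r₂) (sepCompl G s g₁ r₁ g₂ r₂) (sepKernel G s g₁ r₁ g₂ r₂ M)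
      G.dim :=
  have hF : ¬ (sep g₁ r₁ g₂ r₂).IsLoop (Sum.inr (Sum.inl ()), Cycle.compl) := by
    simp [IsLoop, sep]
  frtFrame hs hgen (sepIncl G s g₁ r₁ g₂ r₂) (P := frtPres) (x := ()) (fun _ => rfl) id rfl
    (sepCompl G s g₁ r₁ g₂ r₂) (sepKernel G s g₁ r₁ g₂ r₂ M)
    (X := mat G s (sep g₁ r₁ g₂ r₂).pres (Sum.inr (Sum.inl ()), Cycle.A))
    (Y := mat G s (sep g₁ r₁ g₂ r₂).pres (Sum.inr (Sum.inl ()), Cycle.compl))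
    (v := detInv G s (sep g₁ r₁ g₂ r₂).pres (Sum.inr (Sum.inl ()), Cycle.compl))
    (frtHom_mat _ hF) (frtHom_detInv _ hF) (smashFrt_eq id)
    (reflection_eq (Or.inl rfl)) (fun m hm => (mem_sepKernel m).1 hm)
    (sepIncl_smul_mem hs) (by
      have key : ∀ x : (sep g₁ r₁ g₂ r₂).Block × Cycle,
          (∀ i j, mat G s (sep g₁ r₁ g₂ r₂).pres x i j ∈ actOver (sepIncl G s g₁ r₁ g₂ r₂)
            (sepKernel G s g₁ r₁ g₂ r₂ M) (Sum.inr (Sum.inl ()), Cycle.compl)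
            (sepIncl_smul_mem hs)) ∧
          detInv G s (sep g₁ r₁ g₂ r₂).pres x ∈ actOver (sepIncl G s g₁ r₁ g₂ r₂)
            (sepKernel G s g₁ r₁ g₂ r₂ M) (Sum.inr (Sum.inl ()), Cycle.compl)
            (sepIncl_smul_mem hs) := by
        rintro ⟨i | _ | i, c⟩
        · exact emb_mem_actOver (sepEmb₁ g₁ r₁ g₂ r₂) Algebra.TensorProduct.includeLeft
            (fun a => by simp [sepIncl]) (i, c) (movesPast_of_after hs trivial hF)
        · cases c
          · exact fixed_mem_actOver mem_sepKernel (movesPast_compl hs _)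
          · exact self_mem_actOver
        · exact emb_mem_actOver (sepEmb₂ g₁ r₁ g₂ r₂) Algebra.TensorProduct.includeRight
            (fun a => by simp [sepIncl]) (i, c) (movesPast_of_feeds hs trivial hF)
      exact mem_of_generators _ (fun x => (key x).1) fun x => (key x).2)

end Separating

end GluingPattern

end QSkein

end

open QSkein in
theorem mainTheorem4 {k : Type*} [Field k] (G : Gauge) (s : k) (hs : s ≠ 0)
    (hgen : ∀ l : ℕ, 1 ≤ l → s ^ l ≠ 1) :
    (∀ (g r : ℕ), 1 ≤ r →
      ∀ (M : Type*) [AddCommGroup M] [Module k M] [Module (SkeinAlg G s (g + 1) r) M]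
        [IsScalarTower k (SkeinAlg G s (g + 1) r) M],
      IsHolonomic k (SkeinAlg G s (g + 1) r) M ((g + 1 + r - 1) * G.dim) →
      ∃ M₀ : Submodule (SkeinAlg G s g r) (Restrict (nonsepIncl G s g r) M),
        (∀ m : M, m ∈ M₀ ↔ m ∈ nonsepKernel G s g r M) ∧
        IsHolonomic k (SkeinAlg G s g r) M₀ ((g + r - 1) * G.dim) ∧
        (IsEquidimensional k (SkeinAlg G s (g + 1) r) M ((g + 1 + r - 1) * G.dim) →
          IsEquidimensional k (SkeinAlg G s g r) M₀ ((g + r - 1) * G.dim)) ∧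
        Function.Injective (actionMap (nonsepCompl G s g r) (nonsepKernel G s g r M)) ∧
        LinearMap.range (actionMap (nonsepCompl G s g r) (nonsepKernel G s g r M)) =
          (Submodule.span (SkeinAlg G s (g + 1) r)
            (nonsepKernel G s g r M : Set M)).restrictScalars k ∧
        (M₀ ≠ ⊥ →
          gkDim k (SkeinAlg G s (g + 1) r) (Submodule.span (SkeinAlg G s (g + 1) r)
            (nonsepKernel G s g r M : Set M)) =
          gkDim k (SkeinAlg G s g r) M₀ + G.dim)) ∧
    (∀ (g₁ r₁ g₂ r₂ : ℕ), 1 ≤ r₁ → 1 ≤ r₂ →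
      ∀ (M : Type*) [AddCommGroup M] [Module k M] [Module (SepAlg G s g₁ r₁ g₂ r₂) M]
        [IsScalarTower k (SepAlg G s g₁ r₁ g₂ r₂) M],
      IsHolonomic k (SepAlg G s g₁ r₁ g₂ r₂) M ((g₁ + g₂ + (r₁ + r₂) - 1) * G.dim) →
      ∃ M₀ : Submodule (SkeinAlg G s g₁ r₁ ⊗[k] SkeinAlg G s g₂ r₂)
          (Restrict (sepIncl G s g₁ r₁ g₂ r₂) M),
        (∀ m : M, m ∈ M₀ ↔ m ∈ sepKernel G s g₁ r₁ g₂ r₂ M) ∧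
        IsHolonomic k (SkeinAlg G s g₁ r₁ ⊗[k] SkeinAlg G s g₂ r₂) M₀
          ((g₁ + r₁ - 1 + (g₂ + r₂ - 1)) * G.dim) ∧
        (IsEquidimensional k (SepAlg G s g₁ r₁ g₂ r₂) M
            ((g₁ + g₂ + (r₁ + r₂) - 1) * G.dim) →
          IsEquidimensional k (SkeinAlg G s g₁ r₁ ⊗[k] SkeinAlg G s g₂ r₂) M₀
            ((g₁ + r₁ - 1 + (g₂ + r₂ - 1)) * G.dim)) ∧
        Function.Injective
          (actionMap (sepCompl G s g₁ r₁ g₂ r₂) (sepKernel G s g₁ r₁ g₂ r₂ M)) ∧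
        LinearMap.range
            (actionMap (sepCompl G s g₁ r₁ g₂ r₂) (sepKernel G s g₁ r₁ g₂ r₂ M)) =
          (Submodule.span (SepAlg G s g₁ r₁ g₂ r₂)
            (sepKernel G s g₁ r₁ g₂ r₂ M : Set M)).restrictScalars k ∧
        (M₀ ≠ ⊥ →
          gkDim k (SepAlg G s g₁ r₁ g₂ r₂) (Submodule.span (SepAlg G s g₁ r₁ g₂ r₂)
            (sepKernel G s g₁ r₁ g₂ r₂ M : Set M)) =
          gkDim k (SkeinAlg G s g₁ r₁ ⊗[k] SkeinAlg G s g₂ r₂) M₀ + G.dim)) := by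
  constructor
  · intro g r hr M _ _ _ _ hM
    have := GluingPattern.skeinAlg_isNoetherianRing G hs (g + 1) r
    have hn : (g + 1 + r - 1) * G.dim = (g + r - 1) * G.dim + G.dim := by
      rw [← Nat.succ_mul]
      congr 1
      omega
    rw [hn] at hM ⊢
    exact (GluingPattern.nonsepFrame M hs hgen).conclusion hM
  · intro g₁ r₁ g₂ r₂ h₁ h₂ M _ _ _ _ hM
    have := GluingPattern.sepAlg_isNoetherianRing G hs g₁ r₁ g₂ r₂
    have hn : (g₁ + g₂ + (r₁ + r₂) - 1) * G.dim =
        (g₁ + r₁ - 1 + (g₂ + r₂ - 1)) * G.dim + G.dim := by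
      rw [← Nat.succ_mul]
      congr 1
      omega
    rw [hn] at hM ⊢
    exact (GluingPattern.sepFrame M hs hgen).conclusion hM
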